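/- **Series.** For $m,n\in\mathbb N$ let $\mathbb R[[X^*,Y]]$, $X=(X_1,\dots,X_m)$, $Y=(Y_1,\dots,Y_n)$, be the ring of formal series $F=\sum c_{\alpha,N}X^\alpha Y^N$ with real coefficients, $\alpha\in[0,\infty)^m$, $N\in\mathbb N^n$, such that the set of the $\alpha$ occurring in the support of $F$ is contained in a product $S_1\times\dots\times S_m$ of well-ordered subsets of $[0,\infty)$. **Setting.** For a polyradius $r=(s,t)\in(0,\infty)^{m+n}$ let $\hat I_{m,n,r}=\prod_i[0,s_i)\times\prod_j(-t_j,t_j)$, and let $I_{m,n,r}$ be the same box with $(0,s_i)$ in place of $[0,s_i)$. Let $\mathcal A=\{\mathcal A_{m,n,r}\}$ be a collection of $\mathbb R$-algebras of real functions on $\hat I_{m,n,r}$, continuous on $\hat I_{m,n,r}$ and $C^1$ on $I_{m,n,r}$, such that: the coordinate functions belong to $\mathcal A_{m,n,r}$; the collection is closed under restriction to smaller polyradii; every $f\in\mathcal A_{m,n,r}$ extends to an element of $\mathcal A_{m,n,r'}$ for some $r'>r$ (componentwise); the collection is closed under adding a dummy $x$-variable $x_{m+1}$, under regarding the $y$-variables,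 restricted to nonnegative values, as $x$-variables ($\mathcal A_{m,n,r}\subset\mathcal A_{m+n,0,r}$), under permutations of the $x$-variables (with $r$ permuted accordingly), and under setting $x_m=0$; and if $f\in\mathcal A_{m,n,r}$ then $f(s_1x_1,\dots,s_mx_m,t_1y_1,\dots,t_ny_n)\in\mathcal A_{m,n,1}$. Let $\mathcal A_{m,n}$ be the algebra of germs at $0$ (on $[0,\infty)^m\times\mathbb R^n$) of the elements of the $\mathcal A_{m,n,r}$. For all $f\in\mathcal A_{m,n,r}$ and $a\in\hat I_{m,n,r}$, let the germ of $f$ at $a$ be the translate to $a$ of a germ in $\mathcal A_{m',m+n-m'}$, where $m'=|\{i\le m: a_i=0\}|$ and the variables $x_i$ with $a_i\neq0$ are counted as $y$-variables. Let $\mathcal T=\mathcal T_{m,n}:\mathcal A_{m,n}\to\mathbb R[[X^*,Y]]$ be injective $\mathbb R$-algebra morphisms, $\mathcal T_{m',n'}$ extending $\mathcal T_{m,n}$ for $m'\ge m$, $n'\ge n$. Let $\mathbb A\subset[0,\infty)$ be the semiring generated by all components of all elements of the supports of all $\mathcal T(f)$, $f\in\mathcal A_{m,n}$, $m,n\in\mathbb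 N$, and let $\mathbb K$ be the subfield of $\mathbb R$ generated by $\mathbb A$. The *blow-up charts* $\pi:(x',y')\mapsto(x,y)$ are the following maps, where the variables not mentioned are unchanged up to the evident renumbering: * $\pi_{i,j}^\lambda$ ($1\le j<i\le m$, $\lambda>0$): $m'=m-1$, $n'=n+1$, $x_i=x'_j(\lambda+y'_1)$, $x_k=x'_k$ for $k<i$, $x_k=x'_{k-1}$ for $k>i$, $y_k=y'_{k+1}$; * $\pi_{i,j}^0=\pi_{j,i}^\infty$ ($i\neq j\le m$): $x_i=x'_jx'_i$; * $\pi_{m+i,j}^\lambda$ ($i\le n$, $j\le m$, $\lambda\in\mathbb R$): $y_i=x'_j(\lambda+y'_i)$; * $\pi_{m+i,j}^{\pm\infty}$ ($i\le n$, $j\le m$): $m'=m+1$, $n'=n-1$, $x_j=x'_{m+1}x'_j$, $y_i=\pm x'_{m+1}$, $y_k=y'_k$ for $k<i$, $y_k=y'_{k-1}$ for $k>i$; * $\pi_{m+i,m+j}^\lambda$ ($i\ne j\le n$, $\lambda\in\mathbb R$): $y_i=y'_j(\lambda+y'_i)$; and $\pi_{m+i,m+j}^\infty=\pi_{m+j,m+i}^0$.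 Assume: 1. If $\mathbb A\ne\mathbb N$, then for $\alpha\in\mathbb K$, $\alpha\ge0$, the germ $x_1^\alpha$ is in $\mathcal A_{1,0}$ with $\mathcal T(x_1^\alpha)=X_1^\alpha$; moreover, if $\alpha>0$ and $f\in\mathcal A_{m,n}$ with $m\ge1$, then $g=f(x_1^\alpha,x_2,\dots,x_m,y)\in\mathcal A_{m,n}$ and $\mathcal T(g)=\mathcal T(f)(X_1^\alpha,X_2,\dots,X_m,Y)$. 2. If $f\in\mathcal A_{m,n}$ and $\mathcal T(f)=X_1^\alpha G$ with $\alpha\in\mathbb A$ (respectively $\mathcal T(f)=Y_1^kG$ with $k\in\mathbb N$), $G\in\mathbb R[[X^*,Y]]$, then $f=x_1^\alpha g$ (respectively $f=y_1^kg$) for some $g\in\mathcal A_{m,n}$. 3. $\mathcal T$ commutes with permutations of the $x$-variables. 4. $\mathcal T$ commutes with setting $x_m=0$. 5. If $f\in\mathcal A_{m,n}$ and $g_1,\dots,g_n\in\mathcal A_{m',n'}$ with $g_i(0)=0$, then $h(x,x',y')=f(x,g_1(x',y'),\dots,g_n(x',y'))$ is in $\mathcal A_{m+m',n'}$ and $\mathcal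 T(h)=\mathcal T(f)(X,\mathcal T(g_1),\dots,\mathcal T(g_n))$. 6. If $n\ge1$, $f\in\mathcal A_{m,n}$, $f(0)=0$ and $\partial f/\partial y_n(0)$ exists and is nonzero, then there is $g\in\mathcal A_{m,n-1}$ with $g(0)=0$ and $f(x,y_1,\dots,y_{n-1},g(x,y_1,\dots,y_{n-1}))=0$. 7. If $f\in\mathcal A_{m,n}$ and $\pi$ is a blow-up chart, then $f\circ\pi\in\mathcal A_{m',n'}$ and $\mathcal T(f\circ\pi)=\mathcal T(f)\circ\pi$. **Admissible trees.** An *elementary transformation* is a blow-up chart; or a Tschirnhausen translation $\tau_h$: $y_n=y_n'+h(x',y'_1,\dots,y'_{n-1})$, with $h\in\mathcal A_{m,n-1}$, $h(0)=0$; or a linear transformation $L_{i,c}$: $y_k=y_k'+c_ky_i'$ for $k<i$, with $i\le n$, $c\in\mathbb R^{i-1}$; or a ramification $r_i^\gamma$: $x_i=x_i'^\gamma$ ($i\le m$, $0<\gamma\in\mathbb K$) or $r_{m+i}^{d,\pm}$: $y_i=\pm y_i'^d$ ($i\le n$, $d\ge1$). It acts on series by $F\mapsto F\circ\nu$, where $h$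 is replaced by $\mathcal T(h)$ in $\tau_h$, and $(\lambda+Y)^a=\lambda^a\sum_k\binom ak(Y/\lambda)^k$ for $\lambda>0$. An *elementary tree* is a single vertex, or has exactly one edge $L_{i,c}$, $\tau_h$ or $r_i^\gamma$, or the two edges $r_{m+i}^{d,+},r_{m+i}^{d,-}$, or one edge for each element of one of the collections $\pi_{i,j}=\{\pi_{i,j}^\lambda:\lambda\in[0,\infty]\}$ ($j<i\le m$), $\pi_{m+i,j}=\{\pi_{m+i,j}^\lambda:\lambda\in\mathbb R\cup\{\pm\infty\}\}$, $\pi_{m+i,m+j}=\{\pi_{m+i,m+j}^\lambda:\lambda\in\mathbb R\cup\{\infty\}\}$ ($i\neq j$). A tree of height $0$ is a vertex; a tree of height $\le N$ arises from one of height $\le N-1$ by attaching an elementary tree to the end of each branch. It is *admissible* if along every branch $\mathfrak b=(\nu_1,\dots,\nu_M)$ the numbers of $x$- and of $y$-variables of consecutive transformations match; then $\mathfrak b$ induces $T_{\mathfrak b}(F)=F\circ\nu_1\circ\dots\circ\nu_M$ from $\mathbb R[[X^*,Y]]$ to some $\mathbb R[[X'^*,Y']]$, with $m'+n'=m+n$.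 A series $F\in\mathbb R[[X^*,Y]]\setminus\{0\}$ is *normal* if $F=X^\alpha Y^NU$ with $\alpha\in\mathbb A^m$, $N\in\mathbb N^n$ and $U$ a unit of $\mathbb R[[X^*,Y]]$. **Theorem.** Let $F_1,\dots,F_p\in\mathbb R[[X^*,Y]]\setminus\{0\}$ lie in the image of $\mathcal T$. Then there is an admissible tree $T$ (of some finite height) such that for each branch $\mathfrak b$ of $T$ the series $T_{\mathfrak b}(F_1),\dots,T_{\mathfrak b}(F_p)$ are nonzero elements of $\mathbb R[[X'^*,Y']]$ in the image of $\mathcal T$, are normal, and are linearly ordered by division (for all $k,l$, one of $T_{\mathfrak b}(F_k),T_{\mathfrak b}(F_l)$ divides the other in $\mathbb R[[X'^*,Y']]$). -/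

import Mathlib

open Filter Topology
open scoped NNReal

noncomputable section

namespace Quasi

/-! ### Generalised power series -/

/-- Exponents of the monomials `X^α Y^N`, with `α ∈ [0,∞)^m` and `N ∈ ℕ^n`, ordered componentwise. -/
abbrev Expo (m n : ℕ) : Type := (Fin m → ℝ≥0) × (Fin n → ℕ)

/-- The ring `ℝ⟦X*, Y⟧` of series that are generalised in `X = (X_1, …, X_m)` (real exponents `≥ 0`)
and ordinary in `Y = (Y_1, …, Y_n)`. A Hahn series has a partially well-ordered support; for sets of
exponents this is the same as being good, by `isPWO_iff_isGood`. -/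
abbrev GenSeries (m n : ℕ) : Type := HahnSeries (Expo m n) ℝ

/-- A set of exponents is good if its projections to the `X`-exponents are contained in well-ordered
sets. -/
def IsGood {m n : ℕ} (S : Set (Expo m n)) : Prop :=
  ∃ W : Fin m → Set ℝ≥0, (∀ i, (W i).IsWF) ∧ ∀ e ∈ S, ∀ i, e.1 i ∈ W i

theorem isPWO_iff_isGood {m n : ℕ} (S : Set (Expo m n)) : S.IsPWO ↔ IsGood S := by
  constructor
  · intro h
    refine ⟨fun i => (fun e : Expo m n => e.1 i) '' S, fun i => ?_, fun e he i => ⟨e, he, rfl⟩⟩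
    exact (h.image_of_monotone (fun a b hab => hab.1 i)).isWF
  · rintro ⟨W, hW, hS⟩
    have h1 : (Set.univ.pi W).IsPWO := Set.IsPWO.pi fun i => (hW i).isPWO
    have h2 : (Set.univ.pi fun _ : Fin n => (Set.univ : Set ℕ)).IsPWO :=
      Set.IsPWO.pi fun _ => Set.IsPWO.of_linearOrder _
    exact (h1.prod h2).mono fun e he => ⟨fun i _ => hS e he i, fun _ _ => trivial⟩

/-- The series `X_i ^ a`, for a real `a ≥ 0`. -/
def X {m n : ℕ} (i : Fin m) (a : ℝ≥0) : GenSeries m n :=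
  HahnSeries.single (Pi.single i a, 0) 1

/-- The series `Y_j`. -/
def Y {m n : ℕ} (j : Fin n) : GenSeries m n :=
  HahnSeries.single (0, Pi.single j 1) 1

/-- The series `(lam + Y_j) ^ a = lam ^ a * ∑ k, (a choose k) * (Y_j / lam) ^ k`, for `lam > 0`. -/
def binomialSeries {m n : ℕ} (lam : ℝ) (a : ℝ≥0) (j : Fin n) : GenSeries m n where
  coeff e := if e.1 = 0 ∧ e.2 = Pi.single j (e.2 j) then
    lam ^ (a : ℝ) * Ring.choose (a : ℝ) (e.2 j) * lam⁻¹ ^ (e.2 j) else 0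
  isPWO_support' := by
    rw [isPWO_iff_isGood]
    refine ⟨fun _ => {0}, fun _ => (Set.finite_singleton _).isWF, fun e he i => ?_⟩
    have h : e.1 = 0 := by
      by_contra h
      exact he (if_neg fun h' => h h'.1)
    simp [h]

/-- Extending an exponent by zeros along injections of the variables. -/
def expoEmb {m n m' n' : ℕ} (σ : Fin m ↪ Fin m') (τ : Fin n ↪ Fin n') :
    Expo m n ↪o Expo m' n' :=
  OrderEmbedding.ofMapLEIff
    (fun e => (Function.extend σ e.1 0, Function.extend τ e.2 0)) (by
      intro a b
      constructor
      · rintro ⟨h1, h2⟩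
        refine ⟨fun i => ?_, fun j => ?_⟩
        · simpa [σ.injective.extend_apply] using h1 (σ i)
        · simpa [τ.injective.extend_apply] using h2 (τ j)
      · rintro ⟨h1, h2⟩
        refine ⟨fun i => ?_, fun j => ?_⟩
        · by_cases h : ∃ k, σ k = i
          · obtain ⟨k, rfl⟩ := h
            simpa [σ.injective.extend_apply] using h1 k
          · simp [Function.extend_apply' _ _ _ h]
        · by_cases h : ∃ k, τ k = j
          · obtain ⟨k, rfl⟩ := h
            simpa [τ.injective.extend_apply] using h2 k
          · simp [Function.extend_apply' _ _ _ h])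

/-- The series `F(X_{σ 1}, …, X_{σ m}, Y_{τ 1}, …, Y_{τ n})` in `m' + n'` variables. -/
def rename {m n m' n' : ℕ} (σ : Fin m ↪ Fin m') (τ : Fin n ↪ Fin n') (F : GenSeries m n) :
    GenSeries m' n' :=
  HahnSeries.embDomain (expoEmb σ τ) F

/-- The formal data of a transformation `(X', Y') ↦ (X, Y)`: `xPow i a` is the series of the
component `X_i` raised to the real power `a`, and `ySub j` is the series of the component `Y_j`. -/
structure FormalMap (m n m' n' : ℕ) where
  xPow : Fin m → ℝ≥0 → GenSeries m' n'
  ySub : Fin n → GenSeries m' n'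

/-- The image of the monomial `X^α Y^N`. -/
def FormalMap.monomial {m n m' n' : ℕ} (φ : FormalMap m n m' n') (e : Expo m n) :
    GenSeries m' n' :=
  (∏ i, φ.xPow i (e.1 i)) * ∏ j, φ.ySub j ^ e.2 j

/-- `G = F ∘ φ`: if `F = ∑ c_{α,N} X^α Y^N`, then the family `c_{α,N} φ(X)^α φ(Y)^N` is
coefficientwise finite and its sum is `G`. Such a `G` is determined by `F` and `φ`. -/
def FormalMap.IsComp {m n m' n' : ℕ} (φ : FormalMap m n m' n') (F : GenSeries m n)
    (G : GenSeries m' n') : Prop :=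
  ∀ e' : Expo m' n',
    (Function.support fun e => F.coeff e * (φ.monomial e).coeff e').Finite ∧
      G.coeff e' = ∑ᶠ e, F.coeff e * (φ.monomial e).coeff e'

/-! ### Boxes and algebras of functions -/

/-- Points `(x, y)` of `ℝ^{m+n}`. -/
abbrev Pt (m n : ℕ) : Type := (Fin m → ℝ) × (Fin n → ℝ)

/-- The set `[0,∞)^m × ℝ^n`. -/
def Quad (m n : ℕ) : Set (Pt m n) := {p | ∀ i, 0 ≤ p.1 i}

/-- Polyradii `(s, t) ∈ (0,∞)^{m+n}`. -/
@[ext] structure Polyradius (m n : ℕ) where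
  s : Fin m → ℝ
  t : Fin n → ℝ
  s_pos : ∀ i, 0 < s i
  t_pos : ∀ j, 0 < t j

namespace Polyradius

/-- The box `[0, s_1) × … × [0, s_m) × (-t_1, t_1) × … × (-t_n, t_n)`. -/
def box {m n : ℕ} (r : Polyradius m n) : Set (Pt m n) :=
  {p | (∀ i, 0 ≤ p.1 i ∧ p.1 i < r.s i) ∧ ∀ j, |p.2 j| < r.t j}

/-- The open box `(0, s_1) × … × (0, s_m) × (-t_1, t_1) × … × (-t_n, t_n)`. -/
def openBox {m n : ℕ} (r : Polyradius m n) : Set (Pt m n) :=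
  {p | (∀ i, 0 < p.1 i ∧ p.1 i < r.s i) ∧ ∀ j, |p.2 j| < r.t j}

/-- The polyradius `(1, …, 1)`. -/
def unit (m n : ℕ) : Polyradius m n where
  s := fun _ => 1
  t := fun _ => 1
  s_pos := fun _ => one_pos
  t_pos := fun _ => one_pos

/-- The componentwise minimum. -/
def inf {m n : ℕ} (r r' : Polyradius m n) : Polyradius m n where
  s := fun i => min (r.s i) (r'.s i)
  t := fun j => min (r.t j) (r'.t j)
  s_pos := fun i => lt_min (r.s_pos i) (r'.s_pos i)
  t_pos := fun j => lt_min (r.t_pos j) (r'.t_pos j)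

end Polyradius

/-- The function `f`, restricted to the box of polyradius `r`, belongs to the algebra `A r`. -/
def MemOn (A : ∀ {m n : ℕ} (r : Polyradius m n), Subalgebra ℝ (r.box → ℝ))
    {m n : ℕ} (r : Polyradius m n) (f : Pt m n → ℝ) : Prop :=
  (fun p : r.box => f p) ∈ A r

/-- A collection of algebras `A_{m,n,r}` of real functions on the boxes of polyradius `r`, with the
elementary closure conditions. An element of `A_{m,n,r}` is given by a function on `ℝ^{m+n}`, of which
only the restriction to the box counts. -/
structure FunctionAlgebras where
  /-- the algebra `A_{m,n,r}` -/
  alg : ∀ {m n : ℕ} (r : Polyradius m n), Subalgebra ℝ (r.box → ℝ)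
  continuousOn : ∀ {m n : ℕ} (r : Polyradius m n) (f : Pt m n → ℝ),
    MemOn alg r f → ContinuousOn f r.box
  contDiffOn : ∀ {m n : ℕ} (r : Polyradius m n) (f : Pt m n → ℝ),
    MemOn alg r f → ContDiffOn ℝ 1 f r.openBox
  coord_x : ∀ {m n : ℕ} (r : Polyradius m n) (i : Fin m), MemOn alg r (fun p => p.1 i)
  coord_y : ∀ {m n : ℕ} (r : Polyradius m n) (j : Fin n), MemOn alg r (fun p => p.2 j)
  restrict : ∀ {m n : ℕ} (r r' : Polyradius m n) (f : Pt m n → ℝ),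
    (∀ i, r'.s i ≤ r.s i) → (∀ j, r'.t j ≤ r.t j) → MemOn alg r f → MemOn alg r' f
  extend : ∀ {m n : ℕ} (r : Polyradius m n) (f : Pt m n → ℝ), MemOn alg r f →
    ∃ (r' : Polyradius m n) (g : Pt m n → ℝ), (∀ i, r.s i < r'.s i) ∧ (∀ j, r.t j < r'.t j) ∧
      MemOn alg r' g ∧ ∀ p ∈ r.box, g p = f p
  addVariable : ∀ {m n : ℕ} (r : Polyradius m n) (r' : Polyradius (m + 1) n) (f : Pt m n → ℝ),
    (∀ i, r'.s (Fin.castSucc i) = r.s i) → (∀ j, r'.t j = r.t j) → MemOn alg r f →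
      MemOn alg r' (fun p => f (Fin.init p.1, p.2))
  yAsX : ∀ {m n : ℕ} (r : Polyradius m n) (r' : Polyradius (m + n) 0) (f : Pt m n → ℝ),
    (∀ i, r'.s (Fin.castAdd n i) = r.s i) → (∀ j, r'.s (Fin.natAdd m j) = r.t j) →
      MemOn alg r f →
      MemOn alg r' (fun p => f (fun i => p.1 (Fin.castAdd n i), fun j => p.1 (Fin.natAdd m j)))
  permute : ∀ {m n : ℕ} (σ : Equiv.Perm (Fin m)) (r r' : Polyradius m n) (f : Pt m n → ℝ),
    (∀ i, r'.s (σ i) = r.s i) → (∀ j, r'.t j = r.t j) → MemOn alg r f →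
      MemOn alg r' (fun p => f (fun i => p.1 (σ i), p.2))
  setZero : ∀ {m n : ℕ} (r : Polyradius (m + 1) n) (r' : Polyradius m n) (f : Pt (m + 1) n → ℝ),
    (∀ i, r'.s i = r.s (Fin.castSucc i)) → (∀ j, r'.t j = r.t j) → MemOn alg r f →
      MemOn alg r' (fun p => f (Fin.snoc (α := fun _ => ℝ) p.1 0, p.2))
  rescale : ∀ {m n : ℕ} (r : Polyradius m n) (f : Pt m n → ℝ), MemOn alg r f →
    MemOn alg (Polyradius.unit m n) (fun p => f (fun i => r.s i * p.1 i, fun j => r.t j * p.2 j))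

namespace FunctionAlgebras

variable (A : FunctionAlgebras)

/-- The ring `A_{m,n}` of germs at the origin (in `[0,∞)^m × ℝ^n`) of the elements of the `A_{m,n,r}`. -/
def germs (m n : ℕ) : Subring (Germ (𝓝[Quad m n] (0 : Pt m n)) ℝ) where
  carrier := {φ | ∃ (r : Polyradius m n) (f : Pt m n → ℝ), MemOn A.alg r f ∧ φ = (f : Germ _ ℝ)}
  mul_mem' := by
    rintro _ _ ⟨r, f, hf, rfl⟩ ⟨r', g, hg, rfl⟩
    exact ⟨r.inf r', f * g, mul_mem
      (A.restrict r (r.inf r') f (fun _ => min_le_left _ _) (fun _ => min_le_left _ _) hf)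
      (A.restrict r' (r.inf r') g (fun _ => min_le_right _ _) (fun _ => min_le_right _ _) hg), rfl⟩
  add_mem' := by
    rintro _ _ ⟨r, f, hf, rfl⟩ ⟨r', g, hg, rfl⟩
    exact ⟨r.inf r', f + g, add_mem
      (A.restrict r (r.inf r') f (fun _ => min_le_left _ _) (fun _ => min_le_left _ _) hf)
      (A.restrict r' (r.inf r') g (fun _ => min_le_right _ _) (fun _ => min_le_right _ _) hg), rfl⟩
  neg_mem' := by
    rintro _ ⟨r, f, hf, rfl⟩
    exact ⟨r, -f, neg_mem (S := Subalgebra ℝ (r.box → ℝ)) hf, rfl⟩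
  one_mem' := ⟨Polyradius.unit m n, 1, one_mem (A.alg (Polyradius.unit m n)), rfl⟩
  zero_mem' := ⟨Polyradius.unit m n, 0, zero_mem (A.alg (Polyradius.unit m n)), rfl⟩

/-- The germ of `f` at the origin belongs to `A_{m,n}`. -/
def IsGerm {m n : ℕ} (f : Pt m n → ℝ) : Prop :=
  (f : Germ (𝓝[Quad m n] (0 : Pt m n)) ℝ) ∈ A.germs m n

theorem isGerm_const {m n : ℕ} (c : ℝ) : A.IsGerm (fun _ : Pt m n => c) :=
  ⟨Polyradius.unit m n, fun _ => c, (A.alg (Polyradius.unit m n)).algebraMap_mem c, rfl⟩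

end FunctionAlgebras

/-- Algebras of functions together with injective `ℝ`-algebra morphisms `T_{m,n}` from the germs in
`A_{m,n}` to `ℝ⟦X*, Y⟧` which extend one another. -/
structure TaylorAlgebras extends FunctionAlgebras where
  T : ∀ m n : ℕ, toFunctionAlgebras.germs m n →+* GenSeries m n
  T_const : ∀ (m n : ℕ) (c : ℝ),
    T m n ⟨_, toFunctionAlgebras.isGerm_const c⟩ = HahnSeries.C c
  T_injective : ∀ m n : ℕ, Function.Injective (T m n)
  T_extend : ∀ {m n m' n' : ℕ} (hm : m ≤ m') (hn : n ≤ n') (f : Pt m n → ℝ)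
    (hf : toFunctionAlgebras.IsGerm f)
    (hg : toFunctionAlgebras.IsGerm fun p : Pt m' n' =>
      f (fun i => p.1 (Fin.castLE hm i), fun j => p.2 (Fin.castLE hn j))),
    T m' n' ⟨_, hg⟩ = rename (Fin.castLEEmb hm) (Fin.castLEEmb hn) (T m n ⟨_, hf⟩)

namespace TaylorAlgebras

variable (A : TaylorAlgebras)

/-- The germ of `f` at the origin belongs to `A_{m,n}`. -/
abbrev IsGerm {m n : ℕ} (f : Pt m n → ℝ) : Prop := A.toFunctionAlgebras.IsGerm f

/-- The series `T(f)` of a germ `f`. -/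
def ser {m n : ℕ} (f : Pt m n → ℝ) (hf : A.IsGerm f) : GenSeries m n := A.T m n ⟨_, hf⟩

/-- The admissible exponents: the components of the elements of the supports of the `T(f)`. -/
def admissibleExponents : Set ℝ :=
  {a | ∃ (m n : ℕ) (φ : A.germs m n), ∃ e ∈ (A.T m n φ).support,
    (∃ i, a = (e.1 i : ℝ)) ∨ ∃ j, a = (e.2 j : ℝ)}

/-- The semi-ring generated by the admissible exponents. -/
def expSemiring : Subsemiring ℝ := Subsemiring.closure A.admissibleExponents

/-- The field of fractions of that semi-ring. -/
def expField : Subfield ℝ := Subfield.closure (A.expSemiring : Set ℝ)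

end TaylorAlgebras

/-! ### Blow-up charts -/

/-- The blow-up charts `ℝ^{m'+n'} → ℝ^{m+n}`. -/
inductive BlowUpChart : ℕ → ℕ → ℕ → ℕ → Type
  /-- `π_{i,j}^lam` with `j < i` and `lam ∈ (0,∞)` -/
  | xx {m n : ℕ} (i : Fin (m + 1)) (j : Fin m) (hji : j.castSucc < i) (lam : ℝ) (hlam : 0 < lam) :
      BlowUpChart (m + 1) n m (n + 1)
  /-- `π_{i,j}^0` with `i ≠ j` (this is also `π_{j,i}^∞`) -/
  | xxZero {m n : ℕ} (i j : Fin m) (hij : i ≠ j) : BlowUpChart m n m n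
  /-- `π_{m+i,j}^lam` with `lam ∈ ℝ` -/
  | yx {m n : ℕ} (i : Fin n) (j : Fin m) (lam : ℝ) : BlowUpChart m n m n
  /-- `π_{m+i,j}^{±∞}` -/
  | yxInfty {m n : ℕ} (i : Fin (n + 1)) (j : Fin m) (ε : ℤˣ) : BlowUpChart m (n + 1) (m + 1) n
  /-- `π_{m+i,m+j}^lam` with `i ≠ j` and `lam ∈ ℝ` (for `lam = 0` this is also `π_{m+j,m+i}^∞`) -/
  | yy {m n : ℕ} (i j : Fin n) (hij : i ≠ j) (lam : ℝ) : BlowUpChart m n m n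

namespace BlowUpChart

/-- The blow-up chart as a map of points. -/
def toMap : {m n m' n' : ℕ} → BlowUpChart m n m' n' → Pt m' n' → Pt m n
  | _, _, _, _, xx i j _ lam _, p =>
      (Fin.insertNth (α := fun _ => ℝ) i (p.1 j * (lam + p.2 0)) p.1, Fin.tail p.2)
  | _, _, _, _, xxZero i j _, p => (Function.update p.1 i (p.1 j * p.1 i), p.2)
  | _, _, _, _, yx i j lam, p => (p.1, Function.update p.2 i (p.1 j * (lam + p.2 i)))
  | _, _, _, _, yxInfty i j ε, p =>
      (Function.update (Fin.init p.1) j (p.1 (Fin.last _) * p.1 j.castSucc),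
        Fin.insertNth (α := fun _ => ℝ) i (((ε : ℤ) : ℝ) * p.1 (Fin.last _)) p.2)
  | _, _, _, _, yy i j _ lam, p => (p.1, Function.update p.2 i (p.2 j * (lam + p.2 i)))

/-- The blow-up chart as a formal transformation. -/
def formal : {m n m' n' : ℕ} → BlowUpChart m n m' n' → FormalMap m n m' n'
  | _, n, m, _, xx i j _ lam _ =>
      { xPow := Fin.insertNth (α := fun _ => ℝ≥0 → GenSeries m (n + 1)) i
          (fun a => X j a * binomialSeries lam a 0) X
        ySub := fun k => Y k.succ }
  | _, _, _, _, xxZero i j _ =>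
      { xPow := Function.update X i (fun a => X j a * X i a)
        ySub := Y }
  | _, _, _, _, yx i j lam =>
      { xPow := X
        ySub := Function.update Y i (X j 1 * (HahnSeries.C lam + Y i)) }
  | m, _, _, n, yxInfty i j ε =>
      { xPow := Function.update (fun k => X k.castSucc) j
          (fun a => X (Fin.last _) a * X j.castSucc a)
        ySub := Fin.insertNth (α := fun _ => GenSeries (m + 1) n) i
          (HahnSeries.C ((ε : ℤ) : ℝ) * X (Fin.last _) 1) Y }
  | _, _, _, _, yy i j _ lam =>
      { xPow := X
        ySub := Function.update Y i (Y j * (HahnSeries.C lam + Y i)) }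

end BlowUpChart

/-- The formal ramification `X_i ↦ X_i ^ γ`. -/
def ramFormal {m n : ℕ} (i : Fin m) (γ : ℝ≥0) : FormalMap m n m n where
  xPow := Function.update X i (fun a => X i (γ * a))
  ySub := Y

/-! ### Quasianalytic systems -/

/-- A collection of algebras of functions with quasianalytic algebras of germs, satisfying
`𝒜`-analyticity and the closure and compatibility properties. -/
structure QuasianalyticSystem extends TaylorAlgebras where
  /-- Every function of the collection is given at each point `a` of its domain by a germ of the
  collection, in which the variables `x_i` with `a_i ≠ 0` have become `y`-variables. -/
  analytic : ∀ {m n : ℕ} (r : Polyradius m n) (f : Pt m n → ℝ), MemOn alg r f → ∀ a ∈ r.box,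
    ∃ (m' l : ℕ) (ς : Fin m' ⊕ Fin l ≃ Fin m) (g : Pt m' (l + n) → ℝ),
      (∀ i, a.1 (ς (Sum.inl i)) = 0) ∧ (∀ k, a.1 (ς (Sum.inr k)) ≠ 0) ∧
      toTaylorAlgebras.IsGerm g ∧
      ∀ᶠ p in 𝓝[r.box] a, f p = g (fun i => p.1 (ς (Sum.inl i)) - a.1 (ς (Sum.inl i)),
        Fin.append (fun k => p.1 (ς (Sum.inr k)) - a.1 (ς (Sum.inr k))) (fun j => p.2 j - a.2 j))
  /-- Monomials. -/
  monomial : (toTaylorAlgebras.expSemiring : Set ℝ) ≠ Set.range ((↑) : ℕ → ℝ) →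
    ∀ α : ℝ≥0, (α : ℝ) ∈ toTaylorAlgebras.expField →
      ∃ h : toTaylorAlgebras.IsGerm (fun p : Pt 1 0 => p.1 0 ^ (α : ℝ)),
        toTaylorAlgebras.ser _ h = X 0 α
  /-- Ramifications. -/
  ramification : (toTaylorAlgebras.expSemiring : Set ℝ) ≠ Set.range ((↑) : ℕ → ℝ) →
    ∀ α : ℝ≥0, (α : ℝ) ∈ toTaylorAlgebras.expField → 0 < α →
    ∀ {m n : ℕ} (f : Pt (m + 1) n → ℝ) (hf : toTaylorAlgebras.IsGerm f),
      ∃ h : toTaylorAlgebras.IsGerm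
          (fun p : Pt (m + 1) n => f (Function.update p.1 0 (p.1 0 ^ (α : ℝ)), p.2)),
        (ramFormal 0 α).IsComp (toTaylorAlgebras.ser f hf) (toTaylorAlgebras.ser _ h)
  /-- Monomial division, by a power of `x_1`. -/
  divide_x : ∀ {m n : ℕ} (f : Pt (m + 1) n → ℝ) (hf : toTaylorAlgebras.IsGerm f) (α : ℝ≥0)
    (G : GenSeries (m + 1) n), (α : ℝ) ∈ toTaylorAlgebras.expSemiring →
    toTaylorAlgebras.ser f hf = X 0 α * G →
      ∃ g : Pt (m + 1) n → ℝ, toTaylorAlgebras.IsGerm g ∧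
        ∀ᶠ p in 𝓝[Quad (m + 1) n] 0, f p = p.1 0 ^ (α : ℝ) * g p
  /-- Monomial division, by a power of `y_1`. -/
  divide_y : ∀ {m n : ℕ} (f : Pt m (n + 1) → ℝ) (hf : toTaylorAlgebras.IsGerm f) (k : ℕ)
    (G : GenSeries m (n + 1)), toTaylorAlgebras.ser f hf = Y 0 ^ k * G →
      ∃ g : Pt m (n + 1) → ℝ, toTaylorAlgebras.IsGerm g ∧
        ∀ᶠ p in 𝓝[Quad m (n + 1)] 0, f p = p.2 0 ^ k * g p
  /-- Permutations of the `x`-variables. -/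
  T_permute : ∀ {m n : ℕ} (σ : Equiv.Perm (Fin m)) (f : Pt m n → ℝ)
    (hf : toTaylorAlgebras.IsGerm f)
    (h : toTaylorAlgebras.IsGerm fun p : Pt m n => f (fun i => p.1 (σ i), p.2)),
    toTaylorAlgebras.ser _ h =
      rename σ.toEmbedding (Function.Embedding.refl _) (toTaylorAlgebras.ser f hf)
  /-- Setting a variable equal to zero. -/
  T_setZero : ∀ {m n : ℕ} (f : Pt (m + 1) n → ℝ) (hf : toTaylorAlgebras.IsGerm f)
    (h : toTaylorAlgebras.IsGerm fun p : Pt m n => f (Fin.snoc (α := fun _ => ℝ) p.1 0, p.2))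
    (e : Expo m n),
    (toTaylorAlgebras.ser _ h).coeff e =
      (toTaylorAlgebras.ser f hf).coeff (Fin.snoc (α := fun _ => ℝ≥0) e.1 0, e.2)
  /-- Composition in the `y`-variables. -/
  compose : ∀ {m n m' n' : ℕ} (f : Pt m n → ℝ) (hf : toTaylorAlgebras.IsGerm f)
    (g : Fin n → Pt m' n' → ℝ) (hg : ∀ j, toTaylorAlgebras.IsGerm (g j)), (∀ j, g j 0 = 0) →
      ∃ h : toTaylorAlgebras.IsGerm (fun p : Pt (m + m') n' =>
          f (fun i => p.1 (Fin.castAdd m' i), fun j => g j (fun i => p.1 (Fin.natAdd m i), p.2))),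
        FormalMap.IsComp
          { xPow := fun i => X (Fin.castAdd m' i)
            ySub := fun j => rename (Fin.natAddEmb m) (Function.Embedding.refl _)
              (toTaylorAlgebras.ser (g j) (hg j)) }
          (toTaylorAlgebras.ser f hf) (toTaylorAlgebras.ser _ h)
  /-- Implicit functions in the `y`-variables. -/
  implicit : ∀ {m n : ℕ} (f : Pt m (n + 1) → ℝ), toTaylorAlgebras.IsGerm f → f 0 = 0 →
    (∃ d : ℝ, d ≠ 0 ∧ HasDerivAt (fun t : ℝ => f (0, Pi.single (Fin.last n) t)) d 0) →
      ∃ g : Pt m n → ℝ, toTaylorAlgebras.IsGerm g ∧ g 0 = 0 ∧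
        ∀ᶠ p in 𝓝[Quad m n] 0, f (p.1, Fin.snoc (α := fun _ => ℝ) p.2 (g p)) = 0
  /-- Blow-ups. -/
  blowUp : ∀ {m n m' n' : ℕ} (π : BlowUpChart m n m' n') (f : Pt m n → ℝ)
    (hf : toTaylorAlgebras.IsGerm f),
      ∃ h : toTaylorAlgebras.IsGerm (fun p => f (π.toMap p)),
        π.formal.IsComp (toTaylorAlgebras.ser f hf) (toTaylorAlgebras.ser _ h)

/-! ### Elementary transformations, admissible transformations and admissible trees -/

/-- The (germs of) elementary transformations `ℝ^{m'+n'} → ℝ^{m+n}`. -/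
inductive Elementary (A : TaylorAlgebras) : ℕ → ℕ → ℕ → ℕ → Type
  | blowUp {m n m' n' : ℕ} (π : BlowUpChart m n m' n') : Elementary A m n m' n'
  /-- `τ_h : y_{n+1} = y'_{n+1} + h(x', y'_1, …, y'_n)` with `h ∈ A_{m,n}` and `h(0) = 0` -/
  | tschirnhausen {m n : ℕ} (h : Pt m n → ℝ) (hh : A.IsGerm h) (h0 : h 0 = 0) :
      Elementary A m (n + 1) m (n + 1)
  /-- `L_{i,c} : y_k = y'_k + c_k y'_i` for `k < i`; only the `c_k` with `k < i` are used -/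
  | linear {m n : ℕ} (i : Fin n) (c : Fin n → ℝ) : Elementary A m n m n
  /-- `r_i^γ : x_i = x'_i ^ γ` -/
  | ramX {m n : ℕ} (i : Fin m) (γ : ℝ≥0) (hγ : (γ : ℝ) ∈ A.expField) (hpos : 0 < γ) :
      Elementary A m n m n
  /-- `r_{m+i}^{d,±} : y_i = ± y'_i ^ d` -/
  | ramY {m n : ℕ} (i : Fin n) (d : ℕ) (hd : 1 ≤ d) (ε : ℤˣ) : Elementary A m n m n

/-- The formal data of an elementary transformation; in `τ_h` the germ `h` is replaced by `T(h)`. -/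
def Elementary.formal {A : TaylorAlgebras} :
    {m n m' n' : ℕ} → Elementary A m n m' n' → FormalMap m n m' n'
  | _, _, _, _, blowUp π => π.formal
  | _, _, _, _, tschirnhausen (n := n) h hh _ =>
      { xPow := X
        ySub := Function.update Y (Fin.last n)
          (Y (Fin.last n) +
            rename (Function.Embedding.refl _) Fin.castSuccEmb (A.ser h hh)) }
  | _, _, _, _, linear i c =>
      { xPow := X
        ySub := fun k => if k < i then Y k + HahnSeries.C (c k) * Y i else Y k }
  | _, _, _, _, ramX i γ _ _ => ramFormal i γ
  | _, _, _, _, ramY i d _ ε =>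
      { xPow := X
        ySub := Function.update Y i (HahnSeries.C ((ε : ℤ) : ℝ) * Y i ^ d) }

/-- The elementary trees of positive height, as labels. -/
inductive ElementaryTree (A : TaylorAlgebras) : ℕ → ℕ → Type
  | linear {m n : ℕ} (i : Fin n) (c : Fin n → ℝ) : ElementaryTree A m n
  | tschirnhausen {m n : ℕ} (h : Pt m n → ℝ) (hh : A.IsGerm h) (h0 : h 0 = 0) :
      ElementaryTree A m (n + 1)
  | ramX {m n : ℕ} (i : Fin m) (γ : ℝ≥0) (hγ : (γ : ℝ) ∈ A.expField) (hpos : 0 < γ) :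
      ElementaryTree A m n
  | ramY {m n : ℕ} (i : Fin n) (d : ℕ) (hd : 1 ≤ d) : ElementaryTree A m n
  /-- the collection `π_{i,j}`, `j < i` -/
  | blowXX {m n : ℕ} (i : Fin (m + 1)) (j : Fin m) (hji : j.castSucc < i) :
      ElementaryTree A (m + 1) n
  /-- the collection `π_{m+i,j}` -/
  | blowYX {m n : ℕ} (i : Fin (n + 1)) (j : Fin m) : ElementaryTree A m (n + 1)
  /-- the collection `π_{m+i,m+j}`, `i ≠ j` -/
  | blowYY {m n : ℕ} (i j : Fin n) (hij : i ≠ j) : ElementaryTree A m n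

/-- `IsEdge E ν`: the elementary transformation `ν` is one of the edges of the elementary tree `E`. -/
inductive IsEdge {A : TaylorAlgebras} :
    {m n m' n' : ℕ} → ElementaryTree A m n → Elementary A m n m' n' → Prop
  | linear {m n : ℕ} (i : Fin n) (c : Fin n → ℝ) :
      IsEdge (ElementaryTree.linear (m := m) i c) (Elementary.linear i c)
  | tschirnhausen {m n : ℕ} (h : Pt m n → ℝ) (hh : A.IsGerm h) (h0 : h 0 = 0) :
      IsEdge (ElementaryTree.tschirnhausen h hh h0) (Elementary.tschirnhausen h hh h0)
  | ramX {m n : ℕ} (i : Fin m) (γ : ℝ≥0) (hγ : (γ : ℝ) ∈ A.expField) (hpos : 0 < γ) :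
      IsEdge (ElementaryTree.ramX (n := n) i γ hγ hpos) (Elementary.ramX i γ hγ hpos)
  | ramY {m n : ℕ} (i : Fin n) (d : ℕ) (hd : 1 ≤ d) (ε : ℤˣ) :
      IsEdge (ElementaryTree.ramY (m := m) i d hd) (Elementary.ramY i d hd ε)
  | xxPos {m n : ℕ} (i : Fin (m + 1)) (j : Fin m) (hji : j.castSucc < i) (lam : ℝ)
      (hlam : 0 < lam) :
      IsEdge (ElementaryTree.blowXX (n := n) i j hji)
        (Elementary.blowUp (BlowUpChart.xx i j hji lam hlam))
  | xxZero {m n : ℕ} (i : Fin (m + 1)) (j : Fin m) (hji : j.castSucc < i) :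
      IsEdge (ElementaryTree.blowXX (n := n) i j hji)
        (Elementary.blowUp (BlowUpChart.xxZero i j.castSucc hji.ne'))
  | xxInfty {m n : ℕ} (i : Fin (m + 1)) (j : Fin m) (hji : j.castSucc < i) :
      IsEdge (ElementaryTree.blowXX (n := n) i j hji)
        (Elementary.blowUp (BlowUpChart.xxZero j.castSucc i hji.ne))
  | yxReal {m n : ℕ} (i : Fin (n + 1)) (j : Fin m) (lam : ℝ) :
      IsEdge (ElementaryTree.blowYX i j) (Elementary.blowUp (BlowUpChart.yx i j lam))
  | yxInfty {m n : ℕ} (i : Fin (n + 1)) (j : Fin m) (ε : ℤˣ) :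
      IsEdge (ElementaryTree.blowYX i j) (Elementary.blowUp (BlowUpChart.yxInfty i j ε))
  | yyReal {m n : ℕ} (i j : Fin n) (hij : i ≠ j) (lam : ℝ) :
      IsEdge (ElementaryTree.blowYY (m := m) i j hij)
        (Elementary.blowUp (BlowUpChart.yy i j hij lam))
  | yyInfty {m n : ℕ} (i j : Fin n) (hij : i ≠ j) :
      IsEdge (ElementaryTree.blowYY (m := m) i j hij)
        (Elementary.blowUp (BlowUpChart.yy j i hij.symm 0))

/-- Admissible transformations `ℝ^{m'+n'} → ℝ^{m+n}`: finite compositions `ν_1 ∘ … ∘ ν_N` of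
elementary transformations with matching types. -/
inductive Admissible (A : TaylorAlgebras) : ℕ → ℕ → ℕ → ℕ → Type
  | id {m n : ℕ} : Admissible A m n m n
  | comp {m n m₁ n₁ m' n' : ℕ} (ν : Elementary A m n m₁ n₁) (ρ : Admissible A m₁ n₁ m' n') :
      Admissible A m n m' n'

/-- `G = F ∘ ν_1 ∘ … ∘ ν_N`. -/
def Admissible.IsComp {A : TaylorAlgebras} : {m n m' n' : ℕ} → Admissible A m n m' n' →
    GenSeries m n → GenSeries m' n' → Prop
  | _, _, _, _, .id, F, G => G = F
  | _, _, _, _, .comp ν ρ, F, G => ∃ F₁, ν.formal.IsComp F F₁ ∧ ρ.IsComp F₁ G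

/-- Admissible trees over `ℝ^{m+n}` of height at most `N`. -/
inductive AdmissibleTree (A : TaylorAlgebras) : ℕ → ℕ → ℕ → Type
  | vertex {N m n : ℕ} : AdmissibleTree A N m n
  | node {N m n : ℕ} (E : ElementaryTree A m n)
      (child : ∀ (m' n' : ℕ) (ν : Elementary A m n m' n'), IsEdge E ν → AdmissibleTree A N m' n') :
      AdmissibleTree A (N + 1) m n

/-- The branches of an admissible tree, from the initial vertex to the end. -/
inductive AdmissibleTree.IsBranch {A : TaylorAlgebras} :
    {N m n m' n' : ℕ} → AdmissibleTree A N m n → Admissible A m n m' n' → Prop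
  | vertex {N m n : ℕ} :
      AdmissibleTree.IsBranch (AdmissibleTree.vertex (N := N) (m := m) (n := n)) Admissible.id
  | node {N m n m₁ n₁ m' n' : ℕ} (E : ElementaryTree A m n)
      (child : ∀ (m' n' : ℕ) (ν : Elementary A m n m' n'), IsEdge E ν → AdmissibleTree A N m' n')
      (ν : Elementary A m n m₁ n₁) (hν : IsEdge E ν) (ρ : Admissible A m₁ n₁ m' n')
      (hρ : AdmissibleTree.IsBranch (child m₁ n₁ ν hν) ρ) :
      AdmissibleTree.IsBranch (AdmissibleTree.node E child) (Admissible.comp ν ρ)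

/-- `F = X^α Y^N U` with `U` a unit of `ℝ⟦X*, Y⟧` and the components of `α` in the semi-ring
generated by the admissible exponents. -/
def IsNormal (A : TaylorAlgebras) {m n : ℕ} (F : GenSeries m n) : Prop :=
  ∃ (α : Fin m → ℝ≥0) (N : Fin n → ℕ) (U : GenSeries m n),
    (∀ i, (α i : ℝ) ∈ A.expSemiring) ∧ IsUnit U ∧ F = HahnSeries.single (α, N) 1 * U

end Quasi

end

/-!
# Normal crossings along admissible trees

The series in the image of `𝒯` are handled through their germs, which are determined by them. For
the inductions the variables are the elements of a finite set `V`, and `D ⊆ V` is the set of those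
that are nonnegative: `IsG A D f` says that `f : (V → ℝ) → ℝ` is a germ of the collection, `co` is
its coefficient function, and `Normal A D f` that it is a monomial times a unit. That a monomial
dividing all exponents of a germ splits off, with the quotient in the collection, makes the usual
arguments about series available for germs.

**Trees of unbounded height.** `covAll` shows by induction on the number of variables that every
nonzero germ becomes normal along the branches of a well-founded tree (`Cov`).

* The exponents of the variables in `D` have finitely many minimal elements. While two of them are
  incomparable, in the variables `i` and `j` say, ramifications equalise the differences of the
  exponents, and the blow-up of `x_i` and `x_j` makes the exponents agree in one more variable or
  decreases the number of nonnegative variables (`cov_of_dominates`). So a least exponent exists, and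
  it can be divided out.
* Then linear changes of the remaining variables make the germ regular of some order `d` in one of
  them, `z` (`cov_of_zr_ne_zero`), and a Tschirnhausen translation removes the term of degree
  `d - 1` (`exists_tschirnhausen`).
* By induction on the number of variables the coefficients of the powers of `z` become normal, and
  suitable powers of them comparable. For this it is enough to make the product of these powers and
  of their nonzero differences normal, as the factors of a normal germ are normal (`Normal.of_mul`)
  and normal germs with a normal difference are comparable (`IsLeastExp.le_or_le`). Ramifications
  make the exponents of the relevant coefficient integral multiples of its weight
  (`cov_of_exponents`), and blow-ups of `z` along the variables of the resulting monomial lower the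
  order (`cov_of_natural`): in the chart at the origin the monomial becomes smaller, at infinity the
  germ becomes normal, and in the other charts the order drops because there is no term of degree
  `d - 1`.

**Bounded height.** A blow-up has infinitely many charts, whose trees may have unbounded heights a
priori. By analyticity the germs of `f` at the points near the origin are germs of the collection
too, and `Cov.uhd` bounds the heights for all these germs simultaneously, by induction over the tree.
At a blow-up the exceptional divisor is covered by finitely many neighbourhoods, by compactness, and
the germ at a point of such a neighbourhood is the germ of a translate of the pullback, up to a change
of coordinates (`exists_uniform_blow`). Such changes at most double the height (`isoHD`).

**Admissible trees.** A tree over `V` of bounded height becomes an admissible tree, where the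
translations of arbitrary variables are composed of Tschirnhausen translations and linear
transformations (`HD.tr`). That translations and linear transformations act on the series by formal
substitution is `isComp_update_y`. For finitely many series, `exists_tree_of_germs` applies this to
the product of their germs and of the nonzero differences (`exists_prod_diff`).
-/

open Filter Topology
open scoped NNReal

set_option linter.unusedSectionVars false

noncomputable section

namespace Quasi

/-! ### Germs in finitely many numbered variables -/

section Germs

variable (A : QuasianalyticSystem) {m n : ℕ}

theorem isGerm_iff (f : Pt m n → ℝ) :
    A.IsGerm f ↔ ∃ (r : Polyradius m n) (g : Pt m n → ℝ), MemOn A.alg r g ∧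
      f =ᶠ[𝓝[Quad m n] 0] g := by
  constructor
  · rintro ⟨r, g, hg, h⟩
    exact ⟨r, g, hg, Germ.coe_eq.1 h⟩
  · rintro ⟨r, g, hg, h⟩
    exact ⟨r, g, hg, Germ.coe_eq.2 h⟩

variable {A}

theorem isGerm_congr {f g : Pt m n → ℝ} (h : f =ᶠ[𝓝[Quad m n] 0] g)
    (hf : A.IsGerm f) : A.IsGerm g := by
  rw [isGerm_iff] at *
  obtain ⟨r, f0, h0, h1⟩ := hf
  exact ⟨r, f0, h0, h.symm.trans h1⟩

theorem ser_congr {f g : Pt m n → ℝ} (h : f =ᶠ[𝓝[Quad m n] 0] g)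
    (hf : A.IsGerm f) (hg : A.IsGerm g) : A.ser f hf = A.ser g hg := by
  unfold TaylorAlgebras.ser
  congr 1
  exact Subtype.ext (Germ.coe_eq.2 h)

theorem eventuallyEq_of_ser_eq {f g : Pt m n → ℝ}
    (hf : A.IsGerm f) (hg : A.IsGerm g) (h : A.ser f hf = A.ser g hg) :
    f =ᶠ[𝓝[Quad m n] 0] g :=
  Germ.coe_eq.1 (Subtype.ext_iff.1 (A.T_injective m n h))

theorem zero_mem_quad : (0 : Pt m n) ∈ Quad m n := fun _ => le_rfl

theorem eq_at_zero {f g : Pt m n → ℝ} (h : f =ᶠ[𝓝[Quad m n] 0] g) : f 0 = g 0 :=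
  h.self_of_nhdsWithin zero_mem_quad

theorem isGerm_const (m n : ℕ) (c : ℝ) : A.IsGerm (fun _ : Pt m n => c) :=
  A.toFunctionAlgebras.isGerm_const c

theorem TaylorAlgebras.IsGerm.add {f g : Pt m n → ℝ} (hf : A.IsGerm f) (hg : A.IsGerm g) :
    A.IsGerm (fun p => f p + g p) := (A.germs m n).add_mem hf hg

theorem TaylorAlgebras.IsGerm.mul {f g : Pt m n → ℝ} (hf : A.IsGerm f) (hg : A.IsGerm g) :
    A.IsGerm (fun p => f p * g p) := (A.germs m n).mul_mem hf hg

theorem TaylorAlgebras.IsGerm.neg {f : Pt m n → ℝ} (hf : A.IsGerm f) :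
    A.IsGerm (fun p => - f p) := (A.germs m n).neg_mem hf

theorem TaylorAlgebras.IsGerm.sub {f g : Pt m n → ℝ} (hf : A.IsGerm f) (hg : A.IsGerm g) :
    A.IsGerm (fun p => f p - g p) := (A.germs m n).sub_mem hf hg

theorem TaylorAlgebras.IsGerm.pow {f : Pt m n → ℝ} (hf : A.IsGerm f) (k : ℕ) :
    A.IsGerm (fun p => f p ^ k) := (A.germs m n).pow_mem hf k

theorem ser_const (m n : ℕ) (c : ℝ) : A.ser _ (isGerm_const (A := A) m n c) = HahnSeries.C c :=
  A.T_const m n c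

theorem ser_add {f g : Pt m n → ℝ} (hf : A.IsGerm f) (hg : A.IsGerm g) :
    A.ser _ (hf.add hg) = A.ser f hf + A.ser g hg :=
  map_add (A.T m n) ⟨_, hf⟩ ⟨_, hg⟩

theorem ser_mul {f g : Pt m n → ℝ} (hf : A.IsGerm f) (hg : A.IsGerm g) :
    A.ser _ (hf.mul hg) = A.ser f hf * A.ser g hg :=
  map_mul (A.T m n) ⟨_, hf⟩ ⟨_, hg⟩

theorem isGerm_x (i : Fin m) : A.IsGerm (fun p : Pt m n => p.1 i) :=
  (isGerm_iff A _).2 ⟨Polyradius.unit m n, _, A.coord_x _ i, EventuallyEq.rfl⟩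

theorem isGerm_y (j : Fin n) : A.IsGerm (fun p : Pt m n => p.2 j) :=
  (isGerm_iff A _).2 ⟨Polyradius.unit m n, _, A.coord_y _ j, EventuallyEq.rfl⟩

theorem tendsto_quad {m n m' n' : ℕ} {φ : Pt m' n' → Pt m n} (hc : ContinuousAt φ 0)
    (h0 : φ 0 = 0) (hq : ∀ p ∈ Quad m' n', φ p ∈ Quad m n) :
    Tendsto φ (𝓝[Quad m' n'] 0) (𝓝[Quad m n] 0) := by
  refine tendsto_nhdsWithin_iff.2 ⟨?_, eventually_nhdsWithin_of_forall hq⟩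
  have := hc.tendsto
  rw [h0] at this
  exact this.mono_left nhdsWithin_le_nhds

theorem box_mem (r : Polyradius m n) : r.box ∈ 𝓝[Quad m n] (0 : Pt m n) := by
  have h1 : ∀ i, ∀ᶠ p : Pt m n in 𝓝 0, p.1 i < r.s i := fun i =>
    (((continuous_apply i).comp continuous_fst).tendsto (0 : Pt m n)).eventually
      (gt_mem_nhds (by simpa using r.s_pos i))
  have h2 : ∀ j, ∀ᶠ p : Pt m n in 𝓝 0, |p.2 j| < r.t j := fun j =>
    (((continuous_abs.comp ((continuous_apply j).comp continuous_snd))).tendsto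
      (0 : Pt m n)).eventually (gt_mem_nhds (by simpa using r.t_pos j))
  filter_upwards [self_mem_nhdsWithin, nhdsWithin_le_nhds (eventually_all.2 h1),
    nhdsWithin_le_nhds (eventually_all.2 h2)] with p hp h1 h2
  exact ⟨fun i => ⟨hp i, h1 i⟩, h2⟩

theorem TaylorAlgebras.IsGerm.continuousWithinAt {f : Pt m n → ℝ} (hf : A.IsGerm f) :
    Tendsto f (𝓝[Quad m n] 0) (𝓝 (f 0)) := by
  obtain ⟨r, g, hg, h⟩ := (isGerm_iff A f).1 hf
  have hc := A.continuousOn r g hg 0 ⟨fun i => ⟨le_rfl, r.s_pos i⟩, fun j => by simpa using r.t_pos j⟩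
  have hb : r.box ⊆ Quad m n := fun p hp i => (hp.1 i).1
  have : 𝓝[r.box] (0 : Pt m n) = 𝓝[Quad m n] 0 := by
    apply le_antisymm (nhdsWithin_mono _ hb)
    exact nhdsWithin_le_of_mem (box_mem r)
  rw [ContinuousWithinAt, this] at hc
  rw [eq_at_zero h]
  exact hc.congr' h.symm

theorem TaylorAlgebras.IsGerm.addVar {f : Pt m n → ℝ} (hf : A.IsGerm f) :
    A.IsGerm (fun p : Pt (m + 1) n => f (Fin.init p.1, p.2)) := by
  obtain ⟨r, g, hg, h⟩ := (isGerm_iff A f).1 hf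
  refine (isGerm_iff A _).2 ⟨⟨Fin.snoc (α := fun _ => ℝ) r.s 1, r.t, ?_, r.t_pos⟩, _,
    A.addVariable r _ g (by intro i; simp) (fun _ => rfl) hg, ?_⟩
  · intro i
    refine Fin.lastCases ?_ (fun i => ?_) i
    · simp
    · simpa using r.s_pos i
  · exact (tendsto_quad (φ := fun p : Pt (m + 1) n => ((Fin.init p.1, p.2) : Pt m n))
      (by apply Continuous.continuousAt; unfold Fin.init; fun_prop) (by ext <;> rfl)
      (fun p hp i => hp _)).eventually h

theorem TaylorAlgebras.IsGerm.permX {f : Pt m n → ℝ} (hf : A.IsGerm f) (σ : Equiv.Perm (Fin m)) :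
    A.IsGerm (fun p : Pt m n => f (fun i => p.1 (σ i), p.2)) := by
  obtain ⟨r, g, hg, h⟩ := (isGerm_iff A f).1 hf
  refine (isGerm_iff A _).2 ⟨⟨fun i => r.s (σ.symm i), r.t, fun i => r.s_pos _, r.t_pos⟩, _,
    A.permute σ r _ g (by intro i; simp) (fun _ => rfl) hg, ?_⟩
  exact (tendsto_quad (φ := fun p : Pt m n => ((fun i => p.1 (σ i), p.2) : Pt m n))
      (by apply Continuous.continuousAt; fun_prop) (by ext <;> rfl)
      (fun p hp i => hp _)).eventually h

theorem TaylorAlgebras.IsGerm.setZero {f : Pt (m + 1) n → ℝ} (hf : A.IsGerm f) :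
    A.IsGerm (fun p : Pt m n => f (Fin.snoc (α := fun _ => ℝ) p.1 0, p.2)) := by
  obtain ⟨r, g, hg, h⟩ := (isGerm_iff A f).1 hf
  refine (isGerm_iff A _).2 ⟨⟨fun i => r.s i.castSucc, r.t, fun i => r.s_pos _, r.t_pos⟩, _,
    A.setZero r _ g (by intro i; simp) (fun _ => rfl) hg, ?_⟩
  refine (tendsto_quad (φ := fun p : Pt m n =>
    ((Fin.snoc (α := fun _ => ℝ) p.1 0, p.2) : Pt (m + 1) n)) ?_ ?_ ?_).eventually h
  · apply Continuous.continuousAt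
    refine Continuous.prodMk (continuous_pi fun i => ?_) continuous_snd
    refine Fin.lastCases ?_ (fun i => ?_) i
    · simpa using continuous_const
    · simp only [Fin.snoc_castSucc]; fun_prop
  · refine Prod.ext (funext fun i => ?_) rfl
    refine Fin.lastCases ?_ (fun i => ?_) i <;> simp
  · intro p hp i
    refine Fin.lastCases ?_ (fun i => ?_) i
    · simp
    · simpa using hp i

/-- Substitution in the `y`-variables of germs that only depend on the new `y`-variables. -/
theorem TaylorAlgebras.IsGerm.composeY {m n n' : ℕ} {f : Pt m n → ℝ} (hf : A.IsGerm f)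
    {g : Fin n → Pt 0 n' → ℝ} (hg : ∀ j, A.IsGerm (g j)) (h0 : ∀ j, g j 0 = 0) :
    A.IsGerm (fun p : Pt m n' => f (p.1, fun j => g j (Fin.elim0, p.2))) := by
  obtain ⟨h, -⟩ := A.compose (m' := 0) f hf g hg h0
  have e : (fun p : Pt m n' => f (p.1, fun j => g j (Fin.elim0, p.2))) = fun p : Pt (m + 0) n' =>
      f (fun i => p.1 (Fin.castAdd 0 i), fun j => g j (fun i => p.1 (Fin.natAdd m i), p.2)) := by
    funext p
    refine congrArg f (Prod.ext rfl (funext fun j => congrArg (g j) (Prod.ext ?_ rfl)))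
    exact Subsingleton.elim _ _
  rw [e]
  exact h

/-- Restriction to the diagonal `x_{m+1} = x_j`. -/
theorem TaylorAlgebras.IsGerm.diagLast {f : Pt (m + 1) n → ℝ} (hf : A.IsGerm f) (j : Fin m) :
    A.IsGerm (fun p : Pt m n => f (Fin.snoc (α := fun _ => ℝ) p.1 (p.1 j), p.2)) := by
  obtain ⟨h, -⟩ := A.blowUp (BlowUpChart.xx (Fin.last m) j (Fin.castSucc_lt_last j) 1 one_pos) f hf
  have := h.composeY (g := Fin.cons (fun _ => 0) (fun k p => p.2 k)) (n' := n) (by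
    intro k
    refine Fin.cases ?_ (fun k => ?_) k
    · exact isGerm_const _ _ 0
    · exact isGerm_y _) (by
    intro k
    refine Fin.cases ?_ (fun k => ?_) k <;> simp)
  convert this using 3 with p
  refine Prod.ext ?_ (funext fun k => ?_)
  · simp [BlowUpChart.toMap]
  · simp [BlowUpChart.toMap, Fin.tail]

theorem TaylorAlgebras.IsGerm.diag : ∀ (k : ℕ) {f : Pt (m + k) n → ℝ} (_ : A.IsGerm f)
    (κ : Fin k → Fin m),
    A.IsGerm (fun p : Pt m n => f (Fin.append p.1 (fun i => p.1 (κ i)), p.2))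
  | 0, f, hf, κ => by
      have e : (fun p : Pt m n => f (Fin.append p.1 (fun i => p.1 (κ i)), p.2)) = f := by
        funext p
        refine congrArg f (Prod.ext (funext fun i => ?_) rfl)
        exact Fin.append_left (n := 0) p.1 (fun i => p.1 (κ i)) i
      rw [e]
      exact hf
  | k + 1, f, hf, κ => by
      have h1 : A.IsGerm (fun p : Pt (m + k) n =>
          f (Fin.snoc (α := fun _ => ℝ) p.1 (p.1 (Fin.castAdd k (κ (Fin.last k)))), p.2)) :=
        TaylorAlgebras.IsGerm.diagLast (m := m + k) hf _
      have h2 := TaylorAlgebras.IsGerm.diag k h1 (fun i => κ i.castSucc)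
      convert h2 using 4 with p
      funext i
      refine Fin.lastCases ?_ (fun i => ?_) i
      · simp only [Fin.snoc_last, Fin.append_left]
        exact Fin.append_right p.1 (fun i => p.1 (κ i)) (Fin.last k)
      · simp only [Fin.snoc_castSucc]
        refine Fin.addCases (fun i => ?_) (fun i => ?_) i
        · rw [Fin.append_left]
          exact Fin.append_left p.1 (fun i => p.1 (κ i)) i
        · rw [Fin.append_right]
          exact Fin.append_right p.1 (fun i => p.1 (κ i)) i.castSucc

/-- Substitution in the `y`-variables. -/
theorem TaylorAlgebras.IsGerm.subY {m n n' : ℕ} {f : Pt m n → ℝ} (hf : A.IsGerm f)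
    {g : Fin n → Pt m n' → ℝ} (hg : ∀ j, A.IsGerm (g j)) (h0 : ∀ j, g j 0 = 0) :
    A.IsGerm (fun p : Pt m n' => f (p.1, fun j => g j p)) := by
  obtain ⟨h, -⟩ := A.compose f hf g hg h0
  have := TaylorAlgebras.IsGerm.diag m h id
  convert this using 3 with p
  refine Prod.ext ?_ (funext fun j => congrArg (g j) (Prod.ext (funext fun i => ?_) rfl))
  · simp
  · exact (Fin.append_right p.1 (fun i => p.1 i) i).symm

theorem TaylorAlgebras.IsGerm.chartXX {f : Pt m n → ℝ} (hf : A.IsGerm f) (i : Fin m) {lam : ℝ}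
    (hlam : 0 < lam) :
    A.IsGerm (fun p : Pt m (n + 1) =>
      f (Function.update p.1 i (p.1 i * (lam + p.2 0)), Fin.tail p.2)) := by
  have h1 := (hf.addVar).permX (Equiv.swap i.castSucc (Fin.last m))
  obtain ⟨h, -⟩ := A.blowUp (BlowUpChart.xx (Fin.last m) i (Fin.castSucc_lt_last i) lam hlam) _ h1
  convert h using 3 with p
  refine Prod.ext (funext fun k => ?_) rfl
  simp only [BlowUpChart.toMap, Fin.init, Fin.insertNth_last']
  by_cases hk : k = i
  · subst hk; simp
  · rw [Function.update_of_ne hk, Equiv.swap_apply_of_ne_of_ne]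
    · simp
    · simpa using hk
    · exact (Fin.castSucc_lt_last k).ne

/-- The substitution `x_i = x_i' u` for a positive unit `u`. -/
theorem TaylorAlgebras.IsGerm.subX {f u : Pt m n → ℝ} (hf : A.IsGerm f) (hu : A.IsGerm u) (i : Fin m)
    (h0 : 0 < u 0) :
    A.IsGerm (fun p : Pt m n => f (Function.update p.1 i (p.1 i * u p), p.2)) := by
  have := TaylorAlgebras.IsGerm.subY (hf.chartXX i h0)
    (g := Fin.cons (fun p => u p - u 0) (fun k p => p.2 k)) (n' := n) (by
    intro k
    refine Fin.cases ?_ (fun k => ?_) k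
    · exact hu.sub (isGerm_const _ _ _)
    · exact isGerm_y _) (by
    intro k
    refine Fin.cases ?_ (fun k => ?_) k <;> simp)
  convert this using 3 with p
  refine Prod.ext ?_ rfl
  simp

/-- The ramification `x_i = x_i' ^ d` for a positive integer `d`. -/
theorem TaylorAlgebras.IsGerm.powX {f : Pt m n → ℝ} (hf : A.IsGerm f) (i : Fin m) (d : ℕ) :
    A.IsGerm (fun p : Pt m n => f (Function.update p.1 i (p.1 i ^ (d + 1)), p.2)) := by
  have h1 : ∀ d : ℕ, A.IsGerm (fun p : Pt (m + 1) n =>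
      f (Function.update (Fin.init p.1) i (p.1 i.castSucc * p.1 (Fin.last m) ^ d), p.2)) := by
    intro d
    induction d with
    | zero =>
      convert hf.addVar using 4 with p
      simp [Fin.init]
    | succ d ih =>
      obtain ⟨h, -⟩ := A.blowUp (BlowUpChart.xxZero i.castSucc (Fin.last m)
        (Fin.castSucc_lt_last i).ne) _ ih
      convert h using 3 with p
      refine Prod.ext (funext fun k => ?_) rfl
      by_cases hk : k = i
      · subst hk
        simp only [BlowUpChart.toMap, Function.update_self]
        rw [Function.update_of_ne (Fin.castSucc_lt_last k).ne']
        ring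
      · simp only [BlowUpChart.toMap]
        rw [Function.update_of_ne hk, Function.update_of_ne hk]
        simp only [Fin.init]
        rw [Function.update_of_ne (by simpa using hk)]
  convert TaylorAlgebras.IsGerm.diagLast (h1 d) i using 4 with p
  simp [pow_succ']

end Germs

/-! ### Formal compositions -/

section Formal

variable {m n m' n' : ℕ}

theorem FormalMap.IsComp.unique {φ : FormalMap m n m' n'} {F : GenSeries m n}
    {G G' : GenSeries m' n'} (h : φ.IsComp F G) (h' : φ.IsComp F G') : G = G' := by
  ext e
  rw [(h e).2, (h' e).2]

theorem FormalMap.IsComp.of_single {φ : FormalMap m n m' n'} {e : Expo m n}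
    {G : GenSeries m' n'} (h : φ.IsComp (HahnSeries.single e 1) G) : G = φ.monomial e := by
  classical
  ext e'
  rw [(h e').2, finsum_eq_single _ e]
  · simp
  · intro x hx
    rw [HahnSeries.coeff_single_of_ne hx, zero_mul]

/-- A formal map is monomial along `L` if it sends monomials to monomials. -/
theorem FormalMap.isComp_iff_of_monomial {φ : FormalMap m n m' n'} {L : Expo m n → Expo m' n'}
    (hL : Function.Injective L) (hφ : ∀ e, φ.monomial e = HahnSeries.single (L e) 1)
    {F : GenSeries m n} {G : GenSeries m' n'} :
    φ.IsComp F G ↔ (∀ e, G.coeff (L e) = F.coeff e) ∧ ∀ e', e' ∉ Set.range L → G.coeff e' = 0 := by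
  classical
  have h1 : ∀ e e', e' ≠ L e → F.coeff e * (φ.monomial e).coeff e' = 0 := by
    intro e e' h
    rw [hφ, HahnSeries.coeff_single_of_ne h, mul_zero]
  have h2 : ∀ e, ∑ᶠ x, F.coeff x * (φ.monomial x).coeff (L e) = F.coeff e := by
    intro e
    rw [finsum_eq_single _ e]
    · rw [hφ, HahnSeries.coeff_single_same, mul_one]
    · intro x hx
      exact h1 _ _ fun h => hx (hL h).symm
  have h3 : ∀ e', e' ∉ Set.range L → ∑ᶠ x, F.coeff x * (φ.monomial x).coeff e' = 0 := by
    intro e' he'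
    rw [finsum_eq_zero_of_forall_eq_zero]
    intro x
    exact h1 _ _ fun h => he' ⟨x, h.symm⟩
  constructor
  · intro h
    exact ⟨fun e => by rw [(h _).2, h2], fun e' he' => by rw [(h _).2, h3 e' he']⟩
  · rintro ⟨ha, hb⟩ e'
    by_cases he' : e' ∈ Set.range L
    · obtain ⟨e, rfl⟩ := he'
      refine ⟨(Set.finite_singleton e).subset fun x hx => ?_, by rw [ha, h2]⟩
      by_contra hxe
      exact hx (h1 _ _ fun h => hxe (hL h).symm)
    · refine ⟨(Set.finite_empty).subset fun x hx => ?_, by rw [hb e' he', h3 e' he']⟩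
      exact hx (h1 _ _ fun h => he' ⟨x, h.symm⟩)

theorem single_prod {ι : Type*} (s : Finset ι) (f : ι → Expo m n) :
    ∏ i ∈ s, (HahnSeries.single (f i) 1 : GenSeries m n) = HahnSeries.single (∑ i ∈ s, f i) 1 := by
  classical
  induction s using Finset.induction_on with
  | empty => simp
  | insert a s ha ih => rw [Finset.prod_insert ha, Finset.sum_insert ha, ih,
      HahnSeries.single_mul_single, one_mul]

theorem single_pow' (e : Expo m n) (k : ℕ) :
    (HahnSeries.single e 1 : GenSeries m n) ^ k = HahnSeries.single (k • e) 1 := by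
  rw [HahnSeries.single_pow, one_pow]

theorem prod_X (α : Fin m → ℝ≥0) :
    ∏ i, (X i (α i) : GenSeries m n) = HahnSeries.single (α, 0) 1 := by
  unfold X
  rw [single_prod]
  congr 2
  refine Prod.ext ?_ ?_
  · rw [Prod.fst_sum]; exact Finset.univ_sum_single α
  · rw [Prod.snd_sum]; simp

theorem prod_Y (N : Fin n → ℕ) :
    ∏ j, (Y j : GenSeries m n) ^ N j = HahnSeries.single (0, N) 1 := by
  unfold Y
  simp_rw [single_pow']
  rw [single_prod]
  congr 2
  refine Prod.ext ?_ ?_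
  · rw [Prod.fst_sum]; simp
  · rw [Prod.snd_sum]
    simp only [Prod.smul_mk]
    conv_rhs => rw [← Finset.univ_sum_single N]
    refine Finset.sum_congr rfl fun j _ => ?_
    rw [← Pi.single_smul]; simp

theorem prod_update_X (i : Fin m) (φ : ℝ≥0 → GenSeries m n) (α : Fin m → ℝ≥0)
    (ψ : GenSeries m n) (h : φ (α i) = ψ * X i (α i)) :
    ∏ k, Function.update X i φ k (α k) = ψ * HahnSeries.single (α, 0) 1 := by
  classical
  have : ∀ k, Function.update X i φ k (α k) = (if k = i then ψ else 1) * X k (α k) := by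
    intro k
    by_cases hk : k = i
    · subst hk; simp [h]
    · simp [hk]
  simp_rw [this]
  rw [Finset.prod_mul_distrib, prod_X]
  simp

theorem xxZero_monomial (i j : Fin m) (hij : i ≠ j) (e : Expo m n) :
    (BlowUpChart.xxZero (n := n) i j hij).formal.monomial e =
      HahnSeries.single (Pi.single j (e.1 i) + e.1, e.2) 1 := by
  unfold FormalMap.monomial
  simp only [BlowUpChart.formal]
  rw [prod_update_X i _ _ (X j (e.1 i)) rfl, prod_Y]
  unfold X
  rw [HahnSeries.single_mul_single, HahnSeries.single_mul_single]
  simp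

theorem xxZero_expo_injective (i j : Fin m) (hij : i ≠ j) :
    Function.Injective fun e : Expo m n => ((Pi.single j (e.1 i) + e.1, e.2) : Expo m n) := by
  intro a b h
  simp only [Prod.mk.injEq] at h
  refine Prod.ext (funext fun k => ?_) h.2
  have hi := congrFun h.1 i
  have hk := congrFun h.1 k
  simp only [Pi.add_apply, Pi.single_apply, hij, if_false, zero_add] at hi hk
  rw [hi] at hk
  simpa using hk

theorem ramFormal_monomial (i : Fin m) (γ : ℝ≥0) (e : Expo m n) :
    (ramFormal (n := n) i γ).monomial e =
      HahnSeries.single (Function.update e.1 i (γ * e.1 i), e.2) 1 := by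
  unfold FormalMap.monomial
  simp only [ramFormal]
  have : ∀ k, Function.update X i (fun a => (X i (γ * a) : GenSeries m n)) k (e.1 k) =
      X k (Function.update e.1 i (γ * e.1 i) k) := by
    intro k
    by_cases hk : k = i
    · subst hk; simp
    · simp [Function.update_of_ne hk]
  simp_rw [this]
  rw [prod_X, prod_Y, HahnSeries.single_mul_single]
  simp

theorem xx_monomial (i : Fin (m + 1)) (j : Fin m) (hji : j.castSucc < i) {lam : ℝ}
    (hlam : 0 < lam) (e : Expo (m + 1) n) :
    (BlowUpChart.xx (n := n) i j hji lam hlam).formal.monomial e =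
      HahnSeries.single (Pi.single j (e.1 i) + fun k => e.1 (i.succAbove k), Fin.cons 0 e.2) 1 *
        binomialSeries lam (e.1 i) 0 := by
  unfold FormalMap.monomial
  simp only [BlowUpChart.formal]
  rw [Fin.prod_univ_succAbove _ i]
  simp only [Fin.insertNth_apply_same, Fin.insertNth_apply_succAbove]
  have h2 := prod_Y (m := m) (n := n + 1) (Fin.cons 0 e.2)
  rw [Fin.prod_univ_succ] at h2
  simp only [Fin.cons_zero, Fin.cons_succ, pow_zero, one_mul] at h2
  rw [h2, prod_X]
  unfold X
  rw [mul_assoc, mul_assoc, HahnSeries.single_mul_single, mul_comm (binomialSeries _ _ _),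
    ← mul_assoc, HahnSeries.single_mul_single]
  simp

theorem binomialSeries_coeff {lam : ℝ} (a : ℝ≥0) (k : ℕ) :
    (binomialSeries lam a 0 : GenSeries m (n + 1)).coeff (0, Pi.single 0 k) =
      lam ^ (a : ℝ) * Ring.choose (a : ℝ) k * lam⁻¹ ^ k := by
  simp [binomialSeries]

theorem binomialSeries_coeff_eq_zero {lam : ℝ} (a : ℝ≥0) (e : Expo m (n + 1))
    (h : ¬(e.1 = 0 ∧ e.2 = Pi.single 0 (e.2 0))) :
    (binomialSeries lam a 0 : GenSeries m (n + 1)).coeff e = 0 := by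
  simp only [binomialSeries]
  rw [if_neg h]

theorem binomialSeries_zero {lam : ℝ} : (binomialSeries lam 0 0 : GenSeries m (n + 1)) = 1 := by
  ext e
  have h0 : (1 : GenSeries m (n + 1)) = HahnSeries.single 0 1 := rfl
  rw [h0]
  by_cases h : e.1 = 0 ∧ e.2 = Pi.single 0 (e.2 0)
  · have he : e = (0, Pi.single 0 (e.2 0)) := Prod.ext h.1 h.2
    rw [he, binomialSeries_coeff]
    rcases Nat.eq_zero_or_pos (e.2 0) with hk | hk
    · rw [hk]
      have : ((0, Pi.single 0 0) : Expo m (n + 1)) = 0 := by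
        refine Prod.ext rfl ?_
        simp
      rw [this, HahnSeries.coeff_single_same]; simp
    · rw [HahnSeries.coeff_single_of_ne]
      · have : Ring.choose (((0 : ℝ≥0) : ℝ)) (e.2 0) = 0 := by
          have h3 : (((0 : ℝ≥0) : ℝ)) = ((0 : ℕ) : ℝ) := by norm_num
          rw [h3, Ring.choose_natCast, Nat.choose_eq_zero_of_lt hk]; simp
        rw [this]; simp
      · intro h
        have := congrFun (congrArg Prod.snd h) 0
        simp at this
        omega
  · rw [binomialSeries_coeff_eq_zero _ _ h, HahnSeries.coeff_single_of_ne]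
    rintro rfl; apply h; simp

theorem rename_coeff {σ : Fin m ↪ Fin m'} {τ : Fin n ↪ Fin n'} (F : GenSeries m n) (e : Expo m n) :
    (rename σ τ F).coeff (expoEmb σ τ e) = F.coeff e :=
  HahnSeries.embDomain_coeff

theorem rename_coeff_of_notMem {σ : Fin m ↪ Fin m'} {τ : Fin n ↪ Fin n'} (F : GenSeries m n)
    (e : Expo m' n') (h : e ∉ Set.range (expoEmb σ τ)) : (rename σ τ F).coeff e = 0 :=
  HahnSeries.embDomain_of_notMem_range h

theorem rename_injective (σ : Fin m ↪ Fin m') (τ : Fin n ↪ Fin n') :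
    Function.Injective (rename σ τ) := HahnSeries.embDomain_injective

theorem rename_single (σ : Fin m ↪ Fin m') (τ : Fin n ↪ Fin n') (e : Expo m n) :
    rename σ τ (HahnSeries.single e 1) = HahnSeries.single (expoEmb σ τ e) 1 :=
  HahnSeries.embDomain_single

theorem extend_single {k l : ℕ} {R : Type*} [Zero R] (σ : Fin k ↪ Fin l) (i : Fin k) (a : R) :
    Function.extend σ (Pi.single i a) 0 = Pi.single (σ i) a := by
  funext q
  by_cases h : ∃ l, σ l = q
  · obtain ⟨l, rfl⟩ := h
    rw [σ.injective.extend_apply]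
    simp [Pi.single_apply]
  · rw [Function.extend_apply' _ _ _ h]
    have : q ≠ σ i := by rintro rfl; exact h ⟨i, rfl⟩
    exact (Pi.single_eq_of_ne (M := fun _ => R) this a).symm

theorem extend_zero {k l : ℕ} {R : Type*} [Zero R] (σ : Fin k ↪ Fin l) :
    Function.extend σ (0 : Fin k → R) 0 = 0 := by
  funext q
  by_cases h : ∃ l, σ l = q
  · obtain ⟨l, rfl⟩ := h
    exact σ.injective.extend_apply _ _ _
  · exact Function.extend_apply' _ _ _ h

theorem expoEmb_single_x (σ : Fin m ↪ Fin m') (τ : Fin n ↪ Fin n') (i : Fin m) (a : ℝ≥0) :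
    expoEmb σ τ (Pi.single i a, 0) = (Pi.single (σ i) a, 0) :=
  Prod.ext (extend_single σ i a) (extend_zero τ)

theorem expoEmb_single_y (σ : Fin m ↪ Fin m') (τ : Fin n ↪ Fin n') (i : Fin n) (a : ℕ) :
    expoEmb σ τ (0, Pi.single i a) = (0, Pi.single (τ i) a) :=
  Prod.ext (extend_zero σ) (extend_single τ i a)

end Formal

/-- If `u + v` is the only decomposition of that exponent along the two supports, the coefficient of
the product there is the product of the coefficients. -/
theorem coeff_mul_of_unique {Γ : Type*} [AddCommMonoid Γ] [PartialOrder Γ]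
    [IsOrderedCancelAddMonoid Γ] {F G : HahnSeries Γ ℝ} {u v : Γ}
    (h : ∀ x y, F.coeff x ≠ 0 → G.coeff y ≠ 0 → x + y = u + v → x = u ∧ y = v) :
    (F * G).coeff (u + v) = F.coeff u * G.coeff v := by
  rw [HahnSeries.coeff_mul, Finset.sum_eq_single (u, v)]
  · rintro ⟨x, y⟩ hxy hne
    rw [Finset.mem_antidiagonal] at hxy
    obtain ⟨rfl, rfl⟩ := h x y hxy.1 hxy.2.1 hxy.2.2
    exact absurd rfl hne
  · intro hn
    by_contra hc
    apply hn
    rw [Finset.mem_antidiagonal]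
    exact ⟨left_ne_zero_of_mul hc, right_ne_zero_of_mul hc, rfl⟩

/-! ### The series of the coordinate functions -/

section Coordinates

variable {A : QuasianalyticSystem}

/-- The series of a coordinate is a power of the variable: with `S` the series of `x`, the blow-up
`x_1 = x_1' x_2'` gives `S(X_1) S(X_2) = S(X_1 X_2)`, so that all products of two different
coefficients of `S` vanish and the nonzero ones are idempotent. -/
theorem ser_x_exists : ∃ a : ℝ≥0,
    A.ser (fun p : Pt 1 0 => p.1 0) (isGerm_x 0) = X 0 a := by
  set S := A.ser (fun p : Pt 1 0 => p.1 0) (isGerm_x 0) with hS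
  have h0 := A.T_extend (m := 1) (n := 0) (m' := 2) (n' := 0) (by norm_num) le_rfl
    (fun p => p.1 0) (isGerm_x 0) (isGerm_x 0)
  change A.ser (fun p : Pt 2 0 => p.1 0) (isGerm_x 0) = rename _ _ S at h0
  have h1 := A.T_permute (Equiv.swap 0 1) (fun p : Pt 2 0 => p.1 0) (isGerm_x 0) (by
    simpa using isGerm_x (1 : Fin 2))
  have h1' : A.ser (fun p : Pt 2 0 => p.1 1) (isGerm_x 1) =
      rename (Equiv.swap (0 : Fin 2) 1).toEmbedding (Function.Embedding.refl _)
        (A.ser (fun p : Pt 2 0 => p.1 0) (isGerm_x 0)) := by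
    rw [← h1]; congr 1
  set F0 := A.ser (fun p : Pt 2 0 => p.1 0) (isGerm_x 0) with hF0
  set F1 := A.ser (fun p : Pt 2 0 => p.1 1) (isGerm_x 1) with hF1
  obtain ⟨h, hc⟩ := A.blowUp (BlowUpChart.xxZero (m := 2) (n := 0) 0 1 (by decide)) _ (isGerm_x 0)
  have h2 : A.ser _ h = F0 * F1 := by
    rw [mul_comm, hF1, hF0, ← ser_mul]
    congr 1
  rw [h2, FormalMap.isComp_iff_of_monomial (xxZero_expo_injective _ _ (by decide))
    (xxZero_monomial _ _ _)] at hc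
  obtain ⟨hc1, hc2⟩ := hc
  have hexp : ∀ e : Expo 1 0, e = (Pi.single 0 (e.1 0), 0) := fun e =>
    Prod.ext (funext fun i => by rw [Subsingleton.elim i 0]; simp) (Subsingleton.elim _ _)
  have e0 : ∀ a : ℝ≥0, F0.coeff (Pi.single 0 a, 0) = S.coeff (Pi.single 0 a, 0) := by
    intro a
    have := expoEmb_single_x (Fin.castLEEmb (by norm_num : 1 ≤ 2))
      (Fin.castLEEmb (le_refl 0)) 0 a
    rw [h0, ← rename_coeff (σ := Fin.castLEEmb (by norm_num : 1 ≤ 2))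
      (τ := Fin.castLEEmb (le_refl 0)) S, this]
    rfl
  have s0 : ∀ e, F0.coeff e ≠ 0 → e = (Pi.single 0 (e.1 0), 0) := by
    intro e he
    rw [h0] at he
    by_contra hne
    refine he (rename_coeff_of_notMem _ _ ?_)
    rintro ⟨e, rfl⟩
    rw [hexp e, expoEmb_single_x] at hne
    apply hne
    simp
  have e1 : ∀ a : ℝ≥0, F1.coeff (Pi.single 1 a, 0) = S.coeff (Pi.single 0 a, 0) := by
    intro a
    have := expoEmb_single_x (Equiv.swap (0 : Fin 2) 1).toEmbedding
      (Function.Embedding.refl (Fin 0)) 0 a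
    rw [h1', ← e0, ← rename_coeff (σ := (Equiv.swap (0 : Fin 2) 1).toEmbedding)
      (τ := (Function.Embedding.refl (Fin 0))) F0, this]
    rfl
  have s1 : ∀ e, F1.coeff e ≠ 0 → e = (Pi.single 1 (e.1 1), 0) := by
    intro e he
    rw [h1'] at he
    by_contra hne
    have : e ∈ Set.range (expoEmb (Equiv.swap (0 : Fin 2) 1).toEmbedding
      (Function.Embedding.refl (Fin 0))) := by
      by_contra hn
      exact he (rename_coeff_of_notMem _ _ hn)
    obtain ⟨e, rfl⟩ := this
    rw [rename_coeff] at he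
    rw [s0 e he, expoEmb_single_x] at hne
    apply hne
    simp
  have hprod : ∀ a b : ℝ≥0, (F0 * F1).coeff ((Pi.single 0 a, 0) + (Pi.single 1 b, 0)) =
      S.coeff (Pi.single 0 a, 0) * S.coeff (Pi.single 0 b, 0) := by
    intro a b
    rw [coeff_mul_of_unique, e0, e1]
    intro x y hx hy hxy
    rw [s0 x hx, s1 y hy] at hxy ⊢
    have h1 := congrFun (congrArg Prod.fst hxy) 0
    have h2 := congrFun (congrArg Prod.fst hxy) 1
    simp at h1 h2
    rw [h1, h2]
    simp
  have hdiag : ∀ a : ℝ≥0, (F0 * F1).coeff ((Pi.single 0 a, 0) + (Pi.single 1 a, 0)) =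
      S.coeff (Pi.single 0 a, 0) := by
    intro a
    rw [← e0, ← hc1 (Pi.single 0 a, 0)]
    congr 1
    refine Prod.ext ?_ rfl
    simp [add_comm]
  have hoff : ∀ a b : ℝ≥0, a ≠ b → (F0 * F1).coeff ((Pi.single 0 a, 0) + (Pi.single 1 b, 0)) =
      0 := by
    intro a b hab
    by_cases hr : ((Pi.single 0 a, 0) + (Pi.single 1 b, 0) : Expo 2 0) ∈
        Set.range fun e : Expo 2 0 => ((Pi.single 1 (e.1 0) + e.1, e.2) : Expo 2 0)
    · obtain ⟨e, he⟩ := hr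
      rw [← he, hc1]
      by_contra hne
      have := s0 e hne
      rw [this] at he
      have h1 := congrFun (congrArg Prod.fst he) 0
      have h2 := congrFun (congrArg Prod.fst he) 1
      simp at h1 h2
      exact hab (h1.symm.trans h2)
    · exact hc2 _ hr
  have hS0 : S ≠ 0 := by
    intro hS0
    have : (0 : GenSeries 1 0) = A.ser _ (isGerm_const 1 0 0) := by rw [ser_const, map_zero]
    rw [hS0.trans this] at hS
    have h3 := eventuallyEq_of_ser_eq (isGerm_const 1 0 0) (isGerm_x 0) hS
    have h4 : Tendsto (fun t : ℝ => ((fun _ => t, Fin.elim0) : Pt 1 0)) (𝓝[>] 0)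
        (𝓝[Quad 1 0] 0) := by
      refine tendsto_nhdsWithin_iff.2 ⟨?_, ?_⟩
      · refine tendsto_nhdsWithin_of_tendsto_nhds (Continuous.tendsto' (by fun_prop) _ _ ?_)
        refine Prod.ext rfl (Subsingleton.elim _ _)
      · filter_upwards [self_mem_nhdsWithin] with t ht i
        exact le_of_lt ht
    have h5 := h4.eventually h3
    obtain ⟨t, ht1, ht2⟩ := (h5.and self_mem_nhdsWithin).exists
    exact (ne_of_gt ht2) ht1.symm
  obtain ⟨e, he⟩ : ∃ e, S.coeff e ≠ 0 := by
    by_contra hn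
    push Not at hn
    exact hS0 (HahnSeries.ext (funext hn))
  refine ⟨e.1 0, ?_⟩
  have ha : S.coeff (Pi.single 0 (e.1 0), 0) ≠ 0 := by rwa [← hexp e]
  ext e'
  rw [hexp e']
  unfold X
  by_cases hee : e'.1 0 = e.1 0
  · rw [hee, HahnSeries.coeff_single_same]
    have := (hdiag (e.1 0)).symm.trans (hprod _ _)
    exact mul_left_cancel₀ ha (by rw [← this, mul_one])
  · rw [HahnSeries.coeff_single_of_ne]
    · have := (hprod _ _).symm.trans (hoff (e'.1 0) (e.1 0) hee)
      exact (mul_eq_zero.1 this).resolve_right ha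
    · intro h
      exact hee (by simpa using congrFun (congrArg Prod.fst h) 0)

theorem ser_x_eq_X {a : ℝ≥0} (ha : A.ser (fun p : Pt 1 0 => p.1 0) (isGerm_x 0) = X 0 a)
    (m n : ℕ) (i : Fin m) : A.ser (fun p : Pt m n => p.1 i) (isGerm_x i) = X i a := by
  obtain ⟨m, rfl⟩ : ∃ k, m = k + 1 := ⟨m - 1, by have := i.2; omega⟩
  have h0 := A.T_extend (m := 1) (n := 0) (m' := m + 1) (n' := n) (by omega) (by omega)
    (fun p => p.1 0) (isGerm_x 0) (isGerm_x 0)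
  change A.ser (fun p : Pt (m + 1) n => p.1 0) (isGerm_x 0) = rename _ _ (A.ser _ _) at h0
  have h1 := A.T_permute (Equiv.swap 0 i) (fun p : Pt (m + 1) n => p.1 0) (isGerm_x 0) (by
    simpa using isGerm_x i)
  have h1' : A.ser (fun p : Pt (m + 1) n => p.1 i) (isGerm_x i) =
      rename (Equiv.swap 0 i).toEmbedding (Function.Embedding.refl _)
        (A.ser (fun p : Pt (m + 1) n => p.1 0) (isGerm_x 0)) := by
    rw [← h1]; congr 1
  rw [h1', h0, ha]
  unfold X
  rw [rename_single, rename_single, expoEmb_single_x, expoEmb_single_x]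
  congr 3

/-- The exponent of the series of a coordinate `x` is one, and the series of `y` is `Y`: the chart
`x_2 = x_1' (λ + y')` shows that `λ + 𝒯(y)` is the binomial series of `(λ + Y) ^ a` for all `λ > 0`,
and the constant terms for `λ = 1, 2` give `a = 1`. -/
theorem ser_x_one : A.ser (fun p : Pt 1 0 => p.1 0) (isGerm_x 0) = X 0 1 ∧
    A.ser (fun p : Pt 1 1 => p.2 0) (isGerm_y 0) = Y 0 := by
  obtain ⟨a, ha⟩ := ser_x_exists (A := A)
  have hx2 := ser_x_eq_X ha 2 0 1
  have hx11 := ser_x_eq_X ha 1 1 0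
  have key : ∀ lam : ℝ, 0 < lam → (binomialSeries lam a 0 : GenSeries 1 1) =
      HahnSeries.C lam + A.ser (fun p : Pt 1 1 => p.2 0) (isGerm_y 0) := by
    intro lam hlam
    obtain ⟨h, hc⟩ := A.blowUp (BlowUpChart.xx (m := 1) (n := 0) 1 0 (by decide) lam hlam) _
      (isGerm_x 1)
    have h2 : A.ser _ h = X 0 a *
        (HahnSeries.C lam + A.ser (fun p : Pt 1 1 => p.2 0) (isGerm_y 0)) := by
      rw [← hx11, ← ser_const, ← ser_add, ← ser_mul]
      congr 1
    rw [hx2, h2] at hc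
    have h3 := hc.of_single
    rw [xx_monomial] at h3
    have e : ((Pi.single 0 ((Pi.single 1 a : Fin 2 → ℝ≥0) 1) +
        fun k => (Pi.single 1 a : Fin 2 → ℝ≥0) ((1 : Fin 2).succAbove k),
        Fin.cons 0 0) : Expo 1 1) = (Pi.single 0 a, 0) := by
      refine Prod.ext (funext fun k => ?_) (funext fun k => ?_)
      · rw [Subsingleton.elim k 0]; simp
      · rw [Subsingleton.elim k 0]; simp
    simp only at h3
    rw [e, Pi.single_eq_same] at h3
    ext e'
    have h4 := congrArg (fun S => S.coeff (e' + (Pi.single 0 a, 0))) h3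
    unfold X at h4
    simp only [HahnSeries.coeff_single_mul_add, one_mul] at h4
    exact h4.symm
  have ha1 : a = 1 := by
    have h1 := congrArg (fun S => S.coeff (0, Pi.single 0 0)) (key 1 one_pos)
    have h2 := congrArg (fun S => S.coeff (0, Pi.single 0 0)) (key 2 two_pos)
    simp only [binomialSeries_coeff, HahnSeries.coeff_add] at h1 h2
    have h0 : ((0, Pi.single 0 0) : Expo 1 1) = 0 := by simp
    rw [h0, HahnSeries.C_apply, HahnSeries.coeff_single_same] at h1 h2
    simp at h1 h2
    rw [h1, add_zero] at h2
    have := (Real.rpow_right_inj (x := 2) (by norm_num) (by norm_num) (y := a) (z := 1)).1 (by simpa using h2)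
    exact_mod_cast this
  subst ha1
  refine ⟨ha, ?_⟩
  have h1 := (eq_sub_of_add_eq' (key 1 one_pos).symm)
  rw [h1]
  ext e
  rw [HahnSeries.coeff_sub, HahnSeries.C_apply]
  unfold Y
  by_cases h : e.1 = 0 ∧ e.2 = Pi.single 0 (e.2 0)
  · have he : e = (0, Pi.single 0 (e.2 0)) := Prod.ext h.1 h.2
    rw [he, binomialSeries_coeff]
    set k := e.2 0
    have hs : ∀ j l : ℕ, ((0, Pi.single 0 j) : Expo 1 1) = (0, Pi.single 0 l) ↔ j = l := by
      intro j l
      constructor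
      · intro h; simpa using congrFun (congrArg Prod.snd h) 0
      · rintro rfl; rfl
    have h0 : (0 : Expo 1 1) = (0, Pi.single 0 0) := Prod.ext rfl (by simp)
    rw [h0, HahnSeries.coeff_single, HahnSeries.coeff_single]
    simp only [hs]
    rcases k with _ | _ | k
    · simp
    · simp
    · have : Ring.choose ((1 : ℝ≥0) : ℝ) (k + 2) = 0 := by
        have h3 : (((1 : ℝ≥0) : ℝ)) = ((1 : ℕ) : ℝ) := by norm_num
        rw [h3, Ring.choose_natCast, Nat.choose_eq_zero_of_lt (by omega)]; simp
      rw [this]; simp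
  · rw [binomialSeries_coeff_eq_zero _ _ h, HahnSeries.coeff_single_of_ne,
      HahnSeries.coeff_single_of_ne, sub_zero]
    · rintro rfl; apply h; simp
    · rintro rfl; apply h; simp

theorem ser_x (m n : ℕ) (i : Fin m) : A.ser (fun p : Pt m n => p.1 i) (isGerm_x i) = X i 1 :=
  ser_x_eq_X ser_x_one.1 m n i

theorem ser_y : ∀ (k m n : ℕ) (hk : k < n),
    A.ser (fun p : Pt m n => p.2 ⟨k, hk⟩) (isGerm_y _) = Y ⟨k, hk⟩ := by
  have red : ∀ (k n : ℕ) (hk : k < n),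
      A.ser (fun p : Pt 1 n => p.2 ⟨k, hk⟩) (isGerm_y _) = Y ⟨k, hk⟩ →
      ∀ m, A.ser (fun p : Pt m n => p.2 ⟨k, hk⟩) (isGerm_y _) = Y ⟨k, hk⟩ := by
    intro k n hk h m
    have up : ∀ {m m' : ℕ} (hm : m ≤ m'),
        A.ser (fun p : Pt m' n => p.2 ⟨k, hk⟩) (isGerm_y _) =
          rename (Fin.castLEEmb hm) (Fin.castLEEmb le_rfl)
            (A.ser (fun p : Pt m n => p.2 ⟨k, hk⟩) (isGerm_y _)) := fun hm =>
      A.T_extend hm le_rfl (fun p => p.2 ⟨k, hk⟩) (isGerm_y _) (isGerm_y _)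
    have upY : ∀ {m m' : ℕ} (hm : m ≤ m'), (Y ⟨k, hk⟩ : GenSeries m' n) =
        rename (Fin.castLEEmb hm) (Fin.castLEEmb le_rfl) (Y ⟨k, hk⟩ : GenSeries m n) := by
      intro m m' hm
      unfold Y
      rw [rename_single, expoEmb_single_y]
      rfl
    rcases Nat.eq_zero_or_pos m with rfl | hm
    · apply rename_injective (Fin.castLEEmb (Nat.zero_le 1)) (Fin.castLEEmb le_rfl)
      rw [← up, ← upY, h]
    · rw [up hm, h, ← upY]
  intro k
  induction k with
  | zero =>
    intro m n hk
    refine red 0 n hk ?_ m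
    have h0 := A.T_extend (m := 1) (n := 1) (m' := 1) (n' := n) le_rfl hk
      (fun p => p.2 0) (isGerm_y 0) (isGerm_y _)
    change A.ser (fun p : Pt 1 n => p.2 ⟨0, hk⟩) (isGerm_y _) = rename _ _ (A.ser _ _) at h0
    rw [h0, ser_x_one.2]
    unfold Y
    rw [rename_single, expoEmb_single_y]
    rfl
  | succ k ih =>
    intro m n hk
    refine red (k + 1) n hk ?_ m
    obtain ⟨n, rfl⟩ : ∃ l, n = l + 1 := ⟨n - 1, by omega⟩
    -- the charts with `λ > 0` turn `y_k` into `y_{k+1}`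
    obtain ⟨h, hc⟩ := A.blowUp (BlowUpChart.xx (m := 1) (n := n) 1 0 (by decide) 1 one_pos) _
      (isGerm_y ⟨k, by omega⟩)
    rw [ih 2 n (by omega)] at hc
    have h3 := hc.of_single
    rw [xx_monomial] at h3
    have e1 : (0 : Fin 2 → ℝ≥0) 1 = 0 := rfl
    simp only [e1, binomialSeries_zero, mul_one] at h3
    refine h3.trans ?_
    unfold Y
    congr 2
    refine Prod.ext (funext fun q => by simp) (funext fun q => ?_)
    refine Fin.cases ?_ (fun q => ?_) q
    · have hne : (0 : Fin (n + 1)) ≠ ⟨k + 1, hk⟩ := by simp [Fin.ext_iff]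
      exact (Pi.single_eq_of_ne (M := fun _ => ℕ) hne 1).symm
    · simp [Pi.single_apply, Fin.ext_iff]

end Coordinates

/-! ### Permutations of the variables of a series -/

section PermSeries

variable {A : QuasianalyticSystem} {m n : ℕ}

theorem ser_permX {f : Pt m n → ℝ} (hf : A.IsGerm f) (σ : Equiv.Perm (Fin m)) (w : Expo m n) :
    (A.ser _ (hf.permX σ)).coeff w = (A.ser f hf).coeff (w.1 ∘ σ, w.2) := by
  have h := A.T_permute σ f hf (hf.permX σ)
  rw [h]
  have e1 : w = expoEmb σ.toEmbedding (Function.Embedding.refl _) (w.1 ∘ σ, w.2) := by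
    refine Prod.ext (funext fun i => ?_) (funext fun j => ?_)
    · obtain ⟨k, rfl⟩ := σ.surjective i
      exact (σ.injective.extend_apply (w.1 ∘ σ) 0 k).symm
    · exact (Function.injective_id.extend_apply w.2 0 j).symm
  conv_lhs => rw [e1]
  exact rename_coeff _ _

/-- Permutations of the `y`-variables are an instance of substitution. -/
theorem exists_ser_permY {f : Pt m n → ℝ} (hf : A.IsGerm f) (τ : Equiv.Perm (Fin n)) :
    ∃ h : A.IsGerm (fun p : Pt m n => f (p.1, fun j => p.2 (τ j))),
      ∀ w, (A.ser _ h).coeff w = (A.ser f hf).coeff (w.1, w.2 ∘ τ) := by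
  obtain ⟨h, hc⟩ := A.compose (m' := 0) (n' := n) f hf (fun j p => p.2 (τ j))
    (fun j => isGerm_y _) (fun j => rfl)
  refine ⟨h, fun w => ?_⟩
  have hm : ∀ e : Expo m n, FormalMap.monomial (n' := n)
      { xPow := fun i => X (Fin.castAdd 0 i)
        ySub := fun j => rename (Fin.natAddEmb m) (Function.Embedding.refl _)
              (A.ser (fun p : Pt 0 n => p.2 (τ j)) (isGerm_y _)) } e =
      HahnSeries.single ((e.1, e.2 ∘ τ.symm) : Expo m n) 1 := by
    intro e
    have hy : ∀ j, A.ser (fun p : Pt 0 n => p.2 (τ j)) (isGerm_y _) = Y (τ j) :=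
      fun j => ser_y _ _ _ (τ j).2
    have h1 : ∀ j, rename (Fin.natAddEmb m) (Function.Embedding.refl _)
        (Y (τ j) : GenSeries 0 n) = (Y (τ j) : GenSeries (m + 0) n) := by
      intro j
      unfold Y
      rw [rename_single, expoEmb_single_y]
      rfl
    unfold FormalMap.monomial
    simp only [hy, h1]
    have h2 : ∏ j, (Y (τ j) : GenSeries (m + 0) n) ^ e.2 j =
        ∏ j, (Y j : GenSeries (m + 0) n) ^ (e.2 ∘ τ.symm) j := by
      have := Equiv.prod_comp τ fun j => (Y j : GenSeries (m + 0) n) ^ (e.2 ∘ τ.symm) j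
      simpa using this
    rw [h2, prod_Y]
    refine (congrArg (· * _) (prod_X (m := m) (n := n) e.1)).trans ?_
    rw [HahnSeries.single_mul_single]
    simp
  have hL : Function.Injective fun e : Expo m n => ((e.1, e.2 ∘ τ.symm) : Expo m n) := by
    intro a b hab
    simp only [Prod.mk.injEq] at hab
    refine Prod.ext hab.1 (funext fun j => ?_)
    simpa using congrFun hab.2 (τ j)
  have := ((FormalMap.isComp_iff_of_monomial (m' := m) hL hm).1 hc).1 (w.1, w.2 ∘ τ)
  refine Eq.trans ?_ this
  congr 1
  refine Prod.ext rfl (funext fun j => ?_)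
  simp

theorem exists_ser_perm {f : Pt m n → ℝ} (hf : A.IsGerm f) (σ : Equiv.Perm (Fin m))
    (τ : Equiv.Perm (Fin n)) :
    ∃ h : A.IsGerm (fun p : Pt m n => f (p.1 ∘ σ, p.2 ∘ τ)),
      ∀ w, (A.ser _ h).coeff w = (A.ser f hf).coeff (w.1 ∘ σ, w.2 ∘ τ) := by
  obtain ⟨h1, h2⟩ := exists_ser_permY hf τ
  exact ⟨h1.permX σ, fun w => (ser_permX h1 σ w).trans (h2 _)⟩

end PermSeries

/-! ### Germs in variables indexed by a finite type -/

section Frames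

variable {V : Type} [Fintype V] [DecidableEq V]

/-- The points whose coordinates in `D` are nonnegative: the variables in `D` are the `x`-variables. -/
def Qd (D : Finset V) : Set (V → ℝ) := {p | ∀ v ∈ D, 0 ≤ p v}

/-- The neighbourhoods of the origin among the points with nonnegative coordinates in `D`. -/
abbrev gz (D : Finset V) : Filter (V → ℝ) := 𝓝[Qd D] 0

/-- `e` numbers the variables in such a way that those in `D` are the `x`-variables. -/
def Fr {m n : ℕ} (e : Fin m ⊕ Fin n ≃ V) (D : Finset V) : Prop :=
  (∀ i, e (Sum.inl i) ∈ D) ∧ ∀ j, e (Sum.inr j) ∉ D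

/-- The point with the numbered coordinates `p`. -/
def pull {m n : ℕ} (e : Fin m ⊕ Fin n ≃ V) (p : Pt m n) : V → ℝ :=
  fun v => Sum.elim p.1 p.2 (e.symm v)

/-- The exponent with the numbered components `w`. -/
def ex {m n : ℕ} (e : Fin m ⊕ Fin n ≃ V) (w : Expo m n) : V → ℝ≥0 :=
  fun v => Sum.elim w.1 (fun j => (w.2 j : ℝ≥0)) (e.symm v)

variable {m n : ℕ} {e : Fin m ⊕ Fin n ≃ V} {D : Finset V}

@[simp] theorem pull_inl (p : Pt m n) (i : Fin m) : pull e p (e (Sum.inl i)) = p.1 i := by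
  simp [pull]

@[simp] theorem pull_inr (p : Pt m n) (j : Fin n) : pull e p (e (Sum.inr j)) = p.2 j := by
  simp [pull]

@[simp] theorem ex_inl (p : Expo m n) (i : Fin m) : ex e p (e (Sum.inl i)) = p.1 i := by
  simp [ex]

@[simp] theorem ex_inr (p : Expo m n) (j : Fin n) : ex e p (e (Sum.inr j)) = p.2 j := by
  simp [ex]

/-- A property of all variables holds if it holds for the numbered `x`- and `y`-variables. -/
theorem frame_forall (e : Fin m ⊕ Fin n ≃ V) {P : V → Prop} (h1 : ∀ i, P (e (Sum.inl i)))
    (h2 : ∀ j, P (e (Sum.inr j))) (v : V) : P v := by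
  obtain ⟨s, rfl⟩ := e.surjective v
  rcases s with i | j
  · exact h1 i
  · exact h2 j

theorem ex_injective (e : Fin m ⊕ Fin n ≃ V) : Function.Injective (ex e) := by
  intro a b h
  refine Prod.ext (funext fun i => ?_) (funext fun j => ?_)
  · simpa using congrFun h (e (Sum.inl i))
  · simpa using congrFun h (e (Sum.inr j))

theorem ex_add (e : Fin m ⊕ Fin n ≃ V) (a b : Expo m n) : ex e (a + b) = ex e a + ex e b := by
  funext v
  refine frame_forall e (P := fun v => ex e (a + b) v = (ex e a + ex e b) v) ?_ ?_ v <;> intro i <;>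
    simp

theorem ex_zero (e : Fin m ⊕ Fin n ≃ V) : ex e 0 = 0 := by
  funext v
  refine frame_forall e (P := fun v => ex e 0 v = 0) ?_ ?_ v <;> intro i <;> simp

theorem ex_le (e : Fin m ⊕ Fin n ≃ V) (a b : Expo m n) : ex e a ≤ ex e b ↔ a ≤ b := by
  constructor
  · intro h
    refine ⟨fun i => ?_, fun j => ?_⟩
    · simpa using h (e (Sum.inl i))
    · simpa using h (e (Sum.inr j))
  · intro h v
    refine frame_forall e (P := fun v => ex e a v ≤ ex e b v) ?_ ?_ v <;> intro i
    · simpa using h.1 i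
    · simpa using h.2 i

theorem pull_injective (e : Fin m ⊕ Fin n ≃ V) : Function.Injective (pull e) := by
  intro a b h
  refine Prod.ext (funext fun i => ?_) (funext fun j => ?_)
  · simpa using congrFun h (e (Sum.inl i))
  · simpa using congrFun h (e (Sum.inr j))

/-- The numbered coordinates of a point. -/
def push (e : Fin m ⊕ Fin n ≃ V) (p : V → ℝ) : Pt m n :=
  (fun i => p (e (Sum.inl i)), fun j => p (e (Sum.inr j)))

@[simp] theorem pull_push (e : Fin m ⊕ Fin n ≃ V) (p : V → ℝ) : pull e (push e p) = p := by
  funext v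
  refine frame_forall e (P := fun v => pull e (push e p) v = p v) ?_ ?_ v <;> intro i <;> simp [push]

@[simp] theorem push_pull (e : Fin m ⊕ Fin n ≃ V) (p : Pt m n) : push e (pull e p) = p :=
  pull_injective e (pull_push e _)

theorem pull_zero (e : Fin m ⊕ Fin n ≃ V) : pull e 0 = 0 := by
  funext v
  refine frame_forall e (P := fun v => pull e 0 v = 0) ?_ ?_ v <;> intro i <;> simp

theorem push_zero (e : Fin m ⊕ Fin n ≃ V) : push e 0 = 0 := rfl

theorem continuous_pull (e : Fin m ⊕ Fin n ≃ V) : Continuous (pull e) := by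
  refine continuous_pi fun v => ?_
  refine frame_forall e (P := fun v => Continuous fun p => pull e p v) ?_ ?_ v <;> intro i <;>
    simp only [pull_inl, pull_inr] <;> fun_prop

theorem continuous_push (e : Fin m ⊕ Fin n ≃ V) : Continuous (push e) := by
  unfold push; fun_prop

theorem Fr.pull_mem (he : Fr e D) {p : Pt m n} : pull e p ∈ Qd D ↔ p ∈ Quad m n := by
  constructor
  · intro h i
    simpa using h _ (he.1 i)
  · intro h v
    refine frame_forall e (P := fun v => v ∈ D → 0 ≤ pull e p v) ?_ ?_ v
    · intro i _; simpa using h i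
    · intro j hj; exact absurd hj (he.2 j)

theorem Fr.tendsto_pull (he : Fr e D) : Tendsto (pull e) (𝓝[Quad m n] 0) (gz D) := by
  refine tendsto_nhdsWithin_iff.2 ⟨?_, eventually_nhdsWithin_of_forall fun p hp => he.pull_mem.2 hp⟩
  have := (continuous_pull e).tendsto 0
  rw [pull_zero] at this
  exact this.mono_left nhdsWithin_le_nhds

theorem Fr.tendsto_push (he : Fr e D) : Tendsto (push e) (gz D) (𝓝[Quad m n] 0) := by
  refine tendsto_nhdsWithin_iff.2 ⟨?_, eventually_nhdsWithin_of_forall fun p hp => ?_⟩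
  · have := (continuous_push e).tendsto 0
    rw [push_zero] at this
    exact this.mono_left nhdsWithin_le_nhds
  · exact fun i => hp _ (he.1 i)

theorem Fr.eventually_iff (he : Fr e D) {P : (V → ℝ) → Prop} :
    (∀ᶠ p in gz D, P p) ↔ ∀ᶠ p in 𝓝[Quad m n] 0, P (pull e p) := by
  constructor
  · exact fun h => he.tendsto_pull.eventually h
  · intro h
    have := he.tendsto_push.eventually h
    simpa using this

theorem zero_mem_Qd (D : Finset V) : (0 : V → ℝ) ∈ Qd D := fun _ _ => le_rfl

theorem exists_inl_of_mem (he : Fr e D) {v : V} (hv : v ∈ D) :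
    ∃ i, e (Sum.inl i) = v := by
  revert hv
  refine frame_forall e (P := fun v => v ∈ D → ∃ i, e (Sum.inl i) = v) ?_ ?_ v
  · exact fun i _ => ⟨i, rfl⟩
  · exact fun j hj => absurd hj (he.2 j)

theorem exists_inr_of_notMem (he : Fr e D) {v : V} (hv : v ∉ D) :
    ∃ i, e (Sum.inr i) = v := by
  revert hv
  refine frame_forall e (P := fun v => v ∉ D → ∃ i, e (Sum.inr i) = v) ?_ ?_ v
  · exact fun i hi => absurd (he.1 i) hi
  · exact fun j _ => ⟨j, rfl⟩

/-- Two numberings of the same variables differ by permutations of the `x`- and of the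
`y`-variables. -/
theorem exists_perm_of_frames {m' n' : ℕ} {e' : Fin m' ⊕ Fin n' ≃ V} (he : Fr e D) (he' : Fr e' D) :
    ∃ (hm : m' = m) (hn : n' = n) (σ : Equiv.Perm (Fin m)) (τ : Equiv.Perm (Fin n)),
      (∀ i, e' (Sum.inl (Fin.cast hm.symm (σ i))) = e (Sum.inl i)) ∧
      ∀ j, e' (Sum.inr (Fin.cast hn.symm (τ j))) = e (Sum.inr j) := by
  choose a ha using fun i => exists_inl_of_mem he' (he.1 i)
  choose a' ha' using fun i => exists_inl_of_mem he (he'.1 i)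
  choose b hb using fun j => exists_inr_of_notMem he' (he.2 j)
  choose b' hb' using fun j => exists_inr_of_notMem he (he'.2 j)
  have aa : ∀ i, a' (a i) = i := fun i => by simpa using (ha' (a i)).trans (ha i)
  have aa' : ∀ i, a (a' i) = i := fun i => by simpa using (ha (a' i)).trans (ha' i)
  have bb : ∀ i, b' (b i) = i := fun i => by simpa using (hb' (b i)).trans (hb i)
  have bb' : ∀ i, b (b' i) = i := fun i => by simpa using (hb (b' i)).trans (hb' i)
  obtain rfl : m' = m := by
    simpa using (Fintype.card_congr (⟨a, a', aa, aa'⟩ : Fin m ≃ Fin m')).symm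
  obtain rfl : n' = n := by
    simpa using (Fintype.card_congr (⟨b, b', bb, bb'⟩ : Fin n ≃ Fin n')).symm
  exact ⟨rfl, rfl, ⟨a, a', aa, aa'⟩, ⟨b, b', bb, bb'⟩, fun i => ha i, fun j => hb j⟩

theorem exists_frame (D : Finset V) : ∃ (m n : ℕ) (e : Fin m ⊕ Fin n ≃ V), Fr e D := by
  classical
  have e1 : Fin (Fintype.card {v // v ∈ D}) ≃ {v // v ∈ D} := (Fintype.equivFin _).symm
  have e2 : Fin (Fintype.card {v // ¬ v ∈ D}) ≃ {v // ¬ v ∈ D} := (Fintype.equivFin _).symm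
  refine ⟨_, _, (Equiv.sumCongr e1 e2).trans (Equiv.sumCompl (· ∈ D)), fun i => ?_, fun j => ?_⟩
  · exact (e1 i).2
  · exact (e2 j).2

/-- There is a numbering in which a given `x`-variable has a given number. -/
theorem exists_frame_x {v : V} (hv : v ∈ D) :
    ∃ (m n : ℕ), ∀ k : Fin (m + 1), ∃ (e : Fin (m + 1) ⊕ Fin n ≃ V), Fr e D ∧ e (Sum.inl k) = v := by
  obtain ⟨m, n, e, he⟩ := exists_frame D
  obtain ⟨i, hi⟩ : ∃ i, e (Sum.inl i) = v := by
    revert hv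
    refine frame_forall e (P := fun v => v ∈ D → ∃ i, e (Sum.inl i) = v) ?_ ?_ v
    · exact fun i _ => ⟨i, rfl⟩
    · exact fun j hj => absurd hj (he.2 j)
  obtain ⟨m, rfl⟩ : ∃ l, m = l + 1 := ⟨m - 1, by have := i.2; omega⟩
  refine ⟨m, n, fun k => ⟨(Equiv.sumCongr (Equiv.swap k i) (Equiv.refl _)).trans e, ⟨fun l => ?_,
    fun l => ?_⟩, ?_⟩⟩
  · exact he.1 _
  · exact he.2 _
  · simp [hi]

/-- There is a numbering in which a given `y`-variable has a given number. -/
theorem exists_frame_y {v : V} (hv : v ∉ D) :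
    ∃ (m n : ℕ), ∀ k : Fin (n + 1), ∃ (e : Fin m ⊕ Fin (n + 1) ≃ V), Fr e D ∧ e (Sum.inr k) = v := by
  obtain ⟨m, n, e, he⟩ := exists_frame D
  obtain ⟨i, hi⟩ : ∃ i, e (Sum.inr i) = v := by
    revert hv
    refine frame_forall e (P := fun v => v ∉ D → ∃ i, e (Sum.inr i) = v) ?_ ?_ v
    · exact fun i hi => absurd (he.1 i) hi
    · exact fun j _ => ⟨j, rfl⟩
  obtain ⟨n, rfl⟩ : ∃ l, n = l + 1 := ⟨n - 1, by have := i.2; omega⟩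
  refine ⟨m, n, fun k => ⟨(Equiv.sumCongr (Equiv.refl _) (Equiv.swap k i)).trans e, ⟨fun l => ?_,
    fun l => ?_⟩, ?_⟩⟩
  · exact he.1 _
  · exact he.2 _
  · simp [hi]

end Frames

section Functions

variable {V : Type} [Fintype V] [DecidableEq V] (A : QuasianalyticSystem) (D : Finset V)

/-- `f` is a germ of the collection, the variables in `D` being the `x`-variables. -/
def IsG (f : (V → ℝ) → ℝ) : Prop :=
  ∃ (m n : ℕ) (e : Fin m ⊕ Fin n ≃ V), Fr e D ∧ A.IsGerm (fun p => f (pull e p))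

/-- `c` is the coefficient with exponent `w` of the series of `f`, in some numbering. -/
def CoVal (f : (V → ℝ) → ℝ) (w : V → ℝ≥0) (c : ℝ) : Prop :=
  ∃ (m n : ℕ) (e : Fin m ⊕ Fin n ≃ V) (h : A.IsGerm (fun p => f (pull e p))), Fr e D ∧
    ∃ u, ex e u = w ∧ (A.ser _ h).coeff u = c

open Classical in
/-- The coefficient with exponent `w` of the series of the germ `f`; it is zero if some component of
`w` that belongs to a `y`-variable is not a natural number. -/
def co (f : (V → ℝ) → ℝ) (w : V → ℝ≥0) : ℝ :=
  if h : ∃ c, CoVal A D f w c then h.choose else 0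

/-- The support of the series of a germ. -/
def Supp (f : (V → ℝ) → ℝ) : Set (V → ℝ≥0) := {w | co A D f w ≠ 0}

variable {A D} {f g : (V → ℝ) → ℝ}

theorem exists_ser_frame {m n m' n' : ℕ} {e : Fin m ⊕ Fin n ≃ V} {e' : Fin m' ⊕ Fin n' ≃ V}
    (he : Fr e D) (he' : Fr e' D) (h : A.IsGerm (fun p => f (pull e p))) :
    ∃ h' : A.IsGerm (fun p => f (pull e' p)), ∀ w w', ex e w = ex e' w' →
      (A.ser _ h').coeff w' = (A.ser _ h).coeff w := by
  obtain ⟨rfl, rfl, σ, τ, h1, h2⟩ := exists_perm_of_frames he he'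
  obtain ⟨h3, h4⟩ := exists_ser_perm h σ τ
  have e1 : ∀ p, pull e (p.1 ∘ σ, p.2 ∘ τ) = pull e' p := by
    intro p
    funext v
    refine frame_forall e (P := fun v => pull e (p.1 ∘ σ, p.2 ∘ τ) v = pull e' p v) ?_ ?_ v
    · intro i; rw [pull_inl, ← h1]; simp
    · intro j; rw [pull_inr, ← h2]; simp
  have e2 : (fun p => f (pull e (p.1 ∘ σ, p.2 ∘ τ))) = fun p => f (pull e' p) :=
    funext fun p => by rw [e1]
  have h3' : A.IsGerm (fun p => f (pull e' p)) := by rw [← e2]; exact h3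
  refine ⟨h3', fun w w' hw => ?_⟩
  have h5 : A.ser _ h3' = A.ser _ h3 := ser_congr (EventuallyEq.of_eq e2.symm) _ _
  rw [h5, h4]
  congr 1
  refine Prod.ext (funext fun i => ?_) (funext fun j => ?_)
  · have := congrFun hw (e (Sum.inl i))
    rw [ex_inl, ← h1] at this
    simpa using this.symm
  · have := congrFun hw (e (Sum.inr j))
    rw [ex_inr, ← h2] at this
    simpa using this.symm

theorem IsG.isGerm (hf : IsG A D f) {m n : ℕ} {e : Fin m ⊕ Fin n ≃ V} (he : Fr e D) :
    A.IsGerm (fun p => f (pull e p)) := by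
  obtain ⟨m', n', e', he', h⟩ := hf
  exact (exists_ser_frame he' he h).1

theorem exists_ex_eq {m n m' n' : ℕ} {e : Fin m ⊕ Fin n ≃ V} {e' : Fin m' ⊕ Fin n' ≃ V}
    (he : Fr e D) (he' : Fr e' D) (u : Expo m' n') : ∃ u', ex e u' = ex e' u := by
  obtain ⟨rfl, rfl, σ, τ, h1, h2⟩ := exists_perm_of_frames he he'
  refine ⟨(u.1 ∘ σ, u.2 ∘ τ), funext fun v => ?_⟩
  refine frame_forall e (P := fun v => ex e (u.1 ∘ σ, u.2 ∘ τ) v = ex e' u v) ?_ ?_ v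
  · intro i; rw [ex_inl, ← h1]; simp
  · intro j; rw [ex_inr, ← h2]; simp

theorem co_ex {m n : ℕ} {e : Fin m ⊕ Fin n ≃ V} (he : Fr e D)
    (h : A.IsGerm (fun p => f (pull e p))) (u : Expo m n) :
    co A D f (ex e u) = (A.ser _ h).coeff u := by
  have hex : ∃ c, CoVal A D f (ex e u) c := ⟨_, m, n, e, h, he, u, rfl, rfl⟩
  rw [co, dif_pos hex]
  obtain ⟨m', n', e', h', he', u', hu', hc⟩ := hex.choose_spec
  rw [← hc]
  exact (exists_ser_frame he he' h).2 _ _ hu'.symm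

theorem co_of_notMem {m n : ℕ} {e : Fin m ⊕ Fin n ≃ V} (he : Fr e D) {w : V → ℝ≥0}
    (hw : w ∉ Set.range (ex e)) : co A D f w = 0 := by
  rw [co, dif_neg]
  rintro ⟨c, m', n', e', h', he', u', rfl, hc⟩
  obtain ⟨u, hu⟩ := exists_ex_eq he he' u'
  exact hw ⟨u, hu⟩

theorem Supp_eq {m n : ℕ} {e : Fin m ⊕ Fin n ≃ V} (he : Fr e D)
    (h : A.IsGerm (fun p => f (pull e p))) : Supp A D f = ex e '' (A.ser _ h).support := by
  ext w
  constructor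
  · intro hw
    obtain ⟨u, rfl⟩ : w ∈ Set.range (ex e) := by
      by_contra h'
      exact hw (co_of_notMem he h')
    refine ⟨u, ?_, rfl⟩
    have : co A D f (ex e u) ≠ 0 := hw
    rwa [co_ex he h] at this
  · rintro ⟨u, hu, rfl⟩
    change co A D f (ex e u) ≠ 0
    rwa [co_ex he h]

theorem IsG.congr (hf : IsG A D f) (h : f =ᶠ[gz D] g) : IsG A D g := by
  obtain ⟨m, n, e, he, h1⟩ := hf
  exact ⟨m, n, e, he, isGerm_congr (he.tendsto_pull.eventually h) h1⟩

theorem co_congr (h : f =ᶠ[gz D] g) : co A D f = co A D g := by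
  have key : ∀ {f g : (V → ℝ) → ℝ}, f =ᶠ[gz D] g → ∀ w c, CoVal A D f w c → CoVal A D g w c := by
    rintro f g h w c ⟨m, n, e, h1, he, u, hu, hc⟩
    have h2 : (fun p => f (pull e p)) =ᶠ[𝓝[Quad m n] 0] fun p => g (pull e p) :=
      he.tendsto_pull.eventually h
    have h3 := isGerm_congr h2 h1
    refine ⟨m, n, e, h3, he, u, hu, ?_⟩
    rw [← ser_congr h2 h1 h3]
    exact hc
  funext w
  have : CoVal A D f w = CoVal A D g w :=
    funext fun c => propext ⟨key h w c, key h.symm w c⟩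
  have aux : ∀ P Q : ℝ → Prop, P = Q →
      (open Classical in if h : ∃ c, P c then h.choose else 0) =
        (open Classical in if h : ∃ c, Q c then h.choose else 0) := by
    rintro P _ rfl
    rfl
  exact aux _ _ this

theorem Supp_congr (h : f =ᶠ[gz D] g) : Supp A D f = Supp A D g := by
  unfold Supp
  rw [co_congr h]

theorem isG_const (c : ℝ) : IsG A D (fun _ => c) := by
  obtain ⟨m, n, e, he⟩ := exists_frame D
  exact ⟨m, n, e, he, isGerm_const _ _ c⟩

theorem isG_coord (v : V) : IsG A D (fun p => p v) := by
  obtain ⟨m, n, e, he⟩ := exists_frame D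
  refine ⟨m, n, e, he, ?_⟩
  refine frame_forall e (P := fun v => A.IsGerm (fun p => pull e p v)) ?_ ?_ v
  · intro i; simpa using isGerm_x i
  · intro j; simpa using isGerm_y j

theorem IsG.add (hf : IsG A D f) (hg : IsG A D g) : IsG A D (fun p => f p + g p) := by
  obtain ⟨m, n, e, he, h⟩ := hf
  exact ⟨m, n, e, he, h.add (hg.isGerm he)⟩

theorem IsG.mul (hf : IsG A D f) (hg : IsG A D g) : IsG A D (fun p => f p * g p) := by
  obtain ⟨m, n, e, he, h⟩ := hf
  exact ⟨m, n, e, he, h.mul (hg.isGerm he)⟩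

theorem IsG.neg (hf : IsG A D f) : IsG A D (fun p => - f p) := by
  obtain ⟨m, n, e, he, h⟩ := hf
  exact ⟨m, n, e, he, h.neg⟩

theorem IsG.sub (hf : IsG A D f) (hg : IsG A D g) : IsG A D (fun p => f p - g p) := by
  obtain ⟨m, n, e, he, h⟩ := hf
  exact ⟨m, n, e, he, h.sub (hg.isGerm he)⟩

theorem IsG.pow (hf : IsG A D f) (k : ℕ) : IsG A D (fun p => f p ^ k) := by
  obtain ⟨m, n, e, he, h⟩ := hf
  exact ⟨m, n, e, he, h.pow k⟩

theorem IsG.sum {ι : Type*} (s : Finset ι) {f : ι → (V → ℝ) → ℝ} (hf : ∀ i ∈ s, IsG A D (f i)) :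
    IsG A D (fun p => ∑ i ∈ s, f i p) := by
  classical
  induction s using Finset.induction_on with
  | empty => simpa using isG_const 0
  | insert a s ha ih =>
    simp only [Finset.sum_insert ha]
    exact (hf _ (Finset.mem_insert_self _ _)).add (ih fun i hi => hf i (Finset.mem_insert_of_mem hi))

theorem IsG.prod {ι : Type*} (s : Finset ι) {f : ι → (V → ℝ) → ℝ} (hf : ∀ i ∈ s, IsG A D (f i)) :
    IsG A D (fun p => ∏ i ∈ s, f i p) := by
  classical
  induction s using Finset.induction_on with
  | empty => simpa using isG_const 1
  | insert a s ha ih =>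
    simp only [Finset.prod_insert ha]
    exact (hf _ (Finset.mem_insert_self _ _)).mul (ih fun i hi => hf i (Finset.mem_insert_of_mem hi))

theorem IsG.tendsto (hf : IsG A D f) : Tendsto f (gz D) (𝓝 (f 0)) := by
  obtain ⟨m, n, e, he, h⟩ := hf
  have h1 := h.continuousWithinAt.comp he.tendsto_push
  simpa [Function.comp_def, pull_zero] using h1

theorem eq_zero_of_eventuallyEq (h : f =ᶠ[gz D] g) : f 0 = g 0 :=
  h.self_of_nhdsWithin (zero_mem_Qd D)

theorem IsG.Supp_eq_empty_iff (hf : IsG A D f) : Supp A D f = ∅ ↔ f =ᶠ[gz D] 0 := by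
  obtain ⟨m, n, e, he, h⟩ := hf
  have h0 := isGerm_const (A := A) m n 0
  rw [Supp_eq he h, Set.image_eq_empty, HahnSeries.support_eq_empty_iff]
  constructor
  · intro h1
    have : A.ser _ h = A.ser _ h0 := by rw [h1, ser_const, map_zero]
    exact he.eventually_iff.2 (eventuallyEq_of_ser_eq h h0 this)
  · intro h1
    have h2 := he.eventually_iff.1 h1
    rw [ser_congr (g := fun _ => 0) h2 h h0, ser_const, map_zero]

theorem IsG.Supp_nonempty_iff (hf : IsG A D f) : (Supp A D f).Nonempty ↔ ¬ f =ᶠ[gz D] 0 := by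
  rw [← hf.Supp_eq_empty_iff, ← ne_eq, ← Set.nonempty_iff_ne_empty]

/-! ### Coefficients of germs -/

theorem IsG.eventuallyEq_of_co (hf : IsG A D f) (hg : IsG A D g) (h : co A D f = co A D g) :
    f =ᶠ[gz D] g := by
  obtain ⟨m, n, e, he, h1⟩ := hf
  have h2 := hg.isGerm he
  refine he.eventually_iff.2 (eventuallyEq_of_ser_eq h1 h2 ?_)
  ext u
  rw [← co_ex he, ← co_ex he, h]

theorem co_add (hf : IsG A D f) (hg : IsG A D g) (w : V → ℝ≥0) :
    co A D (fun p => f p + g p) w = co A D f w + co A D g w := by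
  obtain ⟨m, n, e, he, h1⟩ := hf
  have h2 := hg.isGerm he
  by_cases hw : w ∈ Set.range (ex e)
  · obtain ⟨u, rfl⟩ := hw
    rw [co_ex he h1, co_ex he h2, co_ex he (h1.add h2), ser_add]
    rfl
  · simp [co_of_notMem he hw]

theorem co_const (c : ℝ) (w : V → ℝ≥0) :
    co A D (fun _ => c) w = if w = 0 then c else 0 := by
  obtain ⟨m, n, e, he⟩ := exists_frame D
  by_cases hw : w ∈ Set.range (ex e)
  · obtain ⟨u, rfl⟩ := hw
    rw [co_ex he (isGerm_const _ _ c), ser_const, HahnSeries.C_apply, HahnSeries.coeff_single]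
    congr 1
    exact propext ⟨fun h => by rw [h, ex_zero], fun h => ex_injective e (by rw [h, ex_zero])⟩
  · rw [co_of_notMem he hw, if_neg]
    rintro rfl
    exact hw ⟨0, ex_zero e⟩

theorem co_sub (hf : IsG A D f) (hg : IsG A D g) (w : V → ℝ≥0) :
    co A D (fun p => f p - g p) w = co A D f w - co A D g w := by
  have h := co_add (hf.sub hg) hg w
  simp only [sub_add_cancel] at h
  linarith

theorem Supp_mul_subset (hf : IsG A D f) (hg : IsG A D g) {w : V → ℝ≥0}
    (hw : w ∈ Supp A D fun p => f p * g p) : ∃ a ∈ Supp A D f, ∃ b ∈ Supp A D g, a + b = w := by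
  obtain ⟨m, n, e, he, h1⟩ := hf
  have h2 := hg.isGerm he
  rw [Supp_eq he (h1.mul h2), ser_mul h1 h2] at hw
  obtain ⟨u, hu, rfl⟩ := hw
  obtain ⟨a, ha, b, hb, rfl⟩ := HahnSeries.support_mul_subset hu
  refine ⟨ex e a, ?_, ex e b, ?_, (ex_add _ _ _).symm⟩
  · rw [Supp_eq he h1]; exact ⟨a, ha, rfl⟩
  · rw [Supp_eq he h2]; exact ⟨b, hb, rfl⟩

/-! Setting variables equal to zero -/

theorem co_setZero_x {m n : ℕ} {f : Pt (m + 1) n → ℝ} (hf : A.IsGerm f) :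
    ∃ h : A.IsGerm (fun p : Pt (m + 1) n => f (Function.update p.1 (Fin.last m) 0, p.2)),
      ∀ u, (A.ser _ h).coeff u = if u.1 (Fin.last m) = 0 then (A.ser f hf).coeff u else 0 := by
  have h1 := hf.setZero
  have h2 := h1.addVar
  have e1 : (fun p : Pt (m + 1) n => f (Fin.snoc (α := fun _ => ℝ) (Fin.init p.1) 0, p.2)) =
      fun p => f (Function.update p.1 (Fin.last m) 0, p.2) := by
    funext p
    congr 2
    funext i
    refine Fin.lastCases ?_ (fun i => ?_) i
    · simp
    · simp [Fin.init]
  have h3 : A.IsGerm (fun p : Pt (m + 1) n => f (Function.update p.1 (Fin.last m) 0, p.2)) :=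
    e1 ▸ h2
  refine ⟨h3, fun u => ?_⟩
  have h4 := A.T_extend (Nat.le_succ m) (le_refl n) _ h1 h2
  change A.ser _ h2 = rename _ _ (A.ser _ h1) at h4
  rw [ser_congr (EventuallyEq.of_eq e1.symm) h3 h2, h4]
  have h5 := A.T_setZero f hf h1
  split_ifs with hu
  · have e2 : u = expoEmb (Fin.castLEEmb (Nat.le_succ m)) (Fin.castLEEmb (le_refl n))
        (Fin.init u.1, u.2) := by
      refine Prod.ext (funext fun i => ?_) (funext fun j => ?_)
      · refine Fin.lastCases ?_ (fun i => ?_) i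
        · rw [hu]
          refine (Function.extend_apply' (f := Fin.castLEEmb (Nat.le_succ m)) (Fin.init u.1) 0 _ ?_).symm
          rintro ⟨k, hk⟩
          have := congrArg Fin.val hk
          simp at this
          have := k.2
          omega
        · exact ((Fin.castLEEmb (Nat.le_succ m)).injective.extend_apply (Fin.init u.1) 0 i).symm
      · exact ((Fin.castLEEmb (le_refl n)).injective.extend_apply u.2 0 j).symm
    conv_lhs => rw [e2]
    rw [rename_coeff, h5]
    congr 1
    refine Prod.ext ?_ rfl
    simp only
    rw [← hu, Fin.snoc_init_self]
  · refine rename_coeff_of_notMem _ _ ?_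
    rintro ⟨k, rfl⟩
    apply hu
    refine Function.extend_apply' _ _ _ ?_
    rintro ⟨k, hk⟩
    have := congrArg Fin.val hk
    simp at this
    have := k.2
    omega

theorem co_setZero_y {m n : ℕ} {f : Pt m n → ℝ} (hf : A.IsGerm f) (k : Fin n) :
    ∃ h : A.IsGerm (fun p : Pt m n => f (p.1, Function.update p.2 k 0)),
      ∀ u, (A.ser _ h).coeff u = if u.2 k = 0 then (A.ser f hf).coeff u else 0 := by
  have hg : ∀ j, A.IsGerm (fun p : Pt 0 n => Function.update p.2 k 0 j) := by
    intro j
    by_cases hj : j = k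
    · subst hj; simpa using isGerm_const 0 n 0
    · simpa [Function.update_of_ne hj] using isGerm_y j
  obtain ⟨h, hc⟩ := A.compose (m' := 0) (n' := n) f hf (fun j p => Function.update p.2 k 0 j) hg
    (fun j => by by_cases hj : j = k <;> simp [Function.update_apply])
  refine ⟨h, fun w => ?_⟩
  have hy : ∀ j, rename (Fin.natAddEmb m) (Function.Embedding.refl _) (A.ser _ (hg j)) =
      if j = k then 0 else (Y j : GenSeries (m + 0) n) := by
    intro j
    by_cases hj : j = k
    · rw [if_pos hj]
      have : A.ser _ (hg j) = 0 := by
        rw [ser_congr (g := fun _ => 0) _ (hg j) (isGerm_const _ _ 0), ser_const, map_zero]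
        exact Eventually.of_forall fun p => by simp [hj]
      rw [this]
      exact HahnSeries.embDomain_zero
    · rw [if_neg hj]
      have : A.ser _ (hg j) = Y j := by
        rw [ser_congr (g := fun p => p.2 j) _ (hg j) (isGerm_y j)]
        · exact ser_y _ _ _ j.2
        · exact Eventually.of_forall fun p => by simp [hj]
      rw [this]
      unfold Y
      rw [rename_single, expoEmb_single_y]
      rfl
  have hm : ∀ e : Expo m n, FormalMap.monomial (n' := n)
      { xPow := fun i => X (Fin.castAdd 0 i)
        ySub := fun j => rename (Fin.natAddEmb m) (Function.Embedding.refl _) (A.ser _ (hg j)) } e =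
      if e.2 k = 0 then HahnSeries.single (e : Expo m n) 1 else 0 := by
    intro e
    unfold FormalMap.monomial
    simp only [hy]
    split_ifs with h0
    · have h2 : ∏ j, (if j = k then 0 else (Y j : GenSeries (m + 0) n)) ^ e.2 j =
          ∏ j, (Y j : GenSeries (m + 0) n) ^ e.2 j := by
        refine Finset.prod_congr rfl fun j _ => ?_
        by_cases hj : j = k
        · subst hj; simp [h0]
        · simp [hj]
      rw [h2, prod_Y]
      refine (congrArg (· * _) (prod_X (m := m) (n := n) e.1)).trans ?_
      rw [HahnSeries.single_mul_single]
      simp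
    · refine mul_eq_zero_of_right _ (Finset.prod_eq_zero (Finset.mem_univ k) ?_)
      simp [h0]
  refine ((hc w).2).trans ?_
  rw [finsum_eq_single _ (w : Expo m n)]
  · rw [hm]
    split_ifs
    · exact (congrArg (_ * ·) (HahnSeries.coeff_single_same w (1 : ℝ))).trans (mul_one _)
    · simp
  · intro x hx
    rw [hm]
    split_ifs
    · exact (congrArg (_ * ·) (HahnSeries.coeff_single_of_ne hx.symm)).trans (mul_zero _)
    · simp

theorem pull_update_inl {m n : ℕ} (e : Fin m ⊕ Fin n ≃ V) (p : Pt m n) (i : Fin m) (a : ℝ) :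
    pull e (Function.update p.1 i a, p.2) = Function.update (pull e p) (e (Sum.inl i)) a := by
  funext v
  refine frame_forall e (P := fun v => pull e (Function.update p.1 i a, p.2) v =
    Function.update (pull e p) (e (Sum.inl i)) a v) ?_ ?_ v <;> intro k <;>
    simp [Function.update_apply]

theorem pull_update_inr {m n : ℕ} (e : Fin m ⊕ Fin n ≃ V) (p : Pt m n) (i : Fin n) (a : ℝ) :
    pull e (p.1, Function.update p.2 i a) = Function.update (pull e p) (e (Sum.inr i)) a := by
  funext v
  refine frame_forall e (P := fun v => pull e (p.1, Function.update p.2 i a) v =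
    Function.update (pull e p) (e (Sum.inr i)) a v) ?_ ?_ v <;> intro k <;>
    simp [Function.update_apply]

theorem IsG.setZero_co (hf : IsG A D f) (v : V) :
    IsG A D (fun p => f (Function.update p v 0)) ∧
      ∀ w, co A D (fun p => f (Function.update p v 0)) w = if w v = 0 then co A D f w else 0 := by
  by_cases hv : v ∈ D
  · obtain ⟨m, n, h⟩ := exists_frame_x hv
    obtain ⟨e, he, rfl⟩ := h (Fin.last m)
    have h1 := hf.isGerm he
    obtain ⟨h2, h3⟩ := co_setZero_x h1
    simp only [pull_update_inl] at h2 h3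
    refine ⟨⟨_, _, e, he, h2⟩, fun w => ?_⟩
    by_cases hw : w ∈ Set.range (ex e)
    · obtain ⟨u, rfl⟩ := hw
      rw [co_ex he h1, co_ex he h2, h3, ex_inl]
    · simp [co_of_notMem he hw]
  · obtain ⟨m, n, h⟩ := exists_frame_y hv
    obtain ⟨e, he, rfl⟩ := h 0
    have h1 := hf.isGerm he
    obtain ⟨h2, h3⟩ := co_setZero_y h1 0
    simp only [pull_update_inr] at h2 h3
    refine ⟨⟨_, _, e, he, h2⟩, fun w => ?_⟩
    by_cases hw : w ∈ Set.range (ex e)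
    · obtain ⟨u, rfl⟩ := hw
      rw [co_ex he h1, co_ex he h2, h3, ex_inr]
      simp
    · simp [co_of_notMem he hw]

/-- The point with the coordinates in `S` replaced by zero. -/
def zr (S : Finset V) (p : V → ℝ) : V → ℝ := fun v => if v ∈ S then 0 else p v

theorem zr_empty (p : V → ℝ) : zr ∅ p = p := by
  funext v
  simp [zr]

theorem IsG.zr_co (hf : IsG A D f) (S : Finset V) :
    IsG A D (fun p => f (zr S p)) ∧
      ∀ w, co A D (fun p => f (zr S p)) w = open Classical in
        if ∀ v ∈ S, w v = 0 then co A D f w else 0 := by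
  classical
  induction S using Finset.induction_on generalizing f with
  | empty => exact ⟨by simpa [zr_empty] using hf, by simp [zr_empty]⟩
  | insert v S hv ih =>
    obtain ⟨h1, h2⟩ := hf.setZero_co v
    obtain ⟨h3, h4⟩ := ih h1
    have e1 : (fun p => f (zr (insert v S) p)) = fun p => f (Function.update (zr S p) v 0) := by
      funext p
      congr 1
      funext q
      by_cases hq : q = v
      · subst hq; simp [zr]
      · simp [zr, hq]
    rw [e1]
    refine ⟨h3, fun w => ?_⟩
    rw [h4, h2]
    simp only [Finset.mem_insert, forall_eq_or_imp]
    split_ifs <;> simp_all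

theorem IsG.zr (hf : IsG A D f) (S : Finset V) : IsG A D (fun p => f (zr S p)) := (hf.zr_co S).1

theorem IsG.mem_Supp_zr (hf : IsG A D f) (S : Finset V) {w : V → ℝ≥0} :
    w ∈ Supp A D (fun p => f (Quasi.zr S p)) ↔ w ∈ Supp A D f ∧ ∀ v ∈ S, w v = 0 := by
  classical
  change co A D _ w ≠ 0 ↔ co A D f w ≠ 0 ∧ _
  rw [(hf.zr_co S).2]
  split_ifs with h
  · exact ⟨fun h' => ⟨h', h⟩, fun h' => h'.1⟩
  · simp [h]

theorem co_zero (hf : IsG A D f) : co A D f 0 = f 0 := by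
  have h := (hf.zr_co Finset.univ).2 0
  have e1 : (fun p => f (Quasi.zr Finset.univ p)) = fun _ => f 0 := by
    funext p
    congr 1
    funext v
    simp [zr]
  rw [e1, co_const] at h
  simpa using h.symm

/-! Exponents -/

variable (A) in
/-- The exponents that occur: natural numbers, and, unless the semiring of the exponents is `ℕ`, the
nonnegative elements of the field generated by the exponents. -/
def ExpOk (a : ℝ≥0) : Prop :=
  (∃ n : ℕ, a = n) ∨ ((A.expSemiring : Set ℝ) ≠ Set.range ((↑) : ℕ → ℝ) ∧ (a : ℝ) ∈ A.expField)

variable (A D) in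
/-- The exponents of the monomials that are germs. -/
def MonoOk (w : V → ℝ≥0) : Prop := (∀ v ∈ D, ExpOk A (w v)) ∧ ∀ v ∉ D, ∃ n : ℕ, w v = n

theorem expOk_nat (n : ℕ) : ExpOk A (n : ℝ≥0) := Or.inl ⟨n, rfl⟩

theorem expOk_zero : ExpOk A 0 := by simpa using expOk_nat (A := A) 0

theorem ExpOk.mem_field {a : ℝ≥0} (h : ExpOk A a) : (a : ℝ) ∈ A.expField := by
  rcases h with ⟨n, rfl⟩ | h
  · simp
  · exact h.2

theorem ExpOk.of_mem_semiring {a : ℝ≥0} (h : (a : ℝ) ∈ A.expSemiring) : ExpOk A a := by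
  by_cases h1 : (A.expSemiring : Set ℝ) = Set.range ((↑) : ℕ → ℝ)
  · have h2 : (a : ℝ) ∈ (A.expSemiring : Set ℝ) := h
    rw [h1] at h2
    obtain ⟨n, hn⟩ := h2
    exact Or.inl ⟨n, by ext; simpa using hn.symm⟩
  · exact Or.inr ⟨h1, Subfield.subset_closure h⟩

theorem mem_expSemiring_x {m n : ℕ} {φ : A.germs m n} {e : Expo m n}
    (h : (A.T m n φ).coeff e ≠ 0) (i : Fin m) : (e.1 i : ℝ) ∈ A.expSemiring :=
  Subsemiring.subset_closure ⟨m, n, φ, e, h, Or.inl ⟨i, rfl⟩⟩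

theorem ExpOk.mem_semiring {a : ℝ≥0} (h : ExpOk A a) : (a : ℝ) ∈ A.expSemiring := by
  rcases h with ⟨n, rfl⟩ | ⟨h1, h2⟩
  · simp
  · obtain ⟨h3, h4⟩ := A.monomial h1 a h2
    have h5 : (A.ser _ h3).coeff (Pi.single 0 a, 0) ≠ 0 := by
      rw [h4, X, HahnSeries.coeff_single_same]
      exact one_ne_zero
    simpa using mem_expSemiring_x h5 0

theorem ExpOk.add {a b : ℝ≥0} (ha : ExpOk A a) (hb : ExpOk A b) : ExpOk A (a + b) := by
  refine ExpOk.of_mem_semiring ?_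
  simpa using add_mem ha.mem_semiring hb.mem_semiring

theorem ExpOk.mul {a b : ℝ≥0} (ha : ExpOk A a) (hb : ExpOk A b) : ExpOk A (a * b) := by
  refine ExpOk.of_mem_semiring ?_
  simpa using mul_mem ha.mem_semiring hb.mem_semiring

theorem ExpOk.sub {a b : ℝ≥0} (ha : ExpOk A a) (hb : ExpOk A b) : ExpOk A (a - b) := by
  by_cases h1 : (A.expSemiring : Set ℝ) = Set.range ((↑) : ℕ → ℝ)
  · rcases ha with ⟨n, rfl⟩ | h
    · rcases hb with ⟨k, rfl⟩ | h
      · exact Or.inl ⟨n - k, by simp⟩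
      · exact absurd h1 h.1
    · exact absurd h1 h.1
  · by_cases h : b ≤ a
    · refine Or.inr ⟨h1, ?_⟩
      rw [NNReal.coe_sub h]
      exact sub_mem ha.mem_field hb.mem_field
    · rw [tsub_eq_zero_of_le (not_le.1 h).le]
      exact expOk_zero

theorem MonoOk.add {a b : V → ℝ≥0} (ha : MonoOk A D a) (hb : MonoOk A D b) : MonoOk A D (a + b) := by
  refine ⟨fun v hv => (ha.1 v hv).add (hb.1 v hv), fun v hv => ?_⟩
  obtain ⟨k, hk⟩ := ha.2 v hv
  obtain ⟨l, hl⟩ := hb.2 v hv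
  exact ⟨k + l, by simp [hk, hl]⟩

theorem MonoOk.sub {a b : V → ℝ≥0} (ha : MonoOk A D a) (hb : MonoOk A D b) : MonoOk A D (a - b) := by
  refine ⟨fun v hv => (ha.1 v hv).sub (hb.1 v hv), fun v hv => ?_⟩
  obtain ⟨k, hk⟩ := ha.2 v hv
  obtain ⟨l, hl⟩ := hb.2 v hv
  exact ⟨k - l, by simp [hk, hl]⟩

theorem monoOk_zero : MonoOk A D (0 : V → ℝ≥0) :=
  ⟨fun _ _ => expOk_zero, fun _ _ => ⟨0, by simp⟩⟩

theorem MonoOk.nat (w : V → ℕ) : MonoOk A D (fun v => (w v : ℝ≥0)) :=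
  ⟨fun _ _ => expOk_nat _, fun v _ => ⟨w v, rfl⟩⟩

theorem monoOk_single_nat (v : V) (k : ℕ) : MonoOk A D (Pi.single v (k : ℝ≥0)) := by
  have := MonoOk.nat (A := A) (D := D) (Pi.single v k)
  convert this using 1
  funext q
  by_cases h : q = v
  · subst h; simp
  · simp [h]

theorem IsG.monoOk_of_mem_Supp (hf : IsG A D f) {w : V → ℝ≥0} (hw : w ∈ Supp A D f) :
    MonoOk A D w := by
  obtain ⟨m, n, e, he, h1⟩ := hf
  rw [Supp_eq he h1] at hw
  obtain ⟨u, hu, rfl⟩ := hw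
  constructor
  · intro v
    refine frame_forall e (P := fun v => v ∈ D → ExpOk A (ex e u v)) ?_ ?_ v
    · intro i _
      rw [ex_inl]
      exact ExpOk.of_mem_semiring (mem_expSemiring_x hu i)
    · intro j hj; exact absurd hj (he.2 j)
  · intro v
    refine frame_forall e (P := fun v => v ∉ D → ∃ n : ℕ, ex e u v = n) ?_ ?_ v
    · intro i hi; exact absurd (he.1 i) hi
    · intro j _; exact ⟨u.2 j, by simp⟩

end Functions

/-! ### Monomials and normal germs -/

section HahnShift

variable {m n : ℕ}

theorem coeff_single_mul_of_not_le (u w : Expo m n) (G : GenSeries m n) (h : ¬ u ≤ w) :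
    (HahnSeries.single u (1 : ℝ) * G).coeff w = 0 := by
  by_contra hne
  obtain ⟨a, ha, b, -, rfl⟩ := HahnSeries.support_mul_subset ((HahnSeries.mem_support _ _).2 hne)
  rw [HahnSeries.support_single_of_ne one_ne_zero, Set.mem_singleton_iff] at ha
  subst ha
  exact h ⟨fun i => le_self_add, fun i => Nat.le_add_right _ _⟩

theorem exists_eq_single_mul (F : GenSeries m n) (u : Expo m n) (h : ∀ x ∈ F.support, u ≤ x) :
    ∃ G : GenSeries m n, F = HahnSeries.single u 1 * G := by
  have hsub : ∀ x, u ≤ x → u + ((x.1 - u.1, x.2 - u.2) : Expo m n) = x := fun x hx =>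
    Prod.ext (funext fun i => add_tsub_cancel_of_le (hx.1 i))
      (funext fun i => add_tsub_cancel_of_le (hx.2 i))
  have hpwo : (Function.support fun w : Expo m n => F.coeff (u + w)).IsPWO := by
    refine (F.isPWO_support.image_of_monotone
      (f := fun x : Expo m n => ((x.1 - u.1, x.2 - u.2) : Expo m n)) ?_).mono ?_
    · exact fun x y hxy => ⟨fun i => tsub_le_tsub_right (hxy.1 i) _,
        fun i => tsub_le_tsub_right (hxy.2 i) _⟩
    · intro w hw
      refine ⟨u + w, hw, Prod.ext (funext fun i => ?_) (funext fun i => ?_)⟩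
      · exact add_tsub_cancel_left _ _
      · exact add_tsub_cancel_left _ _
  refine ⟨⟨fun w => F.coeff (u + w), hpwo⟩, ?_⟩
  ext w
  by_cases hw : u ≤ w
  · rw [← hsub w hw, add_comm u, HahnSeries.coeff_single_mul_add, one_mul]
    exact congrArg F.coeff (add_comm _ _)
  · rw [coeff_single_mul_of_not_le _ _ _ hw]
    by_contra hne
    exact hw (h w hne)

theorem X_one_pow (i : Fin m) (k : ℕ) :
    (X i 1 : GenSeries m n) ^ k = HahnSeries.single (Pi.single i (k : ℝ≥0), 0) 1 := by
  have h : k • ((Pi.single i 1, 0) : Expo m n) = (Pi.single i (k : ℝ≥0), 0) := by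
    refine Prod.ext (funext fun l => ?_) (smul_zero k)
    by_cases hl : l = i
    · subst hl; simp
    · simp [hl]
  rw [X, single_pow', h]

theorem Y_pow (i : Fin n) (k : ℕ) :
    (Y i : GenSeries m n) ^ k = HahnSeries.single (0, Pi.single i k) 1 := by
  have h : k • ((0, Pi.single i 1) : Expo m n) = (0, Pi.single i k) := by
    refine Prod.ext (smul_zero k) (funext fun l => ?_)
    by_cases hl : l = i
    · subst hl; simp
    · simp [hl]
  rw [Y, single_pow', h]

theorem ser_pow {A : QuasianalyticSystem} {f : Pt m n → ℝ} (hf : A.IsGerm f) (k : ℕ) :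
    A.ser _ (hf.pow k) = A.ser f hf ^ k :=
  map_pow (A.T m n) ⟨_, hf⟩ k

end HahnShift

section Monomials

variable {V : Type} [Fintype V] [DecidableEq V] {A : QuasianalyticSystem} {D : Finset V}
  {f g : (V → ℝ) → ℝ}

theorem ex_single_inl {m n : ℕ} (e : Fin m ⊕ Fin n ≃ V) (i : Fin m) (a : ℝ≥0) :
    ex e (Pi.single i a, 0) = Pi.single (e (Sum.inl i)) a := by
  funext v
  refine frame_forall e (P := fun v => ex e (Pi.single i a, 0) v =
    Pi.single (M := fun _ => ℝ≥0) (e (Sum.inl i)) a v) ?_ ?_ v <;> intro k <;>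
    simp [Pi.single_apply]

theorem ex_single_inr {m n : ℕ} (e : Fin m ⊕ Fin n ≃ V) (i : Fin n) (a : ℕ) :
    ex e (0, Pi.single i a) = Pi.single (e (Sum.inr i)) (a : ℝ≥0) := by
  funext v
  refine frame_forall e (P := fun v => ex e (0, Pi.single i a) v =
    Pi.single (M := fun _ => ℝ≥0) (e (Sum.inr i)) (a : ℝ≥0) v) ?_ ?_ v <;> intro k <;>
    simp [Pi.single_apply]

theorem single_le_iff_le {v : V} {a : ℝ≥0} {w : V → ℝ≥0} : Pi.single v a ≤ w ↔ a ≤ w v := by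
  constructor
  · intro h; simpa using h v
  · intro h q
    by_cases hq : q = v
    · subst hq; simpa using h
    · simp [hq]

theorem exists_frame_monomial_nat (v : V) (k : ℕ) :
    ∃ (m n : ℕ) (e : Fin m ⊕ Fin n ≃ V) (_ : Fr e D) (u : Expo m n)
      (h : A.IsGerm (fun p => pull e p v ^ ((k : ℝ≥0) : ℝ))),
      ex e u = Pi.single v (k : ℝ≥0) ∧ A.ser _ h = HahnSeries.single u 1 := by
  by_cases hv : v ∈ D
  · obtain ⟨m, n, h⟩ := exists_frame_x hv
    obtain ⟨e, he, rfl⟩ := h 0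
    have h1 : A.IsGerm (fun p => pull e p (e (Sum.inl 0)) ^ ((k : ℝ≥0) : ℝ)) := by
      simpa using (isGerm_x (A := A) (m := m + 1) (n := n) 0).pow k
    refine ⟨_, _, e, he, (Pi.single 0 (k : ℝ≥0), 0), h1, ex_single_inl e 0 _, ?_⟩
    rw [ser_congr (g := fun p => p.1 0 ^ k) _ h1 ((isGerm_x 0).pow k), ser_pow (isGerm_x 0),
      ser_x, X_one_pow]
    · exact Eventually.of_forall fun p => by simp
  · obtain ⟨m, n, h⟩ := exists_frame_y hv
    obtain ⟨e, he, rfl⟩ := h 0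
    have h1 : A.IsGerm (fun p => pull e p (e (Sum.inr 0)) ^ ((k : ℝ≥0) : ℝ)) := by
      simpa using (isGerm_y (A := A) (m := m) (n := n + 1) 0).pow k
    refine ⟨_, _, e, he, (0, Pi.single 0 k), h1, ex_single_inr e 0 _, ?_⟩
    rw [ser_congr (g := fun p => p.2 0 ^ k) _ h1 ((isGerm_y 0).pow k), ser_pow (isGerm_y 0)]
    · have := ser_y (A := A) 0 m (n + 1) (by omega)
      refine (congrArg (· ^ k) this).trans ?_
      exact Y_pow 0 k
    · exact Eventually.of_forall fun p => by simp

theorem exists_frame_monomial {v : V} {a : ℝ≥0} (ha : MonoOk A D (Pi.single v a)) :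
    ∃ (m n : ℕ) (e : Fin m ⊕ Fin n ≃ V) (_ : Fr e D) (u : Expo m n)
      (h : A.IsGerm (fun p => pull e p v ^ (a : ℝ))),
      ex e u = Pi.single v a ∧ A.ser _ h = HahnSeries.single u 1 := by
  by_cases hn : ∃ k : ℕ, a = k
  · obtain ⟨k, rfl⟩ := hn
    exact exists_frame_monomial_nat v k
  by_cases hv : v ∈ D
  swap
  · have := ha.2 v hv
    rw [Pi.single_eq_same] at this
    exact absurd this hn
  have ha1 := ha.1 v hv
  rw [Pi.single_eq_same] at ha1
  obtain ⟨h1, h2⟩ := ha1.resolve_left hn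
  obtain ⟨h3, h4⟩ := A.monomial h1 a h2
  obtain ⟨m, n, h⟩ := exists_frame_x hv
  obtain ⟨e0, he0, rfl⟩ := h 0
  let e : Fin (1 + m) ⊕ Fin n ≃ V :=
    (Equiv.sumCongr (finCongr (Nat.add_comm 1 m)) (Equiv.refl _)).trans e0
  have he : Fr e D := ⟨fun i => he0.1 _, fun j => he0.2 j⟩
  have e1 : e0 (Sum.inl 0) = e (Sum.inl (Fin.castAdd m 0)) := by
    change e0 (Sum.inl 0) = e0 (Sum.inl _)
    congr 2
  rw [e1]
  obtain ⟨h5, h6⟩ := A.compose (m' := m) (n' := n) _ h3 Fin.elim0 (fun j => j.elim0)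
    (fun j => j.elim0)
  have h7 : A.IsGerm (fun p => pull e p (e (Sum.inl (Fin.castAdd m 0))) ^ (a : ℝ)) := by
    simp only [pull_inl]
    exact h5
  refine ⟨_, _, e, he, (Pi.single (Fin.castAdd m 0) a, 0), h7, ex_single_inl _ _ _, ?_⟩
  rw [h4] at h6
  have h8 := h6.of_single
  rw [ser_congr _ h7 h5, h8]
  · simp [FormalMap.monomial, X]
  · exact Eventually.of_forall fun p => by simp

theorem isG_rpow {v : V} {a : ℝ≥0} (ha : MonoOk A D (Pi.single v a)) :
    IsG A D (fun p => p v ^ (a : ℝ)) := by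
  obtain ⟨m, n, e, he, u, h, -⟩ := exists_frame_monomial ha
  exact ⟨m, n, e, he, h⟩

theorem co_rpow_mul {v : V} {a : ℝ≥0} (ha : MonoOk A D (Pi.single v a)) (hg : IsG A D g)
    (w : V → ℝ≥0) : co A D (fun p => p v ^ (a : ℝ) * g p) w =
      if a ≤ w v then co A D g (w - Pi.single v a) else 0 := by
  obtain ⟨m, n, e, he, u, h, hu, hs⟩ := exists_frame_monomial ha
  have h1 := hg.isGerm he
  have hle : ∀ w : V → ℝ≥0, a ≤ w v ↔ Pi.single v a ≤ w := by
    exact fun w => single_le_iff_le.symm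
  by_cases hw : w ∈ Set.range (ex e)
  · obtain ⟨x, rfl⟩ := hw
    rw [co_ex he (h.mul h1), ser_mul h h1, hs]
    split_ifs with h2 <;> rw [hle, ← hu, ex_le] at h2
    · rw [← hu]
      obtain ⟨y, rfl⟩ : ∃ y, x = u + y := ⟨(x.1 - u.1, x.2 - u.2),
        Prod.ext (funext fun i => (add_tsub_cancel_of_le (h2.1 i)).symm)
          (funext fun i => (add_tsub_cancel_of_le (h2.2 i)).symm)⟩
      rw [ex_add, add_tsub_cancel_left, co_ex he h1, add_comm u, HahnSeries.coeff_single_mul_add,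
        one_mul]
    · exact coeff_single_mul_of_not_le _ _ _ h2
  · rw [co_of_notMem he hw]
    split_ifs with h2
    · rw [co_of_notMem he]
      rintro ⟨y, hy⟩
      apply hw
      refine ⟨u + y, ?_⟩
      rw [ex_add, hy, hu, add_tsub_cancel_of_le ((hle w).1 h2)]
    · rfl

/-- A germ is divisible by a power of a variable if its series is. -/
theorem IsG.exists_eq_rpow_mul (hf : IsG A D f) {v : V} {a : ℝ≥0}
    (ha : MonoOk A D (Pi.single v a)) (h : ∀ w ∈ Supp A D f, a ≤ w v) :
    ∃ g, IsG A D g ∧ f =ᶠ[gz D] fun p => p v ^ (a : ℝ) * g p := by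
  by_cases hv : v ∈ D
  · obtain ⟨m, n, h1⟩ := exists_frame_x hv
    obtain ⟨e, he, rfl⟩ := h1 0
    have h2 := hf.isGerm he
    have ha1 := ha.1 _ hv
    rw [Pi.single_eq_same] at ha1
    obtain ⟨G, hG⟩ := exists_eq_single_mul (A.ser _ h2) (Pi.single 0 a, 0) (by
      intro x hx
      rw [← ex_le e, ex_single_inl, single_le_iff_le]
      refine h _ ?_
      rw [Supp_eq he h2]
      exact ⟨x, hx, rfl⟩)
    obtain ⟨g, hg, h3⟩ := A.divide_x _ h2 a G ha1.mem_semiring hG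
    refine ⟨fun p => g (push e p), ⟨_, _, e, he, by simpa using hg⟩, ?_⟩
    refine he.eventually_iff.2 ?_
    filter_upwards [h3] with p hp
    simpa using hp
  · obtain ⟨m, n, h1⟩ := exists_frame_y hv
    obtain ⟨e, he, rfl⟩ := h1 0
    have h2 := hf.isGerm he
    obtain ⟨k, hk⟩ := ha.2 _ hv
    rw [Pi.single_eq_same] at hk
    subst hk
    obtain ⟨G, hG⟩ := exists_eq_single_mul (A.ser _ h2) (0, Pi.single 0 k) (by
      intro x hx
      rw [← ex_le e, ex_single_inr, single_le_iff_le]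
      refine h _ ?_
      rw [Supp_eq he h2]
      exact ⟨x, hx, rfl⟩)
    obtain ⟨g, hg, h3⟩ := A.divide_y _ h2 k G (by rw [hG, Y_pow])
    refine ⟨fun p => g (push e p), ⟨_, _, e, he, by simpa using hg⟩, ?_⟩
    refine he.eventually_iff.2 ?_
    filter_upwards [h3] with p hp
    simpa using hp

/-- The monomial with exponent `w`. -/
def mono (w : V → ℝ≥0) (p : V → ℝ) : ℝ := ∏ v, p v ^ (w v : ℝ)

theorem MonoOk.single {w : V → ℝ≥0} (hw : MonoOk A D w) (v : V) :
    MonoOk A D (Pi.single v (w v)) := by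
  constructor
  · intro q hq
    by_cases h : q = v
    · subst h; simpa using hw.1 q hq
    · simpa [h] using expOk_zero
  · intro q hq
    by_cases h : q = v
    · subst h; simpa using hw.2 q hq
    · exact ⟨0, by simp [h]⟩

theorem isG_mono {w : V → ℝ≥0} (hw : MonoOk A D w) : IsG A D (mono w) :=
  IsG.prod _ fun v _ => isG_rpow (hw.single v)

theorem co_prod_mul {w : V → ℝ≥0} (hw : MonoOk A D w) (hg : IsG A D g) (S : Finset V)
    (x : V → ℝ≥0) :
    co A D (fun p => (∏ v ∈ S, p v ^ (w v : ℝ)) * g p) x = open Classical in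
      if ∀ v ∈ S, w v ≤ x v then co A D g (x - fun v => if v ∈ S then w v else 0) else 0 := by
  classical
  induction S using Finset.induction_on generalizing x with
  | empty =>
    simp only [Finset.prod_empty, one_mul, Finset.notMem_empty, if_false, false_imp_iff,
      implies_true, if_true]
    congr 1
    funext v
    simp
  | insert v S hv ih =>
    simp only [Finset.prod_insert hv, mul_assoc]
    rw [co_rpow_mul (hw.single v) ((IsG.prod S fun v _ => isG_rpow (hw.single v)).mul hg), ih]
    have h1 : (∀ q ∈ S, w q ≤ (x - Pi.single (M := fun _ => ℝ≥0) v (w v)) q) ↔ ∀ q ∈ S, w q ≤ x q := by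
      refine forall₂_congr fun q hq => ?_
      have : q ≠ v := fun h => hv (h ▸ hq)
      simp [this]
    simp only [Finset.forall_mem_insert]
    by_cases h2 : w v ≤ x v
    · by_cases h3 : ∀ q ∈ S, w q ≤ x q
      · rw [if_pos h2, if_pos (h1.2 h3), if_pos ⟨h2, h3⟩]
        congr 1
        funext q
        by_cases hq : q = v
        · subst hq; simp [hv]
        · simp [hq]
      · rw [if_pos h2, if_neg (mt h1.1 h3), if_neg fun h => h3 h.2]
    · rw [if_neg h2, if_neg fun h => h2 h.1]

theorem co_mono_mul {w : V → ℝ≥0} (hw : MonoOk A D w) (hg : IsG A D g) (x : V → ℝ≥0) :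
    co A D (fun p => mono w p * g p) x = open Classical in
      if w ≤ x then co A D g (x - w) else 0 := by
  classical
  have h := co_prod_mul hw hg Finset.univ x
  simp only [Finset.mem_univ, if_true, forall_true_left] at h
  by_cases hx : w ≤ x
  · rw [if_pos hx]
    rw [if_pos (show ∀ v, w v ≤ x v from hx)] at h
    exact h
  · rw [if_neg hx]
    rw [if_neg (show ¬ ∀ v, w v ≤ x v from hx)] at h
    exact h

theorem mem_Supp_mono_mul {w : V → ℝ≥0} (hw : MonoOk A D w) (hg : IsG A D g) {x : V → ℝ≥0} :
    x ∈ Supp A D (fun p => mono w p * g p) ↔ w ≤ x ∧ x - w ∈ Supp A D g := by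
  classical
  change co A D _ x ≠ 0 ↔ _ ∧ co A D g _ ≠ 0
  rw [co_mono_mul hw hg]
  split_ifs with h <;> simp [h]

theorem IsG.exists_eq_mono_mul (hf : IsG A D f) {w : V → ℝ≥0} (hw : MonoOk A D w)
    (h : ∀ x ∈ Supp A D f, w ≤ x) : ∃ g, IsG A D g ∧ f =ᶠ[gz D] fun p => mono w p * g p := by
  classical
  have key : ∀ S : Finset V, ∃ g, IsG A D g ∧
      f =ᶠ[gz D] fun p => (∏ v ∈ S, p v ^ (w v : ℝ)) * g p := by
    intro S
    induction S using Finset.induction_on with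
    | empty => exact ⟨f, hf, by simp⟩
    | insert v S hv ih =>
      obtain ⟨g, hg, h1⟩ := ih
      obtain ⟨g', hg', h2⟩ := hg.exists_eq_rpow_mul (hw.single v) (by
        intro x hx
        have h3 : (x + fun q => if q ∈ S then w q else 0) ∈ Supp A D f := by
          rw [Supp_congr h1]
          change co A D _ _ ≠ 0
          rw [co_prod_mul hw hg, if_pos, add_tsub_cancel_right]
          · exact hx
          · intro q hq
            simp [hq]
        have := h _ h3 v
        simpa [hv] using this)
      refine ⟨g', hg', ?_⟩
      filter_upwards [h1, h2] with p h1 h2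
      rw [h1, h2, Finset.prod_insert hv]
      ring
  exact key Finset.univ

variable (A D) in
/-- A germ is normal if it is the product of a monomial and a unit. -/
def Normal (f : (V → ℝ) → ℝ) : Prop :=
  ∃ (w : V → ℝ≥0) (u : (V → ℝ) → ℝ), MonoOk A D w ∧ IsG A D u ∧ u 0 ≠ 0 ∧
    f =ᶠ[gz D] fun p => mono w p * u p

variable (A D) in
/-- `w` is the least exponent of the series of `f`. -/
def IsLeastExp (f : (V → ℝ) → ℝ) (w : V → ℝ≥0) : Prop := IsLeast (Supp A D f) w

theorem Normal.congr (hf : Normal A D f) (h : f =ᶠ[gz D] g) : Normal A D g := by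
  obtain ⟨w, u, h1, h2, h3, h4⟩ := hf
  exact ⟨w, u, h1, h2, h3, h.symm.trans h4⟩

theorem Normal.isG (hf : Normal A D f) : IsG A D f := by
  obtain ⟨w, u, h1, h2, h3, h4⟩ := hf
  exact ((isG_mono h1).mul h2).congr h4.symm

theorem isLeastExp_of_eq {w : V → ℝ≥0} {u : (V → ℝ) → ℝ} (hw : MonoOk A D w) (hu : IsG A D u)
    (h0 : u 0 ≠ 0) (h : f =ᶠ[gz D] fun p => mono w p * u p) : IsLeastExp A D f w := by
  unfold IsLeastExp
  rw [Supp_congr h]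
  constructor
  · rw [mem_Supp_mono_mul hw hu]
    refine ⟨le_rfl, ?_⟩
    rw [tsub_self]
    change co A D u 0 ≠ 0
    rwa [co_zero hu]
  · intro x hx
    exact ((mem_Supp_mono_mul hw hu).1 hx).1

theorem Normal.exists_isLeastExp (hf : Normal A D f) : ∃ w, IsLeastExp A D f w := by
  obtain ⟨w, u, h1, h2, h3, h4⟩ := hf
  exact ⟨w, isLeastExp_of_eq h1 h2 h3 h4⟩

theorem IsLeastExp.exists_eq (hf : IsG A D f) {w : V → ℝ≥0} (h : IsLeastExp A D f w) :
    MonoOk A D w ∧ ∃ u, IsG A D u ∧ u 0 ≠ 0 ∧ f =ᶠ[gz D] fun p => mono w p * u p := by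
  have hw := hf.monoOk_of_mem_Supp h.1
  obtain ⟨u, hu, h1⟩ := hf.exists_eq_mono_mul hw h.2
  refine ⟨hw, u, hu, ?_, h1⟩
  have h2 := h.1
  rw [Supp_congr h1, mem_Supp_mono_mul hw hu, tsub_self] at h2
  have h3 : co A D u 0 ≠ 0 := h2.2
  rwa [co_zero hu] at h3

theorem IsLeastExp.normal (hf : IsG A D f) {w : V → ℝ≥0} (h : IsLeastExp A D f w) :
    Normal A D f := by
  obtain ⟨h1, u, h2, h3, h4⟩ := h.exists_eq hf
  exact ⟨w, u, h1, h2, h3, h4⟩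

theorem normal_of_unit (hf : IsG A D f) (h : f 0 ≠ 0) : Normal A D f :=
  ⟨0, f, monoOk_zero, hf, h, by simp [mono]⟩

theorem Normal.not_eventuallyEq_zero (hf : Normal A D f) : ¬ f =ᶠ[gz D] 0 := by
  intro h
  obtain ⟨w, hw⟩ := hf.exists_isLeastExp
  have := hf.isG.Supp_eq_empty_iff.2 h
  have h1 := hw.1
  rw [this] at h1
  exact h1

theorem mono_add {w x : V → ℝ≥0} {p : V → ℝ} (hp : p ∈ Qd D) (hw : MonoOk A D w)
    (hx : MonoOk A D x) : mono (w + x) p = mono w p * mono x p := by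
  unfold mono
  rw [← Finset.prod_mul_distrib]
  refine Finset.prod_congr rfl fun v _ => ?_
  by_cases hv : v ∈ D
  · rw [Pi.add_apply, NNReal.coe_add, Real.rpow_add_of_nonneg (hp v hv) (by positivity) (by positivity)]
  · obtain ⟨k, hk⟩ := hw.2 v hv
    obtain ⟨l, hl⟩ := hx.2 v hv
    rw [Pi.add_apply, hk, hl]
    have := pow_add (p v) k l
    rw [← Real.rpow_natCast, ← Real.rpow_natCast, ← Real.rpow_natCast] at this
    simpa using this

theorem Normal.mul (hf : Normal A D f) (hg : Normal A D g) : Normal A D (fun p => f p * g p) := by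
  obtain ⟨w, u, h1, h2, h3, h4⟩ := hf
  obtain ⟨w', u', h1', h2', h3', h4'⟩ := hg
  refine ⟨w + w', fun p => u p * u' p, h1.add h1', h2.mul h2', mul_ne_zero h3 h3', ?_⟩
  filter_upwards [h4, h4', self_mem_nhdsWithin] with p h4 h4' hp
  rw [h4, h4', mono_add hp h1 h1']
  ring

theorem normal_rpow {v : V} {a : ℝ≥0} (ha : MonoOk A D (Pi.single v a)) :
    Normal A D (fun p => p v ^ (a : ℝ)) := by
  refine ⟨Pi.single v a, fun _ => 1, ha, isG_const 1, one_ne_zero, ?_⟩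
  refine Eventually.of_forall fun p => ?_
  simp only [mono, mul_one]
  rw [Finset.prod_eq_single v]
  · simp
  · intro b _ hb
    simp [hb]
  · simp

theorem normal_coord (v : V) : Normal A D (fun p => p v) := by
  simpa using normal_rpow (monoOk_single_nat (A := A) (D := D) v 1)

theorem Normal.pow (hf : Normal A D f) (k : ℕ) : Normal A D (fun p => f p ^ k) := by
  induction k with
  | zero => simpa using normal_of_unit (isG_const 1) one_ne_zero
  | succ k ih => simpa [pow_succ] using ih.mul hf

theorem Normal.prod {ι : Type*} (s : Finset ι) {f : ι → (V → ℝ) → ℝ}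
    (hf : ∀ i ∈ s, Normal A D (f i)) : Normal A D (fun p => ∏ i ∈ s, f i p) := by
  classical
  induction s using Finset.induction_on with
  | empty => simpa using normal_of_unit (isG_const 1) one_ne_zero
  | insert a s ha ih =>
    simp only [Finset.prod_insert ha]
    exact (hf _ (Finset.mem_insert_self _ _)).mul (ih fun i hi => hf i (Finset.mem_insert_of_mem hi))

/-! Factors and differences of normal germs -/

theorem add_mem_Supp_mul (hf : IsG A D f) (hg : IsG A D g) {a b : V → ℝ≥0} (ha : a ∈ Supp A D f)
    (hb : b ∈ Supp A D g)
    (h : ∀ x ∈ Supp A D f, ∀ y ∈ Supp A D g, x + y = a + b → x = a ∧ y = b) :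
    a + b ∈ Supp A D (fun p => f p * g p) := by
  obtain ⟨m, n, e, he, h1⟩ := hf
  have h2 := hg.isGerm he
  have e1 := Supp_eq he h1
  have e2 := Supp_eq he h2
  rw [e1] at ha
  rw [e2] at hb
  obtain ⟨u, hu, rfl⟩ := ha
  obtain ⟨w, hw, rfl⟩ := hb
  rw [Supp_eq he (h1.mul h2), ← ex_add]
  refine ⟨u + w, ?_, rfl⟩
  rw [HahnSeries.mem_support, ser_mul h1 h2, coeff_mul_of_unique]
  · exact mul_ne_zero hu hw
  · intro x y hx hy hxy
    have h3 := h (ex e x) (by rw [e1]; exact ⟨x, hx, rfl⟩) (ex e y) (by rw [e2]; exact ⟨y, hy, rfl⟩)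
      (by rw [← ex_add, ← ex_add, hxy])
    exact ⟨ex_injective e h3.1, ex_injective e h3.2⟩

theorem IsG.isPWO_Supp (hf : IsG A D f) : (Supp A D f).IsPWO := by
  obtain ⟨m, n, e, he, h1⟩ := hf
  rw [Supp_eq he h1]
  exact (A.ser _ h1).isPWO_support.image_of_monotone fun a b h => (ex_le e a b).2 h

/-- A lexicographic order on the exponents in which the exponent of `v` comes first. -/
def lexOrd (v : V) (w : V → ℝ≥0) : ℝ≥0 ×ₗ (Lex (Fin (Fintype.card V) → ℝ≥0)) :=
  toLex (w v, toLex fun i => w ((Fintype.equivFin V).symm i))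

theorem lexOrd_injective (v : V) : Function.Injective (lexOrd v) := by
  intro a b h
  have h1 : (fun i => a ((Fintype.equivFin V).symm i)) = fun i => b ((Fintype.equivFin V).symm i) :=
    congrArg (fun x : ℝ≥0 ×ₗ (Lex (Fin (Fintype.card V) → ℝ≥0)) => ofLex (ofLex x).2) h
  funext q
  simpa using congrFun h1 (Fintype.equivFin V q)

theorem lexOrd_add (v : V) (a b : V → ℝ≥0) : lexOrd v (a + b) = lexOrd v a + lexOrd v b := rfl

theorem lexOrd_monotone (v : V) : Monotone (lexOrd v) := by
  intro a b h
  refine Prod.Lex.toLex_mono ⟨h v, ?_⟩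
  exact Pi.toLex_monotone fun i => h _

theorem lexOrd_fst_le {v : V} {a b : V → ℝ≥0} (h : lexOrd v a ≤ lexOrd v b) : a v ≤ b v := by
  rcases (Prod.Lex.le_iff.1 h) with h | h
  · exact h.le
  · exact h.1.le

theorem IsG.exists_lexOrd_min (hf : IsG A D f) (hne : (Supp A D f).Nonempty) (v : V) :
    ∃ a ∈ Supp A D f, ∀ b ∈ Supp A D f, lexOrd v a ≤ lexOrd v b := by
  have h1 := (hf.isPWO_Supp.image_of_monotone (lexOrd_monotone v)).isWF
  have h2 : (lexOrd v '' Supp A D f).Nonempty := hne.image _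
  obtain ⟨a, ha, h3⟩ := h1.min_mem h2
  refine ⟨a, ha, fun b hb => ?_⟩
  rw [h3]
  exact h1.min_le h2 ⟨b, hb, rfl⟩

/-- A factor of a normal germ is normal: for each variable, the least exponent of a product is the
sum of the least exponents of the factors. -/
theorem Normal.of_mul (hf : IsG A D f) (hg : IsG A D g) (h : Normal A D (fun p => f p * g p)) :
    Normal A D f := by
  obtain ⟨w, hw, hmin⟩ := h.exists_isLeastExp
  obtain ⟨a, ha, b, hb, hab⟩ := Supp_mul_subset hf hg hw
  refine IsLeastExp.normal (w := a) hf ⟨ha, fun x hx v => ?_⟩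
  obtain ⟨a', ha', h1⟩ := hf.exists_lexOrd_min ⟨a, ha⟩ v
  obtain ⟨b', hb', h2⟩ := hg.exists_lexOrd_min ⟨b, hb⟩ v
  have h3 : a' + b' ∈ Supp A D (fun p => f p * g p) := by
    refine add_mem_Supp_mul hf hg ha' hb' fun x hx y hy hxy => ?_
    have h4 : lexOrd v a' + lexOrd v b' = lexOrd v x + lexOrd v y := by
      rw [← lexOrd_add, ← lexOrd_add, hxy]
    have h5 := (add_eq_add_iff_eq_and_eq (h1 x hx) (h2 y hy)).1 h4
    exact ⟨lexOrd_injective v h5.1.symm, lexOrd_injective v h5.2.symm⟩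
  have h4 : w v ≤ a' v + b' v := hmin h3 v
  rw [← hab, Pi.add_apply] at h4
  have h5 := lexOrd_fst_le (h2 b hb)
  have h6 := lexOrd_fst_le (h1 x hx)
  exact (le_of_add_le_add_right (h4.trans (add_le_add_right h5 _))).trans h6

/-- If two germs and their difference are normal, then their exponents are comparable. -/
theorem IsLeastExp.le_or_le (hf : IsG A D f) (hg : IsG A D g) {a b : V → ℝ≥0}
    (ha : IsLeastExp A D f a) (hb : IsLeastExp A D g b)
    (h : (fun p => f p - g p) =ᶠ[gz D] 0 ∨ Normal A D (fun p => f p - g p)) : a ≤ b ∨ b ≤ a := by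
  rcases h with h | h
  · have : f =ᶠ[gz D] g := by
      filter_upwards [h] with p hp
      simpa [sub_eq_zero] using hp
    unfold IsLeastExp at ha hb
    rw [Supp_congr this] at ha
    exact Or.inl (ha.unique hb).le
  · obtain ⟨w, hw, hmin⟩ := h.exists_isLeastExp
    by_contra! hcon
    have h1 : co A D g a = 0 := by
      by_contra h'
      exact hcon.2 (hb.2 h')
    have h2 : co A D f b = 0 := by
      by_contra h'
      exact hcon.1 (ha.2 h')
    have h3 : w ≤ a := hmin (by
      change co A D _ a ≠ 0
      rw [co_sub hf hg, h1, sub_zero]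
      exact ha.1)
    have h4 : w ≤ b := hmin (by
      change co A D _ b ≠ 0
      rw [co_sub hf hg, h2, zero_sub]
      exact neg_ne_zero.2 hb.1)
    have h5 : co A D (fun p => f p - g p) w ≠ 0 := hw
    rw [co_sub hf hg] at h5
    by_cases h6 : co A D f w = 0
    · rw [h6, zero_sub, neg_ne_zero] at h5
      exact hcon.2 ((hb.2 h5).trans h3)
    · exact hcon.1 ((ha.2 h6).trans h4)

end Monomials

/-! ### Monomial substitutions -/

section FrameChange

variable {V : Type} [Fintype V] [DecidableEq V] {D : Finset V} {m n : ℕ}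

theorem card_of_frame (e : Fin m ⊕ Fin n ≃ V) : Fintype.card V = m + n := by
  rw [← Fintype.card_congr e]
  simp

/-- The numbering in which the `x`-variable with number `i` has become the first `y`-variable. -/
def xtoY (e : Fin (m + 1) ⊕ Fin n ≃ V) (i : Fin (m + 1)) : Fin m ⊕ Fin (n + 1) ≃ V :=
  Equiv.ofBijective
    (Sum.elim (fun k => e (Sum.inl (i.succAbove k)))
      (Fin.cons (e (Sum.inl i)) fun k => e (Sum.inr k))) (by
    rw [Fintype.bijective_iff_surjective_and_card]
    constructor
    · refine frame_forall e ?_ ?_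
      · intro k
        by_cases hk : k = i
        · exact ⟨Sum.inr 0, by simp [hk]⟩
        · obtain ⟨l, rfl⟩ := Fin.exists_succAbove_eq hk
          exact ⟨Sum.inl l, rfl⟩
      · exact fun k => ⟨Sum.inr k.succ, by simp⟩
    · rw [card_of_frame e]
      simp
      omega)

@[simp] theorem xtoY_inl (e : Fin (m + 1) ⊕ Fin n ≃ V) (i : Fin (m + 1)) (k : Fin m) :
    xtoY e i (Sum.inl k) = e (Sum.inl (i.succAbove k)) := rfl

@[simp] theorem xtoY_zero (e : Fin (m + 1) ⊕ Fin n ≃ V) (i : Fin (m + 1)) :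
    xtoY e i (Sum.inr 0) = e (Sum.inl i) := rfl

@[simp] theorem xtoY_succ (e : Fin (m + 1) ⊕ Fin n ≃ V) (i : Fin (m + 1)) (k : Fin n) :
    xtoY e i (Sum.inr k.succ) = e (Sum.inr k) := rfl

theorem Fr.xtoY {e : Fin (m + 1) ⊕ Fin n ≃ V} (he : Fr e D) (i : Fin (m + 1)) :
    Fr (xtoY e i) (D.erase (e (Sum.inl i))) := by
  constructor
  · intro k
    simp [he.1, Fin.succAbove_ne]
  · intro k
    refine Fin.cases ?_ (fun k => ?_) k
    · simp
    · simp [he.2]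

/-- The numbering in which the `y`-variable with number `i` has become the last `x`-variable. -/
def ytoX (e : Fin m ⊕ Fin (n + 1) ≃ V) (i : Fin (n + 1)) : Fin (m + 1) ⊕ Fin n ≃ V :=
  Equiv.ofBijective
    (Sum.elim (Fin.snoc (α := fun _ => V) (fun k => e (Sum.inl k)) (e (Sum.inr i)))
      (fun k => e (Sum.inr (i.succAbove k)))) (by
    rw [Fintype.bijective_iff_surjective_and_card]
    constructor
    · refine frame_forall e ?_ ?_
      · exact fun k => ⟨Sum.inl k.castSucc, by simp⟩
      · intro k
        by_cases hk : k = i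
        · exact ⟨Sum.inl (Fin.last m), by simp [hk]⟩
        · obtain ⟨l, rfl⟩ := Fin.exists_succAbove_eq hk
          exact ⟨Sum.inr l, rfl⟩
    · rw [card_of_frame e]
      simp
      omega)

@[simp] theorem ytoX_inr (e : Fin m ⊕ Fin (n + 1) ≃ V) (i : Fin (n + 1)) (k : Fin n) :
    ytoX e i (Sum.inr k) = e (Sum.inr (i.succAbove k)) := rfl

@[simp] theorem ytoX_last (e : Fin m ⊕ Fin (n + 1) ≃ V) (i : Fin (n + 1)) :
    ytoX e i (Sum.inl (Fin.last m)) = e (Sum.inr i) := by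
  simp [ytoX]

@[simp] theorem ytoX_castSucc (e : Fin m ⊕ Fin (n + 1) ≃ V) (i : Fin (n + 1)) (k : Fin m) :
    ytoX e i (Sum.inl k.castSucc) = e (Sum.inl k) := by
  simp [ytoX]

theorem Fr.ytoX {e : Fin m ⊕ Fin (n + 1) ≃ V} (he : Fr e D) (i : Fin (n + 1)) :
    Fr (ytoX e i) (insert (e (Sum.inr i)) D) := by
  constructor
  · intro k
    refine Fin.lastCases ?_ (fun k => ?_) k
    · simp
    · simp [he.1]
  · intro k
    simp [he.2, Fin.succAbove_ne]

theorem mem_range_ex {e : Fin m ⊕ Fin n ≃ V} {u : Expo m n} {w : V → ℝ≥0}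
    (h : ∀ k, (u.2 k : ℝ≥0) = w (e (Sum.inr k))) : w ∈ Set.range (ex e) :=
  ⟨(fun k => w (e (Sum.inl k)), u.2), funext <| frame_forall e (by simp) (by simpa using h)⟩

theorem ram_expo_injective (i : Fin m) {γ : ℝ≥0} (h0 : 0 < γ) :
    Function.Injective fun u : Expo m n => ((Function.update u.1 i (γ * u.1 i), u.2) : Expo m n) := by
  intro a b hab
  obtain ⟨hab1, hab2⟩ := Prod.ext_iff.1 hab
  refine Prod.ext (funext fun j => ?_) hab2
  have := congrFun hab1 j
  by_cases hj : j = i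
  · subst hj; simpa [h0.ne'] using this
  · simpa [hj] using this

theorem ex_ram (e : Fin m ⊕ Fin n ≃ V) (i : Fin m) (γ : ℝ≥0) (u : Expo m n) :
    ex e (Function.update u.1 i (γ * u.1 i), u.2) =
      Function.update (ex e u) (e (Sum.inl i)) (γ * ex e u (e (Sum.inl i))) := by
  funext v
  refine frame_forall e (P := fun v => ex e (Function.update u.1 i (γ * u.1 i), u.2) v =
    Function.update (ex e u) _ _ v) ?_ ?_ v <;> intro k <;> simp [Function.update_apply]

end FrameChange

section Charts

variable {V : Type} [Fintype V] [DecidableEq V] {A : QuasianalyticSystem} {D : Finset V}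
  {f g : (V → ℝ) → ℝ}

/-- The blow-up chart `p_i = p_j (lam + p_i)`. -/
def blow (i j : V) (lam : ℝ) (p : V → ℝ) : V → ℝ := Function.update p i (p j * (lam + p i))

/-- The blow-up chart `p_i = ε p_i`, `p_j = p_i p_j`. -/
def blowInf (i j : V) (ε : ℤˣ) (p : V → ℝ) : V → ℝ :=
  Function.update (Function.update p j (p i * p j)) i (((ε : ℤ) : ℝ) * p i)

/-- The translation `p_k = p_k + h(p)`. -/
def trans (k : V) (h : (V → ℝ) → ℝ) (p : V → ℝ) : V → ℝ := Function.update p k (p k + h p)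

/-- The ramification `p_i = p_i ^ γ` of an `x`-variable. -/
def ramX (i : V) (γ : ℝ≥0) (p : V → ℝ) : V → ℝ := Function.update p i (p i ^ (γ : ℝ))

/-- The ramification `p_i = ε p_i ^ d` of a `y`-variable. -/
def ramY (i : V) (d : ℕ) (ε : ℤˣ) (p : V → ℝ) : V → ℝ :=
  Function.update p i (((ε : ℤ) : ℝ) * p i ^ d)

theorem pull_xx {m n : ℕ} (e : Fin (m + 1) ⊕ Fin n ≃ V) (i : Fin (m + 1)) (j : Fin m)
    (hji : j.castSucc < i) {lam : ℝ} (hlam : 0 < lam) (p : Pt m (n + 1)) :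
    pull e ((BlowUpChart.xx i j hji lam hlam).toMap p) =
      blow (e (Sum.inl i)) (e (Sum.inl j.castSucc)) lam (pull (xtoY e i) p) := by
  have hj : pull (xtoY e i) p (e (Sum.inl j.castSucc)) = p.1 j := by
    have := pull_inl (e := xtoY e i) p j
    rwa [xtoY_inl, Fin.succAbove_of_castSucc_lt _ _ hji] at this
  have hi : pull (xtoY e i) p (e (Sum.inl i)) = p.2 0 := by
    have := pull_inr (e := xtoY e i) p 0
    rwa [xtoY_zero] at this
  funext v
  refine frame_forall (xtoY e i) (P := fun v => pull e ((BlowUpChart.xx i j hji lam hlam).toMap p) v =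
    blow (e (Sum.inl i)) (e (Sum.inl j.castSucc)) lam (pull (xtoY e i) p) v) ?_ ?_ v
  · intro k
    simp only [blow]
    rw [Function.update_of_ne (by simp [Fin.succAbove_ne]), pull_inl, xtoY_inl, pull_inl]
    simp [BlowUpChart.toMap]
  · intro k
    refine Fin.cases ?_ (fun k => ?_) k
    · rw [xtoY_zero, pull_inl]
      simp [blow, hj, hi, BlowUpChart.toMap]
    · simp only [blow]
      rw [Function.update_of_ne (by simp), pull_inr, xtoY_succ, pull_inr]
      rfl

theorem pull_xxZero {m n : ℕ} (e : Fin m ⊕ Fin n ≃ V) (i j : Fin m) (hij : i ≠ j) (p : Pt m n) :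
    pull e ((BlowUpChart.xxZero i j hij).toMap p) =
      blow (e (Sum.inl i)) (e (Sum.inl j)) 0 (pull e p) := by
  simp [BlowUpChart.toMap, pull_update_inl, blow]

theorem pull_yx {m n : ℕ} (e : Fin m ⊕ Fin n ≃ V) (i : Fin n) (j : Fin m) (lam : ℝ) (p : Pt m n) :
    pull e ((BlowUpChart.yx i j lam).toMap p) =
      blow (e (Sum.inr i)) (e (Sum.inl j)) lam (pull e p) := by
  simp [BlowUpChart.toMap, pull_update_inr, blow]

theorem pull_yy {m n : ℕ} (e : Fin m ⊕ Fin n ≃ V) (i j : Fin n) (hij : i ≠ j) (lam : ℝ)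
    (p : Pt m n) : pull e ((BlowUpChart.yy i j hij lam).toMap p) =
      blow (e (Sum.inr i)) (e (Sum.inr j)) lam (pull e p) := by
  simp [BlowUpChart.toMap, pull_update_inr, blow]

theorem pull_yxInfty {m n : ℕ} (e : Fin m ⊕ Fin (n + 1) ≃ V) (i : Fin (n + 1)) (j : Fin m) (ε : ℤˣ)
    (p : Pt (m + 1) n) : pull e ((BlowUpChart.yxInfty i j ε).toMap p) =
      blowInf (e (Sum.inr i)) (e (Sum.inl j)) ε (pull (ytoX e i) p) := by
  have hj : ∀ j, pull (ytoX e i) p (e (Sum.inl j)) = p.1 j.castSucc := by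
    intro j
    have := pull_inl (e := ytoX e i) p j.castSucc
    rwa [ytoX_castSucc] at this
  have hi : pull (ytoX e i) p (e (Sum.inr i)) = p.1 (Fin.last m) := by
    have := pull_inl (e := ytoX e i) p (Fin.last m)
    rwa [ytoX_last] at this
  have hk : ∀ k, pull (ytoX e i) p (e (Sum.inr (i.succAbove k))) = p.2 k := by
    intro k
    have := pull_inr (e := ytoX e i) p k
    rwa [ytoX_inr] at this
  funext v
  refine frame_forall e (P := fun v => pull e ((BlowUpChart.yxInfty i j ε).toMap p) v =
    blowInf (e (Sum.inr i)) (e (Sum.inl j)) ε (pull (ytoX e i) p) v) ?_ ?_ v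
  · intro k
    simp only [blowInf]
    rw [Function.update_of_ne (by simp), pull_inl]
    by_cases hkj : k = j
    · subst hkj
      simp [hj, hi, BlowUpChart.toMap]
    · rw [Function.update_of_ne (by simpa using hkj), hj]
      simp [BlowUpChart.toMap, hkj, Fin.init]
  · intro k
    by_cases hki : k = i
    · subst hki
      simp [blowInf, hi, BlowUpChart.toMap]
    · obtain ⟨l, rfl⟩ := Fin.exists_succAbove_eq hki
      simp only [blowInf]
      rw [Function.update_of_ne (by simp [Fin.succAbove_ne]), Function.update_of_ne (by simp), hk]
      simp [BlowUpChart.toMap]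

theorem ex_add_single {m n : ℕ} (e : Fin m ⊕ Fin n ≃ V) (i j : Fin m) (u : Expo m n) :
    ex e (Pi.single j (u.1 i) + u.1, u.2) =
      ex e u + Pi.single (e (Sum.inl j)) (ex e u (e (Sum.inl i))) := by
  rw [← ex_single_inl, ← ex_add, ex_inl]
  congr 1
  exact Prod.ext (add_comm _ _) (add_zero _).symm

theorem IsG.co_blow (hf : IsG A D f) {i j : V} (hi : i ∈ D) (hj : j ∈ D) (hij : i ≠ j) :
    IsG A D (fun p => f (blow i j 0 p)) ∧
      (∀ w, co A D (fun p => f (blow i j 0 p)) (w + Pi.single j (w i)) = co A D f w) ∧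
      ∀ w ∈ Supp A D (fun p => f (blow i j 0 p)), ∃ x ∈ Supp A D f, w = x + Pi.single j (x i) := by
  obtain ⟨m, n, e, he, h⟩ := hf
  obtain ⟨i, rfl⟩ := exists_inl_of_mem he hi
  obtain ⟨j, rfl⟩ := exists_inl_of_mem he hj
  have hij' : i ≠ j := fun h => hij (by rw [h])
  obtain ⟨h1, h2⟩ := A.blowUp (BlowUpChart.xxZero i j hij') _ h
  obtain ⟨h3, h4⟩ := (FormalMap.isComp_iff_of_monomial (xxZero_expo_injective i j hij')
    (xxZero_monomial i j hij')).1 h2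
  simp only [pull_xxZero] at h1 h3 h4
  refine ⟨⟨_, _, e, he, h1⟩, fun w => ?_, fun w hw => ?_⟩
  · by_cases hw : w ∈ Set.range (ex e)
    · obtain ⟨u, rfl⟩ := hw
      rw [← ex_add_single, co_ex he h1, co_ex he h, h3]
    · rw [co_of_notMem he hw, co_of_notMem he]
      rintro ⟨u, hu⟩
      apply hw
      -- the exponent of `j` becomes smaller, so that it is a matter of the `x`-exponents only
      exact mem_range_ex fun k => by simpa using congrFun hu (e (Sum.inr k))
  · rw [Supp_eq he h1] at hw
    obtain ⟨u, hu, rfl⟩ := hw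
    have h5 : u ∈ Set.range fun e : Expo m n => ((Pi.single j (e.1 i) + e.1, e.2) : Expo m n) := by
      by_contra h5
      exact hu (h4 u h5)
    obtain ⟨y, rfl⟩ := h5
    refine ⟨ex e y, ?_, ex_add_single e i j y⟩
    rw [Supp_eq he h]
    refine ⟨y, ?_, rfl⟩
    rw [HahnSeries.mem_support, ← h3]
    exact hu

theorem tendsto_gz {D' : Finset V} {φ : (V → ℝ) → V → ℝ} (hc : Tendsto φ (gz D') (𝓝 0))
    (hq : ∀ᶠ p in gz D', φ p ∈ Qd D) : Tendsto φ (gz D') (gz D) :=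
  tendsto_nhdsWithin_iff.2 ⟨hc, hq⟩

theorem tendsto_coord (v : V) : Tendsto (fun p : V → ℝ => p v) (gz D) (𝓝 0) :=
  ((continuous_apply v).tendsto (0 : V → ℝ)).mono_left nhdsWithin_le_nhds

theorem tendsto_update (k : V) {g : (V → ℝ) → ℝ} (hg : Tendsto g (gz D) (𝓝 0))
    (hk : k ∈ D → ∀ p ∈ Qd D, 0 ≤ g p) :
    Tendsto (fun p => Function.update p k (g p)) (gz D) (gz D) := by
  refine tendsto_gz (tendsto_pi_nhds.2 fun v => ?_)
    (eventually_nhdsWithin_of_forall fun p hp v hv => ?_)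
  · by_cases h : v = k
    · subst h; simpa using hg
    · simpa [h] using tendsto_coord v
  · by_cases h : v = k
    · subst h; simpa using hk hv p hp
    · simpa [h] using hp v hv

theorem tendsto_update_rpow (i : V) {a : ℝ} (ha : 0 < a) :
    Tendsto (fun p : V → ℝ => Function.update p i (p i ^ a)) (gz D) (gz D) := by
  refine tendsto_update i ?_ fun hi p hp => Real.rpow_nonneg (hp i hi) _
  simpa [Real.zero_rpow ha.ne'] using (tendsto_coord i).rpow_const (Or.inr ha.le)

theorem tendsto_ramX {i : V} {γ : ℝ≥0} (hγ : 0 < γ) : Tendsto (ramX i γ) (gz D) (gz D) :=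
  tendsto_update_rpow i hγ

theorem expOk_nat_of {a : ℝ≥0} (ha : ExpOk A a)
    (h : (A.expSemiring : Set ℝ) = Set.range ((↑) : ℕ → ℝ)) : ∃ n : ℕ, a = n := by
  rcases ha with h1 | h1
  · exact h1
  · exact absurd h h1.1

/-- If the exponents are natural numbers, the ramifications `x = x' ^ k` are not part of the
hypotheses, and their effect on the series is computed coefficient by coefficient: `f = f|_{x = 0} +
x g`, and induction applies to `g`. -/
theorem co_ramX_nat_aux {i : V} (hi : i ∈ D) {k : ℕ} (hk : 1 ≤ k)
    (hN : (A.expSemiring : Set ℝ) = Set.range ((↑) : ℕ → ℝ))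
    (hG : ∀ f, IsG A D f → IsG A D (fun p => f (ramX i k p))) (N : ℕ) :
    ∀ f, IsG A D f →
      (∀ w : V → ℝ≥0, w i < N → co A D (fun p => f (ramX i k p)) (Function.update w i (k * w i)) =
        co A D f w) ∧
      ∀ w ∈ Supp A D (fun p => f (ramX i k p)), w i < N →
        ∃ x ∈ Supp A D f, w = Function.update x i (k * x i) := by
  induction N with
  | zero =>
    intro f hf
    exact ⟨fun w hw => absurd hw (by simp), fun w _ hw => absurd hw (by simp)⟩
  | succ N ih =>
    intro f hf
    have hk0 : (0 : ℝ≥0) < k := by exact_mod_cast hk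
    have hk1 : (1 : ℝ≥0) ≤ k := by exact_mod_cast hk
    obtain ⟨hc, hcc⟩ := hf.setZero_co i
    obtain ⟨g, hg, hfg⟩ := (hf.sub hc).exists_eq_rpow_mul (v := i) (a := ((1 : ℕ) : ℝ≥0)) (monoOk_single_nat i 1) (by
      intro w hw
      have h1 : co A D (fun p => f p - f (Function.update p i 0)) w ≠ 0 := hw
      rw [co_sub hf hc, hcc] at h1
      obtain ⟨n, hn⟩ := expOk_nat_of (((hf.sub hc).monoOk_of_mem_Supp hw).1 i hi) hN
      rcases Nat.eq_zero_or_pos n with rfl | hn0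
      · simp [hn] at h1
      · rw [hn]; exact_mod_cast hn0)
    obtain ⟨ih1, ih2⟩ := ih g hg
    have e1 : f =ᶠ[gz D] fun p => f (Function.update p i 0) + p i ^ (((1 : ℕ) : ℝ≥0) : ℝ) * g p := by
      filter_upwards [hfg] with p hp
      linarith
    have e2 : (fun p => f (ramX i k p)) =ᶠ[gz D]
        fun p => f (Function.update p i 0) + p i ^ ((k : ℝ≥0) : ℝ) * g (ramX i k p) := by
      filter_upwards [(tendsto_ramX hk0).eventually e1] with p hp
      rw [hp]
      simp [ramX]
    have f1 : ∀ w, co A D f w = (if w i = 0 then co A D f w else 0) +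
        if 1 ≤ w i then co A D g (w - Pi.single i 1) else 0 := by
      intro w
      conv_lhs => rw [co_congr e1]
      rw [co_add hc ((isG_rpow (monoOk_single_nat i 1)).mul hg), hcc, co_rpow_mul (monoOk_single_nat i 1) hg]
      simp
    have f2 : ∀ w, co A D (fun p => f (ramX i k p)) w = (if w i = 0 then co A D f w else 0) +
        if (k : ℝ≥0) ≤ w i then co A D (fun p => g (ramX i k p)) (w - Pi.single i (k : ℝ≥0)) else 0 := by
      intro w
      rw [co_congr e2, co_add hc ((isG_rpow (monoOk_single_nat i k)).mul (hG g hg)), hcc,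
        co_rpow_mul (monoOk_single_nat i k) (hG g hg)]
    constructor
    · intro w hw
      rw [f1 w, f2]
      simp only [Function.update_self, mul_eq_zero, hk0.ne', false_or]
      congr 1
      · by_cases h0 : w i = 0
        · rw [if_pos h0, if_pos h0]
          congr 1
          rw [h0, mul_zero, ← h0]
          exact Function.update_eq_self i w
        · rw [if_neg h0, if_neg h0]
      · by_cases h1 : 1 ≤ w i
        · rw [if_pos h1, if_pos (le_mul_of_one_le_right (zero_le) h1), ← ih1]
          · congr 1
            funext q
            by_cases hq : q = i
            · subst hq; simp [mul_tsub]
            · simp [hq]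
          · simp only [Pi.sub_apply, Pi.single_eq_same]
            rw [tsub_lt_iff_right h1]
            exact_mod_cast hw
        · rw [if_neg h1, if_neg]
          rw [not_le] at h1 ⊢
          exact mul_lt_of_lt_one_right hk0 h1
    · intro w hw hwN
      have hw' : co A D (fun p => f (ramX i k p)) w ≠ 0 := hw
      rw [f2] at hw'
      by_cases h0 : w i = 0
      · rw [if_pos h0, if_neg (by rw [h0, not_le]; exact hk0), add_zero] at hw'
        refine ⟨w, hw', ?_⟩
        rw [h0, mul_zero, ← h0]
        exact (Function.update_eq_self i w).symm
      · rw [if_neg h0, zero_add] at hw'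
        have hki : (k : ℝ≥0) ≤ w i := by
          by_contra h
          rw [if_neg h] at hw'
          exact hw' rfl
        rw [if_pos hki] at hw'
        obtain ⟨x, hx, hxw⟩ := ih2 _ hw' (by
          simp only [Pi.sub_apply, Pi.single_eq_same]
          rw [tsub_lt_iff_right hki]
          push_cast at hwN
          exact hwN.trans_le (add_le_add_right hk1 _))
        refine ⟨x + Pi.single i 1, ?_, ?_⟩
        · change co A D f _ ≠ 0
          rw [f1]
          simpa [Supp] using hx
        · funext q
          have := congrFun hxw q
          by_cases hq : q = i
          · subst hq
            simp only [Pi.sub_apply, Pi.single_eq_same, Function.update_self] at this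
            simp only [Function.update_self, Pi.add_apply, Pi.single_eq_same, mul_add, mul_one]
            rw [← this, tsub_add_cancel_of_le hki]
          · simpa [hq] using this

theorem IsG.co_ramX (hf : IsG A D f) {i : V} (hi : i ∈ D) {γ : ℝ≥0} (hγ : ExpOk A γ) (h0 : 0 < γ) :
    IsG A D (fun p => f (ramX i γ p)) ∧
      (∀ w, co A D (fun p => f (ramX i γ p)) (Function.update w i (γ * w i)) = co A D f w) ∧
      ∀ w ∈ Supp A D (fun p => f (ramX i γ p)),
        ∃ x ∈ Supp A D f, w = Function.update x i (γ * x i) := by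
  by_cases hN : (A.expSemiring : Set ℝ) = Set.range ((↑) : ℕ → ℝ)
  · obtain ⟨k, rfl⟩ := expOk_nat_of hγ hN
    have hk : 1 ≤ k := by exact_mod_cast h0
    -- the composition with `x' ^ k` comes from iterated substitutions, see `powX`
    have hG : ∀ f, IsG A D f → IsG A D (fun p => f (ramX i k p)) := by
      rintro f ⟨m, n, e, he, h⟩
      obtain ⟨i, rfl⟩ := exists_inl_of_mem he hi
      refine ⟨m, n, e, he, ?_⟩
      have h1 := h.powX i (k - 1)
      rw [Nat.sub_add_cancel hk] at h1
      simpa [pull_update_inl, ramX] using h1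
    refine ⟨hG f hf, fun w => ?_, fun w hw => ?_⟩
    · obtain ⟨N, hN'⟩ := exists_nat_gt (w i)
      exact (co_ramX_nat_aux hi hk hN hG N f hf).1 w hN'
    · obtain ⟨N, hN'⟩ := exists_nat_gt (w i)
      exact (co_ramX_nat_aux hi hk hN hG N f hf).2 w hw hN'
  -- otherwise the ramifications belong to the hypotheses on the collection
  · obtain ⟨m, n, h1⟩ := exists_frame_x hi
    obtain ⟨e, he, rfl⟩ := h1 0
    have h := hf.isGerm he
    obtain ⟨h2, h3⟩ := A.ramification hN γ hγ.mem_field h0 _ h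
    obtain ⟨h4, h5⟩ := (FormalMap.isComp_iff_of_monomial (ram_expo_injective 0 h0)
      (ramFormal_monomial 0 γ)).1 h3
    simp only [pull_update_inl] at h2 h4 h5
    have h2' : A.IsGerm (fun p => f (ramX (e (Sum.inl 0)) γ (pull e p))) := by
      simpa [ramX] using h2
    have hs : A.ser _ h2' = A.ser _ h2 := ser_congr (Eventually.of_forall fun p => by simp [ramX]) _ _
    refine ⟨⟨_, _, e, he, h2'⟩, fun w => ?_, fun w hw => ?_⟩
    · by_cases hw : w ∈ Set.range (ex e)
      · obtain ⟨u, rfl⟩ := hw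
        rw [← ex_ram, co_ex he h2', hs, co_ex he h, h4]
      · rw [co_of_notMem he hw, co_of_notMem he]
        rintro ⟨u, hu⟩
        apply hw
        exact mem_range_ex fun k => by simpa using congrFun hu (e (Sum.inr k))
    · rw [Supp_eq he h2'] at hw
      obtain ⟨u, hu, rfl⟩ := hw
      rw [hs] at hu
      have h6 : u ∈ Set.range fun w : Expo (m + 1) n =>
          ((Function.update w.1 0 (γ * w.1 0), w.2) : Expo (m + 1) n) := by
        by_contra h6
        exact hu (h5 u h6)
      obtain ⟨y, rfl⟩ := h6
      refine ⟨ex e y, ?_, ex_ram e 0 γ y⟩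
      rw [Supp_eq he h]
      refine ⟨y, ?_, rfl⟩
      rw [HahnSeries.mem_support, ← h4]
      exact hu

end Charts

/-! ### Independence of binomial series -/

section Independence

/-- The sequences `k ↦ (a choose k)`, for distinct real numbers `a`, are linearly independent. -/
theorem eq_zero_of_sum_choose {ι : Type*} (s : Finset ι) (w a : ι → ℝ) (ha : Set.InjOn a s)
    (h : ∀ k : ℕ, ∑ e ∈ s, w e * Ring.choose (a e) k = 0) : ∀ e ∈ s, w e = 0 := by
  classical
  have hstep : ∀ (x : ℝ) (k : ℕ), x * Ring.choose x k =
      (k + 1) * Ring.choose x (k + 1) + k * Ring.choose x k := by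
    intro x k
    have h1 := Ring.descPochhammer_eq_factorial_smul_choose x k
    have h2 := Ring.descPochhammer_eq_factorial_smul_choose x (k + 1)
    rw [descPochhammer_succ_right, Polynomial.smeval_mul, Polynomial.smeval_sub,
      Polynomial.smeval_X, Polynomial.smeval_natCast, h1] at h2
    simp only [nsmul_eq_mul, Nat.factorial_succ, Nat.cast_mul, pow_zero, pow_one, mul_one] at h2
    have h3 : ((k.factorial : ℕ) : ℝ) ≠ 0 := by exact_mod_cast k.factorial_ne_zero
    apply mul_left_cancel₀ h3
    push_cast at h2
    linarith
  have hpow : ∀ n k : ℕ, ∑ e ∈ s, w e * (a e ^ n * Ring.choose (a e) k) = 0 := by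
    intro n
    induction n with
    | zero => simpa using h
    | succ n ih =>
      intro k
      have h1 : ∀ e ∈ s, w e * (a e ^ (n + 1) * Ring.choose (a e) k) =
          (k + 1) * (w e * (a e ^ n * Ring.choose (a e) (k + 1))) +
            k * (w e * (a e ^ n * Ring.choose (a e) k)) := by
        intro e _
        rw [pow_succ, mul_assoc (a e ^ n), hstep]
        ring
      rw [Finset.sum_congr rfl h1, Finset.sum_add_distrib, ← Finset.mul_sum, ← Finset.mul_sum, ih, ih]
      simp
  have hpoly : ∀ P : Polynomial ℝ, ∑ e ∈ s, w e * P.eval (a e) = 0 := by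
    intro P
    simp_rw [Polynomial.eval_eq_sum_range, Finset.mul_sum]
    rw [Finset.sum_comm]
    refine Finset.sum_eq_zero fun i _ => ?_
    have := hpow i 0
    simp only [Ring.choose_zero_right, mul_one] at this
    calc ∑ e ∈ s, w e * (P.coeff i * a e ^ i) = P.coeff i * ∑ e ∈ s, w e * a e ^ i := by
          rw [Finset.mul_sum]; exact Finset.sum_congr rfl fun _ _ => by ring
      _ = 0 := by rw [this, mul_zero]
  intro e he
  have h1 := hpoly (∏ x ∈ s.erase e, (Polynomial.X - Polynomial.C (a x)))
  rw [Finset.sum_eq_single e] at h1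
  · refine (mul_eq_zero.1 h1).resolve_right ?_
    rw [Polynomial.eval_prod]
    refine Finset.prod_ne_zero_iff.2 fun x hx => ?_
    simp only [Polynomial.eval_sub, Polynomial.eval_X, Polynomial.eval_C, sub_ne_zero]
    intro hax
    exact (Finset.mem_erase.1 hx).1 (ha (Finset.mem_erase.1 hx).2 he hax.symm)
  · intro b hb hbe
    rw [Polynomial.eval_prod, Finset.prod_eq_zero (i := b), mul_zero]
    · exact Finset.mem_erase.2 ⟨hbe, hb⟩
    · simp
  · exact fun h => absurd he h

/-- The charts with `λ > 0` kill no nonzero series. The monomials that contribute to the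
coefficients of the image with given exponents, that of the new variable excepted, differ in the
exponent of `x_i` only, and their binomial series are linearly independent by
`eq_zero_of_sum_choose`. -/
theorem xx_ne_zero {m n : ℕ} {i : Fin (m + 1)} {j : Fin m} {hji : j.castSucc < i} {lam : ℝ}
    {hlam : 0 < lam} {F : GenSeries (m + 1) n} {G : GenSeries m (n + 1)}
    (h : (BlowUpChart.xx (n := n) i j hji lam hlam).formal.IsComp F G) (hF : F ≠ 0) : G ≠ 0 := by
  classical
  intro hG
  obtain ⟨e0, he0⟩ : ∃ e, F.coeff e ≠ 0 := by
    by_contra! hcon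
    exact hF (HahnSeries.ext (funext hcon))
  set σ : Expo (m + 1) n → Fin m → ℝ≥0 := fun e =>
    Pi.single j (e.1 i) + fun k => e.1 (i.succAbove k) with hσ
  -- the coefficient of the image of a monomial
  have hmon : ∀ (e : Expo (m + 1) n) (k : ℕ),
      ((BlowUpChart.xx (n := n) i j hji lam hlam).formal.monomial e).coeff
        (σ e0, Fin.cons k e0.2) =
        if σ e = σ e0 ∧ e.2 = e0.2 then
          lam ^ (e.1 i : ℝ) * Ring.choose (e.1 i : ℝ) k * lam⁻¹ ^ k else 0 := by
    intro e k
    rw [xx_monomial]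
    split_ifs with hc
    · have h1 : ((σ e0, Fin.cons k e0.2) : Expo m (n + 1)) =
          ((0, Pi.single 0 k) : Expo m (n + 1)) + (σ e, Fin.cons 0 e.2) := by
        refine Prod.ext ?_ (funext fun q => ?_)
        · simp [hc.1]
        · refine Fin.cases ?_ (fun q => ?_) q <;> simp [hc.2]
      rw [h1, HahnSeries.coeff_single_mul_add, one_mul, binomialSeries_coeff]
    · by_contra hne
      obtain ⟨a, ha, b, hb, hab⟩ := HahnSeries.support_mul_subset
        ((HahnSeries.mem_support _ _).2 hne)
      rw [HahnSeries.support_single_of_ne one_ne_zero, Set.mem_singleton_iff] at ha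
      have hb' : b.1 = 0 ∧ b.2 = Pi.single 0 (b.2 0) := by
        by_contra h'
        exact hb (binomialSeries_coeff_eq_zero _ _ h')
      subst ha
      apply hc
      have h1 := congrArg Prod.fst hab
      have h2 := congrArg Prod.snd hab
      simp only [Prod.fst_add, Prod.snd_add, hb'.1, add_zero] at h1 h2
      refine ⟨h1, funext fun q => ?_⟩
      have h3 := congrFun h2 q.succ
      rw [hb'.2] at h3
      simpa using h3
  set Φ : Set (Expo (m + 1) n) := {e | F.coeff e ≠ 0 ∧ σ e = σ e0 ∧ e.2 = e0.2} with hΦ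
  have hfin : Φ.Finite := by
    refine (h (σ e0, Fin.cons 0 e0.2)).1.subset ?_
    rintro e ⟨h1, h2⟩
    rw [Function.mem_support, hmon, if_pos h2]
    refine mul_ne_zero h1 ?_
    simpa using (Real.rpow_pos_of_pos hlam _).ne'
  have hsum : ∀ k : ℕ, ∑ e ∈ hfin.toFinset,
      (F.coeff e * lam ^ (e.1 i : ℝ)) * Ring.choose (e.1 i : ℝ) k = 0 := by
    intro k
    have h1 := (h (σ e0, Fin.cons k e0.2)).2
    rw [hG, HahnSeries.coeff_zero] at h1
    rw [finsum_eq_sum_of_support_subset (s := hfin.toFinset)] at h1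
    · have h2 : ∀ e ∈ hfin.toFinset, F.coeff e *
          ((BlowUpChart.xx (n := n) i j hji lam hlam).formal.monomial e).coeff
            (σ e0, Fin.cons k e0.2) =
          lam⁻¹ ^ k * ((F.coeff e * lam ^ (e.1 i : ℝ)) * Ring.choose (e.1 i : ℝ) k) := by
        intro e he
        rw [Set.Finite.mem_toFinset] at he
        rw [hmon, if_pos he.2]
        ring
      rw [Finset.sum_congr rfl h2, ← Finset.mul_sum] at h1
      refine (mul_eq_zero.1 h1.symm).resolve_left ?_
      exact pow_ne_zero _ (inv_ne_zero hlam.ne')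
    · intro e he
      rw [Set.Finite.coe_toFinset]
      rw [Function.mem_support, hmon] at he
      refine ⟨left_ne_zero_of_mul he, ?_⟩
      by_contra h'
      rw [if_neg h'] at he
      simp at he
  have hinj : Set.InjOn (fun e : Expo (m + 1) n => (e.1 i : ℝ)) hfin.toFinset := by
    intro a ha b hb hab
    rw [Set.Finite.coe_toFinset] at ha hb
    have hi : a.1 i = b.1 i := NNReal.coe_injective hab
    refine Prod.ext (funext fun q => ?_) (ha.2.2.trans hb.2.2.symm)
    by_cases hq : q = i
    · rw [hq, hi]
    · obtain ⟨k, rfl⟩ := Fin.exists_succAbove_eq hq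
      have h1 := congrFun (ha.2.1.trans hb.2.1.symm) k
      simp only [hσ, Pi.add_apply, hi] at h1
      exact add_left_cancel h1
  have h0 := eq_zero_of_sum_choose _ _ _ hinj hsum e0 (by
    rw [Set.Finite.mem_toFinset]
    exact ⟨he0, rfl, rfl⟩)
  exact (mul_ne_zero he0 (Real.rpow_pos_of_pos hlam _).ne') h0

variable {V : Type} [Fintype V] [DecidableEq V] {A : QuasianalyticSystem} {D : Finset V}
  {f g : (V → ℝ) → ℝ}

theorem exists_frame_last {i : V} (hi : i ∈ D) {j : V} (hj : j ∈ D) (hij : i ≠ j) :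
    ∃ (m n : ℕ) (e : Fin (m + 1) ⊕ Fin n ≃ V) (k : Fin m), Fr e D ∧ e (Sum.inl (Fin.last m)) = i ∧
      e (Sum.inl k.castSucc) = j := by
  obtain ⟨m, n, h1⟩ := exists_frame_x hi
  obtain ⟨e, he, rfl⟩ := h1 (Fin.last m)
  obtain ⟨k, rfl⟩ := exists_inl_of_mem he hj
  have hk : k ≠ Fin.last m := fun h => hij (by rw [h])
  obtain ⟨k, rfl⟩ := Fin.exists_castSucc_eq.2 hk
  exact ⟨m, n, e, k, he, rfl, rfl⟩

theorem IsG.blow_pos (hf : IsG A D f) {i j : V} (hi : i ∈ D) (hj : j ∈ D) (hij : i ≠ j) {lam : ℝ}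
    (hlam : 0 < lam) : IsG A (D.erase i) (fun p => f (blow i j lam p)) ∧
      (¬ f =ᶠ[gz D] 0 → ¬ (fun p => f (blow i j lam p)) =ᶠ[gz (D.erase i)] 0) := by
  obtain ⟨m, n, e, k, he, rfl, rfl⟩ := exists_frame_last hi hj hij
  have h := hf.isGerm he
  obtain ⟨h1, h2⟩ := A.blowUp (BlowUpChart.xx (Fin.last m) k (Fin.castSucc_lt_last k) lam hlam) _ h
  have h3 := he.xtoY (Fin.last m)
  simp only [pull_xx] at h1
  have hG : IsG A (D.erase (e (Sum.inl (Fin.last m))))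
      (fun p => f (blow (e (Sum.inl (Fin.last m))) (e (Sum.inl k.castSucc)) lam p)) :=
    ⟨_, _, _, h3, h1⟩
  refine ⟨hG, fun hne h0 => hne ?_⟩
  rw [← hf.Supp_eq_empty_iff, Supp_eq he h]
  rw [← hG.Supp_eq_empty_iff, Supp_eq h3 h1, Set.image_eq_empty, HahnSeries.support_eq_empty_iff] at h0
  rw [Set.image_eq_empty, HahnSeries.support_eq_empty_iff]
  by_contra h4
  refine xx_ne_zero h2 h4 ?_
  rw [← h0]
  exact ser_congr (Eventually.of_forall fun p => by simp only [pull_xx]) _ _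

end Independence

/-! ### Substitutions -/

section Substitutions

variable {A : QuasianalyticSystem}

theorem isGerm_cast {m m' n : ℕ} (h : m' = m) {f : Pt m' n → ℝ} (hf : A.IsGerm f) :
    A.IsGerm (fun p : Pt m n => f (fun i => p.1 (Fin.cast h i), p.2)) := by
  subst h
  exact hf

/-- Substitution in a germ that has only `y`-variables. -/
theorem TaylorAlgebras.IsGerm.compY {n m' n' : ℕ} {f : Pt 0 n → ℝ} (hf : A.IsGerm f)
    {g : Fin n → Pt m' n' → ℝ} (hg : ∀ j, A.IsGerm (g j)) (h0 : ∀ j, g j 0 = 0) :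
    A.IsGerm (fun p : Pt m' n' => f (Fin.elim0, fun j => g j p)) := by
  obtain ⟨h, -⟩ := A.compose f hf g hg h0
  convert isGerm_cast (Nat.zero_add m') h using 3 with p
  refine Prod.ext (Subsingleton.elim _ _) (funext fun j => congrArg (g j) ?_)
  refine Prod.ext (funext fun i => congrArg p.1 ?_) rfl
  ext
  simp

/-- A germ, with dummy `x`-variables in front. -/
theorem TaylorAlgebras.IsGerm.frontX {m m' n' : ℕ} {u : Pt m' n' → ℝ} (hu : A.IsGerm u) :
    A.IsGerm (fun p : Pt (m + m') n' => u (fun i => p.1 (Fin.natAdd m i), p.2)) := by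
  obtain ⟨h, -⟩ := A.compose (m := m) (n := 1) _ (isGerm_y 0) (fun _ p => u p - u 0)
    (fun _ => hu.sub (isGerm_const _ _ _)) (fun _ => sub_self _)
  convert h.add (isGerm_const _ _ (u 0)) using 2 with p
  simp

/-- Substitution of products `x_i u_i` with positive units `u_i` for the `x`-variables, and of
arbitrary germs for the `y`-variables. -/
theorem TaylorAlgebras.IsGerm.subXY {m n n' : ℕ} {f : Pt m n → ℝ} (hf : A.IsGerm f)
    {u : Fin m → Pt m n' → ℝ} (hu : ∀ i, A.IsGerm (u i)) (hu0 : ∀ i, 0 < u i 0)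
    {g : Fin n → Pt m n' → ℝ} (hg : ∀ j, A.IsGerm (g j)) (h0 : ∀ j, g j 0 = 0) :
    A.IsGerm (fun p : Pt m n' => f (fun i => p.1 i * u i p, fun j => g j p)) := by
  classical
  obtain ⟨h, -⟩ := A.compose f hf g hg h0
  -- the `x`-variables are doubled: the units `u_i` depend on the second copy, while the first copy
  -- is multiplied by them one variable at a time; at the end the copies are identified
  have h1 : ∀ S : Finset (Fin m), A.IsGerm (fun p : Pt (m + m) n' =>
      f (fun i => p.1 (Fin.castAdd m i) *
          if i ∈ S then u i (fun k => p.1 (Fin.natAdd m k), p.2) else 1,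
        fun j => g j (fun k => p.1 (Fin.natAdd m k), p.2))) := by
    intro S
    induction S using Finset.induction_on with
    | empty => simpa using h
    | insert k S hk ih =>
      have h2 := ih.subX ((hu k).frontX (m := m)) (Fin.castAdd m k) (hu0 k)
      convert h2 using 3 with p
      have h3 : ∀ (a : ℝ) (l : Fin m), Function.update p.1 (Fin.castAdd m k) a (Fin.natAdd m l) =
          p.1 (Fin.natAdd m l) := by
        intro a l
        rw [Function.update_of_ne]
        intro h'
        have := congrArg Fin.val h'
        simp at this
        have := k.2
        omega
      simp only [h3]
      refine Prod.ext (funext fun i => ?_) rfl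
      by_cases hi : i = k
      · subst hi
        simp [hk]
      · have h4 : Fin.castAdd m i ≠ Fin.castAdd m k := fun h => hi (Fin.castAdd_injective _ _ h)
        simp [hi, h4]
  have h5 := TaylorAlgebras.IsGerm.diag m (h1 Finset.univ) id
  convert h5 using 3 with p
  have h6 : (fun k => Fin.append p.1 (fun i => p.1 (id i)) (Fin.natAdd m k)) = p.1 := by
    funext k
    exact Fin.append_right _ _ _
  simp only [h6]
  refine Prod.ext (funext fun i => ?_) rfl
  simp

variable {V W : Type} [Fintype V] [DecidableEq V] [Fintype W] [DecidableEq W] {D : Finset V}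
  {D' : Finset W}

/-- The substitutions allowed in a germ: with the `x`-variables renamed by a bijection, products
`x_i u_i` with positive units for the `x`-variables, and arbitrary germs that vanish at the origin
for the `y`-variables. -/
theorem IsG.subst {f : (V → ℝ) → ℝ} (hf : IsG A D f) (σ : V → W) (hσ : Set.BijOn σ D D')
    {ψ : (W → ℝ) → V → ℝ} {u : V → (W → ℝ) → ℝ} (hu : ∀ v ∈ D, IsG A D' (u v))
    (hu0 : ∀ v ∈ D, 0 < u v 0) (hx : ∀ v ∈ D, (fun q => ψ q v) =ᶠ[gz D'] fun q => q (σ v) * u v q)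
    (hy : ∀ v ∉ D, IsG A D' (fun q => ψ q v)) (hy0 : ∀ v ∉ D, ψ 0 v = 0) :
    IsG A D' (fun q => f (ψ q)) := by
  obtain ⟨m, n, e, he, h⟩ := hf
  obtain ⟨m', n', e', he'⟩ := exists_frame D'
  -- the numbering of the new `x`-variables that corresponds to the old one
  have hex : ∀ i : Fin m, ∃ k, e' (Sum.inl k) = σ (e (Sum.inl i)) := fun i =>
    exists_inl_of_mem he' (hσ.mapsTo (he.1 i))
  choose a ha using hex
  have hainj : Function.Injective a := by
    intro i k hik
    have := hσ.injOn (he.1 i) (he.1 k) (by rw [← ha, ← ha, hik])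
    simpa using this
  have hasurj : Function.Surjective a := by
    intro k
    obtain ⟨v, hv, hvk⟩ := hσ.surjOn (he'.1 k)
    obtain ⟨i, rfl⟩ := exists_inl_of_mem he hv
    refine ⟨i, ?_⟩
    have := (ha i).trans hvk
    simpa using this
  let b : Fin m ≃ Fin m' := Equiv.ofBijective a ⟨hainj, hasurj⟩
  let e'' : Fin m ⊕ Fin n' ≃ W := (Equiv.sumCongr b (Equiv.refl _)).trans e'
  have he'' : Fr e'' D' := ⟨fun i => he'.1 _, fun j => he'.2 _⟩
  have hb : ∀ i, e'' (Sum.inl i) = σ (e (Sum.inl i)) := ha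
  refine ⟨m, n', e'', he'', ?_⟩
  have h1 := h.subXY (fun i => (hu _ (he.1 i)).isGerm he'') (fun i => by
    simpa [pull_zero] using hu0 _ (he.1 i)) (fun j => (hy _ (he.2 j)).isGerm he'') (fun j => by
    simpa [pull_zero] using hy0 _ (he.2 j))
  refine isGerm_congr ?_ h1
  have h2 : ∀ᶠ p in 𝓝[Quad m n'] 0, ∀ i : Fin m, ψ (pull e'' p) (e (Sum.inl i)) =
      p.1 i * u (e (Sum.inl i)) (pull e'' p) := by
    rw [eventually_all]
    intro i
    filter_upwards [he''.tendsto_pull.eventually (hx _ (he.1 i))] with p hp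
    rw [hp, ← hb, pull_inl]
  filter_upwards [h2] with p hp
  congr 1
  funext v
  refine frame_forall e (P := fun v => pull e _ v = ψ (pull e'' p) v) ?_ ?_ v
  · intro i; rw [pull_inl, hp]
  · intro j; rw [pull_inr]

/-- Substitution for `y`-variables. -/
theorem IsG.subst_y {V : Type} [Fintype V] [DecidableEq V] {D : Finset V} {f : (V → ℝ) → ℝ}
    (hf : IsG A D f) {ψ : (V → ℝ) → V → ℝ}
    (hx : ∀ v ∈ D, ∀ q, ψ q v = q v) (hy : ∀ v ∉ D, IsG A D (fun q => ψ q v))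
    (hy0 : ∀ v ∉ D, ψ 0 v = 0) : IsG A D (fun q => f (ψ q)) :=
  hf.subst id (Set.bijOn_id _) (u := fun _ _ => 1) (fun _ _ => isG_const 1) (fun _ _ => one_pos)
    (fun v hv => Eventually.of_forall fun q => by simp [hx v hv]) hy hy0

variable {f : (V → ℝ) → ℝ}

theorem IsG.update_y (hf : IsG A D f) {k : V} (hk : k ∉ D) {g : (V → ℝ) → ℝ} (hg : IsG A D g)
    (h0 : g 0 = 0) : IsG A D (fun q => f (Function.update q k (g q))) := by
  refine hf.subst_y (fun v hv q => ?_) (fun v _ => ?_) (fun v _ => ?_)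
  · rw [Function.update_of_ne]
    rintro rfl
    exact hk hv
  · by_cases h : v = k
    · subst h; simpa using hg
    · simpa [h] using isG_coord v
  · by_cases h : v = k
    · subst h; simpa using h0
    · simp [h]

theorem IsG.trans (hf : IsG A D f) {k : V} (hk : k ∉ D) {h : (V → ℝ) → ℝ} (hh : IsG A D h)
    (h0 : h 0 = 0) : IsG A D (fun q => f (trans k h q)) :=
  hf.update_y hk ((isG_coord k).add hh) (by simp [h0])

theorem IsG.blow_y (hf : IsG A D f) {i : V} (hi : i ∉ D) (j : V) (lam : ℝ) :
    IsG A D (fun q => f (blow i j lam q)) :=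
  hf.update_y hi ((isG_coord j).mul ((isG_const lam).add (isG_coord i))) (by simp)

theorem IsG.ramY (hf : IsG A D f) {i : V} (hi : i ∉ D) {d : ℕ} (hd : 1 ≤ d) (ε : ℤˣ) :
    IsG A D (fun q => f (ramY i d ε q)) :=
  hf.update_y hi ((isG_const _).mul ((isG_coord i).pow d)) (by simp; omega)

theorem IsG.blowInf (hf : IsG A D f) {i j : V} (hi : i ∉ D) (hj : j ∈ D) (ε : ℤˣ) :
    IsG A (insert i D) (fun q => f (blowInf i j ε q)) := by
  obtain ⟨m, n, h1⟩ := exists_frame_y hi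
  obtain ⟨e, he, rfl⟩ := h1 0
  obtain ⟨j, rfl⟩ := exists_inl_of_mem he hj
  obtain ⟨h2, -⟩ := A.blowUp (BlowUpChart.yxInfty 0 j ε) _ (hf.isGerm he)
  simp only [pull_yxInfty] at h2
  exact ⟨_, _, _, he.ytoX 0, h2⟩

end Substitutions

/-! ### Germs at nearby points and powers of units -/

section Nearby

variable {V : Type} [Fintype V] [DecidableEq V] {A : QuasianalyticSystem} {D : Finset V}
  {f g : (V → ℝ) → ℝ}

open Classical in
/-- The `x`-variables at the point `a`: those that vanish there. -/
def Da (D : Finset V) (a : V → ℝ) : Finset V := {v ∈ D | a v = 0}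

theorem mem_Da {a : V → ℝ} {v : V} : v ∈ Da D a ↔ v ∈ D ∧ a v = 0 := by
  classical
  simp [Da]

theorem Da_zero : Da D (0 : V → ℝ) = D := by
  ext v
  simp [mem_Da]

theorem tendsto_translate {a : V → ℝ} (ha : a ∈ Qd D) :
    Tendsto (fun p => a + p) (gz (Da D a)) (𝓝[Qd D] a) := by
  refine tendsto_nhdsWithin_iff.2 ⟨?_, ?_⟩
  · have : Tendsto (fun p : V → ℝ => a + p) (𝓝 0) (𝓝 (a + 0)) :=
      (continuous_const.add continuous_id).tendsto 0
    rw [add_zero] at this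
    exact this.mono_left nhdsWithin_le_nhds
  · have h : ∀ᶠ p : V → ℝ in gz (Da D a), ∀ v : V, v ∈ D → 0 ≤ a v + p v := by
      rw [eventually_all]
      intro v
      by_cases hv : v ∈ D
      · rcases eq_or_lt_of_le (ha v hv) with h0 | h0
        · filter_upwards [self_mem_nhdsWithin] with p hp _
          rw [← h0, zero_add]
          exact hp v (mem_Da.2 ⟨hv, h0.symm⟩)
        · have : Tendsto (fun p : V → ℝ => a v + p v) (𝓝 0) (𝓝 (a v + 0)) :=
            (continuous_const.add (continuous_apply v)).tendsto 0
          rw [add_zero] at this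
          filter_upwards [nhdsWithin_le_nhds (this.eventually (lt_mem_nhds h0))] with p hp _
          exact hp.le
      · exact Eventually.of_forall fun p h => absurd h hv
    filter_upwards [h] with p hp v hv
    exact hp v hv

theorem eventually_translate {P : (V → ℝ) → Prop} (h : ∀ᶠ p in gz D, P p) :
    ∀ᶠ a in gz D, ∀ᶠ p in gz (Da D a), P (a + p) := by
  filter_upwards [eventually_eventually_nhdsWithin.2 h, self_mem_nhdsWithin] with a ha hq
  exact (tendsto_translate hq).eventually ha

/-- The numbering of the variables at a nearby point. -/
def nearFrame {m n m' l : ℕ} (e : Fin m ⊕ Fin n ≃ V) (ς : Fin m' ⊕ Fin l ≃ Fin m) :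
    Fin m' ⊕ Fin (l + n) ≃ V :=
  ((Equiv.sumCongr (Equiv.refl _) finSumFinEquiv.symm).trans (Equiv.sumAssoc _ _ _).symm).trans
    ((Equiv.sumCongr ς (Equiv.refl _)).trans e)

/-- Near the origin, germs of the collection are given by germs of the collection. -/
theorem IsG.eventually_translate (hf : IsG A D f) :
    ∀ᶠ a in gz D, IsG A (Da D a) (fun p => f (a + p)) := by
  obtain ⟨m, n, e, he, h⟩ := hf
  rw [he.eventually_iff]
  obtain ⟨r, g, hg, hfg⟩ := (isGerm_iff A _).1 h
  filter_upwards [eventually_eventually_nhdsWithin.2 (box_mem r), box_mem r,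
    eventually_eventually_nhdsWithin.2 hfg, self_mem_nhdsWithin] with p h1 h2 h3 hp
  obtain ⟨m', l, ς, g', hς0, hς1, hg', h4⟩ := A.analytic r g hg p h2
  -- the `x`-variables that do not vanish at the point are counted among the `y`-variables
  set e2 := nearFrame e ς with he2
  have k1 : ∀ i, e2 (Sum.inl i) = e (Sum.inl (ς (Sum.inl i))) := fun i => rfl
  have k2 : ∀ k, e2 (Sum.inr (Fin.castAdd n k)) = e (Sum.inl (ς (Sum.inr k))) := by
    intro k
    simp [he2, nearFrame]
  have k3 : ∀ j, e2 (Sum.inr (Fin.natAdd l j)) = e (Sum.inr j) := by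
    intro k
    simp [he2, nearFrame]
  have hFr : Fr e2 (Da D (pull e p)) := by
    constructor
    · intro i
      rw [k1, mem_Da, pull_inl]
      exact ⟨he.1 _, hς0 i⟩
    · intro j
      refine Fin.addCases (fun k => ?_) (fun j => ?_) j
      · rw [k2, mem_Da, pull_inl]
        exact fun h => hς1 k h.2
      · rw [k3, mem_Da]
        exact fun h => he.2 j h.1
  refine ⟨_, _, e2, hFr, isGerm_congr ?_ hg'⟩
  have ht : Tendsto (fun q => push e (pull e p + pull e2 q)) (𝓝[Quad m' (l + n)] 0)
      (𝓝[Quad m n] p) := by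
    have t1 := (tendsto_translate (D := D) (he.pull_mem.2 hp)).comp hFr.tendsto_pull
    refine tendsto_nhdsWithin_iff.2 ⟨?_, ?_⟩
    · have := ((continuous_push e).tendsto (pull e p)).comp (tendsto_nhdsWithin_iff.1 t1).1
      rwa [push_pull] at this
    · filter_upwards [(tendsto_nhdsWithin_iff.1 t1).2] with q hq i
      exact hq _ (he.1 i)
  have ht' : Tendsto (fun q => push e (pull e p + pull e2 q)) (𝓝[Quad m' (l + n)] 0)
      (𝓝[r.box] p) :=
    tendsto_nhdsWithin_iff.2 ⟨(tendsto_nhdsWithin_iff.1 ht).1, ht.eventually h1⟩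
  filter_upwards [ht.eventually h3, ht'.eventually h4] with q h5 h6
  rw [pull_push] at h5
  rw [h5, h6]
  congr 1
  refine Prod.ext (funext fun i => ?_) (funext fun j => ?_)
  · simp [push, ← k1]
  · refine Fin.addCases (fun k => ?_) (fun j => ?_) j
    · simp [push, ← k2]
    · have h7 : pull e p (e2 (Sum.inr (Fin.natAdd l j))) = p.2 j := by rw [k3, pull_inr]
      simp [push, ← k3, h7]

theorem IsG.comp {W : Type} [Fintype W] [DecidableEq W] {D' : Finset W} {f : (V → ℝ) → ℝ}
    (hf : IsG A ∅ f) {g : V → (W → ℝ) → ℝ} (hg : ∀ v, IsG A D' (g v)) (h0 : ∀ v, g v 0 = 0) :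
    IsG A D' (fun q => f (fun v => g v q)) := by
  obtain ⟨m, n, e, he, h⟩ := hf
  obtain rfl : m = 0 := by
    rcases m with _ | m
    · rfl
    · exact absurd (he.1 0) (by simp)
  obtain ⟨m', n', e', he'⟩ := exists_frame D'
  refine ⟨m', n', e', he', ?_⟩
  have h1 := h.compY (fun j => (hg (e (Sum.inr j))).isGerm he') (fun j => by
    simpa [pull_zero] using h0 _)
  convert h1 using 3 with p
  funext v
  refine frame_forall e (P := fun v => g v (pull e' p) = pull e _ v) ?_ ?_ v
  · intro i; exact i.elim0
  · intro j; simp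

variable (A) in
/-- The power `(1 + y) ^ r` is a germ of the collection. -/
def PowOk (r : ℝ) : Prop := IsG (V := Unit) A ∅ (fun p => (1 + p ()) ^ r)

theorem isG_unit_rpow {r : ℝ} (hr : PowOk A r) {u : (V → ℝ) → ℝ} (hu : IsG A D u) (h0 : 0 < u 0) :
    IsG A D (fun p => u p ^ r) := by
  have h1 : IsG A D (fun p => (u 0)⁻¹ * u p - 1) :=
    ((isG_const _).mul hu).sub (isG_const 1)
  have h2 := (isG_const (u 0 ^ r)).mul (IsG.comp hr (fun _ => h1) (fun _ => by
    rw [inv_mul_cancel₀ h0.ne', sub_self]))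
  refine h2.congr ?_
  filter_upwards [hu.tendsto.eventually (lt_mem_nhds h0)] with p hp
  rw [add_sub_cancel, ← Real.mul_rpow h0.le (by positivity), mul_inv_cancel_left₀ h0.ne']

/-- The numbering of a single `y`-variable. -/
def unitFrame : Fin 0 ⊕ Fin 1 ≃ Unit := (Equiv.emptySum _ _).trans (Equiv.ofUnique _ _)

theorem fr_unitFrame : Fr unitFrame ∅ := ⟨fun i => i.elim0, fun _ => by simp⟩

/-- The powers `1 / d` of units, and `-1`, by the implicit function theorem. -/
theorem powOk_of_implicit {F : ℝ → ℝ → ℝ} {r : ℝ}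
    (hF : A.IsGerm (fun p : Pt 0 2 => F (p.2 0) (p.2 1))) (h0 : F 0 0 = 0)
    (hd : ∃ d : ℝ, d ≠ 0 ∧ HasDerivAt (F 0) d 0)
    (hr : ∀ᶠ q : ℝ × ℝ in 𝓝 0, F q.1 q.2 = 0 → 1 + q.2 = (1 + q.1) ^ r) : PowOk A r := by
  obtain ⟨g, hg, hg0, hgF⟩ := A.implicit (m := 0) (n := 1) _ hF h0 (by
    obtain ⟨d, hd0, hd⟩ := hd
    refine ⟨d, hd0, ?_⟩
    convert hd using 2 with t
    rfl)
  refine ⟨0, 1, unitFrame, fr_unitFrame, ?_⟩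
  refine isGerm_congr ?_ ((isGerm_const 0 1 1).add hg)
  have hg1 := hg.continuousWithinAt
  rw [hg0] at hg1
  have ht : Tendsto (fun p : Pt 0 1 => (p.2 0, g p)) (𝓝[Quad 0 1] 0) (𝓝 (0, 0)) := by
    refine Tendsto.prodMk_nhds ?_ hg1
    exact (((continuous_apply 0).comp continuous_snd).tendsto (0 : Pt 0 1)).mono_left
      nhdsWithin_le_nhds
  filter_upwards [hgF, ht.eventually hr] with p h1 h2
  have h5 : Fin.snoc (α := fun _ => ℝ) p.2 (g p) 1 = g p := Fin.snoc_last (α := fun _ => ℝ) _ _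
  have h6 : Fin.snoc (α := fun _ => ℝ) p.2 (g p) 0 = p.2 0 :=
    Fin.snoc_castSucc (α := fun _ => ℝ) (g p) p.2 0
  have h3 := h2 (by simpa only [h5, h6] using h1)
  have h4 : pull unitFrame p () = p.2 0 := pull_inr (e := unitFrame) p 0
  rw [h3, h4]

theorem powOk_neg_one : PowOk A (-1) := by
  refine powOk_of_implicit (F := fun s t => (1 + s) * (1 + t) - 1) ?_ (by norm_num) ⟨1, one_ne_zero, ?_⟩ ?_
  · exact (((isGerm_const _ _ 1).add (isGerm_y 0)).mul
      ((isGerm_const _ _ 1).add (isGerm_y 1))).sub (isGerm_const _ _ 1)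
  · have := ((hasDerivAt_id (0 : ℝ)).const_add 1).const_mul (1 + 0 : ℝ)
    simpa using this.sub_const 1
  · refine Eventually.of_forall fun q h => ?_
    rw [Real.rpow_neg_one]
    have h1 : (1 + q.1) * (1 + q.2) = 1 := by linarith
    exact (eq_inv_of_mul_eq_one_right h1)

theorem powOk_inv_nat {d : ℕ} (hd : d ≠ 0) : PowOk A ((d : ℝ)⁻¹) := by
  refine powOk_of_implicit (F := fun s t => (1 + t) ^ d - (1 + s)) ?_ (by norm_num)
    ⟨d, by exact_mod_cast hd, ?_⟩ ?_
  · exact (((isGerm_const _ _ 1).add (isGerm_y 1)).pow d).sub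
      ((isGerm_const _ _ 1).add (isGerm_y 0))
  · have := (((hasDerivAt_id (0 : ℝ)).const_add 1).pow d).sub_const (1 + 0)
    simpa using this
  · have h1 : ∀ᶠ q : ℝ × ℝ in 𝓝 0, -1 < q.2 :=
      (continuous_snd.tendsto (0 : ℝ × ℝ)).eventually (lt_mem_nhds (by norm_num))
    filter_upwards [h1] with q h1 h
    have h2 : 1 + q.1 = (1 + q.2) ^ d := by linarith
    rw [h2, Real.pow_rpow_inv_natCast (by linarith) hd]

theorem powOk_of_expField (hN : (A.expSemiring : Set ℝ) ≠ Set.range ((↑) : ℕ → ℝ)) {r : ℝ≥0}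
    (hr : (r : ℝ) ∈ A.expField) : PowOk A (r : ℝ) := by
  classical
  have h1 : IsG (V := Unit) A {()} (fun p => p () ^ (r : ℝ)) := by
    refine isG_rpow ⟨fun v _ => ?_, fun v hv => absurd (Finset.mem_singleton.2 rfl) hv⟩
    rw [Pi.single_eq_same]
    exact Or.inr ⟨hN, hr⟩
  have ht : Tendsto (fun t : ℝ => fun _ : Unit => t) (𝓝[>] 0) (gz {()}) := by
    refine tendsto_nhdsWithin_iff.2 ⟨?_, ?_⟩
    · exact (tendsto_pi_nhds.2 fun _ => tendsto_id).mono_left nhdsWithin_le_nhds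
    · filter_upwards [self_mem_nhdsWithin] with t ht v _
      exact le_of_lt ht
  obtain ⟨t, h2, ht0 : 0 < t⟩ := ((ht.eventually h1.eventually_translate).and
    self_mem_nhdsWithin).exists
  have h3 : Da {()} (fun _ : Unit => t) = ∅ := by
    ext v
    simp [mem_Da, ht0.ne']
  rw [h3] at h2
  have h4 := (isG_const ((t ^ (r : ℝ))⁻¹)).mul (h2.comp (D' := (∅ : Finset Unit))
    (fun v => (isG_const t).mul (isG_coord v)) (fun v => by simp))
  refine h4.congr ?_
  have h5 : ∀ᶠ p : Unit → ℝ in gz ∅, -1 < p () :=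
    (((continuous_apply ()).tendsto (0 : Unit → ℝ)).mono_left nhdsWithin_le_nhds).eventually
      (lt_mem_nhds (by simp))
  filter_upwards [h5] with p hp
  simp only [Pi.add_apply]
  rw [← mul_one_add, Real.mul_rpow ht0.le (by linarith), inv_mul_cancel_left₀]
  exact (Real.rpow_pos_of_pos ht0 _).ne'

theorem powOk_of_expOk {a : ℝ≥0} (ha : ExpOk A a) : PowOk A (a : ℝ) := by
  rcases ha with ⟨n, rfl⟩ | ⟨h1, h2⟩
  · have : IsG (V := Unit) A ∅ (fun p => (1 + p ()) ^ n) := ((isG_const 1).add (isG_coord ())).pow n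
    simpa [PowOk] using this
  · exact powOk_of_expField h1 h2

theorem powOk_inv_of_expOk {a : ℝ≥0} (ha : ExpOk A a) (h0 : a ≠ 0) : PowOk A (a : ℝ)⁻¹ := by
  rcases ha with ⟨n, rfl⟩ | ⟨h1, h2⟩
  · simpa using powOk_inv_nat (A := A) (d := n) (by exact_mod_cast h0)
  · have : ((a⁻¹ : ℝ≥0) : ℝ) ∈ A.expField := by
      rw [NNReal.coe_inv]
      exact inv_mem h2
    simpa using powOk_of_expField h1 this

theorem IsG.inv (hf : IsG A D f) (h0 : f 0 ≠ 0) : IsG A D (fun p => (f p)⁻¹) := by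
  rcases lt_or_gt_of_ne h0 with h | h
  · have h1 := (isG_unit_rpow powOk_neg_one hf.neg (by simpa using h)).neg
    refine h1.congr (Eventually.of_forall fun p => ?_)
    simp [Real.rpow_neg_one, inv_neg]
  · have h1 := isG_unit_rpow powOk_neg_one hf h
    simpa [Real.rpow_neg_one] using h1

theorem IsG.abs_of_ne (hf : IsG A D f) (h0 : f 0 ≠ 0) : IsG A D (fun p => |f p|) := by
  rcases lt_or_gt_of_ne h0 with h | h
  · refine hf.neg.congr ?_
    filter_upwards [hf.tendsto.eventually (gt_mem_nhds h)] with p hp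
    rw [abs_of_neg hp]
  · refine hf.congr ?_
    filter_upwards [hf.tendsto.eventually (lt_mem_nhds h)] with p hp
    rw [abs_of_pos hp]

end Nearby

/-! ### Expansions in one variable -/

section Expansions

variable {V : Type} [Fintype V] [DecidableEq V] {A : QuasianalyticSystem} {D : Finset V}
  {f g : (V → ℝ) → ℝ}

theorem continuous_zr (S : Finset V) : Continuous (zr S) := by
  refine continuous_pi fun v => ?_
  unfold zr
  split_ifs
  · exact continuous_const
  · exact continuous_apply v

theorem zr_zero (S : Finset V) : zr S 0 = 0 := by
  funext v
  simp [zr]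

theorem tendsto_zr (S : Finset V) : Tendsto (zr S) (gz D) (gz D) := by
  refine tendsto_gz ?_ (eventually_nhdsWithin_of_forall fun p hp v hv => ?_)
  · have := (continuous_zr S).tendsto 0
    rw [zr_zero] at this
    exact this.mono_left nhdsWithin_le_nhds
  · unfold zr
    split_ifs
    · exact le_rfl
    · exact hp v hv

theorem zr_singleton (v : V) (p : V → ℝ) : zr {v} p = Function.update p v 0 := by
  funext q
  simp [zr, Function.update_apply]

theorem co_pow_mul (hg : IsG A D g) (v : V) (k : ℕ) (w : V → ℝ≥0) :
    co A D (fun p => p v ^ k * g p) w =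
      if (k : ℝ≥0) ≤ w v then co A D g (w - Pi.single v (k : ℝ≥0)) else 0 := by
  rw [← co_rpow_mul (monoOk_single_nat v k) hg]
  simp

theorem co_coord_mul (hg : IsG A D g) (v : V) (w : V → ℝ≥0) :
    co A D (fun p => p v * g p) w =
      if 1 ≤ w v then co A D g (w - Pi.single v 1) else 0 := by
  simpa using co_pow_mul hg v 1 w

theorem co_sum {ι : Type*} (s : Finset ι) {f : ι → (V → ℝ) → ℝ} (hf : ∀ i ∈ s, IsG A D (f i))
    (w : V → ℝ≥0) : co A D (fun p => ∑ i ∈ s, f i p) w = ∑ i ∈ s, co A D (f i) w := by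
  classical
  induction s using Finset.induction_on with
  | empty => simpa using co_const (A := A) (D := D) 0 w
  | insert a s ha ih =>
    have h1 := fun i hi => hf i (Finset.mem_insert_of_mem hi)
    simp only [Finset.sum_insert ha]
    rw [co_add (hf a (Finset.mem_insert_self _ _)) (IsG.sum s h1), ih h1]

theorem coord_mul_cancel (hf : IsG A D f) {v : V} (h : (fun p => p v * f p) =ᶠ[gz D] 0) :
    f =ᶠ[gz D] 0 := by
  refine hf.eventuallyEq_of_co (isG_const 0) (funext fun w => ?_)
  have h1 := co_coord_mul hf v (w + Pi.single v 1)
  rw [if_pos (by simp), add_tsub_cancel_right] at h1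
  rw [← h1, co_congr h]
  have h2 : (0 : (V → ℝ) → ℝ) = fun _ => 0 := rfl
  rw [h2, co_const, co_const]
  simp

theorem co_eq_zero_of_dependsOn (hf : IsG A D f) {v : V} (h : DependsOn f ({v}ᶜ : Set V))
    {w : V → ℝ≥0} (hw : w v ≠ 0) : co A D f w = 0 := by
  have h1 := (hf.setZero_co v).2 w
  rw [if_neg hw] at h1
  rw [← h1]
  congr 1
  funext p
  exact h fun q hq => by simp [show q ≠ v from hq]

theorem IsG.exists_eq_coord_mul (hf : IsG A D f) {z : V} (hz : z ∉ D)
    (h : (fun p => f (Function.update p z 0)) =ᶠ[gz D] 0) :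
    ∃ g, IsG A D g ∧ f =ᶠ[gz D] fun p => p z * g p := by
  obtain ⟨g, hg, h1⟩ := hf.exists_eq_rpow_mul (monoOk_single_nat z 1) (by
    intro w hw
    obtain ⟨n, hn⟩ := (hf.monoOk_of_mem_Supp hw).2 z hz
    rcases Nat.eq_zero_or_pos n with rfl | hn0
    · have h2 := (hf.setZero_co z).2 w
      rw [hn, Nat.cast_zero, if_pos rfl, co_congr h] at h2
      have h3 : (0 : (V → ℝ) → ℝ) = fun _ => 0 := rfl
      rw [h3, co_const, ite_self] at h2
      exact absurd h2.symm hw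
    · rw [hn]; exact_mod_cast hn0)
  exact ⟨g, hg, by simpa using h1⟩

theorem dependsOn_update (z : V) : DependsOn (fun p => f (Function.update p z 0)) ({z}ᶜ : Set V) := by
  intro p q h
  simp only
  congr 1
  funext v
  by_cases hv : v = z
  · simp [hv]
  · simpa [hv] using h v hv

/-- The Taylor expansion of order `d` in a `y`-variable. -/
theorem IsG.exists_expansion (hf : IsG A D f) {z : V} (hz : z ∉ D) (d : ℕ) :
    ∃ (c : ℕ → (V → ℝ) → ℝ) (g : (V → ℝ) → ℝ), (∀ k, IsG A D (c k)) ∧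
      (∀ k, DependsOn (c k) ({z}ᶜ : Set V)) ∧ IsG A D g ∧
      f =ᶠ[gz D] fun p => ∑ k ∈ Finset.range d, p z ^ k * c k p + p z ^ d * g p := by
  induction d with
  | zero =>
    exact ⟨fun _ _ => 0, f, fun _ => isG_const 0, fun _ _ _ _ => rfl, hf, by simp⟩
  | succ d ih =>
    obtain ⟨c, g, hc, hdep, hg, h⟩ := ih
    obtain ⟨h0, -⟩ := hg.setZero_co z
    obtain ⟨g', hg', h'⟩ := (hg.sub h0).exists_eq_coord_mul hz (by simp; rfl)
    refine ⟨fun k => if k = d then fun p => g (Function.update p z 0) else c k, g', fun k => ?_,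
      fun k => ?_, hg', ?_⟩
    · dsimp only
      split_ifs
      exacts [h0, hc k]
    · dsimp only
      split_ifs
      exacts [dependsOn_update z, hdep k]
    · filter_upwards [h, h'] with p h h'
      rw [h, Finset.sum_range_succ, if_pos rfl]
      have h1 : ∑ k ∈ Finset.range d, p z ^ k *
          (if k = d then fun p => g (Function.update p z 0) else c k) p =
          ∑ k ∈ Finset.range d, p z ^ k * c k p := by
        refine Finset.sum_congr rfl fun k hk => ?_
        rw [if_neg (Finset.mem_range.1 hk).ne]
      rw [h1]
      have h2 : g p = g (Function.update p z 0) + p z * g' p := by linarith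
      conv_lhs => rw [h2]
      ring

variable (A D) in
/-- `f` is regular of order `d` in the variable `z`. -/
def Reg (z : V) (d : ℕ) (f : (V → ℝ) → ℝ) : Prop :=
  ∃ u, IsG A D u ∧ u 0 ≠ 0 ∧
    (fun p => f (zr (Finset.univ.erase z) p)) =ᶠ[gz D] fun p => p z ^ d * u p

/-- The order is the least exponent in the support of the restriction to the axis of `z`. -/
theorem exists_reg (hf : IsG A D f) {z : V} (hz : z ∉ D)
    (h : ¬ (fun p => f (zr (Finset.univ.erase z) p)) =ᶠ[gz D] 0) : ∃ d, Reg A D z d f := by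
  classical
  set g := fun p => f (zr (Finset.univ.erase z) p) with hg
  have hgG : IsG A D g := hf.zr _
  rw [← hgG.Supp_nonempty_iff] at h
  have hex : ∃ d : ℕ, Pi.single z (d : ℝ≥0) ∈ Supp A D g := by
    obtain ⟨w, hw⟩ := h
    obtain ⟨n, hn⟩ := (hgG.monoOk_of_mem_Supp hw).2 z hz
    refine ⟨n, ?_⟩
    convert hw using 1
    funext q
    by_cases hq : q = z
    · subst hq; simp [hn]
    · have := ((hf.mem_Supp_zr _).1 hw).2 q (by simp [hq])
      simp [hq, this]
  have hmin : ∀ w ∈ Supp A D g, Pi.single z ((Nat.find hex : ℕ) : ℝ≥0) ≤ w := by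
    intro w hw
    obtain ⟨n, hn⟩ := (hgG.monoOk_of_mem_Supp hw).2 z hz
    rw [single_le_iff_le, hn]
    refine Nat.cast_le.2 (Nat.find_min' hex ?_)
    convert hw using 1
    funext q
    by_cases hq : q = z
    · subst hq; simp [hn]
    · have := ((hf.mem_Supp_zr _).1 hw).2 q (by simp [hq])
      simp [hq, this]
  obtain ⟨-, u, hu, hu0, h1⟩ := IsLeastExp.exists_eq hgG ⟨Nat.find_spec hex, hmin⟩
  refine ⟨Nat.find hex, u, hu, hu0, ?_⟩
  filter_upwards [h1] with p hp
  refine hp.trans ?_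
  congr 1
  unfold mono
  rw [Finset.prod_eq_single z]
  · simp
  · intro b _ hb
    simp [hb]
  · simp

theorem Reg.ne_zero_of_zero {z : V} (h : Reg A D z 0 f) : f 0 ≠ 0 := by
  obtain ⟨u, hu, hu0, h1⟩ := h
  have := eq_zero_of_eventuallyEq h1
  simp only [zr_zero, pow_zero, one_mul] at this
  rwa [this]

/-- A germ has a derivative at the origin along each `y`-variable, and it is a coefficient. -/
theorem IsG.hasDerivAt (hf : IsG A D f) {v : V} (hv : v ∉ D) :
    HasDerivAt (fun t : ℝ => f (Pi.single v t)) (co A D f (Pi.single v 1)) 0 := by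
  have hS := hf.zr (Finset.univ.erase v)
  -- on the axis of `v`, `f = f 0 + v g` for a germ `g`, and both sides are `g 0`
  obtain ⟨g, hg, h1⟩ := (hS.sub (isG_const (f 0))).exists_eq_coord_mul hv (by
    refine Eventually.of_forall fun p => ?_
    simp only [Pi.zero_apply]
    rw [sub_eq_zero]
    congr 1
    funext q
    by_cases hq : q = v <;> simp [Quasi.zr, hq])
  have h2 : co A D f (Pi.single v 1) = g 0 := by
    have h3 := (hf.zr_co (Finset.univ.erase v)).2 (Pi.single v 1)
    rw [if_pos (fun q hq => by simp [(Finset.mem_erase.1 hq).1])] at h3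
    have h4 : (fun p => f (Quasi.zr (Finset.univ.erase v) p)) =ᶠ[gz D] fun p => f 0 + p v * g p := by
      filter_upwards [h1] with p hp
      linarith
    rw [← h3, co_congr h4, co_add (isG_const _) ((isG_coord v).mul hg), co_const, co_coord_mul hg,
      if_neg, if_pos]
    · simp [co_zero hg]
    · simp
    · intro h
      have := congrFun h v
      simp at this
  have ht : Tendsto (fun t : ℝ => (Pi.single v t : V → ℝ)) (𝓝 0) (gz D) := by
    refine tendsto_nhdsWithin_iff.2 ⟨?_, Eventually.of_forall fun t q hq => ?_⟩
    · have : Continuous fun t : ℝ => (Pi.single v t : V → ℝ) := continuous_single (A := fun _ : V => ℝ) v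
      simpa using this.tendsto 0
    · have : q ≠ v := fun h => hv (h ▸ hq)
      simp [this]
  have h5 : (fun t : ℝ => f (Pi.single v t)) =ᶠ[𝓝 0] fun t => f 0 + t * g (Pi.single v t) := by
    filter_upwards [ht.eventually h1] with t ht
    have : Quasi.zr (Finset.univ.erase v) (Pi.single v t) = (Pi.single v t : V → ℝ) := by
      funext q
      by_cases hq : q = v <;> simp [Quasi.zr, hq]
    rw [this] at ht
    simp only [Pi.single_eq_same] at ht
    linarith
  refine HasDerivAt.congr_of_eventuallyEq ?_ h5
  rw [h2, hasDerivAt_iff_tendsto_slope]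
  have h6 : Tendsto (fun t : ℝ => g (Pi.single v t)) (𝓝[≠] 0) (𝓝 (g 0)) :=
    (hg.tendsto.comp ht).mono_left nhdsWithin_le_nhds
  refine h6.congr' ?_
  filter_upwards [self_mem_nhdsWithin] with t ht
  have ht0 : t ≠ 0 := ht
  simp [slope_def_field, ht0]

/-! ### The Tschirnhausen transformation -/

section PowerOfSum

variable {z w : V} (hzw : z ≠ w) (hf : IsG A D f)

include hzw hf

theorem co_add_pow_mul_succ (d : ℕ) (x : V → ℝ≥0) :
    co A D (fun p => (p z + p w) ^ (d + 1) * f p) x =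
      (if 1 ≤ x z then co A D (fun p => (p z + p w) ^ d * f p) (x - Pi.single z 1) else 0) +
      if 1 ≤ x w then co A D (fun p => (p z + p w) ^ d * f p) (x - Pi.single w 1) else 0 := by
  have h : IsG A D (fun p => (p z + p w) ^ d * f p) :=
    (((isG_coord z).add (isG_coord w)).pow d).mul hf
  rw [← co_coord_mul h, ← co_coord_mul h, ← co_add ((isG_coord z).mul h) ((isG_coord w).mul h)]
  congr 1
  funext p
  ring

theorem co_add_pow_mul_self (d : ℕ) :
    co A D (fun p => (p z + p w) ^ d * f p) (Pi.single z (d : ℝ≥0)) = f 0 := by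
  induction d with
  | zero => simpa using co_zero hf
  | succ d ih =>
    rw [co_add_pow_mul_succ hzw hf, if_pos, if_neg, add_zero]
    · rw [← ih]
      congr 1
      funext q
      by_cases hq : q = z
      · subst hq; simp
      · simp [hq]
    · simp [hzw.symm]
    · simp

theorem co_add_pow_mul_pred (d : ℕ) :
    co A D (fun p => (p z + p w) ^ (d + 1) * f p) (Pi.single z (d : ℝ≥0)) = 0 := by
  induction d with
  | zero =>
    rw [co_add_pow_mul_succ hzw hf, if_neg (by simp), if_neg (by simp), add_zero]
  | succ d ih =>
    rw [co_add_pow_mul_succ hzw hf, if_pos (by simp), if_neg (by simp [hzw.symm]), add_zero, ← ih]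
    congr 1
    funext q
    by_cases hq : q = z
    · subst hq; simp
    · simp [hq]

theorem co_add_pow_mul_mixed (d : ℕ) :
    co A D (fun p => (p z + p w) ^ (d + 1) * f p) (Pi.single z (d : ℝ≥0) + Pi.single w 1) =
      (d + 1) * f 0 := by
  induction d with
  | zero =>
    rw [co_add_pow_mul_succ hzw hf, if_neg (by simp [hzw]), if_pos (by simp)]
    simp [co_zero hf]
  | succ d ih =>
    rw [co_add_pow_mul_succ hzw hf, if_pos (by simp [hzw]), if_pos (by simp)]
    have e1 : (Pi.single z ((d + 1 : ℕ) : ℝ≥0) + Pi.single w 1 - Pi.single z 1 : V → ℝ≥0) =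
        Pi.single z (d : ℝ≥0) + Pi.single w 1 := by
      funext q
      by_cases hq : q = z
      · subst hq; simp [hzw]
      · simp [hq]
    rw [e1, ih, add_tsub_cancel_right, co_add_pow_mul_self hzw hf]
    push_cast
    ring

end PowerOfSum

/-- The implicit function theorem, for a variable `none` added to the variables `V`. -/
theorem exists_implicit {c : (Option V → ℝ) → ℝ} (hc : IsG A (D.map Function.Embedding.some) c)
    (h0 : c 0 = 0) (h1 : co A (D.map Function.Embedding.some) c (Pi.single none 1) ≠ 0) :
    ∃ h : (V → ℝ) → ℝ, IsG A D h ∧ h 0 = 0 ∧ ∀ᶠ p in gz D, c (fun o => o.elim (h p) p) = 0 := by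
  obtain ⟨m, n, e, he⟩ := exists_frame D
  -- the new variable is numbered last
  let e' : Fin m ⊕ Fin (n + 1) ≃ Option V := Equiv.ofBijective
    (Sum.elim (fun i => some (e (Sum.inl i)))
      (Fin.snoc (α := fun _ => Option V) (fun j => some (e (Sum.inr j))) none)) (by
    rw [Fintype.bijective_iff_surjective_and_card]
    constructor
    · intro o
      rcases o with _ | v
      · exact ⟨Sum.inr (Fin.last n), by simp⟩
      · obtain ⟨i | j, rfl⟩ := e.surjective v
        · exact ⟨Sum.inl i, rfl⟩
        · exact ⟨Sum.inr j.castSucc, by simp⟩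
    · simp [card_of_frame e]
      omega)
  have k1 : ∀ i, e' (Sum.inl i) = some (e (Sum.inl i)) := fun i => rfl
  have k2 : ∀ j : Fin n, e' (Sum.inr j.castSucc) = some (e (Sum.inr j)) := fun j => by simp [e']
  have k3 : e' (Sum.inr (Fin.last n)) = none := by simp [e']
  have he' : Fr e' (D.map Function.Embedding.some) := by
    constructor
    · intro i
      rw [k1]
      simpa using he.1 i
    · intro j
      refine Fin.lastCases ?_ (fun j => ?_) j
      · rw [k3]; simp
      · rw [k2]; simpa using he.2 j
  have hs : ∀ t : ℝ, pull e' ((0, Pi.single (Fin.last n) t) : Pt m (n + 1)) =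
      (Pi.single none t : Option V → ℝ) := by
    intro t
    rw [← k3]
    have h := pull_update_inr e' 0 (Fin.last n) t
    rw [pull_zero] at h
    exact h
  obtain ⟨g, hg, hg0, h2⟩ := A.implicit _ (hc.isGerm he') (by simpa [pull_zero] using h0) (by
    refine ⟨_, h1, ?_⟩
    simp only [hs]
    exact hc.hasDerivAt (by simp))
  refine ⟨fun p => g (push e p), ⟨_, _, e, he, by simpa using hg⟩, by simpa [push_zero] using hg0, ?_⟩
  rw [he.eventually_iff]
  filter_upwards [h2] with p hp
  rw [push_pull, ← hp]
  congr 1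
  funext o
  refine frame_forall e' (P := fun o => Option.elim o (g p) (pull e p) = pull e' _ o) ?_ ?_ o
  · intro i; rw [pull_inl, k1]; simp
  · intro j
    refine Fin.lastCases ?_ (fun j => ?_) j
    · rw [pull_inr, k3]; simp
    · rw [pull_inr, k2]; simp

/-- With a new variable `t`, the coefficient `c_d` of `z ^ d` in `f (z + t)` is a germ with `c_d 0 =
0`, and its derivative in `t` at the origin is `(d + 1) u 0 ≠ 0`, `z ^ (d + 1) u` being the
restriction of `f` to the axis. The translation is the solution `t = h` of `c_d = 0`. -/
theorem exists_tschirnhausen_aux {z : V} (hz : z ∉ D) {d : ℕ} (hf : IsG A D f)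
    (hreg : Reg A D z (d + 1) f) :
    ∃ (h : (V → ℝ) → ℝ) (c : ℕ → (V → ℝ) → ℝ) (g : (V → ℝ) → ℝ), IsG A D h ∧
      DependsOn h ({z}ᶜ : Set V) ∧ h 0 = 0 ∧ (∀ k, IsG A D (c k)) ∧
      (∀ k, DependsOn (c k) ({z}ᶜ : Set V)) ∧ IsG A D g ∧ g 0 ≠ 0 ∧
      (fun p => f (trans z h p)) =ᶠ[gz D]
        fun p => ∑ k ∈ Finset.range d, p z ^ k * c k p + p z ^ (d + 1) * g p := by
  classical
  set D' := D.map Function.Embedding.some with hD'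
  have hsome : ∀ v, some v ∈ D' ↔ v ∈ D := fun v => by simp [hD']
  have hnone : none ∉ D' := by simp [hD']
  have hz' : some z ∉ D' := by rwa [hsome]
  -- the germ with the additional variable added to `z`
  set s : (Option V → ℝ) → V → ℝ := fun q v => if v = z then q (some z) + q none else q (some v)
    with hs
  have hbij : Set.BijOn some (D : Set V) (D' : Set (Option V)) := by
    refine ⟨fun v hv => (hsome v).2 hv, (Option.some_injective V).injOn, fun o ho => ?_⟩
    rcases o with _ | v
    · exact absurd ho hnone
    · exact ⟨v, (hsome v).1 ho, rfl⟩
  have hsub : ∀ {φ : (V → ℝ) → ℝ}, IsG A D φ → IsG A D' (fun q => φ (s q)) := by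
    intro φ hφ
    refine hφ.subst some hbij (u := fun _ _ => 1) (fun _ _ => isG_const 1) (fun _ _ => one_pos)
      (fun v hv => Eventually.of_forall fun q => ?_) (fun v hv => ?_) (fun v hv => ?_)
    · have : v ≠ z := fun h => hz (h ▸ hv)
      simp [hs, this]
    · by_cases h : v = z
      · simpa [hs, h] using (isG_coord (some z)).add (isG_coord none)
      · simpa [hs, h] using isG_coord (some v)
    · by_cases h : v = z <;> simp [hs, h]
  have hst : Tendsto s (gz D') (gz D) := by
    refine tendsto_nhdsWithin_iff.2 ⟨?_, eventually_nhdsWithin_of_forall fun q hq v hv => ?_⟩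
    · have hc : Continuous s := by
        refine continuous_pi fun v => ?_
        by_cases h : v = z <;> simp only [hs, h, if_true, if_false] <;> fun_prop
      have := hc.tendsto 0
      have h0 : s 0 = 0 := by funext v; simp [hs]
      rw [h0] at this
      exact this.mono_left nhdsWithin_le_nhds
    · have : v ≠ z := fun h => hz (h ▸ hv)
      simpa [hs, this] using hq _ ((hsome v).2 hv)
  obtain ⟨u, hu, hu0, hfu⟩ := hreg
  -- the expansion of `f (z + t)` in powers of `z`
  obtain ⟨c, g, hc, hcd, hg, hexp⟩ := (hsub hf).exists_expansion hz' (d + 1)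
  have hzn : (some z : Option V) ≠ none := by simp
  -- the coefficients of the powers of `z` and the new variable
  have hco : ∀ x : Option V → ℝ≥0, (∀ o, o ≠ some z → o ≠ none → x o = 0) →
      co A D' (fun q => (q (some z) + q none) ^ (d + 1) * u (s q)) x =
        ∑ k ∈ Finset.range (d + 1), (if (k : ℝ≥0) ≤ x (some z) then
          co A D' (c k) (x - Pi.single (some z) (k : ℝ≥0)) else 0) +
        if ((d + 1 : ℕ) : ℝ≥0) ≤ x (some z) then
          co A D' g (x - Pi.single (some z) ((d + 1 : ℕ) : ℝ≥0)) else 0 := by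
    intro x hx
    have h1 := ((hsub hf).zr_co ((Finset.univ.erase (some z)).erase none)).2 x
    rw [if_pos (fun o ho => by
      simp only [Finset.mem_erase, Finset.mem_univ, and_true] at ho
      exact hx o ho.2 ho.1)] at h1
    have h2 : (fun q => f (s (zr ((Finset.univ.erase (some z)).erase none) q))) =ᶠ[gz D']
        fun q => (q (some z) + q none) ^ (d + 1) * u (s q) := by
      filter_upwards [hst.eventually hfu] with q hq
      have h3 : s (zr ((Finset.univ.erase (some z)).erase none) q) =
          zr (Finset.univ.erase z) (s q) := by
        funext v
        by_cases h : v = z <;> simp [hs, zr, h]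
      rw [h3, hq]
      simp [hs]
    rw [← co_congr h2, h1, co_congr hexp, co_add (IsG.sum _ fun k _ => ((isG_coord _).pow k).mul (hc k))
      (((isG_coord _).pow _).mul hg), co_sum _ fun k _ => ((isG_coord _).pow k).mul (hc k),
      co_pow_mul hg]
    congr 1
    exact Finset.sum_congr rfl fun k _ => co_pow_mul (hc k) _ _ _
  have hus : u (s 0) = u 0 := by
    congr 1
    funext v
    simp [hs]
  have hcz : ∀ k (x : Option V → ℝ≥0), x (some z) ≠ 0 → co A D' (c k) x = 0 := fun k x hx =>
    co_eq_zero_of_dependsOn (hc k) (hcd k) hx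
  have hsum : ∀ x : Option V → ℝ≥0, x (some z) = (d : ℝ≥0) →
      ∑ k ∈ Finset.range (d + 1), (if (k : ℝ≥0) ≤ x (some z) then
          co A D' (c k) (x - Pi.single (some z) (k : ℝ≥0)) else 0) =
        co A D' (c d) (x - Pi.single (some z) (d : ℝ≥0)) := by
    intro x hx
    rw [Finset.sum_range_succ, Finset.sum_eq_zero, zero_add, if_pos hx.ge]
    intro k hk
    rw [Finset.mem_range] at hk
    rw [if_pos (by rw [hx]; exact_mod_cast hk.le), hcz]
    simp only [Pi.sub_apply, Pi.single_eq_same, hx]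
    exact (tsub_pos_of_lt (by exact_mod_cast hk)).ne'
  have hlt : ¬ ((d + 1 : ℕ) : ℝ≥0) ≤ (d : ℝ≥0) := by
    rw [not_le]; exact_mod_cast Nat.lt_succ_self d
  -- constant term and derivative in the new variable of the coefficient of `z ^ d`
  have c0 : c d 0 = 0 := by
    have h1 := hco (Pi.single (some z) (d : ℝ≥0)) (fun o ho _ => by simp [ho])
    rw [co_add_pow_mul_pred hzn (hsub hu), hsum _ (by simp), if_neg (by simp), tsub_self,
      add_zero, co_zero (hc d)] at h1
    exact h1.symm
  have c1 : co A D' (c d) (Pi.single none 1) ≠ 0 := by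
    have h1 := hco (Pi.single (some z) (d : ℝ≥0) + Pi.single none 1) (fun o ho ho' => by simp [ho, ho'])
    rw [co_add_pow_mul_mixed hzn (hsub hu), hsum _ (by simp), if_neg (by simp),
      add_tsub_cancel_left, add_zero, hus] at h1
    rw [← h1]
    exact mul_ne_zero (by positivity) hu0
  have g0 : g 0 ≠ 0 := by
    have h1 := hco (Pi.single (some z) ((d + 1 : ℕ) : ℝ≥0)) (fun o ho _ => by simp [ho])
    rw [co_add_pow_mul_self hzn (hsub hu), Finset.sum_eq_zero, if_pos (by simp), tsub_self, zero_add,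
      co_zero hg, hus] at h1
    · rwa [← h1]
    · intro k hk
      rw [Finset.mem_range] at hk
      rw [hcz, ite_self]
      simp only [Pi.sub_apply, Pi.single_eq_same]
      exact (tsub_pos_of_lt (by exact_mod_cast hk)).ne'
  obtain ⟨h0, hh0, hh00, himp⟩ := exists_implicit (hc d) c0 c1
  -- the value of `z` is irrelevant for the solution and is set equal to zero
  set h : (V → ℝ) → ℝ := fun p => h0 (Function.update p z 0) with hh
  have hhG : IsG A D h := (hh0.setZero_co z).1
  have hhd : DependsOn h ({z}ᶜ : Set V) := dependsOn_update z
  have hh0' : h 0 = 0 := by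
    have : Function.update (0 : V → ℝ) z 0 = 0 := Function.update_eq_self z _
    rw [hh]
    simp only [this, hh00]
  -- `E` inserts the solution for the new variable
  set E : (V → ℝ) → Option V → ℝ := fun p o => o.elim (h p) p with hE
  have hE0 : E 0 = 0 := by
    funext o
    rcases o with _ | v <;> simp [hE, hh0']
  have hbij' : Set.BijOn (fun o => o.getD z) (D' : Set (Option V)) (D : Set V) := by
    refine ⟨fun o ho => ?_, fun o ho o' ho' hoo => ?_, fun v hv => ⟨some v, (hsome v).2 hv, rfl⟩⟩
    · rcases o with _ | v
      · exact absurd ho hnone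
      · exact (hsome v).1 ho
    · rcases o with _ | v
      · exact absurd ho hnone
      rcases o' with _ | v'
      · exact absurd ho' hnone
      exact congrArg some hoo
  have hsubE : ∀ {φ : (Option V → ℝ) → ℝ}, IsG A D' φ → IsG A D (fun p => φ (E p)) := by
    intro φ hφ
    refine hφ.subst _ hbij' (u := fun _ _ => 1) (fun _ _ => isG_const 1) (fun _ _ => one_pos)
      (fun o ho => Eventually.of_forall fun q => ?_) (fun o ho => ?_) (fun o ho => ?_)
    · rcases o with _ | v
      · exact absurd ho hnone
      · simp [hE]
    · rcases o with _ | v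
      · simpa [hE] using hhG
      · simpa [hE] using isG_coord v
    · rw [hE0]; rfl
  have hEt : Tendsto E (gz D) (gz D') := by
    refine tendsto_nhdsWithin_iff.2 ⟨tendsto_pi_nhds.2 fun o => ?_,
      eventually_nhdsWithin_of_forall fun q hq o ho => ?_⟩
    · rcases o with _ | v
      · have := hhG.tendsto
        rwa [hh0'] at this
      · exact ((continuous_apply v).tendsto (0 : V → ℝ)).mono_left nhdsWithin_le_nhds
    · rcases o with _ | v
      · exact absurd ho hnone
      · exact hq v ((hsome v).1 ho)
  refine ⟨h, fun k p => c k (E p), fun p => g (E p), hhG, hhd, hh0', fun k => hsubE (hc k),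
    fun k p q hpq => hcd k fun o ho => ?_, hsubE hg, by simpa only [hE0] using g0, ?_⟩
  · rcases o with _ | v
    · exact hhd hpq
    · exact hpq v fun hv => ho (by rw [show v = z from hv]; rfl)
  · have hcd0 : ∀ᶠ p in gz D, c d (E p) = 0 := by
      filter_upwards [(tendsto_zr {z}).eventually himp] with p hp
      rw [zr_singleton] at hp
      rw [← hp]
      refine hcd d fun o ho => ?_
      rcases o with _ | v
      · rfl
      · have : v ≠ z := fun hv => ho (by rw [hv]; rfl)
        simp [hE, this]
    filter_upwards [hEt.eventually hexp, hcd0] with p hp hp0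
    have h1 : s (E p) = trans z h p := by
      funext v
      by_cases hv : v = z
      · subst hv; simp [hs, hE, trans]
      · simp [hs, hE, trans, hv]
    rw [h1] at hp
    rw [hp, Finset.sum_range_succ, hp0]
    simp [hE]

theorem dependsOn_zr {K : Finset V} : DependsOn (fun p => f (zr Kᶜ p)) (K : Set V) := by
  intro p q h
  simp only
  congr 1
  funext v
  by_cases hv : v ∈ K
  · simpa [zr, hv] using h v hv
  · simp [zr, hv]

theorem zr_eq_of_dependsOn {K : Finset V} (h : DependsOn f (K : Set V)) (p : V → ℝ) :
    f (zr Kᶜ p) = f p :=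
  h fun v hv => by simp [zr, Finset.mem_coe.1 hv]

/-- The Tschirnhausen transformation: after a translation of `z`, a germ that is regular of order `d + 1`
in `z` has no term of degree `d` in `z`. -/
theorem exists_tschirnhausen {K : Finset V} {z : V} (hz : z ∉ D) (hzK : z ∈ K) {d : ℕ}
    (hf : IsG A D f) (hdep : DependsOn f (K : Set V)) (hreg : Reg A D z (d + 1) f) :
    ∃ (h : (V → ℝ) → ℝ) (c : ℕ → (V → ℝ) → ℝ) (g : (V → ℝ) → ℝ), IsG A D h ∧
      DependsOn h (K.erase z : Set V) ∧ h 0 = 0 ∧ (∀ k, IsG A D (c k)) ∧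
      (∀ k, DependsOn (c k) (K.erase z : Set V)) ∧ IsG A D g ∧ DependsOn g (K : Set V) ∧ g 0 ≠ 0 ∧
      (fun p => f (trans z h p)) =ᶠ[gz D]
        fun p => ∑ k ∈ Finset.range d, p z ^ k * c k p + p z ^ (d + 1) * g p := by
  obtain ⟨h, c, g, h1, h2, h3, h4, h5, h6, h7, h8⟩ := exists_tschirnhausen_aux hz hf hreg
  have hdep' : ∀ {φ : (V → ℝ) → ℝ}, DependsOn φ ({z}ᶜ : Set V) →
      DependsOn (fun p => φ (zr Kᶜ p)) (K.erase z : Set V) := by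
    intro φ hφ p q hpq
    refine hφ fun v hv => ?_
    by_cases hvK : v ∈ K
    · simpa [zr, hvK] using hpq v (by simpa using ⟨hvK, hv⟩)
    · simp [zr, hvK]
  refine ⟨fun p => h (zr Kᶜ p), fun k p => c k (zr Kᶜ p), fun p => g (zr Kᶜ p), h1.zr _,
    hdep' h2, by simpa [zr_zero] using h3, fun k => (h4 k).zr _, fun k => hdep' (h5 k), h6.zr _,
    dependsOn_zr, by simpa [zr_zero] using h7, ?_⟩
  filter_upwards [(tendsto_zr Kᶜ).eventually h8] with p hp
  have e1 : zr Kᶜ p z = p z := by simp [zr, hzK]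
  rw [e1] at hp
  rw [← hp]
  refine hdep fun v hv => ?_
  by_cases hvz : v = z
  · subst hvz; simp [trans, e1]
  · simp [trans, hvz, zr, Finset.mem_coe.1 hv]

/-! ### Making a germ regular -/

/-- A germ that vanishes on the hypersurfaces `p_k = c p_z`, `c = 0, 1, …, N - 1`, is divisible by
the product of their equations. -/
theorem exists_factor_lines {k z : V} (hk : k ∉ D) (hkz : k ≠ z) (hf : IsG A D f)
    (h : ∀ c : ℕ, (fun p => f (Function.update p k (c * p z))) =ᶠ[gz D] 0) (N : ℕ) :
    ∃ g, IsG A D g ∧ f =ᶠ[gz D] fun p => (∏ c ∈ Finset.range N, (p k - c * p z)) * g p := by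
  induction N with
  | zero => exact ⟨f, hf, by simp⟩
  | succ N ih =>
    obtain ⟨g, hg, h1⟩ := ih
    -- the factor already found does not vanish on the line with slope `N`
    have h2 : (fun p => g (Function.update p k (N * p z))) =ᶠ[gz D] 0 := by
      have hG : IsG A D (fun p => g (Function.update p k (N * p z))) :=
        hg.update_y hk ((isG_const _).mul (isG_coord z)) (by simp)
      have h3 : (fun p : V → ℝ => p z ^ N * g (Function.update p k (N * p z))) =ᶠ[gz D] 0 := by
        have ht : Tendsto (fun p : V → ℝ => Function.update p k (N * p z)) (gz D) (gz D) :=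
          tendsto_update k (by simpa using (tendsto_coord z).const_mul (N : ℝ)) fun h => absurd h hk
        filter_upwards [ht.eventually h1, h N] with p hp hp'
        simp only [Pi.zero_apply] at hp' ⊢
        rw [hp'] at hp
        have h4 : ∏ c ∈ Finset.range N, ((Function.update p k (N * p z)) k -
            c * (Function.update p k (N * p z)) z) =
            (∏ c ∈ Finset.range N, ((N : ℝ) - c)) * p z ^ N := by
          rw [Finset.prod_congr rfl (g := fun c : ℕ => ((N : ℝ) - c) * p z)]
          · rw [Finset.prod_mul_distrib]
            simp
          · intro c _
            rw [Function.update_self, Function.update_of_ne hkz.symm]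
            ring
        rw [h4, mul_assoc] at hp
        refine (mul_eq_zero.1 hp.symm).resolve_left (Finset.prod_ne_zero_iff.2 fun c hc => ?_)
        rw [sub_ne_zero]
        exact_mod_cast (Finset.mem_range.1 hc).ne'
      -- cancel the powers of `p z`
      have hcan : ∀ M : ℕ, (fun p : V → ℝ => p z ^ M * g (Function.update p k (N * p z))) =ᶠ[gz D] 0 →
          (fun p => g (Function.update p k (N * p z))) =ᶠ[gz D] 0 := by
        intro M
        induction M with
        | zero => intro h; simpa using h
        | succ M ihM =>
          intro h
          refine ihM (coord_mul_cancel (v := z) (((isG_coord z).pow M).mul hG) ?_)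
          filter_upwards [h] with p hp
          rw [← hp]
          ring
      exact hcan N h3
    -- a shear moves the hypersurface to `p k = 0`, where division by the coordinate applies
    have hG' : IsG A D (fun p => g (Function.update p k (p k + N * p z))) :=
      hg.update_y hk ((isG_coord k).add ((isG_const _).mul (isG_coord z))) (by simp)
    obtain ⟨g', hg', h5⟩ := hG'.exists_eq_coord_mul hk (by
      filter_upwards [h2] with p hp
      simpa [hkz.symm] using hp)
    refine ⟨fun p => g' (Function.update p k (p k + -(N : ℝ) * p z)),
      hg'.update_y hk ((isG_coord k).add ((isG_const _).mul (isG_coord z))) (by simp), ?_⟩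
    have ht : Tendsto (fun p : V → ℝ => Function.update p k (p k + -(N : ℝ) * p z)) (gz D) (gz D) :=
      tendsto_update k (by simpa using (tendsto_coord k).add ((tendsto_coord z).const_mul (-(N : ℝ))))
        fun h => absurd h hk
    filter_upwards [h1, ht.eventually h5] with p hp hp'
    rw [hp, Finset.prod_range_succ, mul_assoc]
    congr 1
    simp only [Function.update_self, Function.update_idem, Function.update_of_ne hkz.symm] at hp'
    have h6 : p k + -(N : ℝ) * p z + N * p z = p k := by ring
    rw [h6, Function.update_eq_self] at hp'
    rw [hp']
    ring

/-- Each of the factors raises the total order in the variables `k` and `z`. -/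
theorem le_of_mem_Supp_factor_lines {k z : V} (hkz : k ≠ z) (hg : IsG A D g) (N : ℕ) {w : V → ℝ≥0}
    (hw : w ∈ Supp A D fun p => (∏ c ∈ Finset.range N, (p k - c * p z)) * g p) :
    (N : ℝ≥0) ≤ w k + w z := by
  induction N generalizing w with
  | zero => simp
  | succ N ih =>
    have hG : IsG A D (fun p => (∏ c ∈ Finset.range N, (p k - c * p z)) * g p) :=
      (IsG.prod _ fun c _ => (isG_coord k).sub ((isG_const _).mul (isG_coord z))).mul hg
    have e1 : (fun p : V → ℝ => (∏ c ∈ Finset.range (N + 1), (p k - (c : ℝ) * p z)) * g p) =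
        fun p => p k * ((∏ c ∈ Finset.range N, (p k - (c : ℝ) * p z)) * g p) -
          N * (p z * ((∏ c ∈ Finset.range N, (p k - (c : ℝ) * p z)) * g p)) := by
      funext p
      rw [Finset.prod_range_succ]
      ring
    have hw' : co A D _ w ≠ 0 := hw
    rw [e1, co_sub ((isG_coord k).mul hG) ((isG_const _).mul ((isG_coord z).mul hG)),
      co_coord_mul hG] at hw'
    have key : ∀ v, v = k ∨ v = z → 1 ≤ w v → w - Pi.single v 1 ∈
        Supp A D (fun p => (∏ c ∈ Finset.range N, (p k - c * p z)) * g p) →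
        ((N + 1 : ℕ) : ℝ≥0) ≤ w k + w z := by
      rintro v (rfl | rfl) h1 h2
      · have := ih h2
        simp only [Pi.sub_apply, Pi.single_eq_same, Pi.single_eq_of_ne hkz.symm, tsub_zero] at this
        push_cast
        calc (N : ℝ≥0) + 1 ≤ (w v - 1 + w z) + 1 := by gcongr
          _ = w v + w z := by rw [add_right_comm, tsub_add_cancel_of_le h1]
      · have := ih h2
        simp only [Pi.sub_apply, Pi.single_eq_same, Pi.single_eq_of_ne hkz, tsub_zero] at this
        push_cast
        calc (N : ℝ≥0) + 1 ≤ (w k + (w v - 1)) + 1 := by gcongr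
          _ = w k + w v := by rw [add_assoc, tsub_add_cancel_of_le h1]
    by_cases h1 : 1 ≤ w k ∧ w - Pi.single k 1 ∈
        Supp A D (fun p => (∏ c ∈ Finset.range N, (p k - c * p z)) * g p)
    · exact key k (Or.inl rfl) h1.1 h1.2
    · have h2 : (if 1 ≤ w k then co A D (fun p => (∏ c ∈ Finset.range N, (p k - c * p z)) * g p)
          (w - Pi.single k 1) else 0) = 0 := by
        split_ifs with h3
        · by_contra h4
          exact h1 ⟨h3, h4⟩
        · rfl
      rw [h2, zero_sub, neg_ne_zero] at hw'
      obtain ⟨a, ha, b, hb, hab⟩ := Supp_mul_subset (isG_const _) ((isG_coord z).mul hG) hw'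
      have ha' : co A D (fun _ => (N : ℝ)) a ≠ 0 := ha
      rw [co_const] at ha'
      have ha0 : a = 0 := by
        by_contra h
        rw [if_neg h] at ha'
        exact ha' rfl
      rw [ha0, zero_add] at hab
      subst hab
      have hb' : co A D _ b ≠ 0 := hb
      rw [co_coord_mul hG] at hb'
      have h3 : 1 ≤ b z := by
        by_contra h
        rw [if_neg h] at hb'
        exact hb' rfl
      rw [if_pos h3] at hb'
      exact key z (Or.inr rfl) h3 hb'

/-- A nonzero germ does not vanish on all hypersurfaces `p_k = c p_z`, as this would make it
divisible by products of arbitrarily many linear forms. -/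
theorem exists_line_ne_zero {k z : V} (hk : k ∉ D) (hkz : k ≠ z) (hf : IsG A D f)
    (h : ¬ f =ᶠ[gz D] 0) : ∃ c : ℝ, ¬ (fun p => f (Function.update p k (c * p z))) =ᶠ[gz D] 0 := by
  by_contra! hcon
  rw [← hf.Supp_nonempty_iff] at h
  obtain ⟨w, hw⟩ := h
  obtain ⟨N, hN⟩ := exists_nat_gt (w k + w z)
  obtain ⟨g, hg, h1⟩ := exists_factor_lines hk hkz hf (fun c => hcon c) N
  rw [Supp_congr h1] at hw
  exact absurd (le_of_mem_Supp_factor_lines hkz hg N hw) (not_le.2 hN)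

end Expansions

/-! ### Nodes and coverings -/

section Nodes

variable {V : Type} [Fintype V] [DecidableEq V]

/-- The labels of the nodes of a tree over the variables `V`, of which those in `D` range over
nonnegative values. -/
inductive ElNode (A : QuasianalyticSystem) (D : Finset V) : Type
  | trans (k : V) (h : (V → ℝ) → ℝ) (hk : k ∉ D) (hh : IsG A D h) (h0 : h 0 = 0)
      (hdep : DependsOn h (Finset.univ.erase k : Set V)) : ElNode A D
  | ramX (i : V) (γ : ℝ≥0) (hi : i ∈ D) (hγ : ExpOk A γ) (h0 : 0 < γ) : ElNode A D
  | ramY (i : V) (d : ℕ) (hi : i ∉ D) (hd : 1 ≤ d) : ElNode A D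
  | xx (i j : V) (hi : i ∈ D) (hj : j ∈ D) (hij : i ≠ j) : ElNode A D
  | yx (i j : V) (hi : i ∉ D) (hj : j ∈ D) : ElNode A D
  | yy (i j : V) (hi : i ∉ D) (hj : j ∉ D) (hij : i ≠ j) : ElNode A D

variable {A : QuasianalyticSystem} {D : Finset V}

/-- The node `ν` involves only the variables in `K`. -/
def ElNode.Inside (K : Finset V) : ElNode A D → Prop
  | trans k h _ _ _ _ => k ∈ K ∧ DependsOn h (K.erase k : Set V)
  | ramX i _ _ _ _ => i ∈ K
  | ramY i _ _ _ => i ∈ K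
  | xx i j _ _ _ => i ∈ K ∧ j ∈ K
  | yx i j _ _ => i ∈ K ∧ j ∈ K
  | yy i j _ _ _ => i ∈ K ∧ j ∈ K

/-- The edges at a node: a map, and the set of the variables of its source that range over
nonnegative values. For the blow-up of two nonnegative variables the charts in both directions are
included. -/
inductive ElNode.Edge : ElNode A D → Finset V → ((V → ℝ) → V → ℝ) → Prop
  | trans (k h hk hh h0 hdep) : Edge (.trans k h hk hh h0 hdep) D (Quasi.trans k h)
  | ramX (i γ hi hγ h0) : Edge (.ramX i γ hi hγ h0) D (Quasi.ramX i γ)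
  | ramY (i d hi hd) (ε : ℤˣ) : Edge (.ramY i d hi hd) D (Quasi.ramY i d ε)
  | xxZero (i j hi hj hij) : Edge (.xx i j hi hj hij) D (blow i j 0)
  | xxZero' (i j hi hj hij) : Edge (.xx i j hi hj hij) D (blow j i 0)
  | xxPos (i j hi hj hij) (lam : ℝ) (hlam : 0 < lam) :
      Edge (.xx i j hi hj hij) (D.erase i) (blow i j lam)
  | xxPos' (i j hi hj hij) (lam : ℝ) (hlam : 0 < lam) :
      Edge (.xx i j hi hj hij) (D.erase j) (blow j i lam)
  | yx (i j hi hj) (lam : ℝ) : Edge (.yx i j hi hj) D (blow i j lam)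
  | yxInfty (i j hi hj) (ε : ℤˣ) : Edge (.yx i j hi hj) (insert i D) (blowInf i j ε)
  | yy (i j hi hj hij) (lam : ℝ) : Edge (.yy i j hi hj hij) D (blow i j lam)
  | yyInfty (i j hi hj hij) : Edge (.yy i j hi hj hij) D (blow j i 0)

theorem ElNode.Inside.mono {K K' : Finset V} (hK : K' ⊆ K) {ν : ElNode A D} (h : ν.Inside K') :
    ν.Inside K := by
  cases ν with
  | trans k f hk hh h0 hdep =>
    exact ⟨hK h.1, fun p q hpq => h.2 fun v hv => hpq v
      (Finset.mem_coe.2 (Finset.erase_subset_erase _ hK (Finset.mem_coe.1 hv)))⟩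
  | ramX => exact hK h
  | ramY => exact hK h
  | xx => exact ⟨hK h.1, hK h.2⟩
  | yx => exact ⟨hK h.1, hK h.2⟩
  | yy => exact ⟨hK h.1, hK h.2⟩

theorem ElNode.inside_univ (ν : ElNode A D) : ν.Inside Finset.univ := by
  cases ν with
  | trans k f hk hh h0 hdep => exact ⟨Finset.mem_univ _, hdep⟩
  | ramX => exact Finset.mem_univ _
  | ramY => exact Finset.mem_univ _
  | xx => exact ⟨Finset.mem_univ _, Finset.mem_univ _⟩
  | yx => exact ⟨Finset.mem_univ _, Finset.mem_univ _⟩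
  | yy => exact ⟨Finset.mem_univ _, Finset.mem_univ _⟩

variable (A) in
/-- A change of coordinates that only involves the variables in `K`. -/
structure Good (K D D' : Finset V) (ρ : (V → ℝ) → V → ℝ) : Prop where
  isG : ∀ f, IsG A D f → IsG A D' (fun p => f (ρ p))
  zero : ρ 0 = 0
  tendsto : Tendsto ρ (gz D') (gz D)
  off : ∀ v ∉ K, ∀ p, ρ p v = p v
  dep : ∀ v ∈ K, DependsOn (fun p => ρ p v) (K : Set V)
  mem_iff : ∀ v ∉ K, v ∈ D' ↔ v ∈ D

theorem Good.id (K D : Finset V) : Good A K D D (fun p => p) :=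
  ⟨fun _ h => h, rfl, tendsto_id, fun _ _ _ => rfl, fun v hv _ _ h => h v hv, fun _ _ => Iff.rfl⟩

theorem Good.comp {K D D' D'' : Finset V} {ρ ρ' : (V → ℝ) → V → ℝ} (h : Good A K D D' ρ)
    (h' : Good A K D' D'' ρ') : Good A K D D'' (fun p => ρ (ρ' p)) where
  isG f hf := h'.isG _ (h.isG f hf)
  zero := by rw [h'.zero, h.zero]
  tendsto := h.tendsto.comp h'.tendsto
  off v hv p := by rw [h.off v hv, h'.off v hv]
  dep v hv p q hpq := h.dep v hv fun w hw => h'.dep w (Finset.mem_coe.1 hw) hpq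
  mem_iff v hv := (h'.mem_iff v hv).trans (h.mem_iff v hv)

theorem Good.dependsOn {K D D' : Finset V} {ρ : (V → ℝ) → V → ℝ} (h : Good A K D D' ρ)
    {f : (V → ℝ) → ℝ} (hf : DependsOn f (K : Set V)) :
    DependsOn (fun p => f (ρ p)) (K : Set V) :=
  fun _ _ hpq => hf fun w hw => h.dep w (Finset.mem_coe.1 hw) hpq

/-- A version of the definition with the hypotheses that remain to be checked for an elementary
transformation. -/
theorem Good.of {K D D' : Finset V} {ρ : (V → ℝ) → V → ℝ}
    (isG : ∀ f, IsG A D f → IsG A D' (fun p => f (ρ p))) (zero : ρ 0 = 0)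
    (nonneg : ∀ v ∈ D, ∀ᶠ p in gz D', 0 ≤ ρ p v) (off : ∀ v ∉ K, ∀ p, ρ p v = p v)
    (dep : ∀ v ∈ K, DependsOn (fun p => ρ p v) (K : Set V)) (mem_iff : ∀ v ∉ K, v ∈ D' ↔ v ∈ D) :
    Good A K D D' ρ where
  isG := isG
  zero := zero
  off := off
  dep := dep
  mem_iff := mem_iff
  tendsto := by
    refine tendsto_gz (tendsto_pi_nhds.2 fun v => ?_) ?_
    · have := (isG _ (isG_coord v)).tendsto
      rwa [zero] at this
    · exact (Filter.eventually_all_finset D).2 nonneg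

theorem eventually_nonneg {v : V} (hv : v ∈ D) : ∀ᶠ p in gz D, 0 ≤ p v :=
  eventually_nhdsWithin_of_forall fun _ hp => hp v hv

theorem dependsOn_update_of {K : Finset V} {i : V} {g : (V → ℝ) → ℝ}
    (hg : DependsOn g (K : Set V)) : ∀ v ∈ K,
      DependsOn (fun p : V → ℝ => Function.update p i (g p) v) (K : Set V) := by
  intro v hv p q hpq
  by_cases h : v = i
  · subst h; simpa using hg hpq
  · simpa [h] using hpq v hv

theorem good_blow_y {K : Finset V} {i j : V} (lam : ℝ) (hi : i ∉ D) (hiK : i ∈ K) (hjK : j ∈ K) :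
    Good A K D D (blow i j lam) := by
  refine Good.of (fun f hf => hf.blow_y hi j lam) ?_ (fun v hv => ?_) (fun v hv p => ?_)
    (dependsOn_update_of fun p q h => ?_) fun _ _ => Iff.rfl
  · funext v; by_cases h : v = i <;> simp [blow, h]
  · have : v ≠ i := fun h => hi (h ▸ hv)
    simpa [blow, this] using eventually_nonneg hv
  · have : v ≠ i := fun h => hv (h ▸ hiK)
    simp [blow, this]
  · rw [h i hiK, h j hjK]

theorem good_blow_zero {K : Finset V} {i j : V} (hi : i ∈ D) (hj : j ∈ D) (hij : i ≠ j)
    (hiK : i ∈ K) (hjK : j ∈ K) : Good A K D D (blow i j 0) := by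
  refine Good.of (fun f hf => (hf.co_blow hi hj hij).1) ?_ (fun v hv => ?_) (fun v hv p => ?_)
    (dependsOn_update_of fun p q h => ?_) fun _ _ => Iff.rfl
  · funext v; by_cases h : v = i <;> simp [blow, h]
  · by_cases h : v = i
    · subst h
      filter_upwards [eventually_nonneg hi, eventually_nonneg hj] with p h1 h2
      simpa [blow] using mul_nonneg h2 h1
    · simpa [blow, h] using eventually_nonneg hv
  · have : v ≠ i := fun h => hv (h ▸ hiK)
    simp [blow, this]
  · rw [h i hiK, h j hjK]

theorem good_blow_pos {K : Finset V} {i j : V} (hi : i ∈ D) (hj : j ∈ D) (hij : i ≠ j)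
    (hiK : i ∈ K) (hjK : j ∈ K) {lam : ℝ} (hlam : 0 < lam) :
    Good A K D (D.erase i) (blow i j lam) := by
  refine Good.of (fun f hf => (hf.blow_pos hi hj hij hlam).1) ?_ (fun v hv => ?_) (fun v hv p => ?_)
    (dependsOn_update_of fun p q h => ?_) fun v hv => ?_
  · funext v; by_cases h : v = i <;> simp [blow, h]
  · by_cases h : v = i
    · subst h
      filter_upwards [eventually_nonneg (Finset.mem_erase.2 ⟨hij.symm, hj⟩),
        (tendsto_coord v).eventually (lt_mem_nhds (neg_lt_zero.2 hlam))] with p h1 h2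
      simpa [blow] using mul_nonneg h1 (by linarith)
    · simpa [blow, h] using eventually_nonneg (Finset.mem_erase.2 ⟨h, hv⟩)
  · have : v ≠ i := fun h => hv (h ▸ hiK)
    simp [blow, this]
  · rw [h i hiK, h j hjK]
  · have : v ≠ i := fun h => hv (h ▸ hiK)
    simp [this]

theorem good_blowInf {K : Finset V} {i j : V} (hi : i ∉ D) (hj : j ∈ D) (hiK : i ∈ K) (hjK : j ∈ K)
    (ε : ℤˣ) : Good A K D (insert i D) (blowInf i j ε) := by
  have hij : j ≠ i := fun h => hi (h ▸ hj)
  refine Good.of (fun f hf => hf.blowInf hi hj ε) ?_ (fun v hv => ?_) (fun v hv p => ?_)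
    (fun v hv p q hpq => ?_) fun v hv => ?_
  · funext v
    by_cases h : v = i
    · subst h; simp [blowInf]
    · by_cases h' : v = j
      · subst h'; simp [blowInf, h]
      · simp [blowInf, h]
  · have h : v ≠ i := fun h => hi (h ▸ hv)
    by_cases h' : v = j
    · subst h'
      filter_upwards [eventually_nonneg (Finset.mem_insert_self i D),
        eventually_nonneg (Finset.mem_insert_of_mem hv)] with p h1 h2
      simpa [blowInf, h] using mul_nonneg h1 h2
    · simpa [blowInf, h, h'] using eventually_nonneg (Finset.mem_insert_of_mem hv)
  · have h1 : v ≠ i := fun h => hv (h ▸ hiK)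
    have h2 : v ≠ j := fun h => hv (h ▸ hjK)
    simp [blowInf, h1, h2]
  · by_cases h : v = i
    · subst h; simp [blowInf, hpq v hv]
    · by_cases h' : v = j
      · subst h'; simp [blowInf, h, hpq v hv, hpq i hiK]
      · simp [blowInf, h, h', hpq v hv]
  · have : v ≠ i := fun h => hv (h ▸ hiK)
    simp [this]

theorem ElNode.Edge.good {K D' : Finset V} {ν : ElNode A D} {ρ : (V → ℝ) → V → ℝ}
    (h : ν.Edge D' ρ) (hν : ν.Inside K) : Good A K D D' ρ := by
  cases h with
  | trans k h hk hh h0 hdep =>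
    obtain ⟨hkK, hd⟩ := hν
    refine Good.of (fun f hf => hf.trans hk hh h0) ?_ (fun v hv => ?_) (fun v hv p => ?_)
      (dependsOn_update_of fun p q hpq => ?_) fun _ _ => Iff.rfl
    · funext v; by_cases h' : v = k <;> simp [Quasi.trans, h', h0]
    · have : v ≠ k := fun h => hk (h ▸ hv)
      simpa [Quasi.trans, this] using eventually_nonneg hv
    · have : v ≠ k := fun h => hv (h ▸ hkK)
      simp [Quasi.trans, this]
    · rw [hpq k hkK, hd fun v hv => hpq v (Finset.mem_of_mem_erase (Finset.mem_coe.1 hv))]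
  | ramX i γ hi hγ h0 =>
    have hiK : i ∈ K := hν
    refine Good.of (fun f hf => (hf.co_ramX hi hγ h0).1) ?_ (fun v hv => ?_) (fun v hv p => ?_)
      (dependsOn_update_of fun p q h => ?_) fun _ _ => Iff.rfl
    · funext v
      by_cases h : v = i
      · subst h; simp [Quasi.ramX, h0.ne']
      · simp [Quasi.ramX, h]
    · by_cases h : v = i
      · subst h
        filter_upwards [eventually_nonneg hv] with p hp
        simpa [Quasi.ramX] using Real.rpow_nonneg hp _
      · simpa [Quasi.ramX, h] using eventually_nonneg hv
    · have : v ≠ i := fun h => hv (h ▸ hiK)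
      simp [Quasi.ramX, this]
    · rw [h i hiK]
  | ramY i d hi hd ε =>
    have hiK : i ∈ K := hν
    refine Good.of (fun f hf => hf.ramY hi hd ε) ?_ (fun v hv => ?_) (fun v hv p => ?_)
      (dependsOn_update_of fun p q h => ?_) fun _ _ => Iff.rfl
    · have : d ≠ 0 := by omega
      funext v; by_cases h : v = i <;> simp [Quasi.ramY, h, this]
    · have : v ≠ i := fun h => hi (h ▸ hv)
      simpa [Quasi.ramY, this] using eventually_nonneg hv
    · have : v ≠ i := fun h => hv (h ▸ hiK)
      simp [Quasi.ramY, this]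
    · rw [h i hiK]
  | xxZero i j hi hj hij => exact good_blow_zero hi hj hij hν.1 hν.2
  | xxZero' i j hi hj hij => exact good_blow_zero hj hi hij.symm hν.2 hν.1
  | xxPos i j hi hj hij lam hlam => exact good_blow_pos hi hj hij hν.1 hν.2 hlam
  | xxPos' i j hi hj hij lam hlam => exact good_blow_pos hj hi hij.symm hν.2 hν.1 hlam
  | yx i j hi hj lam => exact good_blow_y lam hi hν.1 hν.2
  | yxInfty i j hi hj ε => exact good_blowInf hi hj hν.1 hν.2 ε
  | yy i j hi hj hij lam => exact good_blow_y lam hi hν.1 hν.2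
  | yyInfty i j hi hj hij => exact good_blow_y 0 hj hν.2 hν.1

variable (A) in
/-- The germ `f` becomes normal along all branches of a tree, possibly of unbounded height, whose
nodes involve only the variables in `K`. -/
inductive Cov (K : Finset V) : Finset V → ((V → ℝ) → ℝ) → Prop
  | normal {D f} (h : Normal A D f) : Cov K D f
  | node {D f} (ν : ElNode A D) (hν : ν.Inside K)
      (h : ∀ D' ρ, ν.Edge D' ρ → Cov K D' (fun p => f (ρ p))) : Cov K D f

theorem Cov.congr {K : Finset V} {f g : (V → ℝ) → ℝ} (h : Cov A K D f) (hfg : f =ᶠ[gz D] g) :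
    Cov A K D g := by
  induction h generalizing g with
  | normal h => exact .normal (h.congr hfg)
  | node ν hν h ih =>
    exact .node ν hν fun D' ρ he => ih D' ρ he ((he.good hν).tendsto.eventually hfg)

/-- Trees may be concatenated: it suffices to treat `f` at the ends of a tree that makes another germ
normal. -/
theorem Cov.bind {K K' : Finset V} (hK : K' ⊆ K) {Φ f : (V → ℝ) → ℝ} (h : Cov A K' D Φ)
    (H : ∀ D' ρ, Good A K' D D' ρ → Normal A D' (fun p => Φ (ρ p)) →
      Cov A K D' (fun p => f (ρ p))) : Cov A K D f := by
  have key : ∀ {D' g}, Cov A K' D' g → ∀ ρ, Good A K' D D' ρ → g = (fun p => Φ (ρ p)) →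
      Cov A K D' (fun p => f (ρ p)) := by
    intro D' g hg
    induction hg with
    | normal h => exact fun ρ hρ he => H _ ρ hρ (he ▸ h)
    | node ν hν h ih =>
      intro ρ hρ he
      refine .node ν (hν.mono hK) fun D'' ρ' he' => ?_
      exact ih D'' ρ' he' _ (hρ.comp (he'.good hν)) (by rw [he])
  exact key h _ (Good.id _ _) rfl

end Nodes

/-! ### Normal germs under monomial transformations -/

section Normalisation

variable {V : Type} [Fintype V] [DecidableEq V] {A : QuasianalyticSystem} {D D' : Finset V}
  {f g : (V → ℝ) → ℝ}

theorem normal_mono {w : V → ℝ≥0} (hw : MonoOk A D w) : Normal A D (mono w) :=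
  ⟨w, fun _ => 1, hw, isG_const 1, one_ne_zero, by simp⟩

theorem normal_coord_rpow {v : V} (hv : v ∈ D) {a : ℝ≥0} (ha : ExpOk A a) :
    Normal A D (fun p => p v ^ (a : ℝ)) := by
  refine normal_rpow ⟨fun q hq => ?_, fun q hq => ⟨0, ?_⟩⟩
  · by_cases h : q = v
    · subst h; simpa using ha
    · simpa [h] using expOk_zero
  · have : q ≠ v := fun h => hq (h ▸ hv)
    simp [this]

/-- Normality is preserved if the variables are replaced by germs of which the relevant powers are
normal. -/
theorem Normal.comp {K : Finset V} {ρ : (V → ℝ) → V → ℝ} (hρ : Good A K D D' ρ) (hf : Normal A D f)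
    (hx : ∀ v ∈ D, ∀ a : ℝ≥0, ExpOk A a → Normal A D' (fun p => ρ p v ^ (a : ℝ)))
    (hy : ∀ v ∉ D, Normal A D' (fun p => ρ p v)) : Normal A D' (fun p => f (ρ p)) := by
  obtain ⟨w, u, hw, hu, hu0, h⟩ := hf
  have h1 : Normal A D' (fun p => mono w (ρ p)) := by
    unfold mono
    refine Normal.prod _ fun v _ => ?_
    by_cases hv : v ∈ D
    · exact hx v hv _ (hw.1 v hv)
    · obtain ⟨n, hn⟩ := hw.2 v hv
      refine ((hy v hv).pow n).congr (Eventually.of_forall fun p => ?_)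
      simp [hn]
  refine (h1.mul (normal_of_unit (hρ.isG u hu) (by simpa [hρ.zero] using hu0))).congr ?_
  filter_upwards [hρ.tendsto.eventually h] with p hp using hp.symm

theorem not_eventuallyEq_zero_mul (hf : IsG A D f) (hg : IsG A D g) (hf0 : ¬ f =ᶠ[gz D] 0)
    (hg0 : ¬ g =ᶠ[gz D] 0) : ¬ (fun p => f p * g p) =ᶠ[gz D] 0 := by
  rcases isEmpty_or_nonempty V with hV | ⟨⟨v⟩⟩
  · intro h
    have h1 := eq_zero_of_eventuallyEq h
    have key : ∀ {φ : (V → ℝ) → ℝ}, φ 0 = 0 → φ =ᶠ[gz D] 0 := fun {φ} h =>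
      Eventually.of_forall fun p => by rw [Subsingleton.elim p 0, h]; rfl
    rcases mul_eq_zero.1 h1 with h2 | h2
    exacts [hf0 (key h2), hg0 (key h2)]
  · rw [← hf.Supp_nonempty_iff] at hf0
    rw [← hg.Supp_nonempty_iff] at hg0
    obtain ⟨a, ha, ha'⟩ := hf.exists_lexOrd_min hf0 v
    obtain ⟨b, hb, hb'⟩ := hg.exists_lexOrd_min hg0 v
    rw [← (hf.mul hg).Supp_eq_empty_iff]
    refine Set.Nonempty.ne_empty ⟨a + b, add_mem_Supp_mul hf hg ha hb fun x hx y hy hxy => ?_⟩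
    have h1 : lexOrd v x + lexOrd v y = lexOrd v a + lexOrd v b := by
      rw [← lexOrd_add, ← lexOrd_add, hxy]
    have hxa : x = a := by
      rcases (ha' x hx).lt_or_eq with h | h
      · exact absurd h1 (add_lt_add_of_lt_of_le h (hb' y hy)).ne'
      · exact (lexOrd_injective v h).symm
    subst hxa
    exact ⟨rfl, add_left_cancel hxy⟩

theorem not_eventuallyEq_zero_pow (hf : IsG A D f) (hf0 : ¬ f =ᶠ[gz D] 0) (k : ℕ) :
    ¬ (fun p => f p ^ k) =ᶠ[gz D] 0 := by
  induction k with
  | zero =>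
    intro h
    have := eq_zero_of_eventuallyEq h
    simp at this
  | succ k ih =>
    have := not_eventuallyEq_zero_mul (hf.pow k) hf ih hf0
    simpa only [pow_succ] using this

theorem not_eventuallyEq_zero_prod {ι : Type*} (s : Finset ι) {f : ι → (V → ℝ) → ℝ}
    (hf : ∀ i ∈ s, IsG A D (f i)) (hf0 : ∀ i ∈ s, ¬ f i =ᶠ[gz D] 0) :
    ¬ (fun p => ∏ i ∈ s, f i p) =ᶠ[gz D] 0 := by
  classical
  induction s using Finset.induction_on with
  | empty =>
    intro h
    have := eq_zero_of_eventuallyEq h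
    simp at this
  | insert a s ha ih =>
    simp only [Finset.prod_insert ha]
    exact not_eventuallyEq_zero_mul (hf a (Finset.mem_insert_self _ _))
      (IsG.prod s fun i hi => hf i (Finset.mem_insert_of_mem hi))
      (hf0 a (Finset.mem_insert_self _ _))
      (ih (fun i hi => hf i (Finset.mem_insert_of_mem hi)) fun i hi =>
        hf0 i (Finset.mem_insert_of_mem hi))

theorem Normal.of_prod {ι : Type*} [DecidableEq ι] (s : Finset ι) {f : ι → (V → ℝ) → ℝ}
    (hf : ∀ i ∈ s, IsG A D (f i)) (h : Normal A D (fun p => ∏ i ∈ s, f i p)) {i : ι} (hi : i ∈ s) :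
    Normal A D (f i) := by
  refine Normal.of_mul (hf i hi) (IsG.prod (s.erase i) fun k hk => hf k (Finset.mem_of_mem_erase hk))
    (h.congr (Eventually.of_forall fun p => ?_))
  exact (Finset.mul_prod_erase s (fun i => f i p) hi).symm

theorem Normal.of_pow (hf : IsG A D f) {k : ℕ} (hk : 1 ≤ k) (h : Normal A D (fun p => f p ^ k)) :
    Normal A D f := by
  obtain ⟨k, rfl⟩ := Nat.exists_eq_add_of_le' hk
  exact Normal.of_mul hf (hf.pow k) (h.congr (Eventually.of_forall fun p => pow_succ' _ _))

/-! ### Germs without the subleading power of a variable -/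

theorem dependsOn_mono {K : Finset V} {w : V → ℝ≥0} (hw : ∀ v ∉ K, w v = 0) :
    DependsOn (mono w) (K : Set V) := by
  intro p q h
  refine Finset.prod_congr rfl fun v _ => ?_
  by_cases hv : v ∈ K
  · rw [h v hv]
  · simp [hw v hv]

theorem apply_eq_zero_of_mem_Supp {K : Finset V} (hf : IsG A D f) (hd : DependsOn f (K : Set V))
    {w : V → ℝ≥0} (hw : w ∈ Supp A D f) {v : V} (hv : v ∉ K) : w v = 0 := by
  by_contra h
  exact hw (co_eq_zero_of_dependsOn hf (fun p q hpq => hd fun x hx => hpq x fun h' => hv (by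
    rw [← Set.mem_singleton_iff.1 h']; exact Finset.mem_coe.1 hx)) h)

theorem eventuallyEq_mono_mul_zr {K : Finset V} (hd : DependsOn f (K : Set V)) {w : V → ℝ≥0}
    (hw : ∀ v ∉ K, w v = 0) {u : (V → ℝ) → ℝ} (h : f =ᶠ[gz D] fun p => mono w p * u p) :
    f =ᶠ[gz D] fun p => mono w p * u (zr Kᶜ p) := by
  filter_upwards [(tendsto_zr Kᶜ).eventually h] with p hp
  rwa [zr_eq_of_dependsOn hd p, zr_eq_of_dependsOn (dependsOn_mono hw) p] at hp

theorem exists_reg_le (hf : IsG A D f) {z : V} (hz : z ∉ D) {k : ℕ}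
    (hk : co A D f (Pi.single z (k : ℝ≥0)) ≠ 0) : ∃ r ≤ k, Reg A D z r f := by
  have h1 := (hf.zr_co (Finset.univ.erase z)).2 (Pi.single z (k : ℝ≥0))
  rw [if_pos (fun q hq => by simp [(Finset.mem_erase.1 hq).1])] at h1
  have h0 : ¬ (fun p => f (zr (Finset.univ.erase z) p)) =ᶠ[gz D] 0 := by
    rw [← (hf.zr _).Supp_nonempty_iff]
    exact ⟨_, fun h => hk (h1 ▸ h)⟩
  obtain ⟨r, hr⟩ := exists_reg hf hz h0
  refine ⟨r, ?_, hr⟩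
  obtain ⟨u, hu, hu0, h2⟩ := hr
  rw [co_congr h2, co_pow_mul hu] at h1
  by_contra h
  rw [if_neg (by simpa using h)] at h1
  exact hk h1.symm

theorem co_polynomial (z : V) (P : Polynomial ℝ) (k : ℕ) :
    co A D (fun p => P.eval (p z)) (Pi.single z (k : ℝ≥0)) = P.coeff k := by
  have h1 : (fun p : V → ℝ => P.eval (p z)) =
      fun p => ∑ i ∈ Finset.range (P.natDegree + 1), p z ^ i * P.coeff i := by
    funext p
    rw [Polynomial.eval_eq_sum_range]
    exact Finset.sum_congr rfl fun i _ => mul_comm _ _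
  rw [h1, co_sum _ fun i _ => ((isG_coord z).pow i).mul (isG_const _)]
  have h2 : ∀ i : ℕ, co A D (fun p => p z ^ i * P.coeff i) (Pi.single z (k : ℝ≥0)) =
      if i = k then P.coeff i else 0 := by
    intro i
    rw [co_pow_mul (isG_const _), co_const]
    rcases lt_trichotomy i k with h | h | h
    · have h3 : (Pi.single z (k : ℝ≥0) - Pi.single z (i : ℝ≥0) : V → ℝ≥0) ≠ 0 := by
        intro h4
        have := congrFun h4 z
        simp only [Pi.sub_apply, Pi.single_eq_same, Pi.zero_apply] at this
        exact (tsub_pos_of_lt (by exact_mod_cast h : (i : ℝ≥0) < k)).ne' this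
      simp [h3, h.ne]
    · subst h; simp
    · have : ¬ (i : ℝ≥0) ≤ (Pi.single z (k : ℝ≥0) : V → ℝ≥0) z := by simpa using h
      rw [if_neg this, if_neg h.ne']
  simp only [h2]
  rw [Finset.sum_ite_eq' (Finset.range (P.natDegree + 1)) k]
  split_ifs with h
  · rfl
  · rw [Polynomial.coeff_eq_zero_of_natDegree_lt]
    simpa [Nat.lt_succ_iff] using h

/-- The germ `∑ j < e, (lam + z) ^ j M ^ (e + 1 - j) c_j + (lam + z) ^ (e + 1) g`. -/
def tschForm (z : V) (e : ℕ) (lam : ℝ) (M : (V → ℝ) → ℝ) (c : ℕ → (V → ℝ) → ℝ)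
    (g : (V → ℝ) → ℝ) (p : V → ℝ) : ℝ :=
  ∑ j ∈ Finset.range e, (lam + p z) ^ j * (M p ^ (e + 1 - j) * c j p) + (lam + p z) ^ (e + 1) * g p

variable {z : V} {e : ℕ} {lam : ℝ} {M : (V → ℝ) → ℝ} {c : ℕ → (V → ℝ) → ℝ}

theorem isG_tschForm (hM : IsG A D M) (hc : ∀ j < e, IsG A D (c j)) (hg : IsG A D g) :
    IsG A D (tschForm z e lam M c g) := by
  have h1 := (isG_const (A := A) (D := D) lam).add (isG_coord z)
  exact (IsG.sum _ fun j hj => (h1.pow j).mul ((hM.pow _).mul (hc j (Finset.mem_range.1 hj)))).add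
    ((h1.pow _).mul hg)

theorem dependsOn_tschForm {K : Finset V} (hz : z ∈ K) (hM : DependsOn M (K : Set V))
    (hc : ∀ j < e, DependsOn (c j) (K : Set V)) (hg : DependsOn g (K : Set V)) :
    DependsOn (tschForm z e lam M c g) (K : Set V) := by
  intro p q h
  unfold tschForm
  rw [h z hz, hg h]
  congr 1
  refine Finset.sum_congr rfl fun j hj => ?_
  rw [hM h, hc j (Finset.mem_range.1 hj) h]

theorem isG_prod_pow (κ : V → ℕ) : IsG A D (fun p => ∏ v, p v ^ κ v) :=
  IsG.prod _ fun v _ => (isG_coord v).pow _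

theorem dependsOn_prod_pow {K : Finset V} {κ : V → ℕ} (h : ∀ v, κ v ≠ 0 → v ∈ K) :
    DependsOn (fun p : V → ℝ => ∏ v, p v ^ κ v) (K : Set V) := by
  intro p q hpq
  refine Finset.prod_congr rfl fun v _ => ?_
  by_cases hv : κ v = 0
  · simp [hv]
  · rw [hpq v (h v hv)]

theorem prod_zero_pow {κ : V → ℕ} {v : V} (h : κ v ≠ 0) : ∏ v, (0 : V → ℝ) v ^ κ v = 0 :=
  Finset.prod_eq_zero (Finset.mem_univ v) (by simp [h])

theorem apply_zr_axis {K : Finset V} (h : DependsOn f (K.erase z : Set V)) (p : V → ℝ) :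
    f (zr (Finset.univ.erase z) p) = f 0 :=
  h fun v hv => by
    have : v ≠ z := (Finset.mem_erase.1 (Finset.mem_coe.1 hv)).1
    simp [zr, this]

/-- The restriction of the coefficients of `tschForm` to the axis of `z`. -/
def axisPoly (e : ℕ) (lam : ℝ) (c : ℕ → (V → ℝ) → ℝ) : Polynomial ℝ :=
  ∑ j ∈ Finset.range e, (Polynomial.X + Polynomial.C lam) ^ j * Polynomial.C (c j 0)

theorem tschForm_axis {K : Finset V} (hc : ∀ j < e, DependsOn (c j) (K.erase z : Set V))
    (p : V → ℝ) : tschForm z e lam (fun _ => 1) c g (zr (Finset.univ.erase z) p) =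
      (axisPoly e lam c).eval (p z) +
        (lam + p z) ^ (e + 1) * g (zr (Finset.univ.erase z) p) := by
  have h1 : zr (Finset.univ.erase z) p z = p z := by simp [zr]
  unfold tschForm axisPoly
  rw [h1, Polynomial.eval_finsetSum]
  congr 1
  refine Finset.sum_congr rfl fun j hj => ?_
  rw [apply_zr_axis (hc j (Finset.mem_range.1 hj))]
  simp [add_comm lam]

theorem isG_polynomial (z : V) (P : Polynomial ℝ) : IsG A D (fun p => P.eval (p z)) := by
  simp only [Polynomial.eval_eq_sum_range]
  exact IsG.sum _ fun i _ => (isG_const _).mul ((isG_coord z).pow i)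

theorem co_tschForm_zero {K : Finset V} {j₀ : ℕ} (hj₀ : j₀ < e) (hc : ∀ j < e, IsG A D (c j))
    (hcd : ∀ j < e, DependsOn (c j) (K.erase z : Set V)) (hg : IsG A D g) :
    co A D (tschForm z e 0 (fun _ => 1) c g) (Pi.single z (j₀ : ℝ≥0)) = c j₀ 0 := by
  have hG := isG_tschForm (z := z) (lam := 0) (isG_const (A := A) (D := D) 1) hc hg
  have h1 := (hG.zr_co (Finset.univ.erase z)).2 (Pi.single z (j₀ : ℝ≥0))
  rw [if_pos (fun q hq => by simp [(Finset.mem_erase.1 hq).1])] at h1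
  rw [← h1]
  simp only [tschForm_axis hcd, zero_add]
  rw [co_add (isG_polynomial z _) (((isG_coord z).pow _).mul (hg.zr _)), co_polynomial,
    co_pow_mul (hg.zr _), if_neg, add_zero]
  · simp [axisPoly, Polynomial.finsetSum_coeff, Polynomial.coeff_X_pow, hj₀]
  · simp only [Pi.single_eq_same, not_le, Nat.cast_lt]
    omega

/-- For `M = 1` the coefficient of `z ^ e` on the axis at `λ ≠ 0` is `(e + 1) λ g 0`, there being no
term of degree `e` in `λ + z` other than those from `(λ + z) ^ (e + 1) g`: this is what the
Tschirnhausen transformation is for. -/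
theorem co_tschForm_ne_zero {K : Finset V} (hlam : lam ≠ 0) (hc : ∀ j < e, IsG A D (c j))
    (hcd : ∀ j < e, DependsOn (c j) (K.erase z : Set V)) (hg : IsG A D g) (hg0 : g 0 ≠ 0)
    (hga : ∀ p, g (zr (Finset.univ.erase z) p) = g 0) :
    co A D (tschForm z e lam (fun _ => 1) c g) (Pi.single z (e : ℝ≥0)) ≠ 0 := by
  have hG := isG_tschForm (z := z) (lam := lam) (isG_const (A := A) (D := D) 1) hc hg
  have h1 := (hG.zr_co (Finset.univ.erase z)).2 (Pi.single z (e : ℝ≥0))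
  rw [if_pos (fun q hq => by simp [(Finset.mem_erase.1 hq).1])] at h1
  rw [← h1]
  have h2 : (fun p => tschForm z e lam (fun _ => 1) c g (zr (Finset.univ.erase z) p)) =
      fun p => (axisPoly e lam c +
        (Polynomial.X + Polynomial.C lam) ^ (e + 1) * Polynomial.C (g 0)).eval (p z) := by
    funext p
    rw [tschForm_axis hcd, hga]
    simp [add_comm lam]
  rw [h2, co_polynomial, Polynomial.coeff_add, Polynomial.coeff_mul_C,
    Polynomial.coeff_X_add_C_pow]
  have h3 : (axisPoly e lam c).coeff e = 0 := by
    unfold axisPoly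
    rw [Polynomial.finsetSum_coeff]
    refine Finset.sum_eq_zero fun j hj => ?_
    rw [Polynomial.coeff_mul_C, Polynomial.coeff_X_add_C_pow,
      Nat.choose_eq_zero_of_lt (Finset.mem_range.1 hj)]
    simp
  rw [h3, zero_add, Nat.add_sub_cancel_left, pow_one, Nat.choose_succ_self_right]
  refine mul_ne_zero (mul_ne_zero hlam (by positivity)) hg0

variable (A) in
/-- Products of a germ `H` without the variable `z` and a germ regular of order less than `d` in `z`
can be made normal. -/
def CovBelow (K : Finset V) (z : V) (d : ℕ) : Prop :=
  ∀ r < d, ∀ (D : Finset V) (H G : (V → ℝ) → ℝ), z ∉ D → IsG A D H →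
    DependsOn H (K.erase z : Set V) → ¬ H =ᶠ[gz D] 0 → IsG A D G → DependsOn G (K : Set V) →
    Reg A D z r G → Cov A K D (fun p => H p * G p)

theorem CovBelow.of_co {K : Finset V} {d k : ℕ} (h : CovBelow A K z d) (hk : k < d) (hz : z ∉ D)
    {H G : (V → ℝ) → ℝ} (hH : Normal A D H) (hHd : DependsOn H (K.erase z : Set V))
    (hG : IsG A D G) (hGd : DependsOn G (K : Set V)) (hco : co A D G (Pi.single z (k : ℝ≥0)) ≠ 0) :
    Cov A K D (fun p => H p * G p) := by
  obtain ⟨r, hr, hreg⟩ := exists_reg_le hG hz hco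
  exact h r (hr.trans_lt hk) D H G hz hH.isG hHd hH.not_eventuallyEq_zero hG hGd hreg

theorem blow_apply_self (i j : V) (p : V → ℝ) : blow i j lam p i = p j * (lam + p i) := by
  simp [blow]

theorem blow_apply_of_ne {i j v : V} (h : v ≠ i) (p : V → ℝ) : blow i j lam p v = p v := by
  simp [blow, h]

theorem erase_dependsOn {K : Finset V} (h : DependsOn f (K.erase z : Set V)) :
    DependsOn f (K : Set V) :=
  fun _ _ hpq => h fun v hv => hpq v (Finset.mem_of_mem_erase (Finset.mem_coe.1 hv))

theorem apply_blow_of_dependsOn {K : Finset V} (h : DependsOn f (K.erase z : Set V)) (v : V)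
    (p : V → ℝ) : f (blow z v lam p) = f p :=
  h fun _ hq => blow_apply_of_ne (Finset.mem_erase.1 (Finset.mem_coe.1 hq)).1 p

/-- At infinity the blow-up of `z` along a variable in the monomial `M` makes the germ normal. -/
theorem normal_tschForm_infty {K : Finset V} {ρ : (V → ℝ) → V → ℝ} (hρ : Good A K D D' ρ)
    (hz : z ∉ D) {v : V} (hvz : v ≠ z) {ε : ℝ} (hε : ε ≠ 0) (hρz : ∀ p, ρ p z = ε * p z)
    (hρv : ∀ p, ρ p v = p z * p v) (hρq : ∀ q, q ≠ z → q ≠ v → ∀ p, ρ p q = p q) (hDD : D ⊆ D')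
    (hvD : v ∈ D → z ∈ D') {κ : V → ℕ} (hκv : κ v ≠ 0) (hκz : κ z = 0) {H : (V → ℝ) → ℝ}
    (hH : Normal A D H) (hc : ∀ j < e, IsG A D (c j)) (hg : IsG A D g) (hg0 : g 0 ≠ 0) :
    Normal A D' (fun p => H (ρ p) * tschForm z e 0 (fun p => ∏ q, p q ^ κ q) c g (ρ p)) := by
  have h1 : Normal A D' (fun p => H (ρ p)) := by
    refine hH.comp hρ (fun q hq a ha => ?_) fun q hq => ?_
    · have hqz : q ≠ z := fun h => hz (h ▸ hq)
      by_cases hqv : q = v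
      · subst hqv
        refine ((normal_coord_rpow (hvD hq) ha).mul (normal_coord_rpow (hDD hq) ha)).congr ?_
        filter_upwards [self_mem_nhdsWithin] with p hp
        rw [hρv, Real.mul_rpow (hp _ (hvD hq)) (hp _ (hDD hq))]
      · simpa only [hρq q hqz hqv] using normal_coord_rpow (hDD hq) ha
    · by_cases hqz : q = z
      · subst hqz
        simp only [hρz]
        exact (normal_of_unit (isG_const ε) hε).mul (normal_coord q)
      by_cases hqv : q = v
      · subst hqv
        simp only [hρv]
        exact (normal_coord z).mul (normal_coord q)
      · simp only [hρq q hqz hqv]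
        exact normal_coord q
  obtain ⟨k, hk⟩ := Nat.exists_eq_succ_of_ne_zero hκv
  -- `M ∘ ρ = z N`, and `N` vanishes at the origin because `v` occurs in it
  set N : (V → ℝ) → ℝ := fun p => p z ^ k * ∏ q, p q ^ κ q with hN
  have hM : ∀ p : V → ℝ, ∏ q, ρ p q ^ κ q = p z * N p := by
    intro p
    have h2 : ∀ q, ρ p q ^ κ q = (if q = v then p z ^ κ v else 1) * p q ^ κ q := by
      intro q
      by_cases hqz : q = z
      · subst hqz; simp [hκz, hvz.symm]
      by_cases hqv : q = v
      · subst hqv; simp [hρv, mul_pow]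
      · simp [hρq q hqz hqv, hqv]
    simp only [h2, Finset.prod_mul_distrib, hN, Finset.prod_ite_eq', Finset.mem_univ, if_true]
    rw [hk, pow_succ]
    ring
  have hNG : IsG A D' N := ((isG_coord z).pow k).mul (isG_prod_pow κ)
  have hN0 : N 0 = 0 := by simp only [hN, prod_zero_pow hκv, mul_zero]
  -- the germ is `z ^ (e + 1)` times the unit `B`
  set B : (V → ℝ) → ℝ := fun p =>
    ∑ j ∈ Finset.range e, ε ^ j * (N p ^ (e + 1 - j) * c j (ρ p)) + ε ^ (e + 1) * g (ρ p) with hB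
  have hBG : IsG A D' B := (IsG.sum _ fun j hj => (isG_const _).mul ((hNG.pow _).mul
    (hρ.isG _ (hc j (Finset.mem_range.1 hj))))).add ((isG_const _).mul (hρ.isG _ hg))
  have hB0 : B 0 ≠ 0 := by
    have : B 0 = ε ^ (e + 1) * g 0 := by
      simp only [hB, hN0, hρ.zero]
      rw [Finset.sum_eq_zero, zero_add]
      intro j hj
      rw [Finset.mem_range] at hj
      rw [zero_pow (by omega)]
      ring
    rw [this]
    exact mul_ne_zero (pow_ne_zero _ hε) hg0
  refine (h1.mul (((normal_coord z).pow (e + 1)).mul (normal_of_unit hBG hB0))).congr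
    (Eventually.of_forall fun p => ?_)
  simp only
  congr 1
  simp only [tschForm, hB, hM, hρz, mul_add, Finset.mul_sum, zero_add]
  congr 1
  · refine Finset.sum_congr rfl fun j hj => ?_
    rw [Finset.mem_range] at hj
    have : p z ^ (e + 1) = p z ^ j * p z ^ (e + 1 - j) := by
      rw [← pow_add]; congr 1; omega
    rw [this, mul_pow, mul_pow]
    ring
  · ring

/-- The germ `∑ j < e, M ^ (e + 1 - j) z ^ j c_j + z ^ (e + 1) g`, where `M` is a monomial and one of
the `c_j` is a unit, is made normal by blow-ups that decrease the degree of `M`. -/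
theorem cov_of_natural {K : Finset V} (hzK : z ∈ K) (hb : CovBelow A K z (e + 1)) {j₀ : ℕ}
    (hj₀ : j₀ < e) (n : ℕ) : ∀ (D : Finset V) (κ : V → ℕ) (H : (V → ℝ) → ℝ)
      (c : ℕ → (V → ℝ) → ℝ) (g : (V → ℝ) → ℝ), ∑ v, κ v = n → (∀ v, κ v ≠ 0 → v ∈ K.erase z) →
      z ∉ D → Normal A D H → DependsOn H (K.erase z : Set V) → (∀ j < e, IsG A D (c j)) →
      (∀ j < e, DependsOn (c j) (K.erase z : Set V)) → c j₀ 0 ≠ 0 → IsG A D g →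
      DependsOn g (K : Set V) → g 0 ≠ 0 →
      Cov A K D (fun p => H p * tschForm z e 0 (fun p => ∏ v, p v ^ κ v) c g p) := by
  induction n with
  | zero =>
    intro D κ H c g hn hκ hz hH hHd hc hcd hc0 hg hgd hg0
    -- `M = 1`, and `c_{j₀}` makes the germ regular of order at most `j₀ < e`
    have h0 : ∀ v, κ v = 0 := fun v => (Finset.sum_eq_zero_iff.1 hn) v (Finset.mem_univ v)
    simp only [h0, pow_zero, Finset.prod_const_one]
    refine hb.of_co (k := j₀) (by omega) hz hH hHd (isG_tschForm (isG_const 1) hc hg)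
      (dependsOn_tschForm hzK (fun _ _ _ => rfl) (fun j hj => erase_dependsOn (hcd j hj)) hgd) ?_
    rwa [co_tschForm_zero hj₀ hc hcd hg]
  | succ n ih =>
    intro D κ H c g hn hκ hz hH hHd hc hcd hc0 hg hgd hg0
    obtain ⟨v, hv⟩ : ∃ v, κ v ≠ 0 := by
      by_contra! h
      simp [h] at hn
    have hvK := hκ v hv
    obtain ⟨hvz, hvK'⟩ := Finset.mem_erase.1 hvK
    have hκz : κ z = 0 := by
      by_contra h
      exact (Finset.mem_erase.1 (hκ z h)).1 rfl
    -- blow up `z` along a variable `v` of `M`; this replaces `M` by `M / v`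
    obtain ⟨k, hk⟩ := Nat.exists_eq_succ_of_ne_zero hv
    set κ' : V → ℕ := Function.update κ v k with hκ'
    have hMM : ∀ p : V → ℝ, ∏ q, p q ^ κ q = p v * ∏ q, p q ^ κ' q := by
      intro p
      have h2 : ∀ q, p q ^ κ q = (if q = v then p v else 1) * p q ^ κ' q := by
        intro q
        by_cases hqv : q = v
        · subst hqv; simp [hκ', hk, pow_succ']
        · simp [hκ', hqv]
      simp only [h2, Finset.prod_mul_distrib, Finset.prod_ite_eq', Finset.mem_univ, if_true]
    have hκ'K : ∀ q, κ' q ≠ 0 → q ∈ K.erase z := by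
      intro q hq
      by_cases hqv : q = v
      · rwa [hqv]
      · exact hκ q (by simpa [hκ', hqv] using hq)
    have hsum : ∑ q, κ' q = n := by
      have h2 : ∀ q, κ q = κ' q + if q = v then 1 else 0 := by
        intro q
        by_cases hqv : q = v
        · subst hqv; simp [hκ', hk]
        · simp [hκ', hqv]
      simp only [h2, Finset.sum_add_distrib, Finset.sum_ite_eq', Finset.mem_univ, if_true] at hn
      omega
    have hgood : ∀ lam, Good A K D D (blow z v lam) := fun lam => good_blow_y lam hz hzK hvK'
    -- the form of the germ in the chart with parameter `lam`
    have hform : ∀ lam : ℝ, (fun p => H (blow z v lam p) *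
        tschForm z e 0 (fun p => ∏ q, p q ^ κ q) c g (blow z v lam p)) = fun p =>
        (H p * p v ^ (e + 1)) * tschForm z e lam (fun p => ∏ q, p q ^ κ' q) c
          (fun p => g (blow z v lam p)) p := by
      intro lam
      funext p
      rw [apply_blow_of_dependsOn hHd, mul_assoc]
      congr 1
      have hMb : ∏ q, blow z v lam p q ^ κ q = p v * ∏ q, p q ^ κ' q := by
        rw [← hMM]
        refine Finset.prod_congr rfl fun q _ => ?_
        by_cases hqz : q = z
        · subst hqz; simp [hκz]
        · rw [blow_apply_of_ne hqz]
      simp only [tschForm, hMb, blow_apply_self, mul_add, Finset.mul_sum, zero_add]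
      congr 1
      · refine Finset.sum_congr rfl fun j hj => ?_
        rw [apply_blow_of_dependsOn (hcd j (Finset.mem_range.1 hj))]
        rw [Finset.mem_range] at hj
        have : p v ^ (e + 1) = p v ^ j * p v ^ (e + 1 - j) := by
          rw [← pow_add]; congr 1; omega
        rw [this, ← mul_add, mul_pow, mul_pow]
        ring
      · rw [← mul_add, mul_pow]
        ring
    have hH' : Normal A D (fun p => H p * p v ^ (e + 1)) := hH.mul ((normal_coord v).pow _)
    have hHd' : DependsOn (fun p => H p * p v ^ (e + 1)) (K.erase z : Set V) := by
      intro p q hpq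
      simp only
      rw [hHd hpq, hpq v hvK]
    have hchart : ∀ lam : ℝ, Cov A K D (fun p => H (blow z v lam p) *
        tschForm z e 0 (fun p => ∏ q, p q ^ κ q) c g (blow z v lam p)) := by
      intro lam
      rw [hform]
      have hg' := (hgood lam).isG g hg
      have hgd' := (hgood lam).dependsOn hgd
      have hg0' : g (blow z v lam 0) ≠ 0 := by rwa [(hgood lam).zero]
      by_cases hlam : lam = 0
      -- in the chart at the origin the germ has the same form
      · subst hlam
        exact ih D κ' _ c _ hsum hκ'K hz hH' hHd' hc hcd hc0 hg' hgd' hg0'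
      have hGd := dependsOn_tschForm (lam := lam) hzK
        (erase_dependsOn (dependsOn_prod_pow hκ'K)) (fun j hj => erase_dependsOn (hcd j hj)) hgd'
      by_cases h0 : ∃ q, κ' q ≠ 0
      -- if `M / v` is not constant, the term with `g` makes the germ a unit off the origin
      · obtain ⟨q, hq⟩ := h0
        have hG := isG_tschForm (z := z) (lam := lam) (isG_prod_pow (A := A) (D := D) κ') hc hg'
        refine hb.of_co (k := 0) (by omega) hz hH' hHd' hG hGd ?_
        rw [Nat.cast_zero, Pi.single_zero, co_zero hG]
        simp only [tschForm, prod_zero_pow hq]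
        rw [Finset.sum_eq_zero, zero_add]
        · exact mul_ne_zero (pow_ne_zero _ (by simpa using hlam)) hg0'
        · intro j hj
          rw [Finset.mem_range] at hj
          rw [zero_pow (by omega)]
          ring
      -- otherwise its order in `z` is at most `e`
      · push Not at h0
        simp only [h0, pow_zero, Finset.prod_const_one] at hGd ⊢
        refine hb.of_co (k := e) (by omega) hz hH' hHd' (isG_tschForm (isG_const 1) hc hg') hGd ?_
        refine co_tschForm_ne_zero hlam hc hcd hg' hg0' fun p => ?_
        congr 1
        funext q
        by_cases hqz : q = z
        · subst hqz; simp [blow, zr, hvz]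
        · simp [blow, zr, hqz]
    by_cases hvD : v ∈ D
    · refine .node (.yx z v hz hvD) ⟨hzK, hvK'⟩ fun D' ρ hρ => ?_
      cases hρ with
      | yx _ _ _ _ lam => exact hchart lam
      | yxInfty _ _ _ _ ε =>
        refine .normal (normal_tschForm_infty (good_blowInf hz hvD hzK hvK' ε) hz hvz
          (ε := ((ε : ℤ) : ℝ)) ?_ (fun p => ?_) (fun p => ?_) (fun q hqz hqv p => ?_)
          (Finset.subset_insert _ _) (fun _ => Finset.mem_insert_self _ _) hv hκz hH hc hg hg0)
        · simp
        · simp [blowInf]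
        · simp [blowInf, hvz]
        · simp [blowInf, hqz, hqv]
    · refine .node (.yy z v hz hvD hvz.symm) ⟨hzK, hvK'⟩ fun D' ρ hρ => ?_
      cases hρ with
      | yy _ _ _ _ _ lam => exact hchart lam
      | yyInfty =>
        refine .normal (normal_tschForm_infty (good_blow_y 0 hvD hvK' hzK) hz hvz
          one_ne_zero (fun p => ?_) (fun p => ?_) (fun q hqz hqv p => ?_) subset_rfl
          (fun h => absurd h hvD) hv hκz hH hc hg hg0)
        · simp [blow, hvz.symm]
        · simp [blow]
        · simp [blow, hqv]

/-! ### Making the exponents integral -/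

theorem mono_ramX {v : V} (hv : v ∈ D) (s : ℝ≥0) (w : V → ℝ≥0) {p : V → ℝ} (hp : p ∈ Qd D) :
    mono w (ramX v s p) = mono (Function.update w v (s * w v)) p := by
  refine Finset.prod_congr rfl fun q _ => ?_
  by_cases hq : q = v
  · subst hq
    simp [ramX, Real.rpow_mul (hp q hv)]
  · simp [ramX, hq]

theorem mono_ramY {v : V} {d n : ℕ} (ε : ℤˣ) {w : V → ℝ≥0} (hw : w v = n) (p : V → ℝ) :
    mono w (ramY v d ε p) =
      ((ε : ℤ) : ℝ) ^ n * mono (Function.update w v ((d : ℝ≥0) * w v)) p := by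
  have h : ∀ q, ramY v d ε p q ^ (w q : ℝ) = (if q = v then ((ε : ℤ) : ℝ) ^ n else 1) *
      p q ^ ((Function.update w v ((d : ℝ≥0) * w v) q : ℝ≥0) : ℝ) := by
    intro q
    by_cases hq : q = v
    · subst hq
      have h2 : (((d : ℝ≥0) * w q : ℝ≥0) : ℝ) = ((d * n : ℕ) : ℝ) := by rw [hw]; push_cast; rfl
      simp only [ramY, Function.update_self, if_true]
      rw [h2, hw, NNReal.coe_natCast, Real.rpow_natCast, Real.rpow_natCast, mul_pow, ← pow_mul]
    · simp [ramY, hq]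
  unfold mono
  simp only [h, Finset.prod_mul_distrib, Finset.prod_ite_eq', Finset.mem_univ, if_true]

open Classical in
/-- The exponents of the coefficients of a germ become integral after ramifications. -/
theorem cov_of_exponents {K : Finset V} (hzK : z ∈ K) (hb : CovBelow A K z (e + 1)) {j₀ : ℕ}
    (hj₀ : j₀ < e) (n : ℕ) : ∀ (D : Finset V) (κ : V → ℝ≥0) (γ : ℕ → V → ℝ≥0) (H : (V → ℝ) → ℝ)
      (u : ℕ → (V → ℝ) → ℝ) (g : (V → ℝ) → ℝ),
      ((K.erase z).filter fun v => ¬ ∃ k : ℕ, κ v = k).card = n →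
      (∀ j < e, MonoOk A D (γ j)) → (∀ j < e, ∀ v, ((e + 1 - j : ℕ) : ℝ≥0) * κ v ≤ γ j v) →
      (∀ v, γ j₀ v = ((e + 1 - j₀ : ℕ) : ℝ≥0) * κ v) → (∀ j < e, ∀ v ∉ K.erase z, γ j v = 0) →
      z ∉ D → Normal A D H → DependsOn H (K.erase z : Set V) → (∀ j < e, IsG A D (u j)) →
      (∀ j < e, DependsOn (u j) (K.erase z : Set V)) → u j₀ 0 ≠ 0 → IsG A D g →
      DependsOn g (K : Set V) → g 0 ≠ 0 →
      Cov A K D (fun p => H p * (∑ j ∈ Finset.range e, p z ^ j * (mono (γ j) p * u j p) +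
        p z ^ (e + 1) * g p)) := by
  induction n with
  | zero =>
    intro D κ γ H u g hn hγ hκγ hγ₀ hγK hz hH hHd hu hud hu0 hg hgd hg0
    -- all `κ v` are integers, and `M = ∏ v ^ κ v` is the monomial of `cov_of_natural`
    have hκK : ∀ v ∉ K.erase z, κ v = 0 := by
      intro v hv
      have h1 := hγ₀ v
      rw [hγK j₀ hj₀ v hv] at h1
      refine (mul_eq_zero.1 h1.symm).resolve_left ?_
      have : e + 1 - j₀ ≠ 0 := by omega
      exact_mod_cast this
    have hnat : ∀ v, ∃ k : ℕ, κ v = k := by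
      intro v
      by_cases hv : v ∈ K.erase z
      · by_contra h
        have := Finset.card_eq_zero.1 hn
        exact Finset.notMem_empty v (this ▸ Finset.mem_filter.2 ⟨hv, h⟩)
      · exact ⟨0, by simp [hκK v hv]⟩
    choose k hk using hnat
    have hκe : κ = fun v => (k v : ℝ≥0) := funext hk
    have hmul : ∀ i : ℕ, MonoOk A D (fun v => (i : ℝ≥0) * κ v) := by
      intro i
      have := MonoOk.nat (A := A) (D := D) fun v => i * k v
      simpa [hκe] using this
    set δ : ℕ → V → ℝ≥0 := fun j => γ j - fun v => ((e + 1 - j : ℕ) : ℝ≥0) * κ v with hδ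
    have hδok : ∀ j < e, MonoOk A D (δ j) := fun j hj => (hγ j hj).sub (hmul _)
    have hδK : ∀ j < e, ∀ v ∉ K.erase z, δ j v = 0 := fun j hj v hv => by
      simp [hδ, hγK j hj v hv]
    refine (cov_of_natural hzK hb hj₀ (∑ v, k v) D k H (fun j p => mono (δ j) p * u j p) g rfl
      (fun v hv => ?_) hz hH hHd (fun j hj => (isG_mono (hδok j hj)).mul (hu j hj))
      (fun j hj p q hpq => ?_) ?_ hg hgd hg0).congr ?_
    · by_contra h
      have := hκK v h
      rw [hk] at this
      exact hv (by exact_mod_cast this)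
    · simp only
      rw [dependsOn_mono (hδK j hj) hpq, hud j hj hpq]
    · have h0 : δ j₀ = 0 := by funext v; simp [hδ, hγ₀ v]
      simpa [h0, mono] using hu0
    · filter_upwards [self_mem_nhdsWithin] with p hp
      congr 1
      simp only [tschForm, zero_add]
      congr 1
      refine Finset.sum_congr rfl fun j hj => ?_
      rw [Finset.mem_range] at hj
      have h1 : γ j = (fun v => ((e + 1 - j : ℕ) : ℝ≥0) * κ v) + δ j := by
        funext v
        exact (add_tsub_cancel_of_le (hκγ j hj v)).symm
      rw [h1, mono_add hp (hmul _) (hδok j hj)]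
      have h2 : mono (fun v => ((e + 1 - j : ℕ) : ℝ≥0) * κ v) p = (∏ v, p v ^ k v) ^ (e + 1 - j) := by
        rw [← Finset.prod_pow]
        refine Finset.prod_congr rfl fun v _ => ?_
        rw [← pow_mul, mul_comm (k v)]
        simp only [hk]
        have h3 : ((((e + 1 - j : ℕ) : ℝ≥0) * (k v : ℝ≥0) : ℝ≥0) : ℝ) =
            (((e + 1 - j) * k v : ℕ) : ℝ) := by
          rw [NNReal.coe_mul, NNReal.coe_natCast, NNReal.coe_natCast, Nat.cast_mul]
        rw [h3, Real.rpow_natCast]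
      rw [h2]
      ring
  | succ n ih =>
    intro D κ γ H u g hn hγ hκγ hγ₀ hγK hz hH hHd hu hud hu0 hg hgd hg0
    obtain ⟨v, hv⟩ : ((K.erase z).filter fun v => ¬ ∃ k : ℕ, κ v = k).Nonempty := by
      rw [← Finset.card_pos]; omega
    obtain ⟨hvK, hvn⟩ := Finset.mem_filter.1 hv
    obtain ⟨hvz, hvK'⟩ := Finset.mem_erase.1 hvK
    -- the effect of a ramification of the variable `v`
    have key : ∀ (s : ℝ≥0) (ρ : (V → ℝ) → V → ℝ) (σ : ℕ → ℝ), Good A (K.erase z) D D ρ →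
        Normal A D (fun p => H (ρ p)) → (∃ k : ℕ, s * κ v = k) → σ j₀ ≠ 0 →
        (∀ j < e, MonoOk A D (Function.update (γ j) v (s * γ j v))) →
        (∀ j < e, (fun p => mono (γ j) (ρ p)) =ᶠ[gz D]
          fun p => σ j * mono (Function.update (γ j) v (s * γ j v)) p) →
        Cov A K D (fun p => H (ρ p) * (∑ j ∈ Finset.range e, ρ p z ^ j *
          (mono (γ j) (ρ p) * u j (ρ p)) + ρ p z ^ (e + 1) * g (ρ p))) := by
      intro s ρ σ hρ hHρ hs hσ hok hmono
      have hK : K.erase z ⊆ K := Finset.erase_subset _ _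
      have hgd' : DependsOn (fun p => g (ρ p)) (K : Set V) := fun p q hpq => hgd fun x hx => by
        by_cases hx' : x ∈ K.erase z
        · exact hρ.dep x hx' fun y hy => hpq y (hK (Finset.mem_coe.1 hy))
        · rw [hρ.off x hx', hρ.off x hx', hpq x hx]
      refine (ih D (Function.update κ v (s * κ v)) (fun j => Function.update (γ j) v (s * γ j v))
        (fun p => H (ρ p)) (fun j p => σ j * u j (ρ p)) (fun p => g (ρ p)) ?_ hok (fun j hj q => ?_)
        (fun q => ?_) (fun j hj q hq => ?_) hz hHρ (hρ.dependsOn hHd)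
        (fun j hj => (isG_const _).mul (hρ.isG _ (hu j hj)))
        (fun j hj p q hpq => ?_) ?_ (hρ.isG g hg) hgd' (by rwa [hρ.zero])).congr ?_
      · have h1 : ((K.erase z).filter fun q => ¬ ∃ k : ℕ, Function.update κ v (s * κ v) q = k) =
            ((K.erase z).filter fun q => ¬ ∃ k : ℕ, κ q = k).erase v := by
          ext q
          by_cases hq : q = v
          · subst hq
            simp [hs]
          · simp [hq]
        rw [h1, Finset.card_erase_of_mem hv, hn]
        rfl
      · by_cases hq : q = v
        · subst hq
          simp only [Function.update_self]
          rw [mul_left_comm]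
          gcongr
          exact hκγ j hj q
        · simpa [hq] using hκγ j hj q
      · by_cases hq : q = v
        · subst hq
          simp only [Function.update_self]
          rw [hγ₀ q]
          ring
        · simpa [hq] using hγ₀ q
      · have hqv : q ≠ v := fun h => hq (h ▸ hvK)
        simpa [hqv] using hγK j hj q hq
      · exact congrArg (σ j * ·) (hρ.dependsOn (hud j hj) hpq)
      · rw [hρ.zero]
        exact mul_ne_zero hσ hu0
      · have h2 := (Finset.eventually_all (Finset.range e)).2 fun j hj =>
          hmono j (Finset.mem_range.1 hj)
        filter_upwards [h2] with p hp
        congr 1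
        have hzρ : ρ p z = p z := hρ.off z (by simp) p
        rw [hzρ]
        congr 1
        refine Finset.sum_congr rfl fun j hj => ?_
        rw [hp j hj]
        ring
    have hN : e + 1 - j₀ ≠ 0 := by omega
    by_cases hvD : v ∈ D
    · -- the exponent of `v` in `γ j₀` is the least multiple that is known to be admissible
      have hγv := (hγ j₀ hj₀).1 v hvD
      have hκ0 : κ v ≠ 0 := fun h => hvn ⟨0, by simp [h]⟩
      obtain ⟨s, hs, hs0, hsκ⟩ : ∃ s : ℝ≥0, ExpOk A s ∧ 0 < s ∧ ∃ k : ℕ, s * κ v = k := by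
        rcases hγv with ⟨k, hk⟩ | ⟨h1, h2⟩
        · exact ⟨(e + 1 - j₀ : ℕ), expOk_nat _, by exact_mod_cast Nat.pos_of_ne_zero hN, k, by
            rw [← hγ₀ v, hk]⟩
        · have h3 : γ j₀ v ≠ 0 := by
            rw [hγ₀ v]
            exact mul_ne_zero (by exact_mod_cast hN) hκ0
          refine ⟨(e + 1 - j₀ : ℕ) / γ j₀ v, Or.inr ⟨h1, ?_⟩, ?_, 1, ?_⟩
          · rw [NNReal.coe_div, NNReal.coe_natCast]
            exact div_mem (natCast_mem _ _) h2
          · exact div_pos (by exact_mod_cast Nat.pos_of_ne_zero hN) (pos_iff_ne_zero.2 h3)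
          · rw [div_mul_eq_mul_div, ← hγ₀ v, div_self h3, Nat.cast_one]
      refine .node (.ramX v s hvD hs hs0) hvK' fun D' ρ hρ => ?_
      have hgood := hρ.good (K := K.erase z) hvK
      cases hρ
      have hupd : ∀ w, MonoOk A D w → MonoOk A D (Function.update w v (s * w v)) := by
        intro w hw
        refine ⟨fun q hq => ?_, fun q hq => ?_⟩
        · by_cases h : q = v
          · subst h; simpa using hs.mul (hw.1 q hq)
          · simpa [h] using hw.1 q hq
        · have h : q ≠ v := fun h => hq (h ▸ hvD)
          simpa [h] using hw.2 q hq
      refine key s _ (fun _ => 1) hgood ?_ hsκ one_ne_zero (fun j hj => hupd _ (hγ j hj))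
        (fun j hj => ?_)
      · refine hH.comp hgood (fun q hq a ha => ?_) fun q hq => ?_
        · by_cases h : q = v
          · subst h
            refine (normal_coord_rpow hq (hs.mul ha)).congr ?_
            filter_upwards [self_mem_nhdsWithin] with p hp
            simp [ramX, Real.rpow_mul (hp q hq)]
          · simpa [ramX, h] using normal_coord_rpow hq ha
        · have h : q ≠ v := fun h => hq (h ▸ hvD)
          simpa [ramX, h] using normal_coord (A := A) (D := D) q
      · filter_upwards [self_mem_nhdsWithin] with p hp
        rw [mono_ramX hvD s _ hp, one_mul]
    -- a multiple of `κ v` by `e + 1 - j₀` is the exponent of `v` in `γ j₀`, an integer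
    · refine .node (.ramY v (e + 1 - j₀) hvD (Nat.pos_of_ne_zero hN)) hvK' fun D' ρ hρ => ?_
      have hgood := hρ.good (K := K.erase z) hvK
      cases hρ with
      | ramY _ _ _ _ ε =>
      have hγn : ∀ j, ∃ n : ℕ, j < e → γ j v = n := by
        intro j
        by_cases hj : j < e
        · obtain ⟨n, hn⟩ := (hγ j hj).2 v hvD
          exact ⟨n, fun _ => hn⟩
        · exact ⟨0, fun h => absurd h hj⟩
      choose N hNγ using hγn
      refine key (e + 1 - j₀ : ℕ) _ (fun j => ((ε : ℤ) : ℝ) ^ N j) hgood ?_ ⟨N j₀, ?_⟩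
        (pow_ne_zero _ (by simp)) (fun j hj => ⟨fun q hq => ?_, fun q hq => ?_⟩) (fun j hj => ?_)
      · refine hH.comp hgood (fun q hq a ha => ?_) fun q hq => ?_
        · have h : q ≠ v := fun h => hvD (h ▸ hq)
          simpa [ramY, h] using normal_coord_rpow hq ha
        · by_cases h : q = v
          · subst h
            simp only [ramY, Function.update_self]
            exact (normal_of_unit (isG_const _) (by simp)).mul ((normal_coord q).pow _)
          · simpa [ramY, h] using normal_coord (A := A) (D := D) q
      · rw [← hγ₀ v, hNγ j₀ hj₀]
      · have h : q ≠ v := fun h => hvD (h ▸ hq)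
        simpa [h] using (hγ j hj).1 q hq
      · by_cases h : q = v
        · subst h
          exact ⟨(e + 1 - j₀) * N j, by simp [hNγ j hj]⟩
        · simpa [h] using (hγ j hj).2 q hq
      · exact Eventually.of_forall fun p => mono_ramY ε (hNγ j hj) p

/-! ### Normal crossings along trees -/

theorem IsLeastExp.pow (hf : IsG A D f) {w : V → ℝ≥0} (h : IsLeastExp A D f w) (k : ℕ) :
    IsLeastExp A D (fun p => f p ^ k) (fun v => (k : ℝ≥0) * w v) := by
  obtain ⟨hw, u, hu, hu0, h1⟩ := h.exists_eq hf
  have h2 : ∀ k : ℕ, MonoOk A D (fun v => (k : ℝ≥0) * w v) ∧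
      ∀ p ∈ Qd D, mono w p ^ k = mono (fun v => (k : ℝ≥0) * w v) p := by
    intro k
    induction k with
    | zero =>
      refine ⟨?_, fun p _ => by simp [mono]⟩
      convert monoOk_zero (A := A) (D := D) using 1
      funext v
      simp
    | succ k ih =>
      have e1 : (fun v => ((k + 1 : ℕ) : ℝ≥0) * w v) = (fun v => (k : ℝ≥0) * w v) + w := by
        funext v
        simp [add_mul]
      rw [e1]
      exact ⟨ih.1.add hw, fun p hp => by rw [mono_add hp ih.1 hw, pow_succ, ih.2 p hp]⟩
  refine isLeastExp_of_eq (h2 k).1 (hu.pow k) (pow_ne_zero k hu0) ?_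
  filter_upwards [h1, self_mem_nhdsWithin] with p hp hp'
  rw [hp, mul_pow, (h2 k).2 p hp']

/-- Making a single germ normal along `ρ` makes finitely many germs `F k` and their nonzero
differences normal: a factor of a normal product is normal. -/
theorem exists_prod_diff {ι : Type*} (s : Finset ι) {F : ι → (V → ℝ) → ℝ} (hF : ∀ k, IsG A D (F k))
    (hF0 : ∀ k ∈ s, ¬ F k =ᶠ[gz D] 0) {K : Set V} (hFd : ∀ k, DependsOn (F k) K) :
    ∃ Φ, IsG A D Φ ∧ DependsOn Φ K ∧ ¬ Φ =ᶠ[gz D] 0 ∧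
      ∀ {D' : Finset V} {ρ : (V → ℝ) → V → ℝ}, (∀ g, IsG A D g → IsG A D' (fun p => g (ρ p))) →
        Normal A D' (fun p => Φ (ρ p)) → (∀ k ∈ s, Normal A D' (fun p => F k (ρ p))) ∧
          ∀ k ∈ s, ∀ l ∈ s, (fun p => F k p - F l p) =ᶠ[gz D] 0 ∨
            Normal A D' (fun p => F k (ρ p) - F l (ρ p)) := by
  classical
  -- the differences, replaced by `1` where they vanish
  let E : ι × ι → (V → ℝ) → ℝ := fun x =>
    if (fun p => F x.1 p - F x.2 p) =ᶠ[gz D] 0 then fun _ => 1 else fun p => F x.1 p - F x.2 p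
  have hE : ∀ x, IsG A D (E x) ∧ ¬ E x =ᶠ[gz D] 0 ∧ DependsOn (E x) K := fun x => by
    by_cases h : (fun p => F x.1 p - F x.2 p) =ᶠ[gz D] 0
    · simp only [E, if_pos h]
      exact ⟨isG_const 1, fun h => one_ne_zero (eq_zero_of_eventuallyEq h), fun _ _ _ => rfl⟩
    · simp only [E, if_neg h]
      exact ⟨(hF _).sub (hF _), h, fun p q hpq => congrArg₂ (· - ·) (hFd _ hpq) (hFd _ hpq)⟩
  let G : ι ⊕ ι × ι → (V → ℝ) → ℝ := Sum.elim F E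
  let S := s.disjSum (s ×ˢ s)
  have hG : ∀ x, IsG A D (G x) := Sum.rec hF fun x => (hE x).1
  refine ⟨fun p => ∏ x ∈ S, G x p, IsG.prod _ fun x _ => hG x,
    fun p q hpq => Finset.prod_congr rfl fun x _ => ?_,
    not_eventuallyEq_zero_prod _ (fun x _ => hG x) ?_, fun {D' ρ} hρ hn => ?_⟩
  · rcases x with k | x
    exacts [hFd k hpq, (hE x).2.2 hpq]
  · rintro (k | x) hx
    exacts [hF0 k (Finset.inl_mem_disjSum.1 hx), (hE x).2.1]
  · have h : ∀ x ∈ S, Normal A D' (fun p => G x (ρ p)) := fun x hx =>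
      Normal.of_prod S (f := fun x p => G x (ρ p)) (fun x _ => hρ _ (hG x)) hn hx
    refine ⟨fun k hk => h (.inl k) (Finset.inl_mem_disjSum.2 hk), fun k hk l hl =>
      or_iff_not_imp_left.2 fun hkl => ?_⟩
    have := h (.inr (k, l)) (Finset.inr_mem_disjSum.2 (Finset.mk_mem_product hk hl))
    simp only [G, E, Sum.elim_inr, if_neg hkl] at this
    exact this

variable (A) in
/-- Every nonzero germ in the variables of `K` can be made normal, over all `D`. -/
def CovAll (K : Finset V) : Prop :=
  ∀ (D : Finset V) (f : (V → ℝ) → ℝ), IsG A D f → DependsOn f (K : Set V) → ¬ f =ᶠ[gz D] 0 →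
    Cov A K D f

/-- The case of a germ that is regular of order `d` in the variable `z`. -/
theorem covBelow_of_covAll {K : Finset V} (hzK : z ∈ K) (hK : CovAll A (K.erase z)) (d : ℕ) :
    CovBelow A K z d := by
  classical
  induction d with
  | zero => intro r hr; exact absurd hr (Nat.not_lt_zero r)
  | succ d ih =>
    intro r hr D H G hz hH hHd hH0 hG hGd hreg
    rcases Nat.lt_succ_iff_lt_or_eq.1 hr with hr | rfl
    · exact ih r hr D H G hz hH hHd hH0 hG hGd hreg
    have hKK : K.erase z ⊆ K := Finset.erase_subset _ _
    -- if the order is zero then `G` is a unit, and only `H` has to be made normal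
    rcases r with _ | e
    · refine (hK D H hH hHd hH0).bind hKK fun D' ρ hρ hn => .normal ?_
      exact hn.mul (normal_of_unit (hρ.isG G hG) (by rw [hρ.zero]; exact hreg.ne_zero_of_zero))
    obtain ⟨h, c, g, hh, hhd, hh0, hc, hcd, hg, hgd, hg0, hexp⟩ :=
      exists_tschirnhausen hz hzK hG hGd hreg
    refine .node (.trans z h hz hh hh0 fun p q hpq => hhd fun v hv => hpq v ?_) ⟨hzK, hhd⟩
      fun D' ρ hρ => ?_
    · have := (Finset.mem_erase.1 (Finset.mem_coe.1 hv)).1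
      simp [this]
    cases hρ
    have e1 : (fun p => H (trans z h p) * G (trans z h p)) =ᶠ[gz D] fun p =>
        H p * (∑ k ∈ Finset.range e, p z ^ k * c k p + p z ^ (e + 1) * g p) := by
      filter_upwards [hexp] with p hp
      rw [hp]
      congr 1
      refine hHd fun v hv => ?_
      have := (Finset.mem_erase.1 (Finset.mem_coe.1 hv)).1
      simp [trans, this]
    refine Cov.congr ?_ e1.symm
    -- the indices of the nonzero coefficients
    set J : Finset ℕ := (Finset.range e).filter fun j => ¬ c j =ᶠ[gz D] 0 with hJ
    have hJe : ∀ j ∈ J, j < e := fun j hj => Finset.mem_range.1 (Finset.mem_filter.1 hj).1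
    have hJc : ∀ j ∈ J, ¬ c j =ᶠ[gz D] 0 := fun j hj => (Finset.mem_filter.1 hj).2
    have hJ' : ∀ j < e, j ∉ J → c j =ᶠ[gz D] 0 := by
      intro j hj hjJ
      by_contra hcon
      exact hjJ (Finset.mem_filter.2 ⟨Finset.mem_range.2 hj, hcon⟩)
    -- the orders in `z` of the terms suggest weights: `c j` is to be compared with `M ^ (e + 1 - j)`,
    -- and the powers of the coefficients that become comparable
    set m : ℕ → ℕ := fun j => (e + 1).factorial / (e + 1 - j) with hm
    have hmj : ∀ j < e, m j * (e + 1 - j) = (e + 1).factorial := fun j hj =>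
      Nat.div_mul_cancel (Nat.dvd_factorial (by omega) (by omega))
    have hm1 : ∀ j < e, 1 ≤ m j := by
      intro j hj
      have := hmj j hj
      rcases Nat.eq_zero_or_pos (m j) with h0 | h0
      · rw [h0, zero_mul] at this
        exact absurd this.symm (Nat.factorial_ne_zero _)
      · exact h0
    set C : ℕ → (V → ℝ) → ℝ := fun j p => c j p ^ m j with hC
    have hCG : ∀ j, IsG A D (C j) := fun j => (hc j).pow _
    have hCd : ∀ j, DependsOn (C j) (K.erase z : Set V) := fun j p q hpq => by
      simp only [hC]; rw [hcd j hpq]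
    -- a product with `H` is made normal in fewer variables
    obtain ⟨Φ, hΦ, hΦd, hΦ0, hΦn⟩ := exists_prod_diff J hCG
      (fun j hj => not_eventuallyEq_zero_pow (hc j) (hJc j hj) _) hCd
    refine (hK D (fun p => H p * Φ p) (hH.mul hΦ) (fun p q hpq => congrArg₂ (· * ·) (hHd hpq) (hΦd hpq))
      (not_eventuallyEq_zero_mul hH hΦ hH0 hΦ0)).bind hKK fun D' ρ hρ hn => ?_
    have hz' : z ∉ D' := fun h => hz ((hρ.mem_iff z (by simp)).1 h)
    have hρz : ∀ p, ρ p z = p z := fun p => hρ.off z (by simp) p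
    have hHn : Normal A D' (fun p => H (ρ p)) := Normal.of_mul (hρ.isG H hH) (hρ.isG Φ hΦ) hn
    obtain ⟨hn3, hn4⟩ := hΦn hρ.isG (Normal.of_mul (hρ.isG Φ hΦ) (hρ.isG H hH)
      (hn.congr (Eventually.of_forall fun p => mul_comm _ _)))
    have hn5 : ∀ j ∈ J, Normal A D' (fun p => c j (ρ p)) := fun j hj =>
      Normal.of_pow (hρ.isG _ (hc j)) (hm1 j (hJe j hj)) (hn3 j hj)
    -- without coefficients the germ is `H` times a power of `z` times a unit
    rcases J.eq_empty_or_nonempty with hJ0 | hJne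
    · refine .normal ((hHn.mul (((normal_coord z).pow (e + 1)).mul
        (normal_of_unit (hρ.isG g hg) (by rwa [hρ.zero])))).congr ?_)
      have h2 := (Finset.eventually_all (Finset.range e)).2 fun j hj =>
        hρ.tendsto.eventually (hJ' j (Finset.mem_range.1 hj) (by rw [hJ0]; exact Finset.notMem_empty j))
      filter_upwards [h2] with p hp
      rw [Finset.sum_eq_zero, zero_add, hρz]
      intro j hj
      rw [hp j hj]
      simp
    have hex : ∀ j, ∃ w : V → ℝ≥0, j ∈ J → IsLeastExp A D' (fun p => c j (ρ p)) w := by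
      intro j
      by_cases hj : j ∈ J
      · obtain ⟨w, hw⟩ := (hn5 j hj).exists_isLeastExp
        exact ⟨w, fun _ => hw⟩
      · exact ⟨0, fun h => absurd h hj⟩
    choose w hw using hex
    have hwC : ∀ j ∈ J, IsLeastExp A D' (fun p => C j (ρ p)) (fun v => (m j : ℝ≥0) * w j v) :=
      fun j hj => (hw j hj).pow (hρ.isG _ (hc j)) _
    have htot : ∀ j ∈ J, ∀ l ∈ J, (fun v => (m j : ℝ≥0) * w j v) ≤ (fun v => (m l : ℝ≥0) * w l v) ∨
        (fun v => (m l : ℝ≥0) * w l v) ≤ (fun v => (m j : ℝ≥0) * w j v) := by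
      intro j hj l hl
      exact IsLeastExp.le_or_le (hρ.isG _ (hCG j)) (hρ.isG _ (hCG l)) (hwC j hj) (hwC l hl)
        ((hn4 j hj l hl).imp_left hρ.tendsto.eventually)
    -- the coefficient whose power has the least exponent determines the monomial `M`
    obtain ⟨j₀, hj₀J, hj₀⟩ := Finset.exists_minimalFor (fun j => fun v => (m j : ℝ≥0) * w j v) J hJne
    have hmin : ∀ j ∈ J, ∀ v, (m j₀ : ℝ≥0) * w j₀ v ≤ (m j : ℝ≥0) * w j v := by
      intro j hj
      rcases htot j₀ hj₀J j hj with h | h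
      · exact h
      · exact hj₀ hj h
    have hj₀e := hJe j₀ hj₀J
    have hwK : ∀ j ∈ J, ∀ v ∉ K.erase z, w j v = 0 := fun j hj v hv =>
      apply_eq_zero_of_mem_Supp (hρ.isG _ (hc j)) (hρ.dependsOn (hcd j)) (hw j hj).1 hv
    set κ : V → ℝ≥0 := fun v => w j₀ v / ((e + 1 - j₀ : ℕ) : ℝ≥0) with hκ
    have hNN : ∀ j < e, ((e + 1 - j : ℕ) : ℝ≥0) ≠ 0 := fun j hj => by
      have : e + 1 - j ≠ 0 := by omega
      exact_mod_cast this
    have hκ0 : ∀ v, w j₀ v = ((e + 1 - j₀ : ℕ) : ℝ≥0) * κ v := fun v => by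
      rw [hκ]; exact (mul_div_cancel₀ _ (hNN j₀ hj₀e)).symm
    have hex2 : ∀ j, ∃ (γ : V → ℝ≥0) (u : (V → ℝ) → ℝ), j < e → MonoOk A D' γ ∧
        (∀ v, ((e + 1 - j : ℕ) : ℝ≥0) * κ v ≤ γ v) ∧ (j = j₀ → γ = w j₀ ∧ u 0 ≠ 0) ∧
        (∀ v ∉ K.erase z, γ v = 0) ∧ IsG A D' u ∧ DependsOn u (K.erase z : Set V) ∧
        (fun p => c j (ρ p)) =ᶠ[gz D'] fun p => mono γ p * u p := by
      intro j
      by_cases hj : j ∈ J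
      · obtain ⟨h1, u, hu, hu0, h2⟩ := (hw j hj).exists_eq (hρ.isG _ (hc j))
        refine ⟨w j, fun p => u (zr (K.erase z)ᶜ p), fun hje => ⟨h1, fun v => ?_, ?_, hwK j hj,
          hu.zr _, dependsOn_zr,
          eventuallyEq_mono_mul_zr (hρ.dependsOn (hcd j)) (hwK j hj) h2⟩⟩
        · have h3 := hmin j hj v
          rw [hκ0 v, ← mul_assoc] at h3
          have h4 : (m j₀ : ℝ≥0) * ((e + 1 - j₀ : ℕ) : ℝ≥0) =
              (m j : ℝ≥0) * ((e + 1 - j : ℕ) : ℝ≥0) := by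
            exact_mod_cast (hmj j₀ hj₀e).trans (hmj j hje).symm
          rw [h4, mul_assoc] at h3
          have h5 : (0 : ℝ≥0) < m j := by exact_mod_cast hm1 j hje
          exact le_of_mul_le_mul_left h3 h5
        · rintro rfl
          exact ⟨rfl, by simpa only [zr_zero] using hu0⟩
      · obtain ⟨h1, -⟩ := (hw j₀ hj₀J).exists_eq (hρ.isG _ (hc j₀))
        -- a zero coefficient is given an exponent that is large enough
        refine ⟨fun v => ((e + 1 : ℕ) : ℝ≥0) * w j₀ v, fun _ => 0, fun hje => ⟨?_, fun v => ?_, ?_,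
          fun v hv => by simp [hwK j₀ hj₀J v hv], isG_const 0, fun _ _ _ => rfl, ?_⟩⟩
        · refine ⟨fun v hv => (expOk_nat _).mul (h1.1 v hv), fun v hv => ?_⟩
          obtain ⟨n, hn⟩ := h1.2 v hv
          exact ⟨(e + 1) * n, by simp [hn]⟩
        · simp only [hκ0 v]
          have h3 : ((e + 1 - j : ℕ) : ℝ≥0) ≤ ((e + 1 : ℕ) : ℝ≥0) := by
            exact_mod_cast Nat.sub_le _ _
          have h4 : (1 : ℝ≥0) ≤ ((e + 1 - j₀ : ℕ) : ℝ≥0) := by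
            have : 1 ≤ e + 1 - j₀ := by omega
            exact_mod_cast this
          exact mul_le_mul h3 (le_mul_of_one_le_left zero_le h4) zero_le zero_le
        · rintro rfl
          exact absurd hj₀J hj
        · filter_upwards [hρ.tendsto.eventually (hJ' j hje hj)] with p hp
          rw [hp]
          simp
    choose γ u hγu using hex2
    refine (cov_of_exponents hzK ih hj₀e _ D' κ γ (fun p => H (ρ p)) u (fun p => g (ρ p)) rfl
      (fun j hj => (hγu j hj).1) (fun j hj => (hγu j hj).2.1) (fun v => ?_)
      (fun j hj => (hγu j hj).2.2.2.1) hz' hHn (hρ.dependsOn hHd)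
      (fun j hj => (hγu j hj).2.2.2.2.1) (fun j hj => (hγu j hj).2.2.2.2.2.1)
      ((hγu j₀ hj₀e).2.2.1 rfl).2 (hρ.isG g hg) (fun p q hpq => hgd fun x hx => ?_)
      (by rwa [hρ.zero])).congr ?_
    · rw [((hγu j₀ hj₀e).2.2.1 rfl).1, hκ0]
    · by_cases hx' : x ∈ K.erase z
      · exact hρ.dep x hx' fun y hy => hpq y (hKK (Finset.mem_coe.1 hy))
      · rw [hρ.off x hx', hρ.off x hx', hpq x hx]
    · have h2 := (Finset.eventually_all (Finset.range e)).2 fun j hj =>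
        (hγu j (Finset.mem_range.1 hj)).2.2.2.2.2.2
      filter_upwards [h2] with p hp
      rw [hρz]
      congr 2
      refine Finset.sum_congr rfl fun j hj => ?_
      rw [hp j hj]

/-- A germ is made regular in the variable `z` by linear changes of the variables outside `D`. -/
theorem cov_of_zr_ne_zero {K : Finset V} (hzK : z ∈ K) (hK : CovAll A (K.erase z)) (hz : z ∉ D)
    {H : (V → ℝ) → ℝ} (hH : Normal A D H) (hHd : DependsOn H (K ∩ D : Finset V)) (n : ℕ) :
    ∀ (R : Finset V) (G : (V → ℝ) → ℝ), (K \ R).card = n → D ⊆ R → z ∉ R → IsG A D G →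
      DependsOn G (K : Set V) → ¬ (fun p => G (zr R p)) =ᶠ[gz D] 0 →
      Cov A K D (fun p => H p * G p) := by
  induction n using Nat.strong_induction_on with
  | _ n ih =>
  intro R G hn hDR hzR hG hGd h0
  -- the variables in `R` are those that may be set equal to zero; a variable `k` joins them after
  -- the change `p_k + c p_z`, for a suitable `c`
  by_cases hk : ∃ k ∈ K, k ∉ R ∧ k ≠ z
  · obtain ⟨k, hkK, hkR, hkz⟩ := hk
    have hkD : k ∉ D := fun h => hkR (hDR h)
    obtain ⟨c, hc⟩ := exists_line_ne_zero hkD hkz (hG.zr R) h0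
    have hlin : IsG A D (fun p => c * p z) := (isG_const c).mul (isG_coord z)
    have hdep : ∀ S : Finset V, z ∈ S → DependsOn (fun p : V → ℝ => c * p z) (S : Set V) :=
      fun S hS p q hpq => congrArg (c * ·) (hpq z (Finset.mem_coe.2 hS))
    have hin := hdep (K.erase k) (Finset.mem_erase.2 ⟨hkz.symm, hzK⟩)
    refine .node (.trans k (fun p => c * p z) hkD hlin (by simp)
      (hdep _ (Finset.mem_erase.2 ⟨hkz.symm, Finset.mem_univ z⟩))) ⟨hkK, hin⟩ fun D' ρ hρ => ?_
    have hgood := hρ.good (K := K) ⟨hkK, hin⟩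
    cases hρ
    have e1 : ∀ p, H (trans k (fun p => c * p z) p) = H p := fun p => hHd fun v hv => by
      have : v ≠ k := fun h => hkD (h ▸ (Finset.mem_inter.1 (Finset.mem_coe.1 hv)).2)
      simp [trans, this]
    simp only [e1]
    refine ih _ ?_ (insert k R) _ rfl (hDR.trans (Finset.subset_insert _ _)) ?_ (hgood.isG G hG)
      (hgood.dependsOn hGd) ?_
    · rw [← hn]
      refine Finset.card_lt_card ⟨fun v hv => ?_, fun h => ?_⟩
      · rw [Finset.mem_sdiff, Finset.mem_insert, not_or] at hv
        exact Finset.mem_sdiff.2 ⟨hv.1, hv.2.2⟩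
      · have := h (Finset.mem_sdiff.2 ⟨hkK, hkR⟩)
        simp at this
    · simp [hkz.symm, hzR]
    · intro h
      refine hc ?_
      filter_upwards [h] with p hp
      rw [← hp]
      congr 1
      funext v
      by_cases hv : v = k
      · subst hv; simp [trans, zr, hkR, hkz.symm, hzR]
      · simp [trans, zr, hv]
  · push Not at hk
    have e1 : (fun p => G (zr R p)) = fun p => G (zr (Finset.univ.erase z) p) := by
      funext p
      refine hGd fun v hv => ?_
      by_cases hvz : v = z
      · subst hvz; simp [zr, hzR]
      · have : v ∈ R := by
          by_contra h
          exact hvz (hk v hv h)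
        simp [zr, hvz, this]
    rw [e1] at h0
    obtain ⟨d, hd⟩ := exists_reg hG hz h0
    refine covBelow_of_covAll hzK hK (d + 1) d (Nat.lt_succ_self d) D H G hz hH.isG
      (fun p q hpq => hHd fun v hv => hpq v ?_) hH.not_eventuallyEq_zero hG hGd hd
    obtain ⟨h1, h2⟩ := Finset.mem_inter.1 (Finset.mem_coe.1 hv)
    exact Finset.mem_coe.2 (Finset.mem_erase.2 ⟨fun h => hz (h ▸ h2), h1⟩)

/-- The case of a germ whose exponents of the nonnegative variables have a least element. -/
theorem cov_of_least {K : Finset V} (hK : ∀ z ∈ K, CovAll A (K.erase z)) (hf : IsG A D f)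
    (hfd : DependsOn f (K : Set V)) {w : V → ℝ≥0} (hw : w ∈ Supp A D f)
    (hmin : ∀ x ∈ Supp A D f, ∀ v ∈ D, w v ≤ x v) : Cov A K D f := by
  classical
  -- divide by the least monomial in the nonnegative variables; what remains does not vanish if
  -- these variables are set equal to zero
  set a : V → ℝ≥0 := fun v => if v ∈ D then w v else 0 with ha
  have haok : MonoOk A D a := by
    refine ⟨fun v hv => ?_, fun v hv => ⟨0, by simp [ha, hv]⟩⟩
    simpa [ha, hv] using (hf.monoOk_of_mem_Supp hw).1 v hv
  have haK : ∀ v ∉ K ∩ D, a v = 0 := by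
    intro v hv
    by_cases hvD : v ∈ D
    · simpa [ha, hvD] using apply_eq_zero_of_mem_Supp hf hfd hw
        (fun h => hv (Finset.mem_inter.2 ⟨h, hvD⟩))
    · simp [ha, hvD]
  obtain ⟨G₀, hG₀, h1⟩ := hf.exists_eq_mono_mul haok fun x hx v => by
    by_cases hv : v ∈ D
    · simpa [ha, hv] using hmin x hx v hv
    · simp [ha, hv]
  have h2 := eventuallyEq_mono_mul_zr hfd
    (fun v hv => haK v fun h => hv (Finset.mem_inter.1 h).1) h1
  set G : (V → ℝ) → ℝ := fun p => G₀ (zr Kᶜ p) with hG'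
  have hG : IsG A D G := hG₀.zr _
  have hGd : DependsOn G (K : Set V) := dependsOn_zr
  have haw : a ≤ w := fun v => by by_cases hv : v ∈ D <;> simp [ha, hv]
  have hwG : w - a ∈ Supp A D G := by
    rw [Supp_congr h2] at hw
    exact ((mem_Supp_mono_mul haok hG).1 hw).2
  have hH := normal_mono haok
  refine Cov.congr ?_ h2.symm
  by_cases hz : ∃ z ∈ K, z ∉ D
  · obtain ⟨z, hzK, hzD⟩ := hz
    refine cov_of_zr_ne_zero hzK (hK z hzK) hzD hH (dependsOn_mono haK) _ D G rfl subset_rfl hzD hG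
      hGd ?_
    rw [← (hG.zr D).Supp_nonempty_iff]
    exact ⟨w - a, (hG.mem_Supp_zr D).2 ⟨hwG, fun v hv => by simp [ha, hv]⟩⟩
  -- without further variables what remains is a unit
  · push Not at hz
    have h3 : w - a = 0 := by
      funext v
      by_cases hv : v ∈ D
      · simp [ha, hv]
      · exact apply_eq_zero_of_mem_Supp hG hGd hwG fun h => hv (hz v h)
    have h4 : G 0 ≠ 0 := by
      rw [h3] at hwG
      rw [← co_zero hG]
      exact hwG
    exact .normal (hH.mul (normal_of_unit hG h4))

variable (A D) in
/-- `Q` is a set of exponents of `f`, as far as the nonnegative variables are concerned, that bounds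
all exponents of `f` from below. -/
def Dominates (Q : Finset (V → ℝ≥0)) (f : (V → ℝ) → ℝ) : Prop :=
  (∀ x ∈ Supp A D f, ∃ q ∈ Q, ∀ v ∈ D, q v ≤ x v) ∧
    ∀ q ∈ Q, ∃ x ∈ Supp A D f, ∀ v ∈ D, x v = q v

theorem Dominates.map {Q : Finset (V → ℝ≥0)} [DecidableEq (V → ℝ≥0)] (h : Dominates A D Q f)
    {T : (V → ℝ≥0) → V → ℝ≥0}
    (hco : ∀ w, co A D g (T w) = co A D f w) (hS : ∀ w ∈ Supp A D g, ∃ x ∈ Supp A D f, w = T x)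
    (hT : ∀ x y : V → ℝ≥0, (∀ v ∈ D, x v ≤ y v) → ∀ v ∈ D, T x v ≤ T y v) :
    Dominates A D (Q.image T) g := by
  refine ⟨fun w hw => ?_, fun q hq => ?_⟩
  · obtain ⟨x, hx, rfl⟩ := hS w hw
    obtain ⟨q, hq, h1⟩ := h.1 x hx
    exact ⟨T q, Finset.mem_image_of_mem _ hq, hT _ _ h1⟩
  · obtain ⟨y, hy, rfl⟩ := Finset.mem_image.1 hq
    obtain ⟨x, hx, h1⟩ := h.2 y hy
    refine ⟨T x, fun h0 => hx ((hco x).symm.trans h0), fun v hv => le_antisymm ?_ ?_⟩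
    · exact hT x y (fun v hv => (h1 v hv).le) v hv
    · exact hT y x (fun v hv => (h1 v hv).ge) v hv

theorem update_mul_le {i : V} (s : ℝ≥0) (x y : V → ℝ≥0) (h : ∀ v ∈ D, x v ≤ y v) :
    ∀ v ∈ D, Function.update x i (s * x i) v ≤ Function.update y i (s * y i) v := by
  intro v hv
  by_cases hvi : v = i
  · subst hvi
    simpa using mul_le_mul_right (h v hv) s
  · simpa [hvi] using h v hv

theorem add_single_le {i j : V} (hi : i ∈ D) (x y : V → ℝ≥0) (h : ∀ v ∈ D, x v ≤ y v) :
    ∀ v ∈ D, (x + Pi.single j (x i) : V → ℝ≥0) v ≤ (y + Pi.single j (y i) : V → ℝ≥0) v := by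
  intro v hv
  simp only [Pi.add_apply]
  refine add_le_add (h v hv) ?_
  by_cases hvj : v = j
  · subst hvj; simpa using h i hi
  · simp [hvj]

/-- The exponents of the nonnegative variables form a partially well-ordered set, and such a set has
finitely many minimal elements. -/
theorem exists_dominates (hf : IsG A D f) : ∃ Q, Dominates A D Q f := by
  classical
  set r : (V → ℝ≥0) → V → ℝ≥0 := fun x v => if v ∈ D then x v else 0 with hr
  have hmono : Monotone r := by
    intro x y h v
    by_cases hv : v ∈ D
    · simpa [hr, hv] using h v
    · simp [hr, hv]
  have hP : (r '' Supp A D f).IsPWO := hf.isPWO_Supp.image_of_monotone hmono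
  set M := {q | Minimal (· ∈ r '' Supp A D f) q} with hM
  have hfin : M.Finite := by
    refine IsAntichain.finite_of_partiallyWellOrderedOn (r := (· ≤ ·)) ?_
      (hP.mono fun q (hq : Minimal (· ∈ r '' Supp A D f) q) => hq.1)
    intro a ha b hb hab hle
    exact hab (le_antisymm hle (hb.2 ha.1 hle))
  refine ⟨hfin.toFinset, fun x hx => ?_, fun q hq => ?_⟩
  · obtain ⟨q, hq, hqm⟩ := hP.exists_le_minimal (Set.mem_image_of_mem r hx)
    refine ⟨q, hfin.mem_toFinset.2 hqm, fun v hv => ?_⟩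
    simpa [hr, hv] using hq v
  · obtain ⟨x, hx, hxq⟩ := ((hfin.mem_toFinset.1 hq).1 : q ∈ r '' Supp A D f)
    exact ⟨x, hx, fun v hv => by rw [← hxq]; simp [hr, hv]⟩

theorem not_eventuallyEq_zero_of_co (hf : IsG A D f) (hg : IsG A D g) {T : (V → ℝ≥0) → V → ℝ≥0}
    (hco : ∀ w, co A D g (T w) = co A D f w) (h : ¬ f =ᶠ[gz D] 0) : ¬ g =ᶠ[gz D] 0 := by
  rw [← hf.Supp_nonempty_iff] at h
  obtain ⟨w, hw⟩ := h
  rw [← hg.Supp_nonempty_iff]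
  exact ⟨T w, fun h0 => hw ((hco w).symm.trans h0)⟩

/-- Reduction to a least exponent `cov_of_least`, by induction on the number of elements of `Q`: two
incomparable exponents differ in a variable `i` and, in the opposite direction, in a variable `j`.
They become equal in one of these variables if these are first ramified, according to the
differences, and then blown up, and they become comparable when they differ in few variables. -/
theorem cov_of_dominates {K : Finset V} (hK : ∀ z ∈ K, CovAll A (K.erase z))
    (hD : ∀ (D' : Finset V) (f : (V → ℝ) → ℝ), D'.card < D.card → IsG A D' f →
      DependsOn f (K : Set V) → ¬ f =ᶠ[gz D'] 0 → Cov A K D' f) (N : ℕ) :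
    ∀ (Q : Finset (V → ℝ≥0)) (f : (V → ℝ) → ℝ), Q.card ≤ N → IsG A D f →
      DependsOn f (K : Set V) → ¬ f =ᶠ[gz D] 0 → Dominates A D Q f → Cov A K D f := by
  classical
  induction N with
  | zero =>
    intro Q f hQ hf hfd h0 hdom
    rw [← hf.Supp_nonempty_iff] at h0
    obtain ⟨w, hw⟩ := h0
    obtain ⟨q, hq, -⟩ := hdom.1 w hw
    rw [Finset.card_eq_zero.1 (Nat.le_zero.1 hQ)] at hq
    exact absurd hq (Finset.notMem_empty q)
  | succ N ihN =>
    -- induction on the number of variables where two given exponents differ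
    have inner : ∀ (n : ℕ) (Q : Finset (V → ℝ≥0)) (f : (V → ℝ) → ℝ) (α β : V → ℝ≥0),
        (D.filter fun v => α v ≠ β v).card = n → α ∈ Q → β ∈ Q → α ≠ β → Q.card ≤ N + 1 →
        IsG A D f → DependsOn f (K : Set V) → ¬ f =ᶠ[gz D] 0 → Dominates A D Q f →
        Cov A K D f := by
      intro n
      induction n using Nat.strong_induction_on with
      | _ n ih =>
      intro Q f α β hn hα hβ hαβ hQ hf hfd h0 hdom
      -- of two comparable exponents the greater one can be dropped
      have hcmp : ∀ {a b : V → ℝ≥0}, a ∈ Q → b ∈ Q → a ≠ b → (∀ v ∈ D, a v ≤ b v) →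
          Cov A K D f := by
        intro a b ha hb hab hle
        refine ihN (Q.erase b) f ?_ hf hfd h0 ⟨fun x hx => ?_, fun q hq =>
          hdom.2 q (Finset.mem_of_mem_erase hq)⟩
        · rw [Finset.card_erase_of_mem hb]; omega
        · obtain ⟨q, hq, h1⟩ := hdom.1 x hx
          by_cases hqb : q = b
          · subst hqb
            exact ⟨a, Finset.mem_erase.2 ⟨hab, ha⟩, fun v hv => (hle v hv).trans (h1 v hv)⟩
          · exact ⟨q, Finset.mem_erase.2 ⟨hqb, hq⟩, h1⟩
      by_cases h1 : ∀ v ∈ D, α v ≤ β v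
      · exact hcmp hα hβ hαβ h1
      by_cases h2 : ∀ v ∈ D, β v ≤ α v
      · exact hcmp hβ hα hαβ.symm h2
      push Not at h1 h2
      obtain ⟨j, hj, hjlt⟩ := h1
      obtain ⟨i, hi, hilt⟩ := h2
      have hij : i ≠ j := by
        rintro rfl
        exact lt_asymm hilt hjlt
      obtain ⟨x, hx, hxα⟩ := hdom.2 α hα
      obtain ⟨y, hy, hyβ⟩ := hdom.2 β hβ
      have hKv : ∀ v ∈ D, α v ≠ β v → v ∈ K := by
        intro v hv hne
        by_contra hvK
        rw [← hxα v hv, ← hyβ v hv, apply_eq_zero_of_mem_Supp hf hfd hx hvK,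
          apply_eq_zero_of_mem_Supp hf hfd hy hvK] at hne
        exact hne rfl
      have hiK := hKv i hi hilt.ne
      have hjK := hKv j hj hjlt.ne'
      have hok : ∀ v ∈ D, ExpOk A (α v) ∧ ExpOk A (β v) := fun v hv =>
        ⟨hxα v hv ▸ (hf.monoOk_of_mem_Supp hx).1 v hv, hyβ v hv ▸ (hf.monoOk_of_mem_Supp hy).1 v hv⟩
      -- the exponents of the ramifications are `α j - β j` for `i` and `β i - α i` for `j`
      have hsi := (hok j hj).1.sub (hok j hj).2
      have hsj := (hok i hi).2.sub (hok i hi).1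
      have hsi0 : 0 < α j - β j := tsub_pos_of_lt hjlt
      have hsj0 : 0 < β i - α i := tsub_pos_of_lt hilt
      refine .node (.ramX i _ hi hsi hsi0) hiK fun D' ρ hρ => ?_
      have g1 := hρ.good (K := K) hiK
      cases hρ
      obtain ⟨G1, c1, s1⟩ := hf.co_ramX hi hsi hsi0
      have z1 := not_eventuallyEq_zero_of_co hf G1 c1 h0
      have d1 := g1.dependsOn hfd
      have m1 := hdom.map c1 s1 (update_mul_le _)
      refine .node (.ramX j _ hj hsj hsj0) hjK fun D' ρ hρ => ?_
      have g2 := hρ.good (K := K) hjK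
      cases hρ
      obtain ⟨G2, c2, s2⟩ := G1.co_ramX hj hsj hsj0
      have z2 := not_eventuallyEq_zero_of_co G1 G2 c2 z1
      have d2 := g2.dependsOn d1
      have m2 := m1.map c2 s2 (update_mul_le _)
      -- now the sums of the exponents of `i` and `j` agree in `α` and `β`, and these sums are the new
      -- exponents of one of the variables in the two charts that are given by monomials
      have heq : (α j - β j) * α i + (β i - α i) * α j = (α j - β j) * β i + (β i - α i) * β j := by
        obtain ⟨a, ha⟩ := exists_add_of_le hjlt.le
        obtain ⟨b, hb⟩ := exists_add_of_le hilt.le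
        rw [ha, hb, add_tsub_cancel_left, add_tsub_cancel_left]
        ring
      set T : (V → ℝ≥0) → V → ℝ≥0 := fun w =>
        Function.update (Function.update w i ((α j - β j) * w i)) j
          ((β i - α i) * (Function.update w i ((α j - β j) * w i)) j) with hT
      have hTi : ∀ w, T w i = (α j - β j) * w i := fun w => by simp [hT, hij]
      have hTj : ∀ w, T w j = (β i - α i) * w j := fun w => by simp [hT, hij.symm]
      have hTv : ∀ w v, v ≠ i → v ≠ j → T w v = w v := fun w v h h' => by simp [hT, h, h']
      have hTQ : ((Q.image fun w => Function.update w i ((α j - β j) * w i)).image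
          fun w => Function.update w j ((β i - α i) * w j)) = Q.image T := by
        rw [Finset.image_image]
        rfl
      rw [hTQ] at m2
      clear_value T
      have hzero : ∀ k l : V, k ∈ D → l ∈ D → k ≠ l → ((k = i ∧ l = j) ∨ (k = j ∧ l = i)) →
          ∀ φ : (V → ℝ) → ℝ, IsG A D φ → DependsOn φ (K : Set V) → ¬ φ =ᶠ[gz D] 0 →
          Dominates A D (Q.image T) φ → Cov A K D (fun p => φ (blow k l 0 p)) := by
        intro k l hk hl hkl hc φ hφ hφd hφ0 hφm
        have hkK : k ∈ K := by rcases hc with ⟨rfl, rfl⟩ | ⟨rfl, rfl⟩ <;> assumption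
        have hlK : l ∈ K := by rcases hc with ⟨rfl, rfl⟩ | ⟨rfl, rfl⟩ <;> assumption
        obtain ⟨G3, c3, s3⟩ := hφ.co_blow hk hl hkl
        have m3 := hφm.map (T := fun w => w + Pi.single l (w k)) c3 s3 (add_single_le hk)
        have hl' : (T α + Pi.single l (T α k) : V → ℝ≥0) l = (T β + Pi.single l (T β k) : V → ℝ≥0) l := by
          simp only [Pi.add_apply, Pi.single_eq_same]
          rcases hc with ⟨rfl, rfl⟩ | ⟨rfl, rfl⟩
          · rw [hTi, hTj, hTi, hTj, add_comm, heq, add_comm]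
          · rw [hTi, hTj, hTi, hTj, heq]
        have hk' : (T α + Pi.single l (T α k) : V → ℝ≥0) k ≠ (T β + Pi.single l (T β k) : V → ℝ≥0) k := by
          simp only [Pi.add_apply, Pi.single_eq_of_ne hkl, add_zero]
          rcases hc with ⟨rfl, rfl⟩ | ⟨rfl, rfl⟩
          · rw [hTi, hTi]
            exact fun h => hilt.ne (mul_left_cancel₀ hsi0.ne' h)
          · rw [hTj, hTj]
            exact fun h => hjlt.ne' (mul_left_cancel₀ hsj0.ne' h)
        have hmem : ∀ a ∈ Q, T a + Pi.single l (T a k) ∈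
            (Q.image T).image fun w => w + Pi.single l (w k) := fun a ha =>
          Finset.mem_image.2 ⟨T a, Finset.mem_image_of_mem T ha, rfl⟩
        refine ih _ ?_ _ _ (T α + Pi.single l (T α k)) (T β + Pi.single l (T β k)) rfl
          (hmem α hα) (hmem β hβ) (fun h => hk' (by rw [h]))
          (Finset.card_image_le.trans (Finset.card_image_le.trans hQ)) G3
          ((good_blow_zero (A := A) hk hl hkl hkK hlK).dependsOn hφd)
          (not_eventuallyEq_zero_of_co (T := fun w => w + Pi.single l (w k)) hφ G3 c3 hφ0) m3
        rw [← hn]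
        refine Finset.card_lt_card ⟨fun v hv => ?_, fun hsub => ?_⟩
        · obtain ⟨hvD, hv⟩ := Finset.mem_filter.1 hv
          refine Finset.mem_filter.2 ⟨hvD, fun h => hv ?_⟩
          have hvl : v ≠ l := fun h => hv (h ▸ hl')
          have hvi : v ≠ i := by rintro rfl; exact hilt.ne h
          have hvj : v ≠ j := by rintro rfl; exact hjlt.ne' h
          simp [hvl, hTv _ v hvi hvj, h]
        · have hlne : α l ≠ β l := by
            rcases hc with ⟨rfl, rfl⟩ | ⟨rfl, rfl⟩
            exacts [hjlt.ne', hilt.ne]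
          exact (Finset.mem_filter.1 (hsub (Finset.mem_filter.2 ⟨hl, hlne⟩))).2 hl'
      refine .node (.xx i j hi hj hij) ⟨hiK, hjK⟩ fun D' ρ hρ => ?_
      have g3 := hρ.good (K := K) ⟨hiK, hjK⟩
      cases hρ with
      | xxZero => exact hzero i j hi hj hij (Or.inl ⟨rfl, rfl⟩) _ G2 d2 z2 m2
      | xxZero' => exact hzero j i hj hi hij.symm (Or.inr ⟨rfl, rfl⟩) _ G2 d2 z2 m2
      | xxPos _ _ _ _ _ lam hlam =>
        -- in the other charts a variable ceases to be nonnegative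
        exact hD _ _ (Finset.card_erase_lt_of_mem hi) (g3.isG _ G2) (g3.dependsOn d2)
          ((G2.blow_pos hi hj hij hlam).2 z2)
      | xxPos' _ _ _ _ _ lam hlam =>
        exact hD _ _ (Finset.card_erase_lt_of_mem hj) (g3.isG _ G2) (g3.dependsOn d2)
          ((G2.blow_pos hj hi hij.symm hlam).2 z2)
    intro Q f hQ hf hfd h0 hdom
    by_cases h1 : ∃ α ∈ Q, ∃ β ∈ Q, α ≠ β
    · obtain ⟨α, hα, β, hβ, hαβ⟩ := h1
      exact inner _ Q f α β rfl hα hβ hαβ hQ hf hfd h0 hdom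
    · push Not at h1
      have h2 := h0
      rw [← hf.Supp_nonempty_iff] at h2
      obtain ⟨w, hw⟩ := h2
      obtain ⟨q, hq, -⟩ := hdom.1 w hw
      obtain ⟨x, hx, hxq⟩ := hdom.2 q hq
      refine cov_of_least hK hf hfd hx fun y hy v hv => ?_
      obtain ⟨q', hq', h3⟩ := hdom.1 y hy
      rw [hxq v hv, h1 q hq q' hq']
      exact h3 v hv

/-- Every nonzero germ becomes normal along the branches of a tree. -/
theorem covAll (n : ℕ) : ∀ K : Finset V, K.card = n → CovAll A K := by
  induction n using Nat.strong_induction_on with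
  | _ n ihn =>
  intro K hKn
  have hK : ∀ z ∈ K, CovAll A (K.erase z) := fun z hz =>
    ihn _ (hKn ▸ Finset.card_erase_lt_of_mem hz) _ rfl
  -- inner induction on the number of nonnegative variables
  have key : ∀ (m : ℕ) (D : Finset V) (f : (V → ℝ) → ℝ), D.card = m → IsG A D f →
      DependsOn f (K : Set V) → ¬ f =ᶠ[gz D] 0 → Cov A K D f := by
    intro m
    induction m using Nat.strong_induction_on with
    | _ m ihm =>
    intro D f hDm hf hfd h0
    obtain ⟨Q, hQ⟩ := exists_dominates hf
    exact cov_of_dominates hK (fun D' f hlt => ihm _ (hDm ▸ hlt) D' f rfl) _ Q f le_rfl hf hfd h0 hQ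
  exact fun D f hf hfd h0 => key _ D f rfl hf hfd h0

/-! ### Trees of bounded height and changes of coordinates -/

variable (A) in
/-- The germ `f` becomes normal along all branches of a tree of height at most `N`. -/
def HD : ℕ → Finset V → ((V → ℝ) → ℝ) → Prop
  | 0, D, f => Normal A D f
  | N + 1, D, f => HD N D f ∨
      ∃ ν : ElNode A D, ∀ D' ρ, ν.Edge D' ρ → HD N D' (fun p => f (ρ p))

theorem HD.congr {N : ℕ} (h : HD A N D f) (hfg : f =ᶠ[gz D] g) : HD A N D g := by
  induction N generalizing D f g with
  | zero => exact Normal.congr h hfg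
  | succ N ih =>
    rcases h with h | ⟨ν, h⟩
    · exact Or.inl (ih h hfg)
    · exact Or.inr ⟨ν, fun D' ρ he =>
        ih (h D' ρ he) ((he.good ν.inside_univ).tendsto.eventually hfg)⟩

theorem HD.mono {N M : ℕ} (hNM : N ≤ M) (h : HD A N D f) : HD A M D f := by
  induction hNM with
  | refl => exact h
  | step _ ih => exact Or.inl ih

/-- The change of coordinates that permutes the variables and multiplies them by units. -/
def iso (σ : Equiv.Perm V) (u : V → (V → ℝ) → ℝ) (q : V → ℝ) : V → ℝ := fun v => q (σ v) * u v q

variable (A) in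
/-- `w` is a unit, positive if the variable `v` ranges over nonnegative values. -/
structure UnitAt (D D' : Finset V) (v : V) (w : (V → ℝ) → ℝ) : Prop where
  isG : IsG A D' w
  ne : w 0 ≠ 0
  pos : v ∈ D → 0 < w 0

theorem UnitAt.comp {D'' : Finset V} {v : V} {w : (V → ℝ) → ℝ} (h : UnitAt A D D' v w)
    {ρ : (V → ℝ) → V → ℝ} (hρ : Good A Finset.univ D' D'' ρ) {D₁ : Finset V}
    (hv : v ∈ D₁ → v ∈ D ∨ 0 < w 0) : UnitAt A D₁ D'' v (fun q => w (ρ q)) where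
  isG := hρ.isG _ h.isG
  ne := by simpa [hρ.zero] using h.ne
  pos hv1 := by
    rw [hρ.zero]
    exact (hv hv1).elim h.pos fun h => h

theorem good_iso {σ : Equiv.Perm V} {u : V → (V → ℝ) → ℝ} (hσ : ∀ v, σ v ∈ D' ↔ v ∈ D)
    (hu : ∀ v, UnitAt A D D' v (u v)) : Good A Finset.univ D D' (iso σ u) := by
  refine Good.of (fun f hf => ?_) ?_ (fun v hv => ?_) (by simp) (fun v _ p q h => ?_) (by simp)
  · refine hf.subst (u := u) σ ⟨fun v hv => (hσ v).2 hv, σ.injective.injOn, fun v hv => ?_⟩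
      (fun v _ => (hu v).isG) (fun v hv => (hu v).pos hv) (fun v _ => EventuallyEq.rfl)
      (fun v _ => (isG_coord _).mul (hu v).isG) fun v _ => by simp [iso]
    exact ⟨σ.symm v, (hσ _).1 (by simpa using hv), by simp⟩
  · funext v
    simp [iso]
  · filter_upwards [eventually_nonneg ((hσ v).2 hv),
      (hu v).isG.tendsto.eventually (lt_mem_nhds ((hu v).pos hv))] with p h1 h2
    exact mul_nonneg h1 h2.le
  · have : p = q := funext fun w => h w (by simp)
    simp [this]

theorem normal_iso {σ : Equiv.Perm V} {u : V → (V → ℝ) → ℝ} (hσ : ∀ v, σ v ∈ D' ↔ v ∈ D)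
    (hu : ∀ v, UnitAt A D D' v (u v)) (hf : Normal A D f) :
    Normal A D' (fun q => f (iso σ u q)) := by
  refine hf.comp (good_iso hσ hu) (fun v hv a ha => ?_) fun v _ => ?_
  · have h1 := isG_unit_rpow (powOk_of_expOk ha) (hu v).isG ((hu v).pos hv)
    have h2 : u v 0 ^ (a : ℝ) ≠ 0 := (Real.rpow_pos_of_pos ((hu v).pos hv) _).ne'
    refine ((normal_coord_rpow ((hσ v).2 hv) ha).mul (normal_of_unit h1 h2)).congr ?_
    filter_upwards [eventually_nonneg ((hσ v).2 hv),
      (hu v).isG.tendsto.eventually (lt_mem_nhds ((hu v).pos hv))] with p h3 h4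
    exact (Real.mul_rpow h3 h4.le).symm
  · exact (normal_coord _).mul (normal_of_unit (hu v).isG (hu v).ne)

/-- A germ with nonzero derivative in a variable is turned into the product of this variable and a
unit by a translation of this variable. -/
theorem exists_trans_eq_mul {k : V} (hk : k ∉ D) (hg : IsG A D g) (h0 : g 0 = 0)
    (hd : ∃ d : ℝ, d ≠ 0 ∧ HasDerivAt (fun t => g (Pi.single k t)) d 0) :
    ∃ (h : (V → ℝ) → ℝ) (w : (V → ℝ) → ℝ), IsG A D h ∧ h 0 = 0 ∧
      DependsOn h (Finset.univ.erase k : Set V) ∧ IsG A D w ∧ w 0 ≠ 0 ∧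
      (fun q => g (trans k h q)) =ᶠ[gz D] fun q => q k * w q := by
  obtain ⟨d, hd0, hd⟩ := hd
  -- solve `g = 0` for the variable `k`, which is renamed `none`, and divide by it
  let ψ : (Option V → ℝ) → V → ℝ := fun q v => if v = k then q none else q (some v)
  have hc : IsG A (D.map Function.Embedding.some) (fun q => g (ψ q)) := by
    refine hg.subst (u := fun _ _ => 1) some ⟨fun v hv => ?_, (Option.some_injective V).injOn,
      fun o ho => ?_⟩ (fun _ _ => isG_const 1) (fun _ _ => one_pos) (fun v hv => ?_)
      (fun v hv => ?_) (fun v hv => ?_)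
    · simpa using hv
    · obtain ⟨v, hv, rfl⟩ := Finset.mem_map.1 (Finset.mem_coe.1 ho)
      exact ⟨v, hv, rfl⟩
    · have : v ≠ k := fun h => hk (h ▸ hv)
      simp [ψ, this]
    · by_cases h : v = k
      · simpa [ψ, h] using isG_coord (A := A) (D := D.map Function.Embedding.some) none
      · simpa [ψ, h] using isG_coord (A := A) (D := D.map Function.Embedding.some) (some v)
    · by_cases h : v = k <;> simp [ψ, h]
  have hψ : ∀ t : ℝ, ψ (Pi.single none t) = Pi.single k t := fun t => by
    funext v
    by_cases h : v = k
    · subst h; simp [ψ]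
    · simp [ψ, h]
  have h1 : co A (D.map Function.Embedding.some) (fun q => g (ψ q)) (Pi.single none 1) = d := by
    have := hc.hasDerivAt (v := none) (by simp)
    simp only [hψ] at this
    exact this.unique hd
  obtain ⟨h, hh, hh0, hz⟩ := exists_implicit hc
    (by rw [show ψ 0 = 0 from by simpa using hψ 0]; exact h0) (by rw [h1]; exact hd0)
  let h' : (V → ℝ) → ℝ := fun p => h (Function.update p k 0)
  have hz0 : ∀ p : V → ℝ, Function.update p k 0 = zr {k} p := fun p => (zr_singleton k p).symm
  have hh' : IsG A D h' := hh.update_y hk (isG_const 0) rfl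
  have hh'0 : h' 0 = 0 := by simp [h', hz0, zr_zero, hh0]
  have hdep : DependsOn h' (Finset.univ.erase k : Set V) := by
    intro p q hpq
    refine dependsOn_update (f := h) k fun v hv => hpq v ?_
    simpa using hv
  have hG : IsG A D (fun q => g (trans k h' q)) := hg.trans hk hh' hh'0
  have hGk : (fun p => g (trans k h' (Function.update p k 0))) =ᶠ[gz D] 0 := by
    have h2 := (tendsto_zr (D := D) {k}).eventually hz
    filter_upwards [h2] with p hp
    refine Eq.trans (congrArg g (funext fun v => ?_)) hp
    by_cases hv : v = k
    · subst hv; simp [ψ, trans, h', zr_singleton]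
    · simp [ψ, trans, zr, hv]
  obtain ⟨w, hw, hgw⟩ := hG.exists_eq_coord_mul hk hGk
  refine ⟨h', w, hh', hh'0, hdep, hw, ?_, hgw⟩
  have h2 := (hG.hasDerivAt hk)
  have h3 : ∀ t : ℝ, trans k h' (Pi.single k t) = Pi.single k t := fun t => by
    have : h' (Pi.single k t) = 0 := by
      rw [← hh'0]
      exact hdep fun v hv => by simp [show v ≠ k by simpa using hv]
    funext v
    by_cases hv : v = k <;> simp [trans, this, hv]
  simp only [h3] at h2
  have h4 := h2.unique hd
  rw [co_congr hgw, co_coord_mul hw, if_pos (by simp), tsub_self, co_zero hw] at h4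
  rwa [h4]

/-- The conclusion of `HD.iso` for all germs and changes of coordinates, with given heights. -/
def IsoHD (A : QuasianalyticSystem) (V : Type) [Fintype V] [DecidableEq V] (N M : ℕ) : Prop :=
  ∀ (D D' : Finset V) (f : (V → ℝ) → ℝ) (σ : Equiv.Perm V) (u : V → (V → ℝ) → ℝ),
    (∀ v, σ v ∈ D' ↔ v ∈ D) → (∀ v, UnitAt A D D' v (u v)) → HD A N D f →
    HD A M D' (fun q => f (iso σ u q))

theorem iso_update (σ : Equiv.Perm V) (u : V → (V → ℝ) → ℝ) (k : V) (w : (V → ℝ) → ℝ)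
    (q : V → ℝ) :
    iso σ (Function.update u k w) q = Function.update (iso σ u q) k (q (σ k) * w q) := by
  funext v
  by_cases hv : v = k
  · subst hv; simp [iso]
  · simp [iso, hv]

theorem unitAt_update {u : V → (V → ℝ) → ℝ} {k : V} {w : (V → ℝ) → ℝ}
    (hu : ∀ v, v ≠ k → UnitAt A D D' v (u v)) (hw : UnitAt A D D' k w) (v : V) :
    UnitAt A D D' v (Function.update u k w v) := by
  by_cases hv : v = k
  · subst hv; simpa using hw
  · simpa [hv] using hu v hv

/-- Changes of coordinates for which one row is only required to have a nonzero derivative reduce to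
monomial ones by a translation. -/
theorem IsoHD.special {N M : ℕ} (H : IsoHD A V N M) {σ : Equiv.Perm V} {u : V → (V → ℝ) → ℝ}
    (hσ : ∀ v, σ v ∈ D' ↔ v ∈ D) {k : V} (hu : ∀ v, v ≠ k → UnitAt A D D' v (u v)) (hk : k ∉ D)
    (hg : IsG A D' g) (h0 : g 0 = 0)
    (hd : ∃ d : ℝ, d ≠ 0 ∧ HasDerivAt (fun t => g (Pi.single (σ k) t)) d 0) (hf : HD A N D f) :
    HD A (M + 1) D' (fun q => f (Function.update (iso σ u q) k (g q))) := by
  have hk' : σ k ∉ D' := fun h => hk ((hσ k).1 h)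
  obtain ⟨h, w, hh, hh0, hdep, hw, hw0, hgw⟩ := exists_trans_eq_mul hk' hg h0 hd
  refine Or.inr ⟨.trans (σ k) h hk' hh hh0 hdep, ?_⟩
  rintro D'' ρ ⟨⟩
  have hρ : Good A Finset.univ D' D' (Quasi.trans (σ k) h) :=
    (ElNode.Edge.trans (σ k) h hk' hh hh0 hdep).good (ElNode.inside_univ _)
  refine (H D D' f σ (Function.update (fun v q => u v (Quasi.trans (σ k) h q)) k w) hσ
    (unitAt_update (fun v hv => (hu v hv).comp hρ Or.inl)
      ⟨hw, hw0, fun h => absurd h hk⟩) hf).congr ?_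
  filter_upwards [hgw] with q hq
  rw [iso_update, ← hq]
  congr 1
  funext v
  by_cases hv : v = k
  · subst hv; simp
  · have : σ v ≠ σ k := fun h => hv (σ.injective h)
    simp [iso, hv, Quasi.trans, this]

theorem hasDerivAt_blow_row {k : V} {w : (V → ℝ) → ℝ} {r : ℝ} (hw : ∀ t, w (Pi.single k t) = r)
    (hr : r ≠ 0) (lam : ℝ) : ∃ d : ℝ, d ≠ 0 ∧
      HasDerivAt (fun t => (lam + (Pi.single k t : V → ℝ) k) * w (Pi.single k t) - lam * r) d 0 := by
  refine ⟨r, hr, ?_⟩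
  simp only [hw, Pi.single_eq_same]
  simpa using (((hasDerivAt_id (0 : ℝ)).const_add lam).mul_const r).sub_const (lam * r)

/-- The charts `blow` of a blow-up commute with changes of coordinates, up to a change of coordinates
in the chart. -/
theorem IsoHD.blow {N M : ℕ} (H : IsoHD A V N M) {D₁ D₁' : Finset V} {σ : Equiv.Perm V}
    {u : V → (V → ℝ) → ℝ} (hu : ∀ v, UnitAt A D D' v (u v)) {i j : V} (hij : i ≠ j)
    (hσ₁ : ∀ v, σ v ∈ D₁' ↔ v ∈ D₁) (hD : D₁ ⊆ D) {lam : ℝ}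
    (hρ : Good A Finset.univ D' D₁' (blow (σ i) (σ j) lam)) (hlam : lam = 0 ∨ i ∉ D₁)
    (hj : i ∈ D₁ → j ∈ D)
    (hf : HD A N D₁ (fun q => f (blow i j (lam * (u i 0 / u j 0)) q))) :
    HD A (M + 1) D₁' (fun q => f (iso σ u (blow (σ i) (σ j) lam q))) := by
  set ρ := Quasi.blow (σ i) (σ j) lam with hρdef
  have hσij : σ i ≠ σ j := fun h => hij (σ.injective h)
  have hu' : ∀ v, UnitAt A D₁ D₁' v (fun q => u v (ρ q)) := fun v =>
    (hu v).comp hρ fun h => Or.inl (hD h)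
  have hr : IsG A D₁' (fun q => u i (ρ q) / u j (ρ q)) := by
    simpa [div_eq_mul_inv] using (hu' i).isG.mul ((hu' j).isG.inv (hu' j).ne)
  have hr0 : u i 0 / u j 0 ≠ 0 := div_ne_zero (hu i).ne (hu j).ne
  -- the quotient of the coordinates `i` and `j` becomes `(λ + q_i) u_i / u_j`, whose value at the
  -- origin is the parameter of the corresponding chart
  have key : ∀ q, u j (ρ q) ≠ 0 → iso σ u (ρ q) =
      Quasi.blow i j (lam * (u i 0 / u j 0)) (Function.update (iso σ (fun v q => u v (ρ q)) q) i
        ((lam + q (σ i)) * (u i (ρ q) / u j (ρ q)) - lam * (u i 0 / u j 0))) := by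
    intro q hq
    funext v
    have h1 : iso σ u (ρ q) v = ρ q (σ v) * u v (ρ q) := rfl
    rw [h1]
    by_cases hv : v = i
    · subst hv
      rw [show ρ q (σ v) = q (σ j) * (lam + q (σ v)) by simp [hρdef, Quasi.blow]]
      simp only [Quasi.blow, Function.update_self, Function.update_of_ne hij.symm, iso]
      field_simp
      ring
    · have : σ v ≠ σ i := fun h => hv (σ.injective h)
      rw [show ρ q (σ v) = q (σ v) by simp [hρdef, Quasi.blow, this]]
      simp [iso, Quasi.blow, hv]
  have hne : ∀ᶠ q in gz D₁', u j (ρ q) ≠ 0 :=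
    (hu' j).isG.tendsto.eventually (isOpen_ne.mem_nhds (hu' j).ne)
  -- if the variable `i` stays nonnegative then `λ = 0`, and the change of coordinates is monomial
  by_cases hi : i ∈ D₁
  · have hlam : lam = 0 := hlam.resolve_right (not_not.2 hi)
    refine Or.inl ((H D₁ D₁' _ σ (Function.update (fun v q => u v (ρ q)) i
      fun q => u i (ρ q) / u j (ρ q)) hσ₁ (unitAt_update (fun v _ => hu' v)
      ⟨hr, by simpa [hρ.zero] using hr0, fun _ => ?_⟩) hf).congr ?_)
    · rw [hρ.zero]
      exact div_pos ((hu i).pos (hD hi)) ((hu j).pos (hj hi))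
    · filter_upwards [hne] with q hq
      rw [key q hq, iso_update]
      simp [hlam]
  -- otherwise one row has a nonzero derivative, and a translation is inserted
  · have hs : ∀ t : ℝ, ρ (Pi.single (σ i) t) = 0 := fun t => by
      funext v
      by_cases hv : v = σ i
      · subst hv; simp [hρdef, Quasi.blow, hσij.symm]
      · simp [hρdef, Quasi.blow, hv]
    refine (H.special hσ₁ (fun v _ => hu' v) hi (g := fun q => (lam + q (σ i)) *
      (u i (ρ q) / u j (ρ q)) - lam * (u i 0 / u j 0)) ?_ ?_ ?_ hf).congr ?_
    · exact (((isG_const _).add (isG_coord _)).mul hr).sub (isG_const _)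
    · simp [hρ.zero]
    · exact hasDerivAt_blow_row (w := fun q => u i (ρ q) / u j (ρ q)) (fun t => by rw [hs]) hr0 lam
    · filter_upwards [hne] with q hq
      rw [key q hq]

theorem exists_unit_mul_abs {x : ℝ} (hx : x ≠ 0) : ∃ ε : ℤˣ, (0 < x → ε = 1) ∧
    ∀ᶠ y in 𝓝 x, y = ((ε : ℤ) : ℝ) * |y| := by
  rcases lt_or_gt_of_ne hx with h | h
  · refine ⟨-1, fun h' => absurd h' h.le.not_gt, ?_⟩
    filter_upwards [gt_mem_nhds h] with y hy
    simp [abs_of_neg hy]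
  · refine ⟨1, fun _ => rfl, ?_⟩
    filter_upwards [lt_mem_nhds h] with y hy
    simp [abs_of_pos hy]

/-- The analogue of `IsoHD.blow` for the charts at infinity, where `|u_i|` and `u_j / |u_i|` appear
and the sign of `u_i` changes the chart. -/
theorem IsoHD.blowInf {N M : ℕ} (H : IsoHD A V N M) {σ : Equiv.Perm V} {u : V → (V → ℝ) → ℝ}
    (hσ : ∀ v, σ v ∈ D' ↔ v ∈ D) (hu : ∀ v, UnitAt A D D' v (u v)) {i j : V} (hi : i ∉ D)
    (hj : j ∈ D) (ε : ℤˣ) (hf : ∀ ε : ℤˣ, HD A N (insert i D) (fun q => f (blowInf i j ε q))) :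
    HD A M (insert (σ i) D') (fun q => f (iso σ u (blowInf (σ i) (σ j) ε q))) := by
  have hij : i ≠ j := fun h => hi (h ▸ hj)
  have hσij : σ i ≠ σ j := fun h => hij (σ.injective h)
  have hi' : σ i ∉ D' := fun h => hi ((hσ i).1 h)
  have hρ : Good A Finset.univ D' (insert (σ i) D') (Quasi.blowInf (σ i) (σ j) ε) :=
    good_blowInf hi' ((hσ j).2 hj) (Finset.mem_univ _) (Finset.mem_univ _) ε
  set ρ := Quasi.blowInf (σ i) (σ j) ε with hρdef
  obtain ⟨ε', -, hε'⟩ := exists_unit_mul_abs (hu i).ne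
  have hui : UnitAt A (insert i D) (insert (σ i) D') i (fun q => |u i (ρ q)|) :=
    ⟨(hρ.isG _ (hu i).isG).abs_of_ne (by simpa [hρ.zero] using (hu i).ne),
      by simpa [hρ.zero] using (hu i).ne, fun _ => by simpa [hρ.zero] using (hu i).ne⟩
  have huj : UnitAt A (insert i D) (insert (σ i) D') j (fun q => u j (ρ q) * |u i (ρ q)|⁻¹) := by
    refine ⟨(hρ.isG _ (hu j).isG).mul (hui.isG.inv hui.ne), ?_, fun _ => ?_⟩
    · exact mul_ne_zero (by simpa [hρ.zero] using (hu j).ne) (inv_ne_zero hui.ne)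
    · exact mul_pos (by simpa [hρ.zero] using (hu j).pos hj)
        (inv_pos.2 (hui.pos (Finset.mem_insert_self _ _)))
  refine (H (insert i D) (insert (σ i) D') _ σ (Function.update (Function.update
    (fun v q => u v (ρ q)) i fun q => |u i (ρ q)|) j fun q => u j (ρ q) * |u i (ρ q)|⁻¹)
    (fun v => by simp [hσ]) (unitAt_update (fun v hv => ?_) huj) (hf (ε * ε'))).congr ?_
  · by_cases h : v = i
    · subst h; simpa using hui
    · simpa [h] using (hu v).comp hρ fun h' => Or.inl (Finset.mem_of_mem_insert_of_ne h' h)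
  · have h1 : Tendsto (fun q => u i (ρ q)) (gz (insert (σ i) D')) (𝓝 (u i 0)) := by
      simpa [hρ.zero] using (hρ.isG _ (hu i).isG).tendsto
    filter_upwards [h1.eventually hε', h1.eventually (isOpen_ne.mem_nhds (hu i).ne)] with q h2 h3
    congr 1
    funext v
    have h1 : iso σ u (ρ q) v = ρ q (σ v) * u v (ρ q) := rfl
    rw [h1]
    by_cases hv : v = i
    · subst hv
      rw [show ρ q (σ v) = ((ε : ℤ) : ℝ) * q (σ v) by simp [hρdef, Quasi.blowInf]]
      simp only [iso, Quasi.blowInf, Function.update_self, Function.update_of_ne hij]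
      conv_rhs => rw [h2]
      push_cast
      ring
    · by_cases hv' : v = j
      · subst hv'
        have := abs_ne_zero.2 h3
        rw [show ρ q (σ v) = q (σ i) * q (σ v) by simp [hρdef, Quasi.blowInf, hσij.symm]]
        simp only [iso, Quasi.blowInf, Function.update_self, Function.update_of_ne hij,
          Function.update_of_ne hij.symm]
        field_simp
      · have h4 : σ v ≠ σ i := fun h => hv (σ.injective h)
        have h5 : σ v ≠ σ j := fun h => hv' (σ.injective h)
        rw [show ρ q (σ v) = q (σ v) by simp [hρdef, Quasi.blowInf, h4, h5]]
        simp [iso, Quasi.blowInf, hv, hv']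

/-- Changes of coordinates pass a ramification if the unit is replaced by its root. -/
theorem IsoHD.ramX {N M : ℕ} (H : IsoHD A V N M) {σ : Equiv.Perm V} {u : V → (V → ℝ) → ℝ}
    (hσ : ∀ v, σ v ∈ D' ↔ v ∈ D) (hu : ∀ v, UnitAt A D D' v (u v)) {i : V} (hi : i ∈ D)
    {γ : ℝ≥0} (hγ : ExpOk A γ) (h0 : 0 < γ) (hf : HD A N D (fun q => f (ramX i γ q))) :
    HD A M D' (fun q => f (iso σ u (ramX (σ i) γ q))) := by
  have hρ : Good A Finset.univ D' D' (Quasi.ramX (σ i) γ) :=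
    (ElNode.Edge.ramX (σ i) γ ((hσ i).2 hi) hγ h0).good (Finset.mem_univ _)
  have hu' : ∀ v, UnitAt A D D' v (fun q => u v (Quasi.ramX (σ i) γ q)) := fun v =>
    (hu v).comp hρ Or.inl
  have hpos := (hu' i).pos hi
  refine (H D D' _ σ (Function.update (fun v q => u v (Quasi.ramX (σ i) γ q)) i
    fun q => u i (Quasi.ramX (σ i) γ q) ^ (γ : ℝ)⁻¹) hσ (unitAt_update (fun v _ => hu' v)
    ⟨isG_unit_rpow (powOk_inv_of_expOk hγ h0.ne') (hu' i).isG hpos,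
      (Real.rpow_pos_of_pos hpos _).ne', fun _ => Real.rpow_pos_of_pos hpos _⟩) hf).congr ?_
  filter_upwards [eventually_nonneg ((hσ i).2 hi),
    (hu' i).isG.tendsto.eventually (lt_mem_nhds hpos)] with q h1 h2
  congr 1
  funext v
  have h4 : ∀ q, iso σ u q v = q (σ v) * u v q := fun _ => rfl
  rw [h4]
  by_cases hv : v = i
  · subst hv
    rw [show Quasi.ramX (σ v) γ q (σ v) = q (σ v) ^ (γ : ℝ) by simp [Quasi.ramX], Quasi.ramX,
      Function.update_self]
    simp only [iso, Function.update_self]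
    rw [Real.mul_rpow h1 (Real.rpow_nonneg h2.le _),
      Real.rpow_inv_rpow h2.le (by exact_mod_cast h0.ne')]
  · have : σ v ≠ σ i := fun h => hv (σ.injective h)
    rw [show Quasi.ramX (σ i) γ q (σ v) = q (σ v) by simp [Quasi.ramX, this], Quasi.ramX]
    simp [iso, hv]

theorem IsoHD.ramY {N M : ℕ} (H : IsoHD A V N M) {σ : Equiv.Perm V} {u : V → (V → ℝ) → ℝ}
    (hσ : ∀ v, σ v ∈ D' ↔ v ∈ D) (hu : ∀ v, UnitAt A D D' v (u v)) {i : V} (hi : i ∉ D)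
    {d : ℕ} (hd : 1 ≤ d) (ε : ℤˣ) (hf : ∀ ε, HD A N D (fun q => f (ramY i d ε q))) :
    HD A M D' (fun q => f (iso σ u (ramY (σ i) d ε q))) := by
  have hi' : σ i ∉ D' := fun h => hi ((hσ i).1 h)
  have hρ : Good A Finset.univ D' D' (Quasi.ramY (σ i) d ε) :=
    (ElNode.Edge.ramY (σ i) d hi' hd ε).good (Finset.mem_univ _)
  have hu' : ∀ v, UnitAt A D D' v (fun q => u v (Quasi.ramY (σ i) d ε q)) := fun v =>
    (hu v).comp hρ Or.inl
  have hd0 : d ≠ 0 := by omega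
  obtain ⟨ε', -, hε'⟩ := exists_unit_mul_abs (hu' i).ne
  have hpos : 0 < |u i (Quasi.ramY (σ i) d ε 0)| := abs_pos.2 (hu' i).ne
  refine (H D D' _ σ (Function.update (fun v q => u v (Quasi.ramY (σ i) d ε q)) i
    fun q => |u i (Quasi.ramY (σ i) d ε q)| ^ (d : ℝ)⁻¹) hσ (unitAt_update (fun v _ => hu' v)
    ⟨isG_unit_rpow (powOk_inv_nat hd0) ((hu' i).isG.abs_of_ne (hu' i).ne) hpos,
      (Real.rpow_pos_of_pos hpos _).ne', fun h => absurd h hi⟩) (hf (ε * ε'))).congr ?_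
  filter_upwards [(hu' i).isG.tendsto.eventually hε'] with q h2
  congr 1
  funext v
  have h4 : ∀ q, iso σ u q v = q (σ v) * u v q := fun _ => rfl
  rw [h4]
  by_cases hv : v = i
  · subst hv
    rw [show Quasi.ramY (σ v) d ε q (σ v) = ((ε : ℤ) : ℝ) * q (σ v) ^ d by simp [Quasi.ramY],
      Quasi.ramY, Function.update_self]
    simp only [iso, Function.update_self]
    rw [mul_pow, Real.rpow_inv_natCast_pow (abs_nonneg _) hd0]
    conv_rhs => rw [h2]
    push_cast
    ring
  · have : σ v ≠ σ i := fun h => hv (σ.injective h)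
    rw [show Quasi.ramY (σ i) d ε q (σ v) = q (σ v) by simp [Quasi.ramY, this], Quasi.ramY]
    simp [iso, hv]

/-- Changes of coordinates at most double the height: each node is replaced by the corresponding node
in the new coordinates, followed by a translation if necessary. -/
theorem isoHD (N : ℕ) : IsoHD A V N (2 * N) := by
  induction N with
  | zero => exact fun D D' f σ u hσ hu hf => normal_iso hσ hu hf
  | succ N H =>
    intro D D' f σ u hσ hu hf
    have hσ' : ∀ v, v ∉ D → σ v ∉ D' := fun v hv h => hv ((hσ v).1 h)
    have hne : ∀ i j, i ≠ j → σ i ≠ σ j := fun i j hij h => hij (σ.injective h)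
    have hE : ∀ i v, σ v ∈ D'.erase (σ i) ↔ v ∈ D.erase i := fun i v => by simp [hσ]
    have hu0 : ∀ i j, i ∈ D → j ∈ D → 0 < u i 0 / u j 0 := fun i j hi hj =>
      div_pos ((hu i).pos hi) ((hu j).pos hj)
    have hU := Finset.mem_univ (α := V)
    change HD A (2 * N + 1 + 1) D' _
    rcases hf with hf | ⟨ν, hf⟩
    · exact (H D D' f σ u hσ hu hf).mono (by omega)
    cases ν with
    | trans k h hk hh h0 hdep =>
      have hι := good_iso hσ hu
      have hkk : IsG A D' (fun q => q (σ k) * u k q) := (isG_coord _).mul (hu k).isG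
      -- `q_k u_k - h` is a germ with nonzero derivative in `q_k`: the node may be dropped, as
      -- another translation is inserted
      refine Or.inl <| (H.special hσ (fun v _ => hu v) hk
        (g := fun q => q (σ k) * u k q - h (iso σ u q)) (hkk.sub (hι.isG h hh))
        (by simp [hι.zero, h0]) ?_ (hf _ _ (.trans k h hk hh h0 hdep))).congr ?_
      · refine ⟨u k 0, (hu k).ne, ?_⟩
        have h1 := hkk.hasDerivAt (hσ' k hk)
        rw [co_coord_mul (hu k).isG, if_pos (by simp), tsub_self, co_zero (hu k).isG] at h1
        convert h1 using 2 with t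
        have : h (iso σ u (Pi.single (σ k) t)) = 0 := by
          rw [← h0]
          refine hdep fun v hv => ?_
          have : v ≠ k := by simpa using hv
          simp [iso, hne _ _ this]
        simp [this]
      · refine Eventually.of_forall fun q => congrArg f ?_
        have : h (Function.update (iso σ u q) k (q (σ k) * u k q - h (iso σ u q))) =
            h (iso σ u q) := hdep fun v hv => by simp [show v ≠ k by simpa using hv]
        funext v
        by_cases hv : v = k
        · subst hv; simp only [Quasi.trans, Function.update_self, this]; simp [iso]
        · simp [Quasi.trans, hv]
    | ramX i γ hi hγ h0 =>
      refine Or.inr ⟨.ramX (σ i) γ ((hσ i).2 hi) hγ h0, ?_⟩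
      rintro _ _ ⟨⟩
      exact (H.ramX hσ hu hi hγ h0 (hf _ _ (.ramX i γ hi hγ h0))).mono (by omega)
    | ramY i d hi hd =>
      refine Or.inr ⟨.ramY (σ i) d (hσ' i hi) hd, ?_⟩
      rintro _ _ (_ | _ | ⟨_, _, _, _, ε⟩)
      exact (H.ramY hσ hu hi hd ε fun ε => hf _ _ (.ramY i d hi hd ε)).mono (by omega)
    | xx i j hi hj hij =>
      have hi' := (hσ i).2 hi
      have hj' := (hσ j).2 hj
      have hij' := hne _ _ hij
      refine Or.inr ⟨.xx (σ i) (σ j) hi' hj' hij', fun D₁ ρ he => ?_⟩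
      have hgood := he.good (ElNode.inside_univ _)
      cases he with
      | xxZero =>
        refine H.blow hu hij hσ subset_rfl hgood (Or.inl rfl) (fun _ => hj) ?_
        rw [zero_mul]; exact hf _ _ (.xxZero i j hi hj hij)
      | xxZero' =>
        refine H.blow hu hij.symm hσ subset_rfl hgood (Or.inl rfl) (fun _ => hi) ?_
        rw [zero_mul]; exact hf _ _ (.xxZero' i j hi hj hij)
      | xxPos _ _ _ _ _ lam hlam =>
        exact H.blow hu hij (hE i) (Finset.erase_subset _ _) hgood (Or.inr (by simp))
          (fun _ => hj) (hf _ _ (.xxPos i j hi hj hij _ (mul_pos hlam (hu0 i j hi hj))))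
      | xxPos' _ _ _ _ _ lam hlam =>
        exact H.blow hu hij.symm (hE j) (Finset.erase_subset _ _) hgood (Or.inr (by simp))
          (fun _ => hi) (hf _ _ (.xxPos' i j hi hj hij _ (mul_pos hlam (hu0 j i hj hi))))
    | yx i j hi hj =>
      have hij : i ≠ j := fun h => hi (h ▸ hj)
      refine Or.inr ⟨.yx (σ i) (σ j) (hσ' i hi) ((hσ j).2 hj), fun D₁ ρ he => ?_⟩
      have hgood := he.good (ElNode.inside_univ _)
      cases he with
      | yx _ _ _ _ lam =>
        exact H.blow hu hij hσ subset_rfl hgood (Or.inr hi) (fun _ => hj)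
          (hf _ _ (.yx i j hi hj _))
      | yxInfty _ _ _ _ ε =>
        exact (H.blowInf hσ hu hi hj ε fun ε => hf _ _ (.yxInfty i j hi hj ε)).mono (by omega)
    | yy i j hi hj hij =>
      refine Or.inr ⟨.yy (σ i) (σ j) (hσ' i hi) (hσ' j hj) (hne _ _ hij), fun D₁ ρ he => ?_⟩
      have hgood := he.good (ElNode.inside_univ _)
      cases he with
      | yy _ _ _ _ _ lam =>
        exact H.blow hu hij hσ subset_rfl hgood (Or.inr hi) (fun h => absurd h hi)
          (hf _ _ (.yy i j hi hj hij _))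
      | yyInfty =>
        refine H.blow hu hij.symm hσ subset_rfl hgood (Or.inl rfl) (fun h => absurd h hj) ?_
        rw [zero_mul]; exact hf _ _ (.yyInfty i j hi hj hij)

/-- The height of a tree that makes `f` normal after a change of coordinates, one row of which may be
a germ with nonzero derivative, if the corresponding variable ranges over both signs. -/
theorem HD.transport {N : ℕ} (hf : HD A N D f) {σ : Equiv.Perm V} {u : V → (V → ℝ) → ℝ}
    (hσ : ∀ v, σ v ∈ D' ↔ v ∈ D) {k : V} (hu : ∀ v, v ≠ k → UnitAt A D D' v (u v))
    (hx : k ∈ D → ∃ w, IsG A D' w ∧ 0 < w 0 ∧ g =ᶠ[gz D'] fun q => q (σ k) * w q)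
    (hy : k ∉ D → IsG A D' g ∧ g 0 = 0 ∧
      ∃ d : ℝ, d ≠ 0 ∧ HasDerivAt (fun t => g (Pi.single (σ k) t)) d 0) :
    HD A (2 * N + 1) D' (fun q => f (Function.update (iso σ u q) k (g q))) := by
  by_cases hk : k ∈ D
  · obtain ⟨w, hw, hw0, hgw⟩ := hx hk
    refine Or.inl ((isoHD N D D' f σ (Function.update u k w) hσ
      (unitAt_update hu ⟨hw, hw0.ne', fun _ => hw0⟩) hf).congr ?_)
    filter_upwards [hgw] with q hq
    rw [iso_update, hq]
  · obtain ⟨h1, h2, h3⟩ := hy hk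
    exact (isoHD N).special hσ hu hk h1 h2 h3 hf

/-! ### Bounded height by compactness -/

variable (A) in
/-- The germs of `f` at all points near `0` become normal on trees of a common height. -/
def UHD (D : Finset V) (f : (V → ℝ) → ℝ) : Prop :=
  ∃ N, ∀ᶠ a in gz D, HD A N (Da D a) (fun p => f (a + p))

theorem UHD.exists_hd (h : UHD A D f) : ∃ N, HD A N D f := by
  obtain ⟨N, h⟩ := h
  refine ⟨N, ?_⟩
  have := h.self_of_nhdsWithin (zero_mem_Qd D)
  simpa [Da_zero] using this

theorem Normal.eventually_translate (hf : Normal A D f) :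
    ∀ᶠ a in gz D, Normal A (Da D a) (fun p => f (a + p)) := by
  obtain ⟨w, u, hw, hu, hu0, h⟩ := hf
  filter_upwards [Quasi.eventually_translate h, hu.eventually_translate,
    hu.tendsto.eventually (isOpen_ne.mem_nhds hu0), self_mem_nhdsWithin] with a h1 h2 h3 ha
  have key : ∀ v ∈ Finset.univ, Normal A (Da D a) (fun p => (a + p) v ^ (w v : ℝ)) := fun v _ => ?_
  · exact ((Normal.prod Finset.univ key).mul
      (normal_of_unit h2 (by simpa using h3))).congr (EventuallyEq.symm h1)
  -- a variable with nonzero value contributes a unit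
  have hav : IsG A (Da D a) (fun p => a v + p v) := (isG_const _).add (isG_coord v)
  by_cases hv : v ∈ D
  · by_cases hav0 : a v = 0
    · simpa [hav0] using normal_coord_rpow (mem_Da.2 ⟨hv, hav0⟩) (hw.1 v hv)
    · have h4 : 0 < a v := (ha v hv).lt_of_ne' hav0
      refine normal_of_unit (isG_unit_rpow (powOk_of_expOk (hw.1 v hv)) hav (by simpa using h4)) ?_
      simpa using (Real.rpow_pos_of_pos h4 _).ne'
  · obtain ⟨n, hn⟩ := hw.2 v hv
    have h4 : Normal A (Da D a) (fun p => a v + p v) := by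
      by_cases hav0 : a v = 0
      · simpa [hav0] using normal_coord (A := A) (D := Da D a) v
      · exact normal_of_unit hav (by simpa using hav0)
    simpa [hn] using h4.pow n

theorem UHD.eventually_nhdsWithin {b : V → ℝ} (h : UHD A (Da D b) (fun p => f (b + p))) :
    ∃ N, ∀ᶠ c in 𝓝[Qd D] b, HD A N (Da D c) (fun p => f (c + p)) := by
  obtain ⟨N, h⟩ := h
  refine ⟨N, ?_⟩
  have ht : Tendsto (fun c => c - b) (𝓝[Qd D] b) (gz (Da D b)) := by
    refine tendsto_nhdsWithin_iff.2 ⟨?_, eventually_nhdsWithin_of_forall fun c hc v hv => ?_⟩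
    · have : Tendsto (fun c => c - b) (𝓝 b) (𝓝 (b - b)) :=
        ((continuous_id.sub continuous_const).tendsto b)
      rw [sub_self] at this
      exact this.mono_left nhdsWithin_le_nhds
    · simpa [(mem_Da.1 hv).2] using hc v (mem_Da.1 hv).1
  have hne : ∀ᶠ c in 𝓝[Qd D] b, ∀ v, b v ≠ 0 → c v ≠ 0 := by
    refine eventually_all.2 fun v => ?_
    by_cases hv : b v = 0
    · simp [hv]
    · filter_upwards [nhdsWithin_le_nhds ((continuous_apply v).continuousAt.eventually_ne hv)]
        with c hc _ using hc
  filter_upwards [ht.eventually h, hne] with c h1 h2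
  have e : Da (Da D b) (c - b) = Da D c := by
    ext v
    simp only [mem_Da, Pi.sub_apply]
    constructor
    · rintro ⟨⟨h3, h4⟩, h5⟩
      exact ⟨h3, by simpa [h4] using h5⟩
    · rintro ⟨h3, h4⟩
      have h5 : b v = 0 := by_contra fun h => h2 v h h4
      exact ⟨⟨h3, h5⟩, by simp [h4, h5]⟩
  rw [e] at h1
  refine h1.congr (Eventually.of_forall fun p => congrArg f ?_)
  funext v
  simp only [Pi.add_apply, Pi.sub_apply]
  ring

/-- By compactness, the height is bounded near a segment of a coordinate axis. -/
theorem exists_uniform_segment {i : V} (L : ℝ) (h : ∀ lam, Pi.single i lam ∈ Qd D →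
      UHD A (Da D (Pi.single i lam)) (fun p => f (Pi.single i lam + p))) :
    ∃ N, ∀ᶠ a in gz D, ∀ lam ∈ Set.Icc (-L) L, Function.update a i lam ∈ Qd D →
      HD A N (Da D (Function.update a i lam)) (fun p => f (Function.update a i lam + p)) := by
  refine isCompact_Icc.induction_on (p := fun s => ∃ N, ∀ᶠ a in gz D, ∀ lam ∈ s,
    Function.update a i lam ∈ Qd D →
      HD A N (Da D (Function.update a i lam)) (fun p => f (Function.update a i lam + p)))
    ⟨0, by simp⟩ ?_ ?_ fun l _ => ?_
  · rintro s t hst ⟨N, h⟩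
    exact ⟨N, h.mono fun a ha lam hl => ha lam (hst hl)⟩
  · rintro s t ⟨N, h⟩ ⟨M, h'⟩
    refine ⟨max N M, ?_⟩
    filter_upwards [h, h'] with a h1 h2 lam hl hq
    rcases hl with hl | hl
    · exact (h1 lam hl hq).mono (le_max_left _ _)
    · exact (h2 lam hl hq).mono (le_max_right _ _)
  -- near each point of the segment there is a bound
  · by_cases hl : Pi.single i l ∈ Qd D
    · obtain ⟨N, hN⟩ := (h l hl).eventually_nhdsWithin
      have ht : Tendsto (fun x : (V → ℝ) × ℝ => Function.update x.1 i x.2) (𝓝 0 ×ˢ 𝓝 l)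
          (𝓝 (Pi.single i l)) := by
        rw [← nhds_prod_eq]
        exact (continuous_fst.update i continuous_snd).tendsto ((0 : V → ℝ), l)
      obtain ⟨pa, ha, pb, hb, hab⟩ :=
        eventually_prod_iff.1 (ht.eventually (eventually_nhdsWithin_iff.1 hN))
      exact ⟨{x | pb x}, nhdsWithin_le_nhds hb, N,
        nhdsWithin_le_nhds (ha.mono fun a h1 lam h2 => hab h1 h2)⟩
    · have hi : i ∈ D ∧ l < 0 := by
        by_contra hcon
        refine hl fun v hv => ?_
        by_cases hvi : v = i
        · subst hvi
          simpa using not_lt.1 fun h => hcon ⟨hv, h⟩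
        · simp [hvi]
      refine ⟨Set.Iio 0, nhdsWithin_le_nhds (Iio_mem_nhds hi.2), 0,
        Eventually.of_forall fun a lam hlam hq => ?_⟩
      have := hq i hi.1
      simp only [Function.update_self] at this
      exact absurd hlam (not_lt.2 this)

theorem eventually_add_ne {v : V} {x : ℝ} (hx : x ≠ 0) : ∀ᶠ q in gz D, x + q v ≠ 0 := by
  have h := (tendsto_coord (D := D) v).const_add x
  rw [add_zero] at h
  exact h.eventually (isOpen_ne.mem_nhds hx)

theorem isG_const_add_coord (x : ℝ) (v : V) : IsG A D (fun q => x + q v) :=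
  (isG_const x).add (isG_coord v)

theorem unitAt_one {D' : Finset V} (v : V) : UnitAt A D D' v (fun _ => 1) :=
  ⟨isG_const 1, one_ne_zero, fun _ => one_pos⟩

theorem mul_self_unit (ε : ℤˣ) : (((ε : ℤ) : ℝ)) * ((ε : ℤ) : ℝ) = 1 := by
  rcases Int.units_eq_one_or ε with h | h <;> simp [h]

/-- The germ of `f` at a point near `0` at which one of the blown up coordinates is nonzero, and the
germs of the pullbacks of such germs at points of the exceptional divisor, are germs of `f` in the
charts of the blow-up, up to a change of coordinates: close to finitely many directions by
compactness, and close to the direction at infinity. The set `E` consists of the signs of the charts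
at infinity, whose nonnegative variables are those in `D₂`. -/
theorem exists_uniform_blow {i j : V} (hij : i ≠ j) {D₂ : Finset V} {E : Set ℤˣ}
    (hD₂ : ∀ v, v ≠ i → (v ∈ D₂ ↔ v ∈ D)) (hiD₂ : i ∈ D₂ ↔ j ∈ D) (hiD : i ∈ D → j ∈ D)
    (hE : ∀ s : ℝ, s ≠ 0 → (i ∈ D → 0 < s) → ∃ ε ∈ E, i ∈ D₂ → 0 < ((ε : ℤ) : ℝ) * s)
    (h1 : ∀ lam, Pi.single i lam ∈ Qd D →
      UHD A (Da D (Pi.single i lam)) (fun p => f (blow i j lam p)))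
    (h2 : ∀ ε ∈ E, UHD A D₂ (fun p => f (blowInf i j ε p))) :
    ∃ N, ∀ᶠ a in gz D, (a i ≠ 0 ∨ a j ≠ 0 → HD A N (Da D a) (fun p => f (a + p))) ∧
      (a i = 0 → a j = 0 →
        (∀ lam, Pi.single i lam ∈ Qd D →
          HD A N (Da D (Function.update a i lam)) (fun p => f (a + blow i j lam p))) ∧
        ∀ ε ∈ E, HD A N (Da D₂ a) (fun p => f (a + blowInf i j ε p))) := by
  -- a bound near the origin of the charts at infinity, say for points of size less than `δ`
  obtain ⟨N₂, H₂⟩ : ∃ N, ∀ᶠ c in gz D₂, ∀ ε ∈ E,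
      HD A N (Da D₂ c) (fun p => f (blowInf i j ε (c + p))) := by
    have : ∀ ε : ℤˣ, ∃ N, ∀ᶠ c in gz D₂, ε ∈ E →
        HD A N (Da D₂ c) (fun p => f (blowInf i j ε (c + p))) := fun ε => by
      by_cases hε : ε ∈ E
      · obtain ⟨N, h⟩ := h2 ε hε
        exact ⟨N, h.mono fun c hc _ => hc⟩
      · exact ⟨0, by simp [hε]⟩
    choose N hN using this
    refine ⟨Finset.univ.sup N, (eventually_all.2 hN).mono fun c hc ε hε => ?_⟩
    exact (hc ε hε).mono (Finset.le_sup (Finset.mem_univ ε))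
  obtain ⟨δ, hδ, hball⟩ := Metric.mem_nhdsWithin_iff.1 H₂
  have H₂' : ∀ c ∈ Qd D₂, (∀ v, |c v| < δ) → ∀ ε ∈ E,
      HD A N₂ (Da D₂ c) (fun p => f (blowInf i j ε (c + p))) := fun c hc h => by
    refine hball ⟨?_, hc⟩
    rw [Metric.mem_ball, dist_pi_lt_iff hδ]
    simpa using h
  -- the segment of directions `|λ| ≤ 1 / δ` covers what the charts at infinity leave out
  obtain ⟨N₁, H₁⟩ := exists_uniform_segment (A := A) (D := D) (f := fun p => f (blow i j 0 p))
    (i := i) (1 / δ) fun lam hl => by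
      convert h1 lam hl using 3 with p
      funext v
      by_cases hv : v = i
      · subst hv; simp [blow, hij.symm]
      · simp [blow, hv]
  have hsmall : ∀ᶠ a in gz D, ∀ v, |a v| < δ := eventually_all.2 fun v => by
    simpa using (tendsto_coord (D := D) v).eventually (Metric.ball_mem_nhds 0 hδ)
  refine ⟨2 * max N₁ N₂ + 1, ?_⟩
  filter_upwards [H₁, hsmall, self_mem_nhdsWithin] with a ha₁ haδ haQ
  have hN₁ : 2 * N₁ + 1 ≤ 2 * max N₁ N₂ + 1 := by have := le_max_left N₁ N₂; omega
  have hN₂ : 2 * N₂ + 1 ≤ 2 * max N₁ N₂ + 1 := by have := le_max_right N₁ N₂; omega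
  have hjD₂ : j ∈ D₂ → j ∈ D ∧ i ∈ D₂ := fun h =>
    ⟨(hD₂ j hij.symm).1 h, hiD₂.2 ((hD₂ j hij.symm).1 h)⟩
  refine ⟨fun hne => ?_, fun hai haj => ⟨fun lam hlam => ?_, fun ε hε => ?_⟩⟩
  -- a point off the centre of the blow-up
  · rcases le_or_gt |a i| (1 / δ * |a j|) with hle | hgt
    · have haj : a j ≠ 0 := fun h => by
        simp only [h, abs_zero, mul_zero, abs_nonpos_iff] at hle
        simp [hle, h] at hne
      -- the point lies in the chart of the direction `a i / a j`
      have hI : a i / a j ∈ Set.Icc (-(1 / δ)) (1 / δ) := by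
        rw [Set.mem_Icc, ← abs_le, abs_div, div_le_iff₀ (abs_pos.2 haj)]
        exact hle
      have hQ : Function.update a i (a i / a j) ∈ Qd D := fun v hv => by
        by_cases h : v = i
        · subst h; simpa using div_nonneg (haQ _ hv) (haQ _ (hiD hv))
        · simpa [h] using haQ v hv
      have hDa : Da D (Function.update a i (a i / a j)) = Da D a := by
        ext v
        by_cases h : v = i
        · subst h; simp [mem_Da, haj]
        · simp [mem_Da, h]
      have h := ha₁ _ hI hQ
      rw [hDa] at h
      have hinv : IsG A (Da D a) (fun q => (a j + q j)⁻¹) :=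
        (isG_const_add_coord _ j).inv (by simpa using haj)
      refine ((h.transport (D' := Da D a) (σ := 1) (u := fun _ _ => 1) (k := i)
        (g := fun q => (a i + q i) * (a j + q j)⁻¹ - a i / a j) (fun v => Iff.rfl)
        (fun v _ => unitAt_one v) (fun hi => ?_) fun _ => ⟨?_, ?_, ?_⟩).mono hN₁).congr ?_
      · obtain ⟨hi1, hi2⟩ := mem_Da.1 hi
        refine ⟨_, hinv, ?_, Eventually.of_forall fun q => by simp [hi2]⟩
        simpa using (haQ j (hiD hi1)).lt_of_ne' haj
      · exact ((isG_const_add_coord _ i).mul hinv).sub (isG_const _)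
      · simp [div_eq_mul_inv]
      · refine ⟨(a j)⁻¹, inv_ne_zero haj, ?_⟩
        simpa [hij.symm] using (((hasDerivAt_id (0 : ℝ)).const_add (a i)).mul_const
          (a j)⁻¹).sub_const (a i / a j)
      · filter_upwards [eventually_add_ne (v := j) haj] with q hq
        congr 1
        funext v
        by_cases hv : v = i
        · subst hv
          simp [blow, iso, hij.symm]
          field_simp
        · simp [blow, iso, hv]
    -- the point is close to the direction at infinity
    · have hai : a i ≠ 0 := fun h => by
        rw [h, abs_zero] at hgt
        exact absurd hgt (not_lt.2 (by positivity))
      obtain ⟨ε, hε, hpos⟩ := hE (a i) hai fun hi => (haQ i hi).lt_of_ne' hai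
      have hs := mul_self_unit ε
      set s : ℝ := ((ε : ℤ) : ℝ) with hsdef
      have hs0 := left_ne_zero_of_mul_eq_one hs
      have hsa : s * a i ≠ 0 := mul_ne_zero hs0 hai
      have habs : |s| = 1 := by rcases Int.units_eq_one_or ε with rfl | rfl <;> simp [hsdef]
      set c : V → ℝ := Function.update (Function.update a j (a j / (s * a i))) i (s * a i) with hc
      have hci : c i = s * a i := by simp [hc]
      have hcj : c j = a j / (s * a i) := by simp [hc, hij.symm]
      have hcv : ∀ v, v ≠ i → v ≠ j → c v = a v := fun v h h' => by simp [hc, h, h']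
      have hQ : c ∈ Qd D₂ := fun v hv => by
        by_cases h : v = i
        · subst h; rw [hci]; exact (hpos hv).le
        · by_cases h' : v = j
          · subst h'; rw [hcj]
            exact div_nonneg (haQ _ (hjD₂ hv).1) (hpos (hjD₂ hv).2).le
          · rw [hcv v h h']; exact haQ v ((hD₂ v h).1 hv)
      have hcδ : ∀ v, |c v| < δ := fun v => by
        by_cases h : v = i
        · subst h; rw [hci, abs_mul, habs, one_mul]; exact haδ _
        · by_cases h' : v = j
          · subst h'
            rw [hcj, abs_div, abs_mul, habs, one_mul, div_lt_iff₀ (abs_pos.2 hai)]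
            rwa [one_div_mul_eq_div, div_lt_iff₀ hδ, mul_comm] at hgt
          · rw [hcv v h h']; exact haδ v
      have hDa : ∀ v, v ∈ Da D a ↔ v ∈ Da D₂ c := fun v => by
        rw [mem_Da, mem_Da]
        by_cases h : v = i
        · subst h; simp [hci, hsa, hai]
        · rw [hD₂ v h]
          by_cases h' : v = j
          · subst h'; simp [hcj, hsa]
          · rw [hcv v h h']
      have hinv : IsG A (Da D a) (fun q => (s * (a i + q i))⁻¹) :=
        ((isG_const s).mul (isG_const_add_coord _ i)).inv (by simpa using hsa)
      refine (((H₂' c hQ hcδ ε hε).transport (D' := Da D a) (σ := 1)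
        (u := fun v _ => if v = i then s else 1) (k := j)
        (g := fun q => (a j + q j) * (s * (a i + q i))⁻¹ - c j) hDa
        (fun v _ => ?_) (fun hj => ?_) fun _ => ⟨?_, ?_, ?_⟩).mono hN₂).congr ?_
      · by_cases h : v = i
        · subst h
          simp only [if_true]
          exact ⟨isG_const s, hs0, fun h => absurd (hci.symm.trans (mem_Da.1 h).2) hsa⟩
        · simpa [h] using unitAt_one v
      · have h3 := mem_Da.1 ((hDa j).2 hj)
        refine ⟨_, hinv, ?_, Eventually.of_forall fun q => by simp [hcj, h3.2]⟩
        simpa only [Pi.zero_apply, add_zero] using inv_pos.2 (hpos (hiD₂.2 h3.1))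
      · exact ((isG_const_add_coord _ j).mul hinv).sub (isG_const _)
      · simp [hcj, div_eq_mul_inv]
      · refine ⟨(s * a i)⁻¹, inv_ne_zero hsa, ?_⟩
        simpa [hij] using (((hasDerivAt_id (0 : ℝ)).const_add (a j)).mul_const
          (s * a i)⁻¹).sub_const (c j)
      · filter_upwards [eventually_add_ne (v := i) hai] with q hq
        congr 1
        funext v
        by_cases hv : v = i
        · subst hv
          simp [blowInf, iso, hij, hci, ← hsdef]
          linear_combination (a v + q v) * hs
        · by_cases hv' : v = j
          · subst hv'
            simp [blowInf, iso, hv, hij, hci]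
            field_simp
          · simp [blowInf, iso, hv, hv', hcv]
  -- points of the centre, and the points with parameter `lam` above them
  · rcases le_or_gt |lam| (1 / δ) with hle | hgt
    · have hQ : Function.update a i lam ∈ Qd D := fun v hv => by
        by_cases h : v = i
        · subst h; simpa using hlam _ hv
        · simpa [h] using haQ v hv
      refine ((ha₁ lam (abs_le.1 hle) hQ).mono (by omega)).congr (Eventually.of_forall fun q => congrArg f ?_)
      funext v
      by_cases hv : v = i
      · subst hv; simp [blow, hij.symm, hai, haj]
      · simp [blow, hv]
    -- for large `lam` the chart at `lam` is a translate of a chart at infinity, with `i` and `j`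
    -- interchanged
    · have hl : lam ≠ 0 := fun h => by
        rw [h, abs_zero] at hgt
        exact absurd hgt (not_lt.2 (by positivity))
      obtain ⟨ε, hε, hpos⟩ := hE lam hl fun hi => by
        simpa using (hlam i hi).lt_of_ne' (by simpa using hl)
      have hs := mul_self_unit ε
      set s : ℝ := ((ε : ℤ) : ℝ) with hsdef
      have hs0 := left_ne_zero_of_mul_eq_one hs
      have habs : |s| = 1 := by rcases Int.units_eq_one_or ε with rfl | rfl <;> simp [hsdef]
      set c : V → ℝ := Function.update a j (s * lam⁻¹) with hc
      have hcj : c j = s * lam⁻¹ := by simp [hc]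
      have hcv : ∀ v, v ≠ j → c v = a v := fun v h => by simp [hc, h]
      have hsl : s * lam⁻¹ ≠ 0 := mul_ne_zero hs0 (inv_ne_zero hl)
      have hQ : c ∈ Qd D₂ := fun v hv => by
        by_cases h' : v = j
        · subst h'
          have h3 : s * lam⁻¹ = s * lam / (lam * lam) := by field_simp
          rw [hcj, h3]
          exact div_nonneg (hpos (hjD₂ hv).2).le (mul_self_nonneg _)
        · rw [hcv v h']
          by_cases h : v = i
          · rw [h, hai]
          · exact haQ v ((hD₂ v h).1 hv)
      have hcδ : ∀ v, |c v| < δ := fun v => by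
        by_cases h' : v = j
        · subst h'
          rw [hcj, abs_mul, habs, one_mul, abs_inv]
          exact inv_lt_of_inv_lt₀ hδ (by simpa using hgt)
        · rw [hcv v h']; exact haδ v
      have hσ : ∀ v, Equiv.swap i j v ∈ Da D (Function.update a i lam) ↔ v ∈ Da D₂ c := fun v => by
        rw [mem_Da, mem_Da]
        by_cases h : v = i
        · subst h; simp [hij.symm, haj, hcv v hij, hai, hiD₂]
        · by_cases h' : v = j
          · subst h'; simp [hl, hcj, hs0]
          · rw [Equiv.swap_apply_of_ne_of_ne h h', hD₂ v h, hcv v h', Function.update_of_ne h]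
      have hinv : IsG A (Da D (Function.update a i lam)) (fun q => (lam + q i)⁻¹) :=
        (isG_const_add_coord _ i).inv (by simpa using hl)
      have hj : j ∉ Da D₂ c := fun h => hsl (hcj.symm.trans (mem_Da.1 h).2)
      refine (((H₂' c hQ hcδ ε hε).transport (D' := Da D (Function.update a i lam))
        (σ := Equiv.swap i j) (u := fun v q => if v = i then s * (lam + q i) else 1) (k := j)
        (g := fun q => s * (lam + q i)⁻¹ - s * lam⁻¹) hσ
        (fun v _ => ?_) (fun h => absurd h hj) fun _ => ⟨?_, ?_, ?_⟩).mono hN₂).congr ?_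
      · by_cases h : v = i
        · subst h
          simp only [if_true]
          exact ⟨(isG_const s).mul (isG_const_add_coord _ v), by simp [hs0, hl],
            fun h => by simpa using hpos (mem_Da.1 h).1⟩
        · simpa [h] using unitAt_one v
      · exact ((isG_const s).mul hinv).sub (isG_const _)
      · simp
      · refine ⟨s * (-1 / lam ^ 2), mul_ne_zero hs0 (div_ne_zero (by norm_num)
          (pow_ne_zero 2 hl)), ?_⟩
        simpa using ((((hasDerivAt_id (0 : ℝ)).const_add lam).inv (by simpa using hl)).const_mul
          s).sub_const (s * lam⁻¹)
      · filter_upwards [eventually_add_ne (v := i) hl] with q hq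
        congr 1
        funext v
        by_cases hv : v = i
        · subst hv
          simp [blowInf, blow, iso, hij, hcv v hij, hai, ← hsdef]
          linear_combination (q j * (lam + q v)) * hs
        · by_cases hv' : v = j
          · subst hv'
            simp [blowInf, blow, iso, hv, hij, hcj, hcv i hij, hai, haj]
            field_simp
            linear_combination q v * hs
          · simp [blowInf, blow, iso, hv, hv', hcv, Equiv.swap_apply_of_ne_of_ne]
  · have hQ : a ∈ Qd D₂ := fun v hv => by
      by_cases h : v = i
      · rw [h, hai]
      · exact haQ v ((hD₂ v h).1 hv)
    refine ((H₂' a hQ haδ ε hε).mono (by omega)).congr (Eventually.of_forall fun q => congrArg f ?_)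
    funext v
    by_cases hv : v = i
    · subst hv; simp [blowInf, hai]
    · by_cases hv' : v = j
      · subst hv'; simp [blowInf, hv, hai, haj]
      · simp [blowInf, hv, hv']

theorem blowInf_one {i j : V} (hij : i ≠ j) (p : V → ℝ) : blowInf i j 1 p = blow j i 0 p := by
  funext v
  by_cases hv : v = i
  · subst hv; simp [blowInf, blow, hij]
  · by_cases hv' : v = j
    · subst hv'; simp [blowInf, blow, hv]
    · simp [blowInf, blow, hv, hv']

theorem Da_update {a : V → ℝ} {i : V} (hi : i ∉ D) (x : ℝ) : Da D (Function.update a i x) = Da D a := by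
  ext v
  by_cases hv : v = i
  · subst hv; simp [mem_Da, hi]
  · simp [mem_Da, hv]

theorem Da_update_erase {a : V → ℝ} {i : V} {x : ℝ} (hx : x ≠ 0) :
    Da D (Function.update a i x) = (Da D a).erase i := by
  ext v
  by_cases hv : v = i
  · subst hv; simp [mem_Da, hx]
  · simp [mem_Da, hv]

theorem single_mem_Qd {i : V} {x : ℝ} : Pi.single i x ∈ Qd D ↔ (i ∈ D → 0 ≤ x) := by
  refine ⟨fun h hi => by simpa using h i hi, fun h v hv => ?_⟩
  by_cases hvi : v = i
  · subst hvi; simpa using h hv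
  · simp [hvi]

/-- The translate of a translation to a nearby point is a translation by a germ that vanishes at the
origin. -/
theorem uhd_trans {k : V} {h : (V → ℝ) → ℝ} (hk : k ∉ D) (hh : IsG A D h) (h0 : h 0 = 0)
    (hdep : DependsOn h (Finset.univ.erase k : Set V))
    (hf : UHD A D (fun p => f (trans k h p))) : UHD A D f := by
  obtain ⟨N, hN⟩ := hf
  refine ⟨N + 1, ?_⟩
  have ht : Tendsto (fun a : V → ℝ => Function.update a k (a k - h a)) (gz D) (gz D) :=
    tendsto_update k (by simpa [h0] using (tendsto_coord k).sub hh.tendsto) fun h => absurd h hk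
  filter_upwards [ht.eventually hN, hh.eventually_translate] with a h1 h2
  rw [Da_update hk] at h1
  have hdep' : DependsOn (fun p => h (a + p) - h a) (Finset.univ.erase k : Set V) :=
    fun p q hpq => congrArg (· - h a) (hdep fun v hv => by simp [hpq v hv])
  refine Or.inr ⟨.trans k _ (fun h => hk (mem_Da.1 h).1) (h2.sub (isG_const _)) (by simp) hdep', ?_⟩
  rintro D' ρ ⟨⟩
  refine h1.congr (Eventually.of_forall fun q => congrArg f ?_)
  have : h (Function.update a k (a k - h a) + q) = h (a + q) := hdep fun v hv => by
    simp [show v ≠ k by simpa using hv]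
  funext v
  by_cases hv : v = k
  · subst hv
    simp only [Quasi.trans, Function.update_self, this, Pi.add_apply]
    ring
  · simp [Quasi.trans, hv]

/-- Where the ramified variable is nonzero, its root is a germ with nonzero derivative, and the
ramification is a change of coordinates. -/
theorem uhd_ramX {i : V} {γ : ℝ≥0} (hi : i ∈ D) (hγ : ExpOk A γ) (h0 : 0 < γ)
    (hf : UHD A D (fun p => f (ramX i γ p))) : UHD A D f := by
  obtain ⟨N, hN⟩ := hf
  refine ⟨2 * N + 1, ?_⟩
  have hγ0 : (γ : ℝ) ≠ 0 := by exact_mod_cast h0.ne'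
  have hγi : (0 : ℝ) < (γ : ℝ)⁻¹ := by positivity
  filter_upwards [(tendsto_update_rpow i hγi).eventually hN, self_mem_nhdsWithin] with a h1 haQ
  by_cases hai : a i = 0
  · have e : Function.update a i (a i ^ (γ : ℝ)⁻¹) = a := by
      rw [hai, Real.zero_rpow hγi.ne', ← hai, Function.update_eq_self]
    rw [e] at h1
    refine Or.inr ⟨.ramX i γ (mem_Da.2 ⟨hi, hai⟩) hγ h0, ?_⟩
    rintro D' ρ ⟨⟩
    refine (h1.mono (M := 2 * N) (by omega)).congr (Eventually.of_forall fun q => congrArg f ?_)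
    funext v
    by_cases hv : v = i
    · subst hv; simp [ramX, hai]
    · simp [ramX, hv]
  -- extract the root of `a i + q i`
  · have hpos : 0 < a i := (haQ i hi).lt_of_ne' hai
    have hroot : a i ^ (γ : ℝ)⁻¹ ≠ 0 := (Real.rpow_pos_of_pos hpos _).ne'
    have hDa : ∀ v, v ∈ Da D a ↔ v ∈ Da D (Function.update a i (a i ^ (γ : ℝ)⁻¹)) := fun v => by
      by_cases hv : v = i
      · subst hv; simp [mem_Da, hai, hroot]
      · simp [mem_Da, hv]
    refine (h1.transport (D' := Da D a) (σ := 1) (u := fun _ _ => 1) (k := i)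
      (g := fun q => (a i + q i) ^ (γ : ℝ)⁻¹ - a i ^ (γ : ℝ)⁻¹) hDa (fun v _ => unitAt_one v)
      (fun h => absurd (mem_Da.1 h).2 (by simp [hroot])) fun _ => ⟨?_, by simp, ?_⟩).congr ?_
    · exact (isG_unit_rpow (powOk_inv_of_expOk hγ h0.ne') (isG_const_add_coord _ i)
        (by simpa using hpos)).sub (isG_const _)
    · have h3 : HasDerivAt (fun t : ℝ => a i + t) 1 0 := (hasDerivAt_id (0 : ℝ)).const_add (a i)
      have h4 := (h3.rpow_const (p := (γ : ℝ)⁻¹) (Or.inl (by simpa using hai))).sub_const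
        (a i ^ (γ : ℝ)⁻¹)
      refine ⟨_, ?_, by simpa using h4⟩
      simpa using ⟨h0.ne', (Real.rpow_pos_of_pos hpos _).ne'⟩
    · filter_upwards [(isG_const_add_coord (A := A) (D := Da D a) (a i) i).tendsto.eventually
        (lt_mem_nhds (by simpa using hpos))] with q hq
      congr 1
      funext v
      by_cases hv : v = i
      · subst hv
        simp [ramX, Real.rpow_inv_rpow hq.le hγ0]
      · simp [ramX, iso, hv]

theorem uhd_ramY {i : V} {d : ℕ} (hi : i ∉ D) (hd : 1 ≤ d)
    (hf : ∀ ε, UHD A D (fun p => f (ramY i d ε p))) : UHD A D f := by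
  choose N hN using hf
  refine ⟨2 * Finset.univ.sup N + 1, ?_⟩
  have hd0 : d ≠ 0 := by omega
  have hNs : ∀ ε, N ε ≤ Finset.univ.sup N := fun ε => Finset.le_sup (Finset.mem_univ ε)
  have hdi : (0 : ℝ) < (d : ℝ)⁻¹ := by positivity
  have ht : Tendsto (fun a : V → ℝ => Function.update a i (|a i| ^ (d : ℝ)⁻¹)) (gz D) (gz D) := by
    refine tendsto_update i ?_ fun h => absurd h hi
    simpa [Real.zero_rpow hdi.ne'] using (tendsto_coord i).abs.rpow_const (Or.inr hdi.le)
  filter_upwards [ht.eventually (eventually_all.2 hN), eventually_all.2 hN] with a h1 h1'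
  by_cases hai : a i = 0
  · refine Or.inr ⟨.ramY i d (fun h => hi (mem_Da.1 h).1) hd, ?_⟩
    rintro _ _ (_ | _ | ⟨_, _, _, _, ε⟩)
    refine ((h1' ε).mono (M := 2 * Finset.univ.sup N) (by have := hNs ε; omega)).congr
      (Eventually.of_forall fun q => congrArg f ?_)
    funext v
    by_cases hv : v = i
    · subst hv; simp [ramY, hai]
    · simp [ramY, hv]
  · have hpos : 0 < |a i| := abs_pos.2 hai
    -- at a point off the hyperplane the sign of the coordinate selects the chart
    obtain ⟨ε, -, hε⟩ := exists_unit_mul_abs hai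
    have h2 := h1 ε
    rw [Da_update hi] at h2
    have hi' : i ∉ Da D a := fun h => hi (mem_Da.1 h).1
    have hg : IsG A (Da D a) (fun q => |a i + q i|) :=
      (isG_const_add_coord _ i).abs_of_ne (by simpa using hai)
    have hg' : IsG A (Da D a) (fun q => |a i + q i| ^ (d : ℝ)⁻¹ - |a i| ^ (d : ℝ)⁻¹) :=
      (isG_unit_rpow (powOk_inv_nat hd0) hg (by simpa using hai)).sub (isG_const _)
    refine ((h2.transport (D' := Da D a) (σ := 1) (u := fun _ _ => 1) (k := i) (g := _)
      (fun v => Iff.rfl) (fun v _ => unitAt_one v) (fun h => absurd h hi')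
      fun _ => ⟨hg', by simp, ?_⟩).mono (by have := hNs ε; omega)).congr ?_
    · have h3 : HasDerivAt (fun t : ℝ => |a i + t|) (SignType.sign (a i) * 1) 0 := by
        have := HasDerivAt.comp (0 : ℝ) (h₂ := fun x => |x|) (h := fun t => a i + t)
          (h₂' := (SignType.sign (a i) : ℝ)) (by simpa using hasDerivAt_abs hai)
          ((hasDerivAt_id (0 : ℝ)).const_add (a i))
        exact this
      have h4 := (h3.rpow_const (p := (d : ℝ)⁻¹) (Or.inl (by simpa using hai))).sub_const
        (|a i| ^ (d : ℝ)⁻¹)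
      refine ⟨_, ?_, by simpa using h4⟩
      have h5 : (SignType.sign (a i) : ℝ) ≠ 0 := by
        rcases lt_or_gt_of_ne hai with h | h <;> simp [h]
      have := (Real.rpow_pos_of_pos hpos ((d : ℝ)⁻¹ - 1)).ne'
      simpa using ⟨⟨h5, hd0⟩, this⟩
    · have ht2 : Tendsto (fun q : V → ℝ => a i + q i) (gz (Da D a)) (𝓝 (a i)) := by
        simpa using (tendsto_coord (D := Da D a) i).const_add (a i)
      filter_upwards [ht2.eventually hε] with q hq
      congr 1
      funext v
      by_cases hv : v = i
      · subst hv
        simp only [ramY, Function.update_self, Pi.add_apply, add_sub_cancel,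
          Real.rpow_inv_natCast_pow (abs_nonneg _) hd0]
        exact hq.symm
      · simp [ramY, iso, hv]

/-- Trees along which `f` becomes normal can be chosen of bounded height, uniformly in the base
point. At a blow-up `exists_uniform_blow` bounds the heights that infinitely many charts require. -/
theorem Cov.uhd (h : Cov A Finset.univ D f) : UHD A D f := by
  induction h with
  | normal h => exact ⟨0, h.eventually_translate⟩
  | @node D f ν _ _ ih =>
    cases ν with
    | trans k h hk hh h0 hdep =>
      exact uhd_trans hk hh h0 hdep (ih _ _ (.trans k h hk hh h0 hdep))
    | ramX i γ hi hγ h0 => exact uhd_ramX hi hγ h0 (ih _ _ (.ramX i γ hi hγ h0))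
    | ramY i d hi hd => exact uhd_ramY hi hd fun ε => ih _ _ (.ramY i d hi hd ε)
    | xx i j hi hj hij =>
      have key : ∀ i j, i ∈ D → j ∈ D → i ≠ j → (UHD A D fun p => f (blow i j 0 p)) →
          (UHD A D fun p => f (blow j i 0 p)) →
          (∀ lam : ℝ, 0 < lam → UHD A (D.erase i) fun p => f (blow i j lam p)) →
          ∃ N, ∀ᶠ a in gz D, (a i ≠ 0 ∨ a j ≠ 0 → HD A N (Da D a) (fun p => f (a + p))) ∧
            (a i = 0 → a j = 0 → HD A N (Da D a) (fun p => f (a + blow i j 0 p)) ∧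
              ∀ lam : ℝ, 0 < lam →
                HD A N ((Da D a).erase i) (fun p => f (a + blow i j lam p))) := by
        intro i j hi hj hij h0 h0' hp
        have h1 : ∀ lam, Pi.single i lam ∈ Qd D →
            UHD A (Da D (Pi.single i lam)) (fun p => f (blow i j lam p)) := fun lam hlam => by
          rcases (single_mem_Qd.1 hlam hi).eq_or_lt with h | h
          · rw [← h]
            simpa [Da_zero] using h0
          · have := hp lam h
            rwa [← Da_zero (D := D), ← Da_update_erase h.ne'] at this
        obtain ⟨N, hN⟩ := exists_uniform_blow (A := A) (D := D) (D₂ := D) (f := f) (E := {1}) hij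
          (fun _ _ => Iff.rfl) ⟨fun _ => hj, fun _ => hi⟩ (fun _ => hj)
          (fun s _ hs => ⟨1, rfl, fun h => by simpa using hs h⟩) h1 (fun ε hε => by
            rw [Set.mem_singleton_iff.1 hε]
            simpa only [blowInf_one hij] using h0')
        refine ⟨N, hN.mono fun a ha => ⟨ha.1, fun hai haj => ⟨?_, fun lam hlam => ?_⟩⟩⟩
        · have := (ha.2 hai haj).1 0 (by simp [zero_mem_Qd])
          rwa [← hai, Function.update_eq_self, hai] at this
        · have := (ha.2 hai haj).1 lam (single_mem_Qd.2 fun _ => hlam.le)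
          rwa [Da_update_erase hlam.ne'] at this
      have e0 := ih _ _ (.xxZero i j hi hj hij)
      have e0' := ih _ _ (.xxZero' i j hi hj hij)
      obtain ⟨N, hN⟩ := key i j hi hj hij e0 e0' fun lam hl => ih _ _ (.xxPos i j hi hj hij lam hl)
      obtain ⟨M, hM⟩ := key j i hj hi hij.symm e0' e0
        fun lam hl => ih _ _ (.xxPos' i j hi hj hij lam hl)
      refine ⟨max N M + 1, ?_⟩
      filter_upwards [hN, hM] with a h1 h2
      by_cases ha : a i ≠ 0 ∨ a j ≠ 0
      · exact (h1.1 ha).mono (by have := le_max_left N M; omega)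
      · obtain ⟨hai, haj⟩ : a i = 0 ∧ a j = 0 := by simpa [not_or] using ha
        have h3 := h1.2 hai haj
        have h4 := h2.2 haj hai
        refine Or.inr ⟨.xx i j (mem_Da.2 ⟨hi, hai⟩) (mem_Da.2 ⟨hj, haj⟩) hij, fun D' ρ he => ?_⟩
        cases he with
        | xxZero => exact h3.1.mono (le_max_left _ _)
        | xxZero' => exact h4.1.mono (le_max_right _ _)
        | xxPos _ _ _ _ _ lam hl => exact (h3.2 lam hl).mono (le_max_left _ _)
        | xxPos' _ _ _ _ _ lam hl => exact (h4.2 lam hl).mono (le_max_right _ _)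
    | yx i j hi hj =>
      have hij : i ≠ j := fun h => hi (h ▸ hj)
      have hmul : ∀ s : ℝ, s ≠ 0 → ∃ ε : ℤˣ, 0 < ((ε : ℤ) : ℝ) * s := fun s hs => by
        rcases lt_or_gt_of_ne hs with h | h
        · exact ⟨-1, by simpa using h⟩
        · exact ⟨1, by simpa using h⟩
      obtain ⟨N, hN⟩ := exists_uniform_blow (A := A) (D := D) (D₂ := insert i D) (f := f)
        (E := Set.univ) hij (fun v hv => by simp [hv]) ⟨fun _ => hj, fun _ => by simp⟩
        (fun h => absurd h hi) (fun s hs _ => (hmul s hs).imp fun ε h => ⟨trivial, fun _ => h⟩)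
        (fun lam _ => by
          have := ih _ _ (.yx i j hi hj lam)
          rwa [← Da_zero (D := D), ← Da_update hi] at this)
        (fun ε _ => ih _ _ (.yxInfty i j hi hj ε))
      refine ⟨N + 1, hN.mono fun a ha => ?_⟩
      by_cases hne : a i ≠ 0 ∨ a j ≠ 0
      · exact (ha.1 hne).mono (Nat.le_succ _)
      · obtain ⟨hai, haj⟩ : a i = 0 ∧ a j = 0 := by simpa [not_or] using hne
        obtain ⟨h1, h2⟩ := ha.2 hai haj
        refine Or.inr ⟨.yx i j (fun h => hi (mem_Da.1 h).1) (mem_Da.2 ⟨hj, haj⟩), fun D' ρ he => ?_⟩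
        cases he with
        | yx _ _ _ _ lam =>
          have := h1 lam (single_mem_Qd.2 fun h => absurd h hi)
          rwa [Da_update hi] at this
        | yxInfty _ _ _ _ ε =>
          have e : insert i (Da D a) = Da (insert i D) a := by
            ext v
            by_cases hv : v = i
            · subst hv; simp [mem_Da, hai]
            · simp [mem_Da, hv]
          rw [e]
          exact h2 ε trivial
    | yy i j hi hj hij =>
      obtain ⟨N, hN⟩ := exists_uniform_blow (A := A) (D := D) (D₂ := D) (f := f) (E := {1}) hij
        (fun _ _ => Iff.rfl) ⟨fun h => absurd h hi, fun h => absurd h hj⟩ (fun h => absurd h hi)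
        (fun s _ hs => ⟨1, rfl, fun h => by simpa using hs h⟩)
        (fun lam _ => by
          have := ih _ _ (.yy i j hi hj hij lam)
          rwa [← Da_zero (D := D), ← Da_update hi] at this)
        (fun ε hε => by
          rw [Set.mem_singleton_iff.1 hε]
          simpa only [blowInf_one hij] using ih _ _ (.yyInfty i j hi hj hij))
      refine ⟨N + 1, hN.mono fun a ha => ?_⟩
      by_cases hne : a i ≠ 0 ∨ a j ≠ 0
      · exact (ha.1 hne).mono (Nat.le_succ _)
      · obtain ⟨hai, haj⟩ : a i = 0 ∧ a j = 0 := by simpa [not_or] using hne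
        obtain ⟨h1, h2⟩ := ha.2 hai haj
        refine Or.inr ⟨.yy i j (fun h => hi (mem_Da.1 h).1) (fun h => hj (mem_Da.1 h).1) hij,
          fun D' ρ he => ?_⟩
        cases he with
        | yy _ _ _ _ _ lam =>
          have := h1 lam (single_mem_Qd.2 fun h => absurd h hi)
          rwa [Da_update hi] at this
        | yyInfty =>
          simpa only [blowInf_one hij] using h2 1 rfl

end Normalisation

/-! ### Formal substitution for a `y`-variable -/

section FormalSubst

variable {m n : ℕ}

/-- The formal map that replaces `Y_l` by the series `S`. -/
def substFormal (l : Fin n) (S : GenSeries m n) : FormalMap m n m n where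
  xPow := X
  ySub := Function.update Y l S

theorem substFormal_monomial (l : Fin n) (S : GenSeries m n) (e : Expo m n) :
    (substFormal l S).monomial e =
      S ^ e.2 l * HahnSeries.single (e.1, Function.update e.2 l 0) 1 := by
  have h1 : ∏ j, Function.update Y l S j ^ e.2 j =
      S ^ e.2 l * ∏ j, (Y j : GenSeries m n) ^ Function.update e.2 l 0 j := by
    rw [← Finset.mul_prod_erase _ _ (Finset.mem_univ l),
      ← Finset.mul_prod_erase (s := Finset.univ) (f := fun j => Y j ^ Function.update e.2 l 0 j)
        (a := l) (h := Finset.mem_univ l)]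
    simp only [Function.update_self, pow_zero, one_mul]
    refine congrArg _ (Finset.prod_congr rfl fun j hj => ?_)
    simp [Finset.ne_of_mem_erase hj]
  rw [FormalMap.monomial]
  change (∏ i, X i (e.1 i)) * ∏ j, Function.update Y l S j ^ e.2 j = _
  rw [h1, prod_X, prod_Y, mul_left_comm, HahnSeries.single_mul_single]
  simp

/-- The product of two series as a sum of translates of the second factor. -/
theorem coeff_mul_eq_finsum (C P : GenSeries m n) (e' : Expo m n) :
    (Function.support fun a => C.coeff a * (HahnSeries.single a (1 : ℝ) * P).coeff e').Finite ∧
      (C * P).coeff e' = ∑ᶠ a, C.coeff a * (HahnSeries.single a (1 : ℝ) * P).coeff e' := by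
  classical
  set s := Finset.antidiagonal C.isPWO_support P.isPWO_support e'
  have hs : (Function.support fun a => C.coeff a * (HahnSeries.single a (1 : ℝ) * P).coeff e') ⊆
      s.image Prod.fst := by
    intro a ha
    have h1 := left_ne_zero_of_mul ha
    have h2 := right_ne_zero_of_mul ha
    have hle : a ≤ e' := not_not.1 fun h => h2 (coeff_single_mul_of_not_le a e' P h)
    obtain ⟨b, rfl⟩ := exists_add_of_le hle
    rw [add_comm a b, HahnSeries.coeff_single_mul_add, one_mul] at h2
    exact Finset.mem_coe.2 (Finset.mem_image.2 ⟨(a, b),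
      Finset.mem_antidiagonal.2 ⟨h1, h2, rfl⟩, rfl⟩)
  refine ⟨(Finset.finite_toSet _).subset hs, ?_⟩
  rw [finsum_eq_sum_of_support_subset _ hs, HahnSeries.coeff_mul, Finset.sum_image]
  · refine Finset.sum_congr rfl fun x hx => ?_
    rw [← (Finset.mem_antidiagonal.1 hx).2.2, add_comm x.1 x.2,
      HahnSeries.coeff_single_mul_add, one_mul]
  · intro x hx y hy hxy
    have h1 := (Finset.mem_antidiagonal.1 hx).2.2
    have h2 := (Finset.mem_antidiagonal.1 hy).2.2
    rw [← h2, hxy] at h1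
    exact Prod.ext hxy (add_left_cancel h1)

/-- The total degree of an exponent. -/
def deg (e : Expo m n) : ℝ≥0 := ∑ i, e.1 i + ∑ j, (e.2 j : ℝ≥0)

theorem deg_add (a b : Expo m n) : deg (a + b) = deg a + deg b := by
  simp only [deg, Prod.fst_add, Prod.snd_add, Pi.add_apply, Nat.cast_add, Finset.sum_add_distrib]
  ring

theorem exists_le_deg (S : GenSeries m n) (h0 : S.coeff 0 = 0) :
    ∃ δ : ℝ≥0, 0 < δ ∧ ∀ e ∈ S.support, δ ≤ deg e := by
  by_cases hS : S.support.Nonempty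
  · have hmono : Monotone (deg : Expo m n → ℝ≥0) := fun a b h => add_le_add
      (Finset.sum_le_sum fun i _ => h.1 i) (Finset.sum_le_sum fun j _ => Nat.cast_le.2 (h.2 j))
    have hwf := (S.isPWO_support.image_of_monotone hmono).isWF
    obtain ⟨a, ha, hmin⟩ := hwf.min_mem (hS.image deg)
    refine ⟨deg a, pos_iff_ne_zero.2 fun h => ?_, fun e he => ?_⟩
    · obtain ⟨h1, h2⟩ := add_eq_zero.1 h
      have : a = 0 := by
        refine Prod.ext (funext fun i => ?_) (funext fun j => ?_)
        · exact Finset.sum_eq_zero_iff.1 h1 i (Finset.mem_univ i)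
        · exact_mod_cast Finset.sum_eq_zero_iff.1 h2 j (Finset.mem_univ j)
      exact ha (this ▸ h0)
    · rw [hmin]
      exact hwf.min_le (hS.image deg) (Set.mem_image_of_mem deg he)
  · exact ⟨1, one_pos, fun e he => absurd ⟨e, he⟩ hS⟩

theorem le_deg_of_coeff_pow_mul {S : GenSeries m n} {δ : ℝ≥0} (hδ : ∀ e ∈ S.support, δ ≤ deg e)
    (d : ℕ) (G : GenSeries m n) {e : Expo m n} (h : (S ^ d * G).coeff e ≠ 0) : d * δ ≤ deg e := by
  induction d generalizing e with
  | zero => simp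
  | succ d ih =>
    rw [pow_succ', mul_assoc] at h
    obtain ⟨a, ha, b, hb, rfl⟩ := HahnSeries.support_mul_subset h
    rw [deg_add]
    push_cast
    rw [add_mul, one_mul, add_comm]
    exact add_le_add (hδ a ha) (ih hb)

end FormalSubst

section Substitution

variable {V : Type} [Fintype V] [DecidableEq V] {A : QuasianalyticSystem} {D : Finset V}
  {f g : (V → ℝ) → ℝ} {m n : ℕ} {e : Fin m ⊕ Fin n ≃ V}

theorem ser_pull_y (l : Fin n) (h : A.IsGerm (fun p : Pt m n => pull e p (e (Sum.inr l)))) :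
    A.ser _ h = Y l := by
  have := ser_y (A := A) l m n l.2
  simpa using this

/-- The series of a substitution in a `y`-variable is the formal substitution: expand in powers of
this variable; the substituted series has no constant term, so that a coefficient is only affected by
finitely many terms of the expansion. -/
theorem isComp_update_y (he : Fr e D) (hf : IsG A D f) {s : (V → ℝ) → ℝ} (hs : IsG A D s)
    (hs0 : s 0 = 0) (l : Fin n) (h1 : A.IsGerm (fun p => f (pull e p)))
    (h2 : A.IsGerm (fun p => s (pull e p)))
    (h3 : A.IsGerm (fun p => f (Function.update (pull e p) (e (Sum.inr l)) (s (pull e p))))) :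
    (substFormal l (A.ser _ h2)).IsComp (A.ser _ h1) (A.ser _ h3) := by
  classical
  intro e'
  set z := e (Sum.inr l) with hzdef
  have hz : z ∉ D := he.2 l
  set S := A.ser _ h2 with hS
  let ψ : (V → ℝ) → V → ℝ := fun p => Function.update p z (s p)
  have hψ : ∀ f, IsG A D f → IsG A D (fun p => f (ψ p)) := fun f hf => hf.update_y hz hs hs0
  have hψt : Tendsto ψ (gz D) (gz D) := by
    refine (Good.of (A := A) (K := Finset.univ) hψ ?_ (fun v hv => ?_) (by simp)
      (dependsOn_update_of fun p q h => by rw [funext fun w => h w (by simp)]) (by simp)).tendsto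
    · simp [ψ, hs0]
    · have : v ≠ z := fun h => hz (h ▸ hv)
      simpa [ψ, this] using eventually_nonneg hv
  obtain ⟨δ, hδ, hSδ⟩ := exists_le_deg S (by
    rw [hS, ← co_ex he h2, ex_zero, co_zero hs, hs0])
  -- powers `S ^ k` with `k ≥ d` do not affect the coefficient of `e'`
  obtain ⟨d, hd⟩ := exists_nat_gt (deg e' / δ)
  have hd' : deg e' < d * δ := (div_lt_iff₀ hδ).1 hd
  have hlarge : ∀ k, d ≤ k → ∀ G, (S ^ k * G).coeff e' = 0 := fun k hk G => by
    by_contra h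
    have h4 := le_deg_of_coeff_pow_mul hSδ k G h
    have h5 : (d : ℝ≥0) * δ ≤ k * δ := mul_le_mul_left (Nat.cast_le.2 hk) δ
    exact absurd (hd'.trans_le (h5.trans h4)) (lt_irrefl _)
  -- the claim for the coefficient of `e'`; it is additive in `f`, and it suffices to show it for
  -- the terms of the expansion of `f` in powers of the variable up to the exponent `d`
  let Q : ((V → ℝ) → ℝ) → Prop := fun f => ∀ (h1 : A.IsGerm (fun p => f (pull e p)))
    (h3 : A.IsGerm (fun p => f (ψ (pull e p)))),
    (Function.support fun x => (A.ser _ h1).coeff x *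
      ((substFormal l S).monomial x).coeff e').Finite ∧
    (A.ser _ h3).coeff e' = ∑ᶠ x, (A.ser _ h1).coeff x * ((substFormal l S).monomial x).coeff e'
  have hser : ∀ k : ℕ, ∀ {g : (V → ℝ) → ℝ} (hg : IsG A D g)
      (h1 : A.IsGerm (fun p => pull e p z ^ k * g (pull e p)))
      (h3 : A.IsGerm (fun p => ψ (pull e p) z ^ k * g (ψ (pull e p)))),
      A.ser _ h1 = HahnSeries.single (0, Pi.single l k) 1 * A.ser _ (hg.isGerm he) ∧
      A.ser _ h3 = S ^ k * A.ser _ ((hψ g hg).isGerm he) := by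
    intro k g hg h1 h3
    have hy : A.IsGerm (fun p => pull e p z) := (isG_coord z).isGerm he
    constructor
    · rw [← Y_pow, ← ser_pull_y l hy, ← ser_pow hy, ← ser_mul]
    · rw [hS, ← ser_pow h2, ← ser_mul]
      refine ser_congr (Eventually.of_forall fun p => ?_) _ _
      simp [ψ]
  have hQadd : ∀ {f g}, IsG A D f → IsG A D g → Q f → Q g → Q (fun p => f p + g p) := by
    intro f g hf hg hQf hQg h1 h3
    obtain ⟨a1, b1⟩ := hQf (hf.isGerm he) ((hψ f hf).isGerm he)
    obtain ⟨a2, b2⟩ := hQg (hg.isGerm he) ((hψ g hg).isGerm he)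
    have e1 : A.ser _ h1 = A.ser _ (hf.isGerm he) + A.ser _ (hg.isGerm he) := by rw [← ser_add]
    have e3 : A.ser _ h3 = A.ser _ ((hψ f hf).isGerm he) + A.ser _ ((hψ g hg).isGerm he) := by
      rw [← ser_add]
    simp only [e1, e3, HahnSeries.coeff_add, add_mul]
    refine ⟨(a1.union a2).subset fun x hx => ?_, by rw [finsum_add_distrib a1 a2, b1, b2]⟩
    by_contra h
    simp only [Set.mem_union, Function.mem_support, not_or, not_not] at h hx
    exact hx (by rw [h.1, h.2, add_zero])
  have hQtail : ∀ {g}, IsG A D g → Q (fun p => p z ^ d * g p) := by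
    intro g hg h1 h3
    obtain ⟨e1, e3⟩ := hser d hg h1 h3
    have h0 : ∀ x, (A.ser _ h1).coeff x * ((substFormal l S).monomial x).coeff e' = 0 := fun x => by
      by_cases hx : ((0, Pi.single l d) : Expo m n) ≤ x
      · rw [substFormal_monomial, hlarge _ (by simpa using hx.2 l), mul_zero]
      · rw [e1, coeff_single_mul_of_not_le _ _ _ hx, zero_mul]
    rw [e3, hlarge d le_rfl]
    simp [h0]
  -- for `z ^ k c`, with `c` free of the variable, only the series of `c` and `S ^ k` are multiplied
  have hQterm : ∀ (k : ℕ) {c : (V → ℝ) → ℝ}, IsG A D c → DependsOn c ({z}ᶜ : Set V) →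
      Q (fun p => p z ^ k * c p) := by
    intro k c hc hdep h1 h3
    obtain ⟨e1, e3⟩ := hser k hc h1 h3
    have e4 : A.ser _ ((hψ c hc).isGerm he) = A.ser _ (hc.isGerm he) :=
      ser_congr (Eventually.of_forall fun p => hdep fun v hv => by
        simp [ψ, show v ≠ z by simpa using hv]) _ _
    rw [e4, mul_comm] at e3
    set C := A.ser _ (hc.isGerm he) with hC
    obtain ⟨hfin, hsum⟩ := coeff_mul_eq_finsum C (S ^ k) e'
    set ι : Expo m n → Expo m n := fun a => (0, Pi.single l k) + a with hι
    have hinj : Function.Injective ι := add_right_injective _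
    have hcoeff : ∀ a, (A.ser _ h1).coeff (ι a) * ((substFormal l S).monomial (ι a)).coeff e' =
        C.coeff a * (HahnSeries.single a (1 : ℝ) * S ^ k).coeff e' := fun a => by
      rw [e1, hι]
      simp only
      rw [add_comm _ a, HahnSeries.coeff_single_mul_add, one_mul]
      by_cases ha : C.coeff a = 0
      · simp [ha]
      · have hal : a.2 l = 0 := by
          by_contra h
          refine ha ?_
          rw [hC, ← co_ex he]
          exact co_eq_zero_of_dependsOn hc hdep (by simpa [hzdef] using h)
        have h5 : Function.update (a + (0, Pi.single l k)).2 l 0 = a.2 := by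
          funext j
          by_cases hj : j = l
          · subst hj; simp [hal]
          · simp [hj]
        rw [substFormal_monomial, h5, mul_comm (S ^ _)]
        simp [hal]
    have hsupp : (Function.support fun x => (A.ser _ h1).coeff x *
        ((substFormal l S).monomial x).coeff e') ⊆ Set.range ι := by
      intro x hx
      have h5 := left_ne_zero_of_mul hx
      rw [e1] at h5
      have hle := not_not.1 fun h => h5 (coeff_single_mul_of_not_le _ _ _ h)
      obtain ⟨b, rfl⟩ := exists_add_of_le hle
      exact ⟨b, rfl⟩
    constructor
    · refine ((hfin.image ι)).subset fun x hx => ?_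
      obtain ⟨a, rfl⟩ := hsupp hx
      exact ⟨a, by simpa only [Function.mem_support, hcoeff] using hx, rfl⟩
    · rw [e3, hsum, ← finsum_mem_univ fun x => (A.ser _ h1).coeff x * _]
      refine Eq.trans ?_ (finsum_mem_inter_support_eq' _ (Set.range ι) Set.univ
        fun x hx => ⟨fun _ => trivial, fun _ => hsupp hx⟩)
      rw [finsum_mem_range hinj]
      exact finsum_congr fun a => (hcoeff a).symm
  obtain ⟨c, g, hc, hcd, hg, hfe⟩ := hf.exists_expansion hz d
  have hterm : ∀ k, IsG A D (fun p => p z ^ k * c k p) := fun k => ((isG_coord z).pow k).mul (hc k)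
  have hall : ∀ k, IsG A D (fun p => ∑ j ∈ Finset.range k, p z ^ j * c j p + p z ^ d * g p) ∧
      Q (fun p => ∑ j ∈ Finset.range k, p z ^ j * c j p + p z ^ d * g p) := by
    intro k
    induction k with
    | zero => simpa using And.intro (((isG_coord z).pow d).mul hg) (hQtail hg)
    | succ k ih =>
      have e1 : (fun p : V → ℝ => ∑ j ∈ Finset.range (k + 1), p z ^ j * c j p + p z ^ d * g p) =
          fun p => (∑ j ∈ Finset.range k, p z ^ j * c j p + p z ^ d * g p) + p z ^ k * c k p := by
        funext p
        rw [Finset.sum_range_succ]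
        ring
      rw [e1]
      exact ⟨ih.1.add (hterm k), hQadd ih.1 (hterm k) ih.2 (hQterm k (hc k) (hcd k))⟩
  obtain ⟨hG, hQ⟩ := hall d
  have e1 : A.ser _ h1 = A.ser _ (hG.isGerm he) := ser_congr (he.tendsto_pull.eventually hfe) _ _
  have e3 : A.ser _ h3 = A.ser _ ((hψ _ hG).isGerm he) :=
    ser_congr ((hψt.comp he.tendsto_pull).eventually hfe) _ _
  rw [e1, e3]
  exact hQ (hG.isGerm he) ((hψ _ hG).isGerm he)

end Substitution

/-! ### Realisation by admissible trees -/

section Trees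

variable {V : Type} [Fintype V] [DecidableEq V] {A : QuasianalyticSystem} {D D' : Finset V}
  {f g : (V → ℝ) → ℝ} {m n m' n' : ℕ} {e : Fin m ⊕ Fin n ≃ V}

variable (A) in
/-- `ρ` is a change of coordinates whose formal counterpart, in the coordinates given by `e` and `e'`,
is the relation `R` between series. -/
def Realises (R : GenSeries m n → GenSeries m' n' → Prop) (e : Fin m ⊕ Fin n ≃ V) (D : Finset V)
    (e' : Fin m' ⊕ Fin n' ≃ V) (D' : Finset V) (ρ : (V → ℝ) → V → ℝ) : Prop :=
  Fr e' D' ∧ ∀ g, IsG A D g → IsG A D' (fun p => g (ρ p)) ∧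
    ∀ (h1 : A.IsGerm (fun p => g (pull e p))) (h2 : A.IsGerm (fun p => g (ρ (pull e' p)))),
      R (A.ser _ h1) (A.ser _ h2)

variable (A) in
/-- The germ `f` becomes normal along all branches of an admissible tree of height at most `M`. -/
def Tr (M : ℕ) (e : Fin m ⊕ Fin n ≃ V) (D : Finset V) (f : (V → ℝ) → ℝ) : Prop :=
  ∃ T : AdmissibleTree A.toTaylorAlgebras M m n,
    ∀ (m' n' : ℕ) (b : Admissible A.toTaylorAlgebras m n m' n'), T.IsBranch b →
      ∃ (D' : Finset V) (ρ : (V → ℝ) → V → ℝ) (e' : Fin m' ⊕ Fin n' ≃ V),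
        Realises A b.IsComp e D e' D' ρ ∧ Normal A D' (fun p => f (ρ p))

theorem Tr.vertex (M : ℕ) (he : Fr e D) (hf : Normal A D f) : Tr A M e D f := by
  refine ⟨.vertex, fun m' n' b hb => ?_⟩
  cases hb
  exact ⟨D, fun p => p, e, ⟨he, fun g hg => ⟨hg, fun _ _ => rfl⟩⟩, hf⟩

theorem Tr.node {M : ℕ} (E : ElementaryTree A.toTaylorAlgebras m n)
    (H : ∀ (m' n' : ℕ) (ν : Elementary A.toTaylorAlgebras m n m' n'), IsEdge E ν →
      ∃ (D' : Finset V) (ρ : (V → ℝ) → V → ℝ) (e' : Fin m' ⊕ Fin n' ≃ V),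
        Realises A ν.formal.IsComp e D e' D' ρ ∧ Tr A M e' D' (fun p => f (ρ p))) :
    Tr A (M + 1) e D f := by
  choose D₁ ρ₁ e₁ hr T hT using H
  refine ⟨.node E T, fun m' n' b hb => ?_⟩
  cases hb with
  | node _ _ ν hν b hb =>
    obtain ⟨D', ρ', e', ⟨he', hr'⟩, hn⟩ := hT _ _ ν hν _ _ b hb
    refine ⟨D', fun p => ρ₁ _ _ ν hν (ρ' p), e', ⟨he', fun g hg => ?_⟩, hn⟩
    obtain ⟨h1, h2⟩ := (hr _ _ ν hν).2 g hg
    obtain ⟨h3, h4⟩ := hr' _ h1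
    exact ⟨h3, fun _ _ => ⟨_, h2 _ (h1.isGerm (hr _ _ ν hν).1), h4 _ _⟩⟩

theorem realises_update_y (he : Fr e D) {s : (V → ℝ) → ℝ} (hs : IsG A D s) (hs0 : s 0 = 0) (l : Fin n)
    {φ : FormalMap m n m n} (hφ : φ = substFormal l (A.ser _ (hs.isGerm he))) :
    Realises A φ.IsComp e D e D (fun p => Function.update p (e (Sum.inr l)) (s p)) :=
  ⟨he, fun _ hg => ⟨hg.update_y (he.2 l) hs hs0, fun h1 h2 =>
    hφ ▸ isComp_update_y he hg hs hs0 l h1 (hs.isGerm he) h2⟩⟩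

theorem Tr.tschirnhausen {M : ℕ} {e : Fin m ⊕ Fin (n + 1) ≃ V} (he : Fr e D)
    {h : (V → ℝ) → ℝ} (hh : IsG A D h) (h0 : h 0 = 0)
    (hdep : DependsOn h (Finset.univ.erase (e (Sum.inr (Fin.last n))) : Set V))
    (hf : Tr A M e D (fun p => f (Quasi.trans (e (Sum.inr (Fin.last n))) h p))) :
    Tr A (M + 1) e D f := by
  -- the germ `h`, which does not depend on the last variable, as a germ in one variable less
  let h' : Pt m n → ℝ := fun q => h (pull e (q.1, Fin.snoc (α := fun _ => ℝ) q.2 0))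
  have hh' : A.IsGerm h' := by
    refine (hh.isGerm he).subY (g := fun j q => (Fin.snoc q.2 0 : Fin (n + 1) → ℝ) j)
      (fun j => ?_) fun j => ?_ <;> refine Fin.lastCases ?_ (fun j => ?_) j
    · simpa using isGerm_const (A := A) m n 0
    · simpa using isGerm_y j
    · simp
    · simp
  have h'0 : h' 0 = 0 := by
    have e0 : ((0 : Pt m n).1, Fin.snoc (α := fun _ => ℝ) (0 : Pt m n).2 0) =
        (0 : Pt m (n + 1)) := by
      refine Prod.ext rfl (funext fun j => ?_)
      refine Fin.lastCases ?_ (fun j => ?_) j <;> simp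
    rw [← h0, ← pull_zero e, ← e0]
  have hs : IsG A D (fun p => p (e (Sum.inr (Fin.last n))) + h p) := (isG_coord _).add hh
  have hext : A.ser _ (hh.isGerm he) =
      rename (Function.Embedding.refl _) Fin.castSuccEmb (A.ser h' hh') := by
    have hE : ∀ p : Pt m (n + 1), h' (fun i => p.1 (Fin.castLE le_rfl i),
        fun j => p.2 (Fin.castLE (Nat.le_succ n) j)) = h (pull e p) := fun p => by
      refine hdep fun v hv => ?_
      revert hv
      refine frame_forall e (P := fun v => v ∈ _ → _ = _) (fun i _ => ?_) (fun j => ?_) v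
      · rw [pull_inl, pull_inl]; rfl
      · refine Fin.lastCases (by simp) (fun j _ => ?_) j
        rw [pull_inr, pull_inr]
        exact (Fin.snoc_castSucc (α := fun _ => ℝ) _ _ _)
    have := A.T_extend le_rfl (Nat.le_succ n) h' hh' (by simpa only [hE] using hh.isGerm he)
    simp only [hE] at this
    exact this
  refine Tr.node (.tschirnhausen h' hh' h'0) fun m₁ n₁ ν hν => ?_
  cases hν
  refine ⟨D, _, e, realises_update_y he hs (by simp [h0]) _ ?_, hf⟩
  have e1 : A.ser _ (hs.isGerm he) = Y (Fin.last n) + A.ser _ (hh.isGerm he) := by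
    rw [← ser_pull_y _ ((isG_coord _).isGerm he), ← ser_add]
  rw [e1, hext]
  rfl

theorem Tr.linear {M : ℕ} (he : Fr e D) {k i : Fin n} (hki : k < i) (c : ℝ)
    (hf : Tr A M e D (fun p => f (Quasi.trans (e (Sum.inr k)) (fun p => c * p (e (Sum.inr i))) p))) :
    Tr A (M + 1) e D f := by
  refine Tr.node (.linear i (Pi.single k c)) fun m₁ n₁ ν hν => ?_
  cases hν
  have hc : IsG A D (fun p => c * p (e (Sum.inr i))) := (isG_const c).mul (isG_coord _)
  have hs : IsG A D (fun p => p (e (Sum.inr k)) + c * p (e (Sum.inr i))) := (isG_coord _).add hc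
  refine ⟨D, _, e, realises_update_y he hs (by simp) k ?_, hf⟩
  have e1 : A.ser _ (hs.isGerm he) = Y k + HahnSeries.C c * Y i := by
    rw [← ser_pull_y k ((isG_coord _).isGerm he), ← ser_pull_y i ((isG_coord _).isGerm he),
      ← ser_const, ← ser_mul, ← ser_add]
  rw [e1]
  refine congrArg (FormalMap.mk X) (funext fun j => ?_)
  by_cases hj : j = k
  · subst hj; simp [hki]
  · simp [hj]

theorem Tr.ramY {M : ℕ} (he : Fr e D) {i : Fin n} {d : ℕ} (hd : 1 ≤ d)
    (hf : ∀ ε, Tr A M e D (fun p => f (Quasi.ramY (e (Sum.inr i)) d ε p))) :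
    Tr A (M + 1) e D f := by
  refine Tr.node (.ramY i d hd) fun m₁ n₁ ν hν => ?_
  cases hν with
  | ramY _ _ _ ε =>
    have hs : IsG A D (fun p => ((ε : ℤ) : ℝ) * p (e (Sum.inr i)) ^ d) :=
      (isG_const _).mul ((isG_coord _).pow d)
    refine ⟨D, _, e, realises_update_y he hs (by simp; omega) i ?_, hf ε⟩
    have e1 : A.ser _ (hs.isGerm he) = HahnSeries.C ((ε : ℤ) : ℝ) * Y i ^ d := by
      have hy : A.IsGerm (fun p => pull e p (e (Sum.inr i))) := (isG_coord _).isGerm he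
      rw [← ser_pull_y i hy, ← ser_const, ← ser_pow hy, ← ser_mul]
    rw [e1]
    rfl

theorem Tr.ramX {M : ℕ} (he : Fr e D) {i : Fin m} {γ : ℝ≥0} (hγ : ExpOk A γ) (h0 : 0 < γ)
    (hf : Tr A M e D (fun p => f (Quasi.ramX (e (Sum.inl i)) γ p))) : Tr A (M + 1) e D f := by
  refine Tr.node (.ramX i γ hγ.mem_field h0) fun m₁ n₁ ν hν => ?_
  cases hν
  refine ⟨D, _, e, ⟨he, fun g hg => ?_⟩, hf⟩
  obtain ⟨h1, h2, h3⟩ := hg.co_ramX (he.1 i) hγ h0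
  refine ⟨h1, fun h4 h5 => ?_⟩
  refine (FormalMap.isComp_iff_of_monomial (ram_expo_injective i h0) (ramFormal_monomial i γ)).2
    ⟨fun u => ?_, fun u hu => by_contra fun hne => hu ?_⟩
  · have := h2 (ex e u)
    rw [← ex_ram] at this
    rw [← co_ex he h4, ← co_ex (f := fun p => g (Quasi.ramX (e (Sum.inl i)) γ p)) he h5]
    exact this
  · rw [← co_ex (f := fun p => g (Quasi.ramX (e (Sum.inl i)) γ p)) he h5] at hne
    obtain ⟨x, hx, hux⟩ := h3 _ hne
    rw [Supp_eq he h4] at hx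
    obtain ⟨x, -, rfl⟩ := hx
    rw [← ex_ram] at hux
    exact ⟨x, (ex_injective e hux).symm⟩

theorem realises_blowUp (he : Fr e D) (π : BlowUpChart m n m' n') {e' : Fin m' ⊕ Fin n' ≃ V}
    (he' : Fr e' D') {ρ : (V → ℝ) → V → ℝ} (h : ∀ p, pull e (π.toMap p) = ρ (pull e' p)) :
    Realises A π.formal.IsComp e D e' D' ρ := by
  refine ⟨he', fun g hg => ?_⟩
  obtain ⟨h1, h2⟩ := A.blowUp π _ (hg.isGerm he)
  simp only [h] at h1 h2
  exact ⟨⟨_, _, e', he', h1⟩, fun _ _ => h2⟩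

theorem Tr.blowXX {M : ℕ} {e : Fin (m + 1) ⊕ Fin n ≃ V} (he : Fr e D) {i : Fin (m + 1)} {j : Fin m}
    (hji : j.castSucc < i)
    (h0 : Tr A M e D (fun p => f (blow (e (Sum.inl i)) (e (Sum.inl j.castSucc)) 0 p)))
    (h1 : Tr A M e D (fun p => f (blow (e (Sum.inl j.castSucc)) (e (Sum.inl i)) 0 p)))
    (h2 : ∀ lam, 0 < lam → Tr A M (xtoY e i) (D.erase (e (Sum.inl i)))
      (fun p => f (blow (e (Sum.inl i)) (e (Sum.inl j.castSucc)) lam p))) :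
    Tr A (M + 1) e D f := by
  refine Tr.node (.blowXX i j hji) fun m₁ n₁ ν hν => ?_
  cases hν with
  | xxPos _ _ _ lam hlam =>
    exact ⟨_, blow (e (Sum.inl i)) (e (Sum.inl j.castSucc)) lam, xtoY e i,
      realises_blowUp he (.xx i j hji lam hlam) (he.xtoY i) (pull_xx e i j hji hlam), h2 lam hlam⟩
  | xxZero =>
    exact ⟨D, blow (e (Sum.inl i)) (e (Sum.inl j.castSucc)) 0, e,
      realises_blowUp he (.xxZero i _ hji.ne') he (pull_xxZero e i _ hji.ne'), h0⟩
  | xxInfty =>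
    exact ⟨D, blow (e (Sum.inl j.castSucc)) (e (Sum.inl i)) 0, e,
      realises_blowUp he (.xxZero _ i hji.ne) he (pull_xxZero e _ i hji.ne), h1⟩

theorem Tr.blowYX {M : ℕ} {e : Fin m ⊕ Fin (n + 1) ≃ V} (he : Fr e D) (i : Fin (n + 1)) (j : Fin m)
    (h1 : ∀ lam, Tr A M e D (fun p => f (blow (e (Sum.inr i)) (e (Sum.inl j)) lam p)))
    (h2 : ∀ ε, Tr A M (ytoX e i) (insert (e (Sum.inr i)) D)
      (fun p => f (blowInf (e (Sum.inr i)) (e (Sum.inl j)) ε p))) :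
    Tr A (M + 1) e D f := by
  refine Tr.node (.blowYX i j) fun m₁ n₁ ν hν => ?_
  cases hν with
  | yxReal _ _ lam =>
    exact ⟨D, blow (e (Sum.inr i)) (e (Sum.inl j)) lam, e,
      realises_blowUp he (.yx i j lam) he (pull_yx e i j lam), h1 lam⟩
  | yxInfty _ _ ε =>
    exact ⟨_, blowInf (e (Sum.inr i)) (e (Sum.inl j)) ε, ytoX e i,
      realises_blowUp he (.yxInfty i j ε) (he.ytoX i) (pull_yxInfty e i j ε), h2 ε⟩

theorem Tr.blowYY {M : ℕ} (he : Fr e D) {i j : Fin n} (hij : i ≠ j)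
    (h1 : ∀ lam, Tr A M e D (fun p => f (blow (e (Sum.inr i)) (e (Sum.inr j)) lam p)))
    (h2 : Tr A M e D (fun p => f (blow (e (Sum.inr j)) (e (Sum.inr i)) 0 p))) :
    Tr A (M + 1) e D f := by
  refine Tr.node (.blowYY i j hij) fun m₁ n₁ ν hν => ?_
  cases hν with
  | yyReal _ _ _ lam =>
    exact ⟨D, blow (e (Sum.inr i)) (e (Sum.inr j)) lam, e,
      realises_blowUp he (.yy i j hij lam) he (pull_yy e i j hij lam), h1 lam⟩
  | yyInfty =>
    exact ⟨D, blow (e (Sum.inr j)) (e (Sum.inr i)) 0, e,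
      realises_blowUp he (.yy j i hij.symm 0) he (pull_yy e j i hij.symm 0), h2⟩

/-- A translation of any `y`-variable is a conjugate of a Tschirnhausen translation of the last one,
by `(p_k, p_z) ↦ (p_k + p_z, -p_k)`, which is the product of a linear transformation and a
Tschirnhausen translation. -/
theorem Tr.trans {M : ℕ} {e : Fin m ⊕ Fin n ≃ V} (he : Fr e D) {k : V} (hk : k ∉ D)
    {h : (V → ℝ) → ℝ} (hh : IsG A D h) (h0 : h 0 = 0)
    (hdep : DependsOn h (Finset.univ.erase k : Set V))
    (hf : ∀ M', M ≤ M' → Tr A M' e D (fun p => f (Quasi.trans k h p))) :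
    Tr A (M + 5) e D f := by
  obtain ⟨l, rfl⟩ := exists_inr_of_notMem he hk
  obtain ⟨n, rfl⟩ : ∃ n', n = n' + 1 := ⟨n - 1, by have := l.2; omega⟩
  by_cases hl : l = Fin.last n
  · subst hl
    exact Tr.tschirnhausen he hh h0 hdep (hf (M + 4) (by omega))
  have hlt : l < Fin.last n := lt_of_le_of_ne (Fin.le_last l) hl
  set k := e (Sum.inr l) with hkdef
  set z := e (Sum.inr (Fin.last n)) with hz
  have hkz : k ≠ z := fun h => hl (Sum.inr_injective (e.injective h))
  have hzD : z ∉ D := he.2 _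
  let C : (V → ℝ) → V → ℝ := fun p =>
    Quasi.trans z (fun p => -p k) (Quasi.trans k (fun p => 1 * p z) p)
  have hCz : ∀ p, C p z = -p k := fun p => by simp [C, Quasi.trans, hkz.symm]
  have hCk : ∀ p, C p k = p k + p z := fun p => by simp [C, Quasi.trans, hkz]
  have hCv : ∀ p v, v ≠ k → v ≠ z → C p v = p v := fun p v h1 h2 => by
    simp [C, Quasi.trans, h1, h2]
  have hC0 : C 0 = 0 := by
    funext v
    by_cases h1 : v = z
    · rw [h1, hCz]; simp
    · by_cases h2 : v = k
      · rw [h2, hCk]; simp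
      · rw [hCv 0 v h2 h1]
  have hkG : IsG A D (fun p => p k) := isG_coord k
  have hzG : IsG A D (fun p => 1 * p z) := (isG_const 1).mul (isG_coord z)
  have hg : IsG A D (fun p => h (C p)) :=
    (hh.trans hzD hkG.neg (by simp)).trans hk hzG (by simp)
  have hgdep : DependsOn (fun p => h (C p)) (Finset.univ.erase z : Set V) := by
    intro p q hpq
    have hpq' : ∀ v, v ≠ z → p v = q v := fun v hv => hpq v (by simpa using hv)
    refine hdep fun v hv => ?_
    have hv : v ≠ k := by simpa using hv
    by_cases h1 : v = z
    · rw [h1, hCz, hCz, hpq' k hkz]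
    · rw [hCv p v hv h1, hCv q v hv h1, hpq' v h1]
  have hkdep : ∀ c : ℝ, DependsOn (fun p : V → ℝ => c * p k) (Finset.univ.erase z : Set V) :=
    fun c p q hpq => by simp only; rw [hpq k (by simpa using hkz)]
  -- the conjugation, the translation of the last variable, and the inverse of the conjugation
  refine Tr.tschirnhausen he hkG.neg (by simp) (by simpa using hkdep (-1)) ?_
  refine Tr.linear he hlt 1 ?_
  refine Tr.tschirnhausen he hg (by rw [hC0, h0]) hgdep ?_
  refine Tr.linear he hlt (-1) ?_
  refine Tr.tschirnhausen he hkG rfl (by simpa using hkdep 1) ?_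
  convert hf M le_rfl using 1
  funext p
  rw [← hkdef, ← hz]
  set q := Quasi.trans k (fun p => -1 * p z) (Quasi.trans z (fun p => p k) p) with hq
  have hqk : q k = -p z := by simp [hq, Quasi.trans, hkz]
  have hqz : q z = p z + p k := by simp [hq, Quasi.trans, hkz.symm]
  have hqv : ∀ v, v ≠ k → v ≠ z → q v = p v := fun v h1 h2 => by
    simp [hq, Quasi.trans, h1, h2]
  have hhC : h (C q) = h p := hdep fun v hv => by
    have hv : v ≠ k := by simpa using hv
    by_cases h1 : v = z
    · rw [h1, hCz, hqk, neg_neg]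
    · rw [hCv q v hv h1, hqv v hv h1]
  refine congrArg f (funext fun v => ?_)
  change C (Quasi.trans z (fun p => h (C p)) q) v = _
  by_cases h1 : v = z
  · subst h1
    rw [hCz]
    simp [Quasi.trans, hkz, hkz.symm, hqk]
  · by_cases h2 : v = k
    · subst h2
      rw [hCk, Quasi.trans, Quasi.trans, hhC, Function.update_of_ne hkz, Function.update_self,
        Function.update_self, hqk, hqz]
      ring
    · rw [hCv _ v h2 h1]
      simp [Quasi.trans, h1, h2, hqv]

/-- Trees over the variables `V` are realised by admissible trees; a translation needs five edges. -/
theorem HD.tr {N : ℕ} (hf : HD A N D f) {M : ℕ} (hM : 5 * N ≤ M) {m n : ℕ} {e : Fin m ⊕ Fin n ≃ V}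
    (he : Fr e D) : Tr A M e D f := by
  induction N generalizing D f M m n with
  | zero => exact .vertex M he hf
  | succ N ih =>
    rcases hf with hf | ⟨ν, hf⟩
    · exact ih hf (by omega) he
    obtain ⟨M, rfl⟩ : ∃ M', M = M' + 5 := ⟨M - 5, by omega⟩
    have hM : 5 * N ≤ M + 4 := by omega
    cases ν with
    | trans k h hk hh h0 hdep =>
      exact Tr.trans he hk hh h0 hdep fun M' hM' =>
        ih (hf _ _ (.trans k h hk hh h0 hdep)) (by omega) he
    | ramX i γ hi hγ h0 =>
      obtain ⟨a, rfl⟩ := exists_inl_of_mem he hi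
      exact Tr.ramX he hγ h0 (ih (hf _ _ (.ramX _ γ hi hγ h0)) hM he)
    | ramY i d hi hd =>
      obtain ⟨a, rfl⟩ := exists_inr_of_notMem he hi
      exact Tr.ramY he hd fun ε => ih (hf _ _ (.ramY _ d hi hd ε)) hM he
    | xx i j hi hj hij =>
      obtain ⟨a, rfl⟩ := exists_inl_of_mem he hi
      obtain ⟨b, rfl⟩ := exists_inl_of_mem he hj
      obtain ⟨m, rfl⟩ : ∃ m', m = m' + 1 := ⟨m - 1, by have := a.2; omega⟩
      have h0 := ih (hf _ _ (.xxZero _ _ hi hj hij)) hM he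
      have h0' := ih (hf _ _ (.xxZero' _ _ hi hj hij)) hM he
      rcases lt_or_gt_of_ne (show a ≠ b from fun h => hij (by rw [h])) with hab | hab
      · obtain ⟨c, rfl⟩ := Fin.exists_castSucc_eq.2 (ne_of_lt (hab.trans_le (Fin.le_last b)))
        exact Tr.blowXX he hab h0' h0 fun lam hl =>
          ih (hf _ _ (.xxPos' _ _ hi hj hij lam hl)) hM (he.xtoY b)
      · obtain ⟨c, rfl⟩ := Fin.exists_castSucc_eq.2 (ne_of_lt (hab.trans_le (Fin.le_last a)))
        exact Tr.blowXX he hab h0 h0' fun lam hl =>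
          ih (hf _ _ (.xxPos _ _ hi hj hij lam hl)) hM (he.xtoY a)
    | yx i j hi hj =>
      obtain ⟨a, rfl⟩ := exists_inr_of_notMem he hi
      obtain ⟨b, rfl⟩ := exists_inl_of_mem he hj
      obtain ⟨n, rfl⟩ : ∃ n', n = n' + 1 := ⟨n - 1, by have := a.2; omega⟩
      exact Tr.blowYX he a b (fun lam => ih (hf _ _ (.yx _ _ hi hj lam)) hM he)
        fun ε => ih (hf _ _ (.yxInfty _ _ hi hj ε)) hM (he.ytoX a)
    | yy i j hi hj hij =>
      obtain ⟨a, rfl⟩ := exists_inr_of_notMem he hi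
      obtain ⟨b, rfl⟩ := exists_inr_of_notMem he hj
      exact Tr.blowYY he (show a ≠ b from fun h => hij (by rw [h]))
        (fun lam => ih (hf _ _ (.yy _ _ hi hj hij lam)) hM he)
        (ih (hf _ _ (.yyInfty _ _ hi hj hij)) hM he)

/-! ### Normal series -/

theorem isUnit_ser (he : Fr e D) (hf : IsG A D f) (h0 : f 0 ≠ 0)
    (h : A.IsGerm (fun p => f (pull e p))) : IsUnit (A.ser _ h) := by
  refine IsUnit.of_mul_eq_one (A.ser _ ((hf.inv h0).isGerm he)) ?_
  have h1 : (fun p => f p * (f p)⁻¹) =ᶠ[gz D] fun _ => 1 :=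
    (hf.tendsto.eventually (isOpen_ne.mem_nhds h0)).mono fun p hp => mul_inv_cancel₀ hp
  rw [← ser_mul, ser_congr (he.tendsto_pull.eventually h1) _ (isGerm_const m n 1), ser_const]
  exact map_one _

/-- The series of a normal germ is the product of its least monomial and a unit. -/
theorem ser_eq_of_isLeastExp (he : Fr e D) (hf : IsG A D f) {w : V → ℝ≥0}
    (hw : IsLeastExp A D f w) (h : A.IsGerm (fun p => f (pull e p))) :
    ∃ x ∈ (A.ser _ h).support, ex e x = w ∧
      ∃ U : GenSeries m n, IsUnit U ∧ A.ser _ h = HahnSeries.single x 1 * U := by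
  classical
  have hmem := hw.1
  rw [Supp_eq he h] at hmem
  obtain ⟨x, hx, rfl⟩ := hmem
  obtain ⟨hok, u, hu, hu0, hfu⟩ := hw.exists_eq hf
  refine ⟨x, hx, rfl, A.ser _ (hu.isGerm he), isUnit_ser he hu hu0 _, ?_⟩
  ext y
  rw [← co_ex he h, co_congr hfu, co_mono_mul hok hu]
  by_cases hxy : x ≤ y
  · obtain ⟨b, rfl⟩ := exists_add_of_le hxy
    rw [if_pos ((ex_le e _ _).2 hxy), ex_add, add_tsub_cancel_left, co_ex he (hu.isGerm he),
      add_comm x b, HahnSeries.coeff_single_mul_add, one_mul]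
  · rw [if_neg fun h => hxy ((ex_le e _ _).1 h), coeff_single_mul_of_not_le _ _ _ hxy]

theorem dvd_of_isLeastExp_le (he : Fr e D) (hf : IsG A D f) (hg : IsG A D g) {w v : V → ℝ≥0}
    (hw : IsLeastExp A D f w) (hv : IsLeastExp A D g v) (hwv : w ≤ v)
    (hf' : A.IsGerm (fun p => f (pull e p))) (hg' : A.IsGerm (fun p => g (pull e p))) :
    A.ser _ hf' ∣ A.ser _ hg' := by
  obtain ⟨x, -, rfl, U, hU, h1⟩ := ser_eq_of_isLeastExp he hf hw hf'
  obtain ⟨y, -, rfl, W, -, h2⟩ := ser_eq_of_isLeastExp he hg hv hg'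
  obtain ⟨b, rfl⟩ := exists_add_of_le ((ex_le e _ _).1 hwv)
  have h3 : (HahnSeries.single (x + b) 1 : GenSeries m n) =
      HahnSeries.single x 1 * HahnSeries.single b 1 := by
    rw [HahnSeries.single_mul_single, one_mul]
  rw [h1, h2, hU.mul_right_dvd, h3, mul_assoc]
  exact dvd_mul_right _ _

theorem isNormal_ser (he : Fr e D) (hf : Normal A D f) (h : A.IsGerm (fun p => f (pull e p))) :
    IsNormal A.toTaylorAlgebras (A.ser _ h) ∧ A.ser _ h ≠ 0 := by
  obtain ⟨w, hw⟩ := hf.exists_isLeastExp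
  obtain ⟨x, hx, -, U, hU, hs⟩ := ser_eq_of_isLeastExp he hf.isG hw h
  refine ⟨⟨x.1, x.2, U, fun i => Subsemiring.subset_closure
    ⟨m, n, ⟨_, h⟩, x, hx, Or.inl ⟨i, rfl⟩⟩, hU, hs⟩, fun h0 => hx ?_⟩
  rw [h0]
  rfl

end Trees

theorem Admissible.IsComp.unique {A : TaylorAlgebras} {m n m' n' : ℕ}
    {b : Admissible A m n m' n'} {F : GenSeries m n} {G H : GenSeries m' n'} (hG : b.IsComp F G)
    (hH : b.IsComp F H) : G = H := by
  induction b with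
  | id => exact Eq.trans hG (Eq.symm hH)
  | comp ν ρ ih =>
    obtain ⟨F₁, h1, h2⟩ := hG
    obtain ⟨F₂, h3, h4⟩ := hH
    exact ih h2 (h1.unique h3 ▸ h4)

/-- Finitely many germs become normal and comparable along an admissible tree for the product of
the germs and of their nonzero differences. -/
theorem exists_tree_of_germs (A : QuasianalyticSystem) {m n p : ℕ} (f : Fin p → Pt m n → ℝ)
    (hf : ∀ k, A.IsGerm (f k)) (hf0 : ∀ k, A.ser _ (hf k) ≠ 0) :
    ∃ (N : ℕ) (T : AdmissibleTree A.toTaylorAlgebras N m n),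
      ∀ {m' n' : ℕ} (b : Admissible A.toTaylorAlgebras m n m' n'), T.IsBranch b →
        ∃ G : Fin p → GenSeries m' n',
          (∀ k, b.IsComp (A.ser _ (hf k)) (G k)) ∧
          (∀ k, G k ≠ 0 ∧ G k ∈ Set.range (A.T m' n') ∧ IsNormal A.toTaylorAlgebras (G k)) ∧
          ∀ k l, G k ∣ G l ∨ G l ∣ G k := by
  classical
  let e : Fin m ⊕ Fin n ≃ Fin m ⊕ Fin n := Equiv.refl _
  let D : Finset (Fin m ⊕ Fin n) := Finset.univ.image Sum.inl
  have he : Fr e D := ⟨fun i => by simp [D, e], fun j => by simp [D, e]⟩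
  let F : Fin p → (Fin m ⊕ Fin n → ℝ) → ℝ := fun k q => f k (push e q)
  have hFf : ∀ k q, F k (pull e q) = f k q := fun k q => by simp [F]
  have hF : ∀ k, IsG A D (F k) := fun k => ⟨m, n, e, he, by simpa only [hFf] using hf k⟩
  have hF0 : ∀ k, ¬ F k =ᶠ[gz D] 0 := fun k h => hf0 k <| by
    have h1 : f k =ᶠ[𝓝[Quad m n] 0] fun _ => 0 := by
      filter_upwards [he.tendsto_pull.eventually h] with q hq
      rwa [hFf] at hq
    rw [ser_congr h1 _ (isGerm_const m n 0), ser_const]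
    exact map_zero _
  obtain ⟨Φ, hΦ, hΦd, hΦ0, hΦn⟩ := exists_prod_diff (K := Set.univ) Finset.univ hF
    (fun k _ => hF0 k) fun k q q' h => by rw [funext fun v => h v trivial]
  have hcov := covAll (A := A) _ Finset.univ rfl D Φ hΦ (by simpa using hΦd) hΦ0
  obtain ⟨N, hN⟩ := hcov.uhd.exists_hd
  obtain ⟨T, hT⟩ := hN.tr le_rfl he
  refine ⟨_, T, fun {m' n'} b hb => ?_⟩
  obtain ⟨D', ρ, e', ⟨he', hr⟩, hn⟩ := hT m' n' b hb
  have hFρ : ∀ k, IsG A D' (fun q => F k (ρ q)) := fun k => (hr _ (hF k)).1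
  obtain ⟨hFn, hdn⟩ := hΦn (fun g hg => (hr g hg).1) hn
  simp only [Finset.mem_univ, true_imp_iff] at hFn hdn
  have hg : ∀ k, A.IsGerm (fun q => F k (ρ (pull e' q))) := fun k => (hFρ k).isGerm he'
  have hG : ∀ k, b.IsComp (A.ser _ (hf k)) (A.ser _ (hg k)) := fun k => by
    have := (hr _ (hF k)).2 (by simpa only [hFf] using hf k) (hg k)
    simpa only [hFf] using this
  -- normal series with normal difference are comparable
  refine ⟨fun k => A.ser _ (hg k), hG, fun k => ?_, fun k l => ?_⟩
  · obtain ⟨h1, h2⟩ := isNormal_ser he' (hFn k) (hg k)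
    exact ⟨h2, ⟨_, rfl⟩, h1⟩
  · rcases hdn k l with h | h1
    · have h1 : f k =ᶠ[𝓝[Quad m n] 0] f l := by
        filter_upwards [he.tendsto_pull.eventually h] with q hq
        simpa only [hFf, Pi.zero_apply, sub_eq_zero] using hq
      have h2 := hG k
      rw [ser_congr h1 (hf k) (hf l)] at h2
      exact Or.inl (dvd_of_eq (h2.unique (hG l)))
    · obtain ⟨w, hw⟩ := (hFn k).exists_isLeastExp
      obtain ⟨v, hv⟩ := (hFn l).exists_isLeastExp
      exact (IsLeastExp.le_or_le (hFρ k) (hFρ l) hw hv (Or.inr h1)).imp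
        (fun h => dvd_of_isLeastExp_le he' (hFρ k) (hFρ l) hw hv h _ _)
        (fun h => dvd_of_isLeastExp_le he' (hFρ l) (hFρ k) hv hw h _ _)

end Quasi

end

theorem mainTheorem8 (𝒜 : Quasi.QuasianalyticSystem) {m n p : ℕ}
    (F : Fin p → Quasi.GenSeries m n) (hF : ∀ k, F k ≠ 0)
    (hT : ∀ k, F k ∈ Set.range (𝒜.T m n)) :
    ∃ (N : ℕ) (T : Quasi.AdmissibleTree 𝒜.toTaylorAlgebras N m n),
      ∀ {m' n' : ℕ} (b : Quasi.Admissible 𝒜.toTaylorAlgebras m n m' n'), T.IsBranch b →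
        ∃ G : Fin p → Quasi.GenSeries m' n',
          (∀ k, b.IsComp (F k) (G k)) ∧
          (∀ k, G k ≠ 0 ∧ G k ∈ Set.range (𝒜.T m' n') ∧
            Quasi.IsNormal 𝒜.toTaylorAlgebras (G k)) ∧
          ∀ k l, G k ∣ G l ∨ G l ∣ G k := by
  have h : ∀ k, ∃ (f : Quasi.Pt m n → ℝ) (hf : 𝒜.IsGerm f), 𝒜.ser f hf = F k := fun k => by
    obtain ⟨⟨_, r, f, hf, rfl⟩, hF⟩ := hT k
    exact ⟨f, ⟨r, f, hf, rfl⟩, hF⟩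
  choose f hf hs using h
  obtain rfl : (fun k => 𝒜.ser (f k) (hf k)) = F := funext hs
  exact Quasi.exists_tree_of_germs 𝒜 f hf hF
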